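/- **Conventions.** Let $(X^n,g)$ be a smooth Riemannian manifold and $i\colon Y^k\to X^n$ a smooth immersion, with $4\le k<n$ and $k\ne 6$. The curvature is normalized by $\nabla_a\nabla_b\tau_c-\nabla_b\nabla_a\tau_c=R_{abc}{}^d\tau_d$, $R_{ab}=R_{acb}{}^c$, $R=R_a{}^a$. Put $\mathsf J=\frac{R}{2(n-1)}$, $\mathsf P_{ab}=\frac1{n-2}(R_{ab}-\mathsf J g_{ab})$, $W_{abcd}=R_{abcd}-\mathsf P_{ac}g_{bd}-\mathsf P_{bd}g_{ac}+\mathsf P_{ad}g_{bc}+\mathsf P_{bc}g_{ad}$, $C_{abc}=\nabla_a\mathsf P_{bc}-\nabla_b\mathsf P_{ac}$, $B_{ab}=\nabla^cC_{cab}+W_{acbd}\mathsf P^{cd}$. Along $Y$, unprimed Greek indices denote projection to $TY$ and primed Greek indices projection to the normal bundle $NY$; $\overline\nabla$ is the connection induced on $TY$ (the Levi-Civita connection of $i^*g$) and on $NY$ (the normal connection); $\overline\Delta=\overline\nabla^\alpha\overline\nabla_\alpha$; $\overline{\mathsf P}_{\alpha\beta}$ and $\overline{\mathsf J}$ are the Schouten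 tensor of $i^*g$ and its trace. Let $L_{\alpha\beta\alpha'}$ be the second fundamental form, $L(U,V)=(\nabla_UV)^\perp$, and put $H_{\alpha'}=\frac1kL_\alpha{}^\alpha{}_{\alpha'}$, $\mathring L_{\alpha\beta\alpha'}=L_{\alpha\beta\alpha'}-H_{\alpha'}g_{\alpha\beta}$, $\mathring L^2_{\alpha\beta}=\mathring L^\gamma{}_{\alpha\alpha'}\mathring L_{\gamma\beta}{}^{\alpha'}$, $|\mathring L|^2=\mathring L_{\alpha\beta\alpha'}\mathring L^{\alpha\beta\alpha'}$, $\operatorname{tr}\mathring L^3_{\alpha'}=\mathring L_\alpha{}^\beta{}_{\beta'}\mathring L_\beta{}^{\gamma\beta'}\mathring L_\gamma{}^\alpha{}_{\alpha'}$, and $$\mathsf G=\tfrac1{2(k-1)}\bigl(|\mathring L|^2-W_{\alpha\beta}{}^{\alpha\beta}\bigr),\quad \mathsf F_{\alpha\beta}=\tfrac1{k-2}\bigl(\mathring L^2_{\alpha\beta}-W_{\alpha\gamma\beta}{}^\gamma-\mathsf Gg_{\alpha\beta}\bigr),\quad \mathsf D_{\alpha\alpha'}=\mathsf P_{\alpha\alpha'}-\overline\nabla_\alpha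 H_{\alpha'},$$ $$\mathcal P_{\alpha\beta}=\mathsf P_{\alpha\beta}+H^{\alpha'}\mathring L_{\alpha\beta\alpha'}+\tfrac12|H|^2g_{\alpha\beta},\quad \mathcal C_{abc}=C_{abc}-H^{\alpha'}W_{abc\alpha'},\quad \mathcal C_\alpha=\mathcal C_{\beta\alpha}{}^\beta,$$ $$\mathcal B_{\alpha\beta}=B_{\alpha\beta}+(n-4)H^{\alpha'}(C_{\alpha'\alpha\beta}+C_{\alpha'\beta\alpha})+(n-4)H^{\alpha'}H^{\beta'}W_{\alpha\alpha'\beta\beta'}.$$ Define $$\mathcal K_1=\overline\nabla^\alpha(\mathring L^{\beta\gamma\alpha'}W_{\alpha\beta\alpha'\gamma})+(k-4)\mathring L^{\alpha\beta\alpha'}\mathcal C_{\alpha\alpha'\beta},\qquad \mathcal K_2=\overline\nabla^\alpha(\mathring L_\alpha{}^{\beta\alpha'}W_{\beta\gamma\alpha'}{}^\gamma)+(k-4)\mathsf D^{\alpha\alpha'}W_{\alpha\beta\alpha'}{}^\beta,$$ $$\mathcal I=(k-1)\bigl(-\overline\Delta\mathsf G+2\mathsf G\mathcal P_\alpha{}^\alpha\bigr)+(k-6)\Bigl[(\mathring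 L^2_{\alpha\beta}-W_{\alpha\gamma\beta}{}^\gamma)\mathcal P^{\alpha\beta}+\overline\nabla^\alpha(\mathcal C_\alpha-\mathsf D^{\beta\alpha'}\mathring L_{\alpha\beta\alpha'})+\tfrac{k-3}{n-4}\mathcal B_\alpha{}^\alpha-(k-3)|\mathsf D|^2\Bigr],$$ $$\mathcal J=-\overline\Delta W_{\alpha\beta}{}^{\alpha\beta}+2W_{\alpha\beta}{}^{\alpha\beta}\mathcal P_\gamma{}^\gamma-2(k-6)\Bigl[\overline\nabla^\alpha\mathcal C_\alpha-\mathcal P^{\alpha\beta}W_{\alpha\gamma\beta}{}^\gamma+\mathsf D^{\alpha\alpha'}W_{\alpha\beta\alpha'}{}^\beta+\mathring L^{\alpha\beta\alpha'}\mathcal C_{\alpha\alpha'\beta}+\tfrac{k-3}{n-4}\mathcal B_\alpha{}^\alpha\Bigr],$$ $$\begin{aligned}\mathcal J_1={}&-\tfrac{k-2}{2(k-3)(k-6)}(2\mathcal I+\mathcal J)+\tfrac{k-2}{k-3}(\mathcal K_1+\mathcal K_2+\mathring L^2_{\alpha\beta}\mathsf F^{\alpha\beta})+\mathring L^2_{\alpha\beta}W^{\alpha\gamma\beta}{}_\gamma+\tfrac{k-2}{(k-3)(k-6)}\mathsf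 G|\mathring L|^2\\&+\mathring L^{\alpha\gamma\alpha'}\mathring L^{\beta\delta}{}_{\alpha'}W_{\alpha\beta\gamma\delta}-\mathring L^{\alpha\beta\alpha'}\mathring L_{\alpha\beta}{}^{\beta'}W_{\alpha'\gamma\beta'}{}^\gamma+\mathring L^{\gamma\alpha\alpha'}\mathring L_\gamma{}^{\beta\beta'}(2W_{\alpha\alpha'\beta\beta'}-W_{\alpha\beta\alpha'\beta'})\\&-\tfrac12W_{\alpha\beta\alpha'\gamma}W^{\alpha\beta\alpha'\gamma}+W_{\alpha\beta\alpha'}{}^\beta W^{\alpha\gamma\alpha'}{}_\gamma,\end{aligned}$$ $$\mathcal J_2=-\tfrac1{2(k-3)(k-6)}(2\mathcal I+\mathcal J)+\tfrac1{k-3}(\mathcal K_1+\mathcal K_2)-\tfrac{k-4}{k-3}\mathring L^2_{\alpha\beta}\mathsf F^{\alpha\beta}+\tfrac1{(k-3)(k-6)}\mathsf G|\mathring L|^2.$$ A *natural submanifold scalar* is an assignment of a function on $Y$ to every such immersion that is a fixed $\mathbb R$-linear combination of complete contractions (with the induced metrics on $TY$ and $NY$) of tensor products of projections to $TY$ and $NY$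 of $\nabla^M\mathrm{Rm}$, of $\overline\nabla^NL$, and of projections of $g$. It is a *conformal submanifold invariant of weight $w$* if its values $S^g$ satisfy $S^{e^{2\Upsilon}g}=e^{w\,i^*\Upsilon}S^g$ for all immersions $i\colon Y^k\to(X^n,g)$ and all $\Upsilon\in C^\infty(X)$. **Theorem.** Let $4\le k<n$ with $k\ne6$. Then $\mathcal J_1$ and $\mathcal J_2$ are scalar conformal submanifold invariants of weight $-4$. If $n=k+1$, they equal Juhl's hypersurface invariants: $$\begin{aligned}\mathcal J_1={}&\tfrac{k-4}{(k-3)(k-6)}\overline\Delta|\mathring L|^2-\tfrac{k-2}{(k-3)(k-6)}\overline{\mathsf J}|\mathring L|^2-\tfrac1{k-3}\overline\nabla^\alpha\overline\nabla^\beta\mathring L^2_{\alpha\beta}+\mathring L^{\alpha\beta\alpha'}\nabla_{\alpha'}W_{\alpha\gamma\beta}{}^\gamma\\&+\tfrac{k-2}{(k-1)^2}(\overline\nabla^\beta\mathring L_{\beta\alpha\alpha'})(\overline\nabla_\gamma\mathring L^{\gamma\alpha\alpha'})-\tfrac{k-2}{k-3}\mathring L^2_{\alpha\beta}\overline{\mathsf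 P}^{\alpha\beta}-2H_{\alpha'}\mathring L^{\alpha\beta\alpha'}W_{\alpha\gamma\beta}{}^\gamma,\end{aligned}$$ $$\begin{aligned}\mathcal J_2={}&-\mathring L^{\alpha\beta\alpha'}\nabla_{\alpha'}\mathsf P_{\alpha\beta}-\mathring L^{\alpha\beta\alpha'}\mathring L_{\alpha\beta}{}^{\beta'}\mathsf P_{\alpha'\beta'}+\mathring L^{\alpha\beta\alpha'}\overline\nabla_\alpha\overline\nabla_\beta H_{\alpha'}+H^{\alpha'}\mathring L^{\alpha\beta}{}_{\alpha'}\overline{\mathsf P}_{\alpha\beta}\\&-\tfrac1{k-3}\overline\nabla^\alpha\overline\nabla^\beta\mathring L^2_{\alpha\beta}+\tfrac{k-5}{2(k-3)(k-6)}\overline\Delta|\mathring L|^2-\tfrac1{(k-3)(k-6)}\overline{\mathsf J}|\mathring L|^2+\tfrac{k-4}{k-3}\mathring L^2_{\alpha\beta}\overline{\mathsf P}^{\alpha\beta}\\&-\tfrac{k-3}{k-2}H^{\alpha'}\operatorname{tr}\mathring L^3_{\alpha'}+\tfrac{k-3}{k-2}H^{\alpha'}\mathring L^{\alpha\beta}{}_{\alpha'}W_{\alpha\gamma\beta}{}^\gamma-\tfrac32|H|^2|\mathring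 L|^2+\tfrac{k}{(k-1)^2}(\overline\nabla^\beta\mathring L_{\beta\alpha\alpha'})(\overline\nabla_\gamma\mathring L^{\gamma\alpha\alpha'}).\end{aligned}$$ -/

import Mathlib

open scoped Manifold ContDiff

universe u v

namespace ConformalSubmanifold

noncomputable section

/-! ### Riemannian geometry in coordinates

All tensors are covariant and given by their components in a coordinate frame. A tensor component
with indices `a, b, c` is written `T x ![a, b, c]`. -/

/-- The coordinate space `ℝᵐ`. -/
abbrev E (m : ℕ) : Type := EuclideanSpace ℝ (Fin m)

/-- The components `g_{ab}` of a metric in coordinates. -/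
abbrev MetricField (m : ℕ) : Type := E m → Matrix (Fin m) (Fin m) ℝ

/-- The components of a covariant tensor field of rank `r` in coordinates. -/
abbrev Tensor (m r : ℕ) : Type := E m → (Fin r → Fin m) → ℝ

/-- The partial derivative `∂_a f`. -/
def pd {m : ℕ} (f : E m → ℝ) (x : E m) (a : Fin m) : ℝ :=
  fderiv ℝ f x (EuclideanSpace.single a 1)

section Ambient

variable {m r : ℕ} (g : MetricField m)

/-- The Christoffel symbols `Γ^c_{ab}`. -/
def christoffel (x : E m) (c a b : Fin m) : ℝ :=
  (1 / 2) * ∑ d, (g x)⁻¹ c d *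
    (pd (fun z => g z b d) x a + pd (fun z => g z a d) x b - pd (fun z => g z a b) x d)

/-- The Levi-Civita covariant derivative; the index of differentiation is the first one:
`(∇T)_{e a₁ … a_r} = ∇_e T_{a₁ … a_r}`. -/
def nabla (T : Tensor m r) : Tensor m (r + 1) := fun x a =>
  pd (fun z => T z (Fin.tail a)) x (a 0) -
    ∑ j : Fin r, ∑ d, christoffel g x d (a 0) (Fin.tail a j) *
      T x (Function.update (Fin.tail a) j d)

/-- The components `R_{abc}{}^d`, determined by
`∇_a ∇_b τ_c - ∇_b ∇_a τ_c = R_{abc}{}^d τ_d`. -/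
def riemUp (x : E m) (a b c d : Fin m) : ℝ :=
  pd (fun z => christoffel g z d a c) x b - pd (fun z => christoffel g z d b c) x a +
    ∑ e, (christoffel g x e a c * christoffel g x d b e -
      christoffel g x e b c * christoffel g x d a e)

/-- The Riemann curvature tensor `R_{abcd}`. -/
def riem : Tensor m 4 := fun x i => ∑ e, g x (i 3) e * riemUp g x (i 0) (i 1) (i 2) e

/-- The Ricci tensor `R_{ab} = R_{acb}{}^c`. -/
def ricci : Tensor m 2 := fun x i => ∑ c, ∑ d, (g x)⁻¹ c d * riem g x ![i 0, c, i 1, d]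

/-- The scalar curvature. -/
def scalarCurv (x : E m) : ℝ := ∑ a, ∑ b, (g x)⁻¹ a b * ricci g x ![a, b]

/-- The trace `J = R / (2 (m - 1))` of the Schouten tensor. -/
def trSchouten (x : E m) : ℝ := 1 / (2 * ((m : ℝ) - 1)) * scalarCurv g x

/-- The Schouten tensor `P_{ab}`. -/
def schouten : Tensor m 2 := fun x i =>
  1 / ((m : ℝ) - 2) * (ricci g x i - trSchouten g x * g x (i 0) (i 1))

/-- The Weyl tensor `W_{abcd}`. -/
def weyl : Tensor m 4 := fun x i =>
  riem g x i
    - schouten g x ![i 0, i 2] * g x (i 1) (i 3) - schouten g x ![i 1, i 3] * g x (i 0) (i 2)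
    + schouten g x ![i 0, i 3] * g x (i 1) (i 2) + schouten g x ![i 1, i 2] * g x (i 0) (i 3)

/-- The Cotton tensor `C_{abc} = ∇_a P_{bc} - ∇_b P_{ac}`. -/
def cotton : Tensor m 3 := fun x i =>
  nabla g (schouten g) x ![i 0, i 1, i 2] - nabla g (schouten g) x ![i 1, i 0, i 2]

/-- The Bach tensor `B_{ab} = ∇^c C_{cab} + W_{acbd} P^{cd}`. -/
def bach : Tensor m 2 := fun x i =>
  (∑ c, ∑ d, (g x)⁻¹ c d * nabla g (cotton g) x ![c, d, i 0, i 1]) +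
    ∑ c, ∑ d, ∑ e, ∑ f, (g x)⁻¹ c e * (g x)⁻¹ d f *
      (weyl g x ![i 0, c, i 1, d] * schouten g x ![e, f])

/-- The iterated covariant derivatives `∇^M Rm`. -/
def nablaRiem : (M : ℕ) → Tensor m (4 + M)
  | 0 => riem g
  | M + 1 => nabla g (nablaRiem M)

end Ambient

/-! ### Submanifold geometry in coordinates -/

/-- A coordinate representation of an immersion of a `k`-manifold into a Riemannian
`n`-manifold: the components of the metric and the map in coordinates. -/
structure Patch (k n : ℕ) where
  /-- the components of the ambient metric -/
  g : MetricField n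
  /-- the immersion -/
  φ : E k → E n

/-- Tensor fields along a patch with `r` tangential indices and one normal index. The normal index
is an ambient index: a conormal vector is represented by its components as a covector on the
ambient space that annihilates the tangent space of the submanifold. -/
abbrev NTensor (k n r : ℕ) : Type := E k → (Fin r → Fin k) → Fin n → ℝ

/-- Indices `inl α` are tangential, indices `inr a` are normal. -/
abbrev Index (k n : ℕ) : Type := Fin k ⊕ Fin n

namespace Patch

open Sum (inl inr)

variable {k n r : ℕ} (p : Patch k n)

/-- The coordinate tangent vector `∂_α φ`. -/
def tan (y : E k) (α : Fin k) : Fin n → ℝ := fun a => pd (fun z => p.φ z a) y α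

/-- The induced metric `g_{αβ}`. -/
def h : MetricField k := fun y => Matrix.of fun α β =>
  ∑ a, ∑ b, p.g (p.φ y) a b * p.tan y α a * p.tan y β b

/-- The orthogonal projection of the ambient coordinate vector `∂_a` to the normal space. -/
def nor (y : E k) (a : Fin n) : Fin n → ℝ := fun b =>
  (if b = a then 1 else 0) -
    ∑ α, ∑ β, ∑ c, (p.h y)⁻¹ α β * p.tan y α b * p.tan y β c * p.g (p.φ y) c a

/-- Contraction of a pair of tangential indices with the inverse of the induced metric. -/
def trT (y : E k) (f : Fin k → Fin k → ℝ) : ℝ := ∑ α, ∑ β, (p.h y)⁻¹ α β * f α β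

/-- Contraction of a pair of normal indices with the inverse of the metric. -/
def trN (y : E k) (f : Fin n → Fin n → ℝ) : ℝ := ∑ a, ∑ b, (p.g (p.φ y))⁻¹ a b * f a b

/-- The vectors on which a tangential or a normal slot of an ambient tensor is evaluated. -/
def frame (y : E k) : Index k n → Fin n → ℝ := Sum.elim (p.tan y) (p.nor y)

/-- The restriction of an ambient tensor to the submanifold, projected in each slot to the tangent
or to the normal bundle according to the kind of the index. -/
def proj (T : Tensor n r) (y : E k) (i : Fin r → Index k n) : ℝ :=
  ∑ a : Fin r → Fin n, (∏ j, p.frame y (i j) (a j)) * T (p.φ y) a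

/-- The connection `∇̄` on tangential tensors, i.e. the Levi-Civita connection of the induced
metric. -/
def nablaT (T : Tensor k r) : Tensor k (r + 1) := nabla p.h T

/-- The connection `∇̄` on tensors with one normal index; on the normal bundle it is the normal
projection of the ambient Levi-Civita connection. The index of differentiation is the first one. -/
def nablaN (T : NTensor k n r) : NTensor k n (r + 1) := fun y A b =>
  ∑ c, p.nor y b c *
    (pd (fun z => T z (Fin.tail A) c) y (A 0)
      - (∑ j : Fin r, ∑ γ, christoffel p.h y γ (A 0) (Fin.tail A j) *
          T y (Function.update (Fin.tail A) j γ) c)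
      - ∑ d, ∑ e, christoffel p.g (p.φ y) d e c * p.tan y (A 0) e * T y (Fin.tail A) d)

/-- The tangential Laplacian `Δ̄ f = ∇̄^α ∇̄_α f`. -/
def lap (f : E k → ℝ) (y : E k) : ℝ :=
  p.trT y fun α β => p.nablaT (p.nablaT fun z (_ : Fin 0 → Fin k) => f z) y ![α, β]

/-- The tangential divergence `∇̄^α V_α`. -/
def divT (V : Tensor k 1) (y : E k) : ℝ := p.trT y fun α β => p.nablaT V y ![α, β]

/-- The second fundamental form `L_{αβα'}`: the inner product of `∇_{∂_α φ} ∂_β φ` with a normal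
vector. -/
def L : NTensor k n 2 := fun y A b =>
  ∑ c, ∑ d, p.g (p.φ y) c d * p.nor y b c *
    (pd (fun z => p.tan z (A 1) d) y (A 0) +
      ∑ e, ∑ f, christoffel p.g (p.φ y) d e f * p.tan y (A 0) e * p.tan y (A 1) f)

/-- The mean curvature `H_{α'} = (1/k) L_α{}^α{}_{α'}`. -/
def H : NTensor k n 0 := fun y _ b => 1 / (k : ℝ) * p.trT y fun α β => p.L y ![α, β] b

/-- The trace-free second fundamental form. -/
def Lo : NTensor k n 2 := fun y A b => p.L y A b - p.H y ![] b * p.h y (A 0) (A 1)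

/-- Projections of the ambient Weyl tensor. -/
def W (y : E k) (i : Fin 4 → Index k n) : ℝ := p.proj (weyl p.g) y i

/-- Projections of the ambient Schouten tensor. -/
def P (y : E k) (i : Fin 2 → Index k n) : ℝ := p.proj (schouten p.g) y i

/-- Projections of the ambient Cotton tensor. -/
def C (y : E k) (i : Fin 3 → Index k n) : ℝ := p.proj (cotton p.g) y i

/-- Projections of the ambient Bach tensor. -/
def B (y : E k) (i : Fin 2 → Index k n) : ℝ := p.proj (bach p.g) y i

/-- The Schouten tensor of the induced metric. -/
def Pbar : Tensor k 2 := schouten p.h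

/-- The trace of the Schouten tensor of the induced metric. -/
def Jbar (y : E k) : ℝ := trSchouten p.h y

/-- `L̊²_{αβ} = L̊^γ{}_{αα'} L̊_{γβ}{}^{α'}`. -/
def Lsq : Tensor k 2 := fun y A =>
  p.trT y fun γ γ' => p.trN y fun a a' => p.Lo y ![γ, A 0] a * p.Lo y ![γ', A 1] a'

/-- `|L̊|²`. -/
def normLsq (y : E k) : ℝ :=
  p.trT y fun α α' => p.trT y fun β β' => p.trN y fun a a' =>
    p.Lo y ![α, β] a * p.Lo y ![α', β'] a'

/-- `tr L̊³_{α'} = L̊_α{}^β{}_{β'} L̊_β{}^{γβ'} L̊_γ{}^α{}_{α'}`. -/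
def trLcube (y : E k) (a : Fin n) : ℝ :=
  p.trT y fun α α' => p.trT y fun β β' => p.trT y fun γ γ' => p.trN y fun b b' =>
    p.Lo y ![α, β] b * p.Lo y ![β', γ] b' * p.Lo y ![γ', α'] a

/-- `|H|²`. -/
def normHsq (y : E k) : ℝ := p.trN y fun a a' => p.H y ![] a * p.H y ![] a'

/-- `W_{αγβ}{}^γ`. -/
def Wtr : Tensor k 2 := fun y A =>
  p.trT y fun γ γ' => p.W y ![inl (A 0), inl γ, inl (A 1), inl γ']

/-- `W_{αβ}{}^{αβ}`. -/
def Wtrtr (y : E k) : ℝ :=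
  p.trT y fun α α' => p.trT y fun β β' => p.W y ![inl α, inl β, inl α', inl β']

/-- `W_{αβα'}{}^β`. -/
def Wmix (y : E k) (α : Fin k) (a : Fin n) : ℝ :=
  p.trT y fun β β' => p.W y ![inl α, inl β, inr a, inl β']

/-- The trace `G` of the Fialkow tensor. -/
def G (y : E k) : ℝ := 1 / (2 * ((k : ℝ) - 1)) * (p.normLsq y - p.Wtrtr y)

/-- The Fialkow tensor `F_{αβ}`. -/
def F : Tensor k 2 := fun y A =>
  1 / ((k : ℝ) - 2) * (p.Lsq y A - p.Wtr y A - p.G y * p.h y (A 0) (A 1))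

/-- `D_{αα'} = P_{αα'} - ∇̄_α H_{α'}`. -/
def D (y : E k) (α : Fin k) (a : Fin n) : ℝ := p.P y ![inl α, inr a] - p.nablaN p.H y ![α] a

/-- `|D|²`. -/
def normDsq (y : E k) : ℝ :=
  p.trT y fun α α' => p.trN y fun a a' => p.D y α a * p.D y α' a'

/-- The modified Schouten tensor
`𝒫_{αβ} = P_{αβ} + H^{α'} L̊_{αβα'} + (1/2) H^{α'} H_{α'} g_{αβ}`. -/
def calP : Tensor k 2 := fun y A =>
  p.P y ![inl (A 0), inl (A 1)] + (p.trN y fun a a' => p.H y ![] a * p.Lo y A a')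
    + (1 / 2) * p.normHsq y * p.h y (A 0) (A 1)

/-- `𝒫_α{}^α`. -/
def trCalP (y : E k) : ℝ := p.trT y fun α β => p.calP y ![α, β]

/-- The modified Cotton tensor `𝒞_{abc} = C_{abc} - H^{α'} W_{abcα'}`, projected in each slot. -/
def calC (y : E k) (i j l : Index k n) : ℝ :=
  p.C y ![i, j, l] - p.trN y fun a a' => p.H y ![] a * p.W y ![i, j, l, inr a']

/-- `𝒞_α = 𝒞_{βα}{}^β`. -/
def calCtr : Tensor k 1 := fun y A =>
  p.trT y fun β β' => p.calC y (inl β) (inl (A 0)) (inl β')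

/-- The modified Bach tensor
`𝓑_{αβ} = B_{αβ} + 2(n-4) H^{α'} C_{α'(αβ)} + (n-4) H^{α'} H^{β'} W_{αα'ββ'}`. -/
def calB : Tensor k 2 := fun y A =>
  p.B y ![inl (A 0), inl (A 1)]
    + 2 * ((n : ℝ) - 4) * (p.trN y fun a a' => p.H y ![] a *
        ((1 / 2) * (p.C y ![inr a', inl (A 0), inl (A 1)] + p.C y ![inr a', inl (A 1), inl (A 0)])))
    + ((n : ℝ) - 4) * (p.trN y fun a a' => p.trN y fun b b' => p.H y ![] a * p.H y ![] b *
        p.W y ![inl (A 0), inr a', inl (A 1), inr b'])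

/-- `𝓑_α{}^α`. -/
def trCalB (y : E k) : ℝ := p.trT y fun α β => p.calB y ![α, β]

/-- The one-form `D^{βα'} L̊_{αβα'}`. -/
def DL : Tensor k 1 := fun y A =>
  p.trT y fun β β' => p.trN y fun a a' => p.D y β a * p.Lo y ![A 0, β'] a'

/-- `D^{αα'} W_{αβα'}{}^β`. -/
def DW (y : E k) : ℝ :=
  p.trT y fun α α' => p.trN y fun a a' => p.D y α a * p.Wmix y α' a'

/-- `L̊^{αβα'} 𝒞_{αα'β}`. -/
def LC (y : E k) : ℝ :=
  p.trT y fun α α' => p.trT y fun β β' => p.trN y fun a a' =>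
    p.Lo y ![α, β] a * p.calC y (inl α') (inr a') (inl β')

/-- The inner product `S_{αβ} T^{αβ}` of tangential two-tensors. -/
def inner2 (S T : Tensor k 2) (y : E k) : ℝ :=
  p.trT y fun α α' => p.trT y fun β β' => S y ![α, β] * T y ![α', β']

/-- `𝒦₁ = ∇̄^α (L̊^{βγα'} W_{αβα'γ}) + (k-4) L̊^{αβα'} 𝒞_{αα'β}`. -/
def K1 (y : E k) : ℝ :=
  p.divT (fun z A => p.trT z fun β β' => p.trT z fun γ γ' => p.trN z fun a a' =>
      p.Lo z ![β, γ] a * p.W z ![inl (A 0), inl β', inr a', inl γ']) y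
    + ((k : ℝ) - 4) * p.LC y

/-- `𝒦₂ = ∇̄^α (L̊_α{}^{βα'} W_{βγα'}{}^γ) + (k-4) D^{αα'} W_{αβα'}{}^β`. -/
def K2 (y : E k) : ℝ :=
  p.divT (fun z A => p.trT z fun β β' => p.trN z fun a a' =>
      p.Lo z ![A 0, β] a * p.Wmix z β' a') y
    + ((k : ℝ) - 4) * p.DW y

/-- The invariant `𝓘`. -/
def I (y : E k) : ℝ :=
  ((k : ℝ) - 1) * (-p.lap p.G y + 2 * p.G y * p.trCalP y)
    + ((k : ℝ) - 6) *
      (p.inner2 (fun z A => p.Lsq z A - p.Wtr z A) p.calP y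
        + p.divT (fun z A => p.calCtr z A - p.DL z A) y
        + ((k : ℝ) - 3) / ((n : ℝ) - 4) * p.trCalB y
        - ((k : ℝ) - 3) * p.normDsq y)

/-- The invariant `𝓙`. -/
def J (y : E k) : ℝ :=
  -p.lap p.Wtrtr y + 2 * p.Wtrtr y * p.trCalP y
    - 2 * ((k : ℝ) - 6) *
      (p.divT p.calCtr y - p.inner2 p.calP p.Wtr y + p.DW y + p.LC y
        + ((k : ℝ) - 3) / ((n : ℝ) - 4) * p.trCalB y)

/-- The invariant `𝒥₁`. -/
def J1 (y : E k) : ℝ :=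
  -(((k : ℝ) - 2) / (2 * ((k : ℝ) - 3) * ((k : ℝ) - 6))) * (2 * p.I y + p.J y)
    + ((k : ℝ) - 2) / ((k : ℝ) - 3) * (p.K1 y + p.K2 y + p.inner2 p.Lsq p.F y)
    + p.inner2 p.Lsq p.Wtr y
    + ((k : ℝ) - 2) / (((k : ℝ) - 3) * ((k : ℝ) - 6)) * (p.G y * p.normLsq y)
    -- `L̊^{αγα'} L̊^{βδ}{}_{α'} W_{αβγδ}`
    + (p.trT y fun α α' => p.trT y fun β β' => p.trT y fun γ γ' => p.trT y fun δ δ' =>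
        p.trN y fun a a' => p.Lo y ![α, γ] a * p.Lo y ![β, δ] a' *
          p.W y ![inl α', inl β', inl γ', inl δ'])
    -- `L̊^{αβα'} L̊_{αβ}{}^{β'} W_{α'γβ'}{}^γ`
    - (p.trT y fun α α' => p.trT y fun β β' => p.trT y fun γ γ' =>
        p.trN y fun a a' => p.trN y fun b b' => p.Lo y ![α, β] a * p.Lo y ![α', β'] b *
          p.W y ![inr a', inl γ, inr b', inl γ'])
    -- `L̊^{γαα'} L̊_γ{}^{ββ'} (2 W_{αα'ββ'} - W_{αβα'β'})`
    + (p.trT y fun α α' => p.trT y fun β β' => p.trT y fun γ γ' =>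
        p.trN y fun a a' => p.trN y fun b b' => p.Lo y ![γ, α] a * p.Lo y ![γ', β] b *
          (2 * p.W y ![inl α', inr a', inl β', inr b'] -
            p.W y ![inl α', inl β', inr a', inr b']))
    -- `W_{αβα'γ} W^{αβα'γ}`
    - (1 / 2) * (p.trT y fun α α' => p.trT y fun β β' => p.trT y fun γ γ' =>
        p.trN y fun a a' => p.W y ![inl α, inl β, inr a, inl γ] *
          p.W y ![inl α', inl β', inr a', inl γ'])
    -- `W_{αβα'}{}^β W^{αγα'}{}_γ`
    + (p.trT y fun α α' => p.trN y fun a a' => p.Wmix y α a * p.Wmix y α' a')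

/-- The invariant `𝒥₂`. -/
def J2 (y : E k) : ℝ :=
  -(1 / (2 * ((k : ℝ) - 3) * ((k : ℝ) - 6))) * (2 * p.I y + p.J y)
    + 1 / ((k : ℝ) - 3) * (p.K1 y + p.K2 y)
    - ((k : ℝ) - 4) / ((k : ℝ) - 3) * p.inner2 p.Lsq p.F y
    + 1 / (((k : ℝ) - 3) * ((k : ℝ) - 6)) * (p.G y * p.normLsq y)

/-- `∇̄^α ∇̄^β L̊²_{αβ}`. -/
def divdivLsq (y : E k) : ℝ :=
  p.trT y fun α α' => p.trT y fun β β' => p.nablaT (p.nablaT p.Lsq) y ![α, β, α', β']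

/-- `∇̄^β L̊_{βαα'}`. -/
def divLo (y : E k) (α : Fin k) (a : Fin n) : ℝ :=
  p.trT y fun β β' => p.nablaN p.Lo y ![β, β', α] a

/-- `(∇̄^β L̊_{βαα'}) (∇̄_γ L̊^{γαα'})`. -/
def normDivLoSq (y : E k) : ℝ :=
  p.trT y fun α α' => p.trN y fun a a' => p.divLo y α a * p.divLo y α' a'

/-- The two-tensor `H^{α'} L̊_{αβα'}`. -/
def HL : Tensor k 2 := fun y A => p.trN y fun a a' => p.H y ![] a * p.Lo y A a'

/-- Juhl's first hypersurface invariant. -/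
def juhl1 (y : E k) : ℝ :=
  ((k : ℝ) - 4) / (((k : ℝ) - 3) * ((k : ℝ) - 6)) * p.lap p.normLsq y
    - ((k : ℝ) - 2) / (((k : ℝ) - 3) * ((k : ℝ) - 6)) * (p.Jbar y * p.normLsq y)
    - 1 / ((k : ℝ) - 3) * p.divdivLsq y
    -- `L̊^{αβα'} ∇_{α'} W_{αγβ}{}^γ`
    + (p.trT y fun α α' => p.trT y fun β β' => p.trT y fun γ γ' => p.trN y fun a a' =>
        p.Lo y ![α, β] a *
          p.proj (nabla p.g (weyl p.g)) y ![inr a', inl α', inl γ, inl β', inl γ'])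
    + ((k : ℝ) - 2) / ((k : ℝ) - 1) ^ 2 * p.normDivLoSq y
    - ((k : ℝ) - 2) / ((k : ℝ) - 3) * p.inner2 p.Lsq p.Pbar y
    - 2 * p.inner2 p.HL p.Wtr y

/-- Juhl's second hypersurface invariant. -/
def juhl2 (y : E k) : ℝ :=
  -- `L̊^{αβα'} ∇_{α'} P_{αβ}`
  -(p.trT y fun α α' => p.trT y fun β β' => p.trN y fun a a' =>
      p.Lo y ![α, β] a * p.proj (nabla p.g (schouten p.g)) y ![inr a', inl α', inl β'])
    -- `L̊^{αβα'} L̊_{αβ}{}^{β'} P_{α'β'}`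
    - (p.trT y fun α α' => p.trT y fun β β' => p.trN y fun a a' => p.trN y fun b b' =>
        p.Lo y ![α, β] a * p.Lo y ![α', β'] b * p.P y ![inr a', inr b'])
    -- `L̊^{αβα'} ∇̄_α ∇̄_β H_{α'}`
    + (p.trT y fun α α' => p.trT y fun β β' => p.trN y fun a a' =>
        p.Lo y ![α, β] a * p.nablaN (p.nablaN p.H) y ![α', β'] a')
    + p.inner2 p.HL p.Pbar y
    - 1 / ((k : ℝ) - 3) * p.divdivLsq y
    + ((k : ℝ) - 5) / (2 * ((k : ℝ) - 3) * ((k : ℝ) - 6)) * p.lap p.normLsq y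
    - 1 / (((k : ℝ) - 3) * ((k : ℝ) - 6)) * (p.Jbar y * p.normLsq y)
    + ((k : ℝ) - 4) / ((k : ℝ) - 3) * p.inner2 p.Lsq p.Pbar y
    - ((k : ℝ) - 3) / ((k : ℝ) - 2) * (p.trN y fun a a' => p.H y ![] a * p.trLcube y a')
    + ((k : ℝ) - 3) / ((k : ℝ) - 2) * p.inner2 p.HL p.Wtr y
    - (3 / 2) * (p.normHsq y * p.normLsq y)
    + (k : ℝ) / ((k : ℝ) - 1) ^ 2 * p.normDivLoSq y

/-- The iterated covariant derivatives `∇̄^N L`. -/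
def nablaL : (N : ℕ) → NTensor k n (2 + N)
  | 0 => p.L
  | N + 1 => p.nablaN (nablaL N)

end Patch

/-! ### Natural submanifold scalars -/

/-- A scalar given by a formula in coordinates. -/
abbrev CoordScalar (k n : ℕ) : Type := Patch k n → E k → ℝ

/-- The elementary tensors `∇^M Rm`, `∇̄^N L` and `g`. -/
inductive Atom : Type
  | riem (M : ℕ)
  | sff (N : ℕ)
  | metric

/-- The rank of an elementary tensor. -/
def Atom.rank : Atom → ℕ
  | .riem M => 4 + M
  | .sff N => 2 + N + 1
  | .metric => 2

/-- A tensor with tangential indices followed by one normal index as a function of all indices; its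
components at indices of other kinds are zero. -/
def NTensor.extend {k n r : ℕ} (T : NTensor k n r) (y : E k) (i : Fin (r + 1) → Index k n) : ℝ :=
  ∑ A : Fin r → Fin k, ∑ b : Fin n,
    if (∀ j : Fin r, i j.castSucc = Sum.inl (A j)) ∧ i (Fin.last r) = Sum.inr b then T y A b else 0

/-- The components of the projections of an elementary tensor to the tangent and normal bundles. -/
def Atom.component {k n : ℕ} (p : Patch k n) (y : E k) :
    (t : Atom) → (Fin t.rank → Index k n) → ℝ
  | .riem M, i => p.proj (nablaRiem p.g M) y i
  | .sff N, i => NTensor.extend (p.nablaL N) y i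
  | .metric, i => p.proj (r := 2) (fun x a => p.g x (a 0) (a 1)) y i

/-- Whether a pair of indices is projected to and contracted in the tangent or the normal bundle. -/
inductive Kind : Type
  | tangential
  | normal

/-- The inverse metric used to contract a pair of indices of the given kind. -/
def Kind.weight {k n : ℕ} (p : Patch k n) (y : E k) : Kind → Index k n → Index k n → ℝ
  | .tangential, .inl α, .inl β => (p.h y)⁻¹ α β
  | .normal, .inr a, .inr b => (p.g (p.φ y))⁻¹ a b
  | _, _, _ => 0

/-- A complete contraction of a tensor product of elementary tensors: the factors, and a grouping
of all their slots into pairs, each of which is tangential or normal. -/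
structure CompleteContraction where
  /-- the number of factors -/
  numFactors : ℕ
  /-- the factors -/
  factor : Fin numFactors → Atom
  /-- the number of contracted pairs -/
  numPairs : ℕ
  /-- the kind of each pair -/
  kind : Fin numPairs → Kind
  /-- the two slots that make up each pair -/
  slots : Fin numPairs × Fin 2 ≃ (Σ j : Fin numFactors, Fin (factor j).rank)

/-- The value of a complete contraction. -/
def CompleteContraction.value {k n : ℕ} (c : CompleteContraction) : CoordScalar k n := fun p y =>
  ∑ i : (Σ j : Fin c.numFactors, Fin (c.factor j).rank) → Index k n,
    (∏ q, (c.kind q).weight p y (i (c.slots (q, 0))) (i (c.slots (q, 1)))) *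
      ∏ j, (c.factor j).component p y fun s => i ⟨j, s⟩

/-! ### Immersions of manifolds -/

section Manifolds

/-- Smooth Riemannian metrics on an `n`-manifold. -/
abbrev SmoothMetric (n : ℕ) (X : Type u) [TopologicalSpace X] [ChartedSpace (E n) X]
    [IsManifold (𝓡 n) ∞ X] : Type u :=
  Bundle.ContMDiffRiemannianMetric (𝓡 n) ∞ (E n) (fun x : X => TangentSpace (𝓡 n) x)

/-- A smooth map with injective differential at every point. -/
structure IsSmoothImmersion (k n : ℕ) {X : Type u} [TopologicalSpace X] [ChartedSpace (E n) X]
    {Y : Type v} [TopologicalSpace Y] [ChartedSpace (E k) Y] (i : Y → X) : Prop where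
  smooth : ContMDiff (𝓡 k) (𝓡 n) ∞ i
  injective : ∀ y, Function.Injective (mfderiv (𝓡 k) (𝓡 n) i y)

variable {k n : ℕ} {X : Type u} [TopologicalSpace X] [ChartedSpace (E n) X]
  [IsManifold (𝓡 n) ∞ X] {Y : Type v} [TopologicalSpace Y] [ChartedSpace (E k) Y]

/-- The components of a metric with respect to the coordinate vector fields of the chart at `x`. -/
def metricInChart (g : SmoothMetric n X) (x : X) : MetricField n := fun u => Matrix.of fun a b =>
  g.inner ((extChartAt (𝓡 n) x).symm u)
    (mfderiv 𝓘(ℝ, E n) (𝓡 n) (extChartAt (𝓡 n) x).symm u (EuclideanSpace.single a (1 : ℝ)))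
    (mfderiv 𝓘(ℝ, E n) (𝓡 n) (extChartAt (𝓡 n) x).symm u (EuclideanSpace.single b (1 : ℝ)))

/-- The coordinate representation of an immersion in the charts at `y` and at `i y`. -/
def patchAt (g : SmoothMetric n X) (i : Y → X) (y : Y) : Patch k n where
  g := metricInChart g (i y)
  φ := writtenInExtChartAt (𝓡 k) (𝓡 n) y i

/-- The function on `Y` that a scalar formula assigns to an immersion `i : Y → (X, g)`: it is
computed at `y` in the charts at `y` and at `i y`. -/
def CoordScalar.onManifold (S : CoordScalar k n) (g : SmoothMetric n X) (i : Y → X) (y : Y) : ℝ :=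
  S (patchAt g i y) (extChartAt (𝓡 k) y y)

end Manifolds

/-- A natural submanifold scalar: on all immersions `i : Y^k → (X^n, g)` it is one and the same
real linear combination of complete contractions of tensor products of projections of `∇^M Rm`,
of `∇̄^N L` and of projections of `g`. -/
def IsNaturalScalar {k n : ℕ} (S : CoordScalar k n) : Prop :=
  ∃ (N : ℕ) (c : Fin N → ℝ) (T : Fin N → CompleteContraction),
    ∀ (X : Type u) [TopologicalSpace X] [ChartedSpace (E n) X] [IsManifold (𝓡 n) ∞ X]
      (Y : Type v) [TopologicalSpace Y] [ChartedSpace (E k) Y] [IsManifold (𝓡 k) ∞ Y]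
      (g : SmoothMetric n X) (i : Y → X), IsSmoothImmersion k n i →
      ∀ y : Y, S.onManifold g i y = ∑ j, c j * CoordScalar.onManifold (k := k) (n := n) (T j).value g i y

/-- A scalar conformal submanifold invariant of weight `w`: a natural submanifold scalar `S` with
`S^{e^{2Υ} g} = e^{w i^*Υ} S^g` for all immersions `i : Y^k → (X^n, g)` and all smooth `Υ` on
`X`. -/
def IsConformalInvariant {k n : ℕ} (S : CoordScalar k n) (w : ℝ) : Prop :=
  IsNaturalScalar.{u, v} S ∧
    ∀ (X : Type u) [TopologicalSpace X] [ChartedSpace (E n) X] [IsManifold (𝓡 n) ∞ X]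
      (Y : Type v) [TopologicalSpace Y] [ChartedSpace (E k) Y] [IsManifold (𝓡 k) ∞ Y]
      (g g' : SmoothMetric n X) (Υ : X → ℝ) (i : Y → X), IsSmoothImmersion k n i →
      ContMDiff (𝓡 n) 𝓘(ℝ, ℝ) ∞ Υ →
      (∀ (x : X) (v w : TangentSpace (𝓡 n) x),
        g'.inner x v w = Real.exp (2 * Υ x) * g.inner x v w) →
      ∀ y : Y, S.onManifold g' i y = Real.exp (w * Υ (i y)) * S.onManifold g i y

/-- The scalar `𝒥₁`. -/
def calJ1 (k n : ℕ) : CoordScalar k n := fun p => p.J1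

/-- The scalar `𝒥₂`. -/
def calJ2 (k n : ℕ) : CoordScalar k n := fun p => p.J2

/-- Juhl's first hypersurface invariant as a submanifold scalar. -/
def juhlFirst (k n : ℕ) : CoordScalar k n := fun p => p.juhl1

/-- Juhl's second hypersurface invariant as a submanifold scalar. -/
def juhlSecond (k n : ℕ) : CoordScalar k n := fun p => p.juhl2

end

end ConformalSubmanifold

open ConformalSubmanifold

namespace ConformalSubmanifold

open TopologicalSpace (Opens)

noncomputable section

/-! ### Smooth functions and partial derivatives -/

/-- Smoothness of a function on an open subset of the coordinate space. -/
def SmoothOn {m : ℕ} (U : Opens (E m)) (f : E m → ℝ) : Prop := ContDiffOn ℝ ∞ f U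

section Calculus

variable {m : ℕ} {U : Opens (E m)} {f f' : E m → ℝ} {x : E m}

theorem SmoothOn.contDiffAt (hf : SmoothOn U f) (hx : x ∈ U) : ContDiffAt ℝ ∞ f x :=
  ContDiffOn.contDiffAt hf (U.isOpen.mem_nhds hx)

theorem SmoothOn.differentiableAt (hf : SmoothOn U f) (hx : x ∈ U) : DifferentiableAt ℝ f x :=
  (hf.contDiffAt hx).differentiableAt (by simp)

theorem SmoothOn.of_contDiffAt (h : ∀ x ∈ U, ContDiffAt ℝ ∞ f x) : SmoothOn U f :=
  fun x hx => (h x hx).contDiffWithinAt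

theorem SmoothOn.const (c : ℝ) : SmoothOn U fun _ => c := contDiffOn_const

theorem SmoothOn.add (hf : SmoothOn U f) (hf' : SmoothOn U f') :
    SmoothOn U fun x => f x + f' x := ContDiffOn.add hf hf'

theorem SmoothOn.sub (hf : SmoothOn U f) (hf' : SmoothOn U f') :
    SmoothOn U fun x => f x - f' x := ContDiffOn.sub hf hf'

theorem SmoothOn.neg (hf : SmoothOn U f) : SmoothOn U fun x => - f x := ContDiffOn.neg hf

theorem SmoothOn.mul (hf : SmoothOn U f) (hf' : SmoothOn U f') :
    SmoothOn U fun x => f x * f' x := ContDiffOn.mul hf hf'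

theorem SmoothOn.const_mul (c : ℝ) (hf : SmoothOn U f) : SmoothOn U fun x => c * f x :=
  (SmoothOn.const c).mul hf

theorem SmoothOn.sum {ι : Type*} {s : Finset ι} {F : ι → E m → ℝ} (h : ∀ i, SmoothOn U (F i)) :
    SmoothOn U fun x => ∑ i ∈ s, F i x := ContDiffOn.sum fun i _ => h i

theorem SmoothOn.prod {ι : Type*} {s : Finset ι} {F : ι → E m → ℝ} (h : ∀ i, SmoothOn U (F i)) :
    SmoothOn U fun x => ∏ i ∈ s, F i x := contDiffOn_prod fun i _ => h i

theorem SmoothOn.inv (hf : SmoothOn U f) (h : ∀ x ∈ U, f x ≠ 0) :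
    SmoothOn U fun x => (f x)⁻¹ := ContDiffOn.inv hf h

theorem SmoothOn.exp (hf : SmoothOn U f) : SmoothOn U fun x => Real.exp (f x) :=
  ContDiffOn.exp hf

theorem SmoothOn.congr (hf : SmoothOn U f) (h : ∀ x ∈ U, f' x = f x) : SmoothOn U f' :=
  ContDiffOn.congr hf h

theorem SmoothOn.pd (hf : SmoothOn U f) (a : Fin m) : SmoothOn U fun x => pd f x a := by
  refine SmoothOn.of_contDiffAt fun x hx => ?_
  exact ((hf.contDiffAt hx).fderiv_right (m := ∞) (by simp)).clm_apply contDiffAt_const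

theorem SmoothOn.comp {l : ℕ} {V : Opens (E l)} {φ : E m → E l} {F : E l → ℝ}
    (hF : SmoothOn V F) (hφ : ∀ a, SmoothOn U fun x => φ x a) (h : ∀ x ∈ U, φ x ∈ V) :
    SmoothOn U fun x => F (φ x) :=
  ContDiffOn.comp hF ((contDiffOn_piLp (p := 2)).2 hφ) h

theorem pd_congr (h : ∀ x ∈ U, f x = f' x) (hx : x ∈ U) (a : Fin m) : pd f x a = pd f' x a := by
  have : f =ᶠ[nhds x] f' := Filter.eventually_of_mem (U.isOpen.mem_nhds hx) h
  simp only [pd, this.fderiv_eq]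

theorem pd_const (c : ℝ) (x : E m) (a : Fin m) : pd (fun _ => c) x a = 0 := by simp [pd]

theorem pd_add (hf : SmoothOn U f) (hf' : SmoothOn U f') (hx : x ∈ U) (a : Fin m) :
    pd (fun x => f x + f' x) x a = pd f x a + pd f' x a := by
  simp only [pd]
  rw [fderiv_fun_add (hf.differentiableAt hx) (hf'.differentiableAt hx)]; rfl

theorem pd_sub (hf : SmoothOn U f) (hf' : SmoothOn U f') (hx : x ∈ U) (a : Fin m) :
    pd (fun x => f x - f' x) x a = pd f x a - pd f' x a := by
  simp only [pd]
  rw [fderiv_fun_sub (hf.differentiableAt hx) (hf'.differentiableAt hx)]; rfl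

theorem pd_mul (hf : SmoothOn U f) (hf' : SmoothOn U f') (hx : x ∈ U) (a : Fin m) :
    pd (fun x => f x * f' x) x a = pd f x a * f' x + f x * pd f' x a := by
  simp only [pd]
  rw [fderiv_fun_mul (hf.differentiableAt hx) (hf'.differentiableAt hx)]
  simp; ring

theorem pd_const_mul (c : ℝ) (hf : SmoothOn U f) (hx : x ∈ U) (a : Fin m) :
    pd (fun x => c * f x) x a = c * pd f x a := by
  rw [pd_mul (SmoothOn.const c) hf hx, pd_const]; ring

theorem pd_sum {ι : Type*} {s : Finset ι} {F : ι → E m → ℝ} (h : ∀ i, SmoothOn U (F i))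
    (hx : x ∈ U) (a : Fin m) :
    pd (fun x => ∑ i ∈ s, F i x) x a = ∑ i ∈ s, pd (F i) x a := by
  simp only [pd]
  rw [fderiv_fun_sum fun i _ => (h i).differentiableAt hx]
  simp

theorem pd_exp (hf : SmoothOn U f) (hx : x ∈ U) (a : Fin m) :
    pd (fun x => Real.exp (f x)) x a = Real.exp (f x) * pd f x a := by
  simp only [pd]
  rw [fderiv_exp (hf.differentiableAt hx)]
  simp

theorem pd_comm (hf : SmoothOn U f) (hx : x ∈ U) (a b : Fin m) :
    pd (fun z => pd f z a) x b = pd (fun z => pd f z b) x a := by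
  have hc := hf.contDiffAt hx
  have hs := hc.isSymmSndFDerivAt (by simpa using WithTop.coe_le_coe.2 (le_top : (2 : ℕ∞) ≤ ⊤))
  have hd : DifferentiableAt ℝ (fderiv ℝ f) x :=
    ((hc.fderiv_right (m := ∞) (by simp))).differentiableAt (by simp)
  simp only [pd]
  rw [fderiv_clm_apply hd (differentiableAt_const _), fderiv_clm_apply hd (differentiableAt_const _)]
  simpa using hs _ _

theorem fderiv_eq_sum_pd (f : E m → ℝ) (x v : E m) :
    fderiv ℝ f x v = ∑ a, v a * pd f x a := by
  have hv : v = ∑ a, v a • EuclideanSpace.single a (1 : ℝ) := by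
    ext b
    simp [Pi.single_apply]
  conv_lhs => rw [hv]
  simp [pd]

theorem pd_comp {l : ℕ} {V : Opens (E l)} {φ : E m → E l} {F : E l → ℝ}
    (hF : SmoothOn V F) (hφ : ∀ a, SmoothOn U fun x => φ x a) (h : ∀ x ∈ U, φ x ∈ V)
    (hx : x ∈ U) (α : Fin m) :
    pd (fun x => F (φ x)) x α = ∑ a, pd (fun z => φ z a) x α * pd F (φ x) a := by
  have hφd : DifferentiableAt ℝ φ x :=
    ((contDiffOn_piLp (p := 2)).2 hφ |>.contDiffAt (U.isOpen.mem_nhds hx)).differentiableAt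
      (by simp)
  have hc : fderiv ℝ (fun x => F (φ x)) x = (fderiv ℝ F (φ x)).comp (fderiv ℝ φ x) :=
    fderiv_comp x (hF.differentiableAt (h x hx)) hφd
  simp only [pd]
  rw [hc, ContinuousLinearMap.comp_apply, fderiv_eq_sum_pd]
  refine Finset.sum_congr rfl fun a _ => ?_
  congr 1
  have := (EuclideanSpace.proj (𝕜 := ℝ) a).hasFDerivAt.comp x hφd.hasFDerivAt
  have h2 : fderiv ℝ (fun z => φ z a) x = (EuclideanSpace.proj (𝕜 := ℝ) a).comp (fderiv ℝ φ x) :=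
    this.fderiv
  rw [h2]; rfl

end Calculus

section Inverse

variable {m : ℕ} {U : Opens (E m)}

theorem SmoothOn.det {ι : Type*} [Fintype ι] [DecidableEq ι] {A : E m → Matrix ι ι ℝ}
    (hA : ∀ i j, SmoothOn U fun x => A x i j) : SmoothOn U fun x => (A x).det := by
  simp only [Matrix.det_apply']
  exact SmoothOn.sum fun σ => SmoothOn.const_mul _ (SmoothOn.prod fun i => hA _ _)

theorem SmoothOn.matrix_inv {ι : Type*} [Fintype ι] [DecidableEq ι] {A : E m → Matrix ι ι ℝ}
    (hA : ∀ i j, SmoothOn U fun x => A x i j) (hdet : ∀ x ∈ U, (A x).det ≠ 0) (i j : ι) :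
    SmoothOn U fun x => (A x)⁻¹ i j := by
  have h : ∀ x, (A x)⁻¹ i j = ((A x).det)⁻¹ * ((A x).updateRow j (Pi.single i 1)).det := by
    intro x
    simp [Matrix.inv_def, Matrix.adjugate_apply]
  simp only [h]
  refine ((SmoothOn.det hA).inv hdet).mul (SmoothOn.det fun a b => ?_)
  by_cases hab : a = j
  · subst hab; simpa using SmoothOn.const _
  · simpa [Matrix.updateRow_ne hab] using hA a b

end Inverse

end

end ConformalSubmanifold

namespace ConformalSubmanifold

open TopologicalSpace (Opens)

noncomputable section

/-! ### Riemannian metrics on open sets: Christoffel symbols and curvature -/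

/-- The components of a smooth Riemannian metric on an open set. -/
structure IsMetricOn {m : ℕ} (g : MetricField m) (V : Opens (E m)) : Prop where
  smooth : ∀ a b, SmoothOn V fun x => g x a b
  posDef : ∀ x ∈ V, (g x).PosDef

/-- Smoothness of the components of a tensor. -/
def SmoothTensor {m r : ℕ} (V : Opens (E m)) (T : Tensor m r) : Prop :=
  ∀ a, SmoothOn V fun x => T x a

namespace IsMetricOn

variable {m : ℕ} {g : MetricField m} {V : Opens (E m)} (hg : IsMetricOn g V) {x : E m}

include hg

theorem symm (hx : x ∈ V) (a b : Fin m) : g x a b = g x b a := by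
  simpa using ((hg.posDef x hx).isHermitian.apply b a)

theorem det_ne_zero (hx : x ∈ V) : (g x).det ≠ 0 := (hg.posDef x hx).det_pos.ne'

theorem inv_smooth (a b : Fin m) : SmoothOn V fun x => (g x)⁻¹ a b :=
  SmoothOn.matrix_inv hg.smooth (fun _ hx => hg.det_ne_zero hx) a b

theorem inv_symm (hx : x ∈ V) (a b : Fin m) : (g x)⁻¹ a b = (g x)⁻¹ b a := by
  simpa using ((hg.posDef x hx).inv.isHermitian.apply b a)

theorem sum_inv_mul (hx : x ∈ V) (a b : Fin m) :
    ∑ c, (g x)⁻¹ a c * g x c b = if a = b then 1 else 0 := by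
  rw [← Matrix.mul_apply, Matrix.nonsing_inv_mul _ (hg.det_ne_zero hx).isUnit, Matrix.one_apply]

theorem sum_mul_inv (hx : x ∈ V) (a b : Fin m) :
    ∑ c, g x a c * (g x)⁻¹ c b = if a = b then 1 else 0 := by
  rw [← Matrix.mul_apply, Matrix.mul_nonsing_inv _ (hg.det_ne_zero hx).isUnit, Matrix.one_apply]

theorem raise_lower (hx : x ∈ V) (v : Fin m → ℝ) (a : Fin m) :
    ∑ c, (g x)⁻¹ a c * ∑ d, g x c d * v d = v a := by
  simp only [Finset.mul_sum]
  rw [Finset.sum_comm]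
  simp only [← mul_assoc, ← Finset.sum_mul, hg.sum_inv_mul hx]
  simp

theorem lower_raise (hx : x ∈ V) (v : Fin m → ℝ) (a : Fin m) :
    ∑ c, g x a c * ∑ d, (g x)⁻¹ c d * v d = v a := by
  simp only [Finset.mul_sum]
  rw [Finset.sum_comm]
  simp only [← mul_assoc, ← Finset.sum_mul, hg.sum_mul_inv hx]
  simp

theorem christoffel_smooth (c a b : Fin m) : SmoothOn V fun x => christoffel g x c a b := by
  unfold christoffel
  refine SmoothOn.const_mul _ (SmoothOn.sum fun d => (hg.inv_smooth c d).mul ?_)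
  exact (((hg.smooth _ _).pd _).add ((hg.smooth _ _).pd _)).sub ((hg.smooth _ _).pd _)

theorem christoffel_symm (hx : x ∈ V) (c a b : Fin m) :
    christoffel g x c a b = christoffel g x c b a := by
  unfold christoffel
  congr 1
  refine Finset.sum_congr rfl fun d _ => ?_
  rw [pd_congr (fun z hz => hg.symm hz a b) hx]
  ring

/-- The Christoffel symbols of the first kind. -/
theorem christoffel_lower (hx : x ∈ V) (a b d : Fin m) :
    ∑ c, g x d c * christoffel g x c a b =
      (1 / 2) * (pd (fun z => g z b d) x a + pd (fun z => g z a d) x b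
        - pd (fun z => g z a b) x d) := by
  have h := hg.lower_raise hx (fun d => pd (fun z => g z b d) x a + pd (fun z => g z a d) x b
        - pd (fun z => g z a b) x d) d
  rw [← h, Finset.mul_sum]
  refine Finset.sum_congr rfl fun c _ => ?_
  simp only [christoffel]
  ring

/-- The metric is parallel. -/
theorem pd_metric (hx : x ∈ V) (e a b : Fin m) :
    pd (fun z => g z a b) x e =
      (∑ d, christoffel g x d e a * g x d b) + ∑ d, christoffel g x d e b * g x a d := by
  have h1 := hg.christoffel_lower hx e a b
  have h2 := hg.christoffel_lower hx e b a
  have e1 : ∑ d, christoffel g x d e a * g x d b = ∑ c, g x b c * christoffel g x c e a :=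
    Finset.sum_congr rfl fun d _ => by rw [hg.symm hx d b]; ring
  have e2 : ∑ d, christoffel g x d e b * g x a d = ∑ c, g x a c * christoffel g x c e b :=
    Finset.sum_congr rfl fun d _ => by ring
  rw [e1, e2, h1, h2, pd_congr (fun z hz => hg.symm hz b a) hx]
  ring

/-- The inverse metric is parallel. -/
theorem pd_inv (hx : x ∈ V) (e a b : Fin m) :
    pd (fun z => (g z)⁻¹ a b) x e =
      -(∑ d, christoffel g x a e d * (g x)⁻¹ d b) - ∑ d, christoffel g x b e d * (g x)⁻¹ a d := by
  have key : ∀ c, ∑ b, pd (fun z => (g z)⁻¹ a b) x e * g x b c =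
      -∑ b, (g x)⁻¹ a b * pd (fun z => g z b c) x e := by
    intro c
    have h0 : pd (fun z => ∑ b, (g z)⁻¹ a b * g z b c) x e = 0 := by
      rw [pd_congr (fun z hz => hg.sum_inv_mul hz a c) hx, pd_const]
    rw [pd_sum (fun b => (hg.inv_smooth a b).mul (hg.smooth b c)) hx] at h0
    simp only [pd_mul (hg.inv_smooth a _) (hg.smooth _ c) hx, Finset.sum_add_distrib] at h0
    linarith
  have h1 : pd (fun z => (g z)⁻¹ a b) x e =
      ∑ c, (∑ b', pd (fun z => (g z)⁻¹ a b') x e * g x b' c) * (g x)⁻¹ c b := by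
    simp only [Finset.sum_mul]
    rw [Finset.sum_comm]
    simp only [mul_assoc, ← Finset.mul_sum, hg.sum_mul_inv hx]
    simp
  rw [h1]
  simp only [key, hg.pd_metric hx, mul_add, Finset.sum_add_distrib]
  have h2 : ∀ c, ∑ b', (g x)⁻¹ a b' * ∑ d, christoffel g x d e c * g x b' d =
      christoffel g x a e c := by
    intro c
    rw [← hg.raise_lower hx (fun d => christoffel g x d e c) a]
    refine Finset.sum_congr rfl fun b' _ => ?_
    congr 1
    exact Finset.sum_congr rfl fun d _ => mul_comm _ _
  have h3 : ∑ c, (∑ b', (g x)⁻¹ a b' * ∑ d, christoffel g x d e b' * g x d c) * (g x)⁻¹ c b =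
      ∑ d, christoffel g x b e d * (g x)⁻¹ a d := by
    calc _ = ∑ b', (g x)⁻¹ a b' * ∑ d, christoffel g x d e b' * ∑ c, g x d c * (g x)⁻¹ c b := by
          simp only [Finset.mul_sum, Finset.sum_mul]
          rw [Finset.sum_comm]
          refine Finset.sum_congr rfl fun b' _ => ?_
          rw [Finset.sum_comm]
          exact Finset.sum_congr rfl fun d _ => Finset.sum_congr rfl fun c _ => by ring
      _ = _ := by
          simp only [hg.sum_mul_inv hx]
          exact Finset.sum_congr rfl fun d _ => by simp; ring
  simp only [h2, neg_mul, Finset.sum_neg_distrib, add_mul, Finset.sum_add_distrib, h3]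
  ring

end IsMetricOn

/-! ### Covariant derivatives of tensors of low rank -/

section LowRank

variable {m : ℕ} (g : MetricField m) (x : E m)

theorem nabla_zero (T : Tensor m 0) (a : Fin m) (A : Fin 0 → Fin m) :
    nabla g T x (Fin.cons a A) = pd (fun z => T z A) x a := by
  simp [nabla]

theorem nabla_one (T : Tensor m 1) (a b : Fin m) :
    nabla g T x ![a, b] = pd (fun z => T z ![b]) x a - ∑ d, christoffel g x d a b * T x ![d] := by
  have h : Fin.tail ![a, b] = ![b] := rfl
  have h0 : ∀ d, Function.update ![b] 0 d = ![d] := fun d => by ext i; fin_cases i; rfl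
  simp only [nabla, h, Fin.sum_univ_one, h0, Matrix.cons_val_zero]

theorem nabla_two (T : Tensor m 2) (a b c : Fin m) :
    nabla g T x ![a, b, c] = pd (fun z => T z ![b, c]) x a
      - (∑ d, christoffel g x d a b * T x ![d, c]) - ∑ d, christoffel g x d a c * T x ![b, d] := by
  have h : Fin.tail ![a, b, c] = ![b, c] := rfl
  have h0 : ∀ d, Function.update ![b, c] 0 d = ![d, c] := fun d => by
    ext i; fin_cases i <;> rfl
  have h1 : ∀ d, Function.update ![b, c] 1 d = ![b, d] := fun d => by
    ext i; fin_cases i <;> rfl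
  simp only [nabla, h, Fin.sum_univ_two, h0, h1, Matrix.cons_val_zero, Matrix.cons_val_one]
  ring

theorem nabla_four (T : Tensor m 4) (e a b c d : Fin m) :
    nabla g T x ![e, a, b, c, d] = pd (fun z => T z ![a, b, c, d]) x e
      - (∑ f, christoffel g x f e a * T x ![f, b, c, d])
      - (∑ f, christoffel g x f e b * T x ![a, f, c, d])
      - (∑ f, christoffel g x f e c * T x ![a, b, f, d])
      - ∑ f, christoffel g x f e d * T x ![a, b, c, f] := by
  have h : Fin.tail ![e, a, b, c, d] = ![a, b, c, d] := rfl
  have h0 : ∀ f, Function.update ![a, b, c, d] 0 f = ![f, b, c, d] := fun d => by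
    ext i; fin_cases i <;> rfl
  have h1 : ∀ f, Function.update ![a, b, c, d] 1 f = ![a, f, c, d] := fun d => by
    ext i; fin_cases i <;> rfl
  have h2 : ∀ f, Function.update ![a, b, c, d] 2 f = ![a, b, f, d] := fun d => by
    ext i; fin_cases i <;> rfl
  have h3 : ∀ f, Function.update ![a, b, c, d] 3 f = ![a, b, c, f] := fun d => by
    ext i; fin_cases i <;> rfl
  simp only [nabla, h, Fin.sum_univ_four, h0, h1, h2, h3]
  simp
  ring

end LowRank

theorem SmoothTensor.nabla {m r : ℕ} {g : MetricField m} {V : Opens (E m)} (hg : IsMetricOn g V)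
    {T : Tensor m r} (hT : SmoothTensor V T) : SmoothTensor V (nabla g T) := fun _ =>
  ((hT _).pd _).sub (SmoothOn.sum fun _ => SmoothOn.sum fun _ =>
    (hg.christoffel_smooth _ _ _).mul (hT _))

namespace IsMetricOn

variable {m : ℕ} {g : MetricField m} {V : Opens (E m)} (hg : IsMetricOn g V) {x : E m}

include hg

theorem riemUp_smooth (a b c d : Fin m) : SmoothOn V fun x => riemUp g x a b c d := by
  have := hg.christoffel_smooth
  exact (((this _ _ _).pd _).sub ((this _ _ _).pd _)).add
    (SmoothOn.sum fun e => ((this _ _ _).mul (this _ _ _)).sub ((this _ _ _).mul (this _ _ _)))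

theorem riem_smooth : SmoothTensor V (riem g) := fun _ =>
  SmoothOn.sum fun _ => (hg.smooth _ _).mul (hg.riemUp_smooth _ _ _ _)

theorem ricci_smooth : SmoothTensor V (ricci g) := fun _ =>
  SmoothOn.sum fun _ => SmoothOn.sum fun _ => (hg.inv_smooth _ _).mul (hg.riem_smooth _)

theorem trSchouten_smooth : SmoothOn V (trSchouten g) :=
  SmoothOn.const_mul _ (SmoothOn.sum fun _ => SmoothOn.sum fun _ =>
    (hg.inv_smooth _ _).mul (hg.ricci_smooth _))

theorem schouten_smooth : SmoothTensor V (schouten g) := fun _ =>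
  SmoothOn.const_mul _ ((hg.ricci_smooth _).sub (hg.trSchouten_smooth.mul (hg.smooth _ _)))

theorem weyl_smooth : SmoothTensor V (weyl g) := fun _ =>
  have h1 := hg.schouten_smooth
  have h2 := hg.smooth
  ((((hg.riem_smooth _).sub ((h1 _).mul (h2 _ _))).sub ((h1 _).mul (h2 _ _))).add
    ((h1 _).mul (h2 _ _))).add ((h1 _).mul (h2 _ _))

theorem cotton_smooth : SmoothTensor V (cotton g) := fun _ =>
  (hg.schouten_smooth.nabla hg _).sub (hg.schouten_smooth.nabla hg _)

/-- The inner product of two coordinate derivatives `∇_a ∂_c` and `∇_b ∂_d`. -/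
theorem sum_lower_christoffel (hx : x ∈ V) (a c b d : Fin m) :
    ∑ e, (∑ f, christoffel g x f b d * g x f e) * christoffel g x e a c =
      ∑ e, (∑ f, christoffel g x f a c * g x f e) * christoffel g x e b d := by
  simp only [Finset.sum_mul]
  rw [Finset.sum_comm]
  refine Finset.sum_congr rfl fun e _ => Finset.sum_congr rfl fun f _ => ?_
  rw [hg.symm hx f e]; ring

/-- The curvature in terms of second derivatives of the metric. -/
theorem riem_eq (hx : x ∈ V) (a b c d : Fin m) :
    riem g x ![a, b, c, d] =
      (1 / 2) * (pd (fun z => pd (fun z => g z a d) z c) x b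
        - pd (fun z => pd (fun z => g z a c) z d) x b
        - pd (fun z => pd (fun z => g z b d) z c) x a
        + pd (fun z => pd (fun z => g z b c) z d) x a)
      - (∑ e, (∑ f, christoffel g x f b d * g x f e) * christoffel g x e a c)
      + ∑ e, (∑ f, christoffel g x f a d * g x f e) * christoffel g x e b c := by
  have hS := hg.smooth
  have hΓ := hg.christoffel_smooth
  have key : ∀ a b c, ∑ e, g x d e * pd (fun z => christoffel g z e a c) x b =
      (1 / 2) * (pd (fun z => pd (fun z => g z c d) z a) x b
        + pd (fun z => pd (fun z => g z a d) z c) x b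
        - pd (fun z => pd (fun z => g z a c) z d) x b)
      - ∑ e, pd (fun z => g z d e) x b * christoffel g x e a c := by
    intro a b c
    have h := pd_congr (fun z hz => hg.christoffel_lower hz a c d) hx b
    rw [pd_sum (fun e => (hS d e).mul (hΓ e a c)) hx,
      pd_const_mul _ ((((hS _ _).pd _).add ((hS _ _).pd _)).sub ((hS _ _).pd _)) hx,
      pd_sub (((hS _ _).pd _).add ((hS _ _).pd _)) ((hS _ _).pd _) hx,
      pd_add ((hS _ _).pd _) ((hS _ _).pd _) hx] at h
    simp only [pd_mul (hS d _) (hΓ _ a c) hx, Finset.sum_add_distrib] at h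
    linarith
  have h2 : ∀ a b c, ∑ e, pd (fun z => g z d e) x b * christoffel g x e a c =
      (∑ e, (∑ f, christoffel g x f b d * g x f e) * christoffel g x e a c) +
      ∑ e, g x d e * ∑ f, christoffel g x f a c * christoffel g x e b f := by
    intro a b c
    simp only [hg.pd_metric hx, add_mul, Finset.sum_add_distrib]
    congr 1
    simp only [Finset.sum_mul, Finset.mul_sum]
    rw [Finset.sum_comm]
    exact Finset.sum_congr rfl fun e _ => Finset.sum_congr rfl fun f _ => by ring
  have h3 : riem g x ![a, b, c, d] =
      (∑ e, g x d e * pd (fun z => christoffel g z e a c) x b)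
      - (∑ e, g x d e * pd (fun z => christoffel g z e b c) x a)
      + (∑ e, g x d e * ∑ f, christoffel g x f a c * christoffel g x e b f)
      - ∑ e, g x d e * ∑ f, christoffel g x f b c * christoffel g x e a f := by
    simp only [riem, riemUp, Finset.sum_sub_distrib, mul_add, mul_sub, Finset.sum_add_distrib,
      Matrix.cons_val]
    ring
  rw [h3, key, key, h2, h2, pd_comm (hS c d) hx a b]
  ring

omit hg in
theorem riem_swap_left (a b c d : Fin m) :
    riem g x ![a, b, c, d] = -riem g x ![b, a, c, d] := by
  simp only [riem, riemUp, Matrix.cons_val, ← Finset.sum_neg_distrib]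
  refine Finset.sum_congr rfl fun e _ => ?_
  simp only [Finset.sum_sub_distrib]
  ring

theorem riem_swap_right (hx : x ∈ V) (a b c d : Fin m) :
    riem g x ![a, b, c, d] = -riem g x ![a, b, d, c] := by
  rw [hg.riem_eq hx, hg.riem_eq hx, hg.sum_lower_christoffel hx a c b d,
    hg.sum_lower_christoffel hx a d b c]
  ring

theorem riem_pair (hx : x ∈ V) (a b c d : Fin m) :
    riem g x ![a, b, c, d] = riem g x ![c, d, a, b] := by
  rw [hg.riem_eq hx, hg.riem_eq hx, pd_congr (fun z _ => pd_congr (fun w hw => hg.symm hw a d) ‹_› c) hx,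
    pd_congr (fun z _ => pd_congr (fun w hw => hg.symm hw a c) ‹_› d) hx,
    pd_congr (fun z _ => pd_congr (fun w hw => hg.symm hw b d) ‹_› c) hx,
    pd_congr (fun z _ => pd_congr (fun w hw => hg.symm hw b c) ‹_› d) hx,
    pd_comm (hg.smooth d a) hx c b, pd_comm (hg.smooth c a) hx d b, pd_comm (hg.smooth d b) hx c a,
    pd_comm (hg.smooth c b) hx d a]
  have e1 : ∀ e, christoffel g x e b d = christoffel g x e d b := fun e => hg.christoffel_symm hx _ _ _
  have e2 : ∀ e, christoffel g x e a c = christoffel g x e c a := fun e => hg.christoffel_symm hx _ _ _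
  have e3 : ∀ e, christoffel g x e a d = christoffel g x e d a := fun e => hg.christoffel_symm hx _ _ _
  have e4 : ∀ e, christoffel g x e b c = christoffel g x e c b := fun e => hg.christoffel_symm hx _ _ _
  simp only [e1, e2, e3, e4]
  rw [hg.sum_lower_christoffel hx d a c b]
  ring

theorem ricci_symm (hx : x ∈ V) (a b : Fin m) : ricci g x ![a, b] = ricci g x ![b, a] := by
  simp only [ricci, Matrix.cons_val]
  rw [Finset.sum_comm]
  refine Finset.sum_congr rfl fun c _ => Finset.sum_congr rfl fun d _ => ?_
  rw [hg.inv_symm hx, hg.riem_pair hx]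

theorem schouten_symm (hx : x ∈ V) (a b : Fin m) :
    schouten g x ![a, b] = schouten g x ![b, a] := by
  simp only [schouten, Matrix.cons_val]
  rw [hg.ricci_symm hx, hg.symm hx]

omit hg in
theorem weyl_swap_left (a b c d : Fin m) :
    weyl g x ![a, b, c, d] = -weyl g x ![b, a, c, d] := by
  simp only [weyl, Matrix.cons_val]
  rw [riem_swap_left]
  ring

theorem weyl_swap_right (hx : x ∈ V) (a b c d : Fin m) :
    weyl g x ![a, b, c, d] = -weyl g x ![a, b, d, c] := by
  simp only [weyl, Matrix.cons_val]
  rw [hg.riem_swap_right hx]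
  ring

theorem weyl_pair (hx : x ∈ V) (a b c d : Fin m) :
    weyl g x ![a, b, c, d] = weyl g x ![c, d, a, b] := by
  simp only [weyl, Matrix.cons_val]
  rw [hg.riem_pair hx, hg.schouten_symm hx a c, hg.schouten_symm hx b d, hg.schouten_symm hx a d,
    hg.schouten_symm hx b c, hg.symm hx a c, hg.symm hx b d, hg.symm hx a d, hg.symm hx b c]
  ring

theorem trace_metric (hx : x ∈ V) : ∑ a, ∑ b, (g x)⁻¹ a b * g x a b = m := by
  have : ∀ a, ∑ b, (g x)⁻¹ a b * g x a b = 1 := fun a => by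
    have := hg.sum_inv_mul hx a a
    rw [if_pos rfl] at this
    rw [← this]
    exact Finset.sum_congr rfl fun b _ => by rw [hg.symm hx a b]
  simp [this]

theorem trace_schouten (hm : 2 < m) (hx : x ∈ V) :
    ∑ a, ∑ b, (g x)⁻¹ a b * schouten g x ![a, b] = trSchouten g x := by
  have hm' : (m : ℝ) - 2 ≠ 0 := by
    have : (2 : ℝ) < m := by exact_mod_cast hm
    linarith
  have hm1 : (m : ℝ) - 1 ≠ 0 := by
    have : (2 : ℝ) < m := by exact_mod_cast hm
    linarith
  have h : ∑ a, ∑ b, (g x)⁻¹ a b * schouten g x ![a, b] =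
      1 / ((m : ℝ) - 2) *
        (scalarCurv g x - trSchouten g x * ∑ a, ∑ b, (g x)⁻¹ a b * g x a b) := by
    simp only [schouten, scalarCurv, Finset.mul_sum, ← Finset.sum_sub_distrib, Matrix.cons_val]
    exact Finset.sum_congr rfl fun a _ => Finset.sum_congr rfl fun b _ => by ring
  rw [h, hg.trace_metric hx]
  have h2 : scalarCurv g x = 2 * ((m : ℝ) - 1) * trSchouten g x := by
    simp only [trSchouten]; field_simp
  rw [h2]; field_simp; ring

/-- The Weyl tensor is trace-free. -/
theorem trace_weyl (hm : 2 < m) (hx : x ∈ V) (a b : Fin m) :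
    ∑ c, ∑ d, (g x)⁻¹ c d * weyl g x ![a, c, b, d] = 0 := by
  have hm' : (m : ℝ) - 2 ≠ 0 := by
    have : (2 : ℝ) < m := by exact_mod_cast hm
    linarith
  have e1 : ∑ c, ∑ d, (g x)⁻¹ c d * (schouten g x ![a, b] * g x c d) = m * schouten g x ![a, b] := by
    rw [← hg.trace_metric hx]
    simp only [Finset.sum_mul]
    exact Finset.sum_congr rfl fun a _ => Finset.sum_congr rfl fun b _ => by ring
  have e2 : ∑ c, ∑ d, (g x)⁻¹ c d * (schouten g x ![c, d] * g x a b) = trSchouten g x * g x a b := by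
    rw [← hg.trace_schouten hm hx]
    simp only [Finset.sum_mul, mul_assoc]
  have e3 : ∑ c, ∑ d, (g x)⁻¹ c d * (schouten g x ![a, d] * g x c b) = schouten g x ![a, b] := by
    have := hg.lower_raise hx (fun d => schouten g x ![a, d]) b
    rw [← this]
    simp only [Finset.mul_sum]
    exact Finset.sum_congr rfl fun c _ => Finset.sum_congr rfl fun d _ => by
      rw [hg.symm hx c b]; ring
  have e4 : ∑ c, ∑ d, (g x)⁻¹ c d * (schouten g x ![c, b] * g x a d) = schouten g x ![a, b] := by
    have := hg.lower_raise hx (fun d => schouten g x ![d, b]) a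
    rw [← this, Finset.sum_comm]
    simp only [Finset.mul_sum]
    exact Finset.sum_congr rfl fun c _ => Finset.sum_congr rfl fun d _ => by
      rw [hg.inv_symm hx c d]; ring
  have e0 : ∑ c, ∑ d, (g x)⁻¹ c d * riem g x ![a, c, b, d] =
      ((m : ℝ) - 2) * schouten g x ![a, b] + trSchouten g x * g x a b := by
    have : ∑ c, ∑ d, (g x)⁻¹ c d * riem g x ![a, c, b, d] = ricci g x ![a, b] := by simp [ricci]
    rw [this]
    simp only [schouten, Matrix.cons_val]
    field_simp; ring
  simp only [weyl, Matrix.cons_val, mul_add, mul_sub, Finset.sum_add_distrib,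
    Finset.sum_sub_distrib, e0, e1, e2, e3, e4]
  ring

end IsMetricOn

end

end ConformalSubmanifold

namespace ConformalSubmanifold

open TopologicalSpace (Opens)

noncomputable section

/-! ### Metric contractions -/

theorem sum_comm_two_two {ι κ : Type*} [Fintype ι] [Fintype κ] {ι' κ' : Type*} [Fintype ι']
    [Fintype κ'] (f : ι → ι' → κ → κ' → ℝ) :
    ∑ j, ∑ d, ∑ a, ∑ b, f j d a b = ∑ a, ∑ b, ∑ j, ∑ d, f j d a b := by
  calc _ = ∑ j, ∑ a, ∑ b, ∑ d, f j d a b := by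
        refine Finset.sum_congr rfl fun j _ => ?_
        rw [Finset.sum_comm]
        exact Finset.sum_congr rfl fun a _ => Finset.sum_comm
    _ = _ := by
        rw [Finset.sum_comm]
        exact Finset.sum_congr rfl fun a _ => Finset.sum_comm

/-- Contraction of a pair of indices with the inverse metric. -/
def ctr {m : ℕ} (g : MetricField m) (x : E m) (f : Fin m → Fin m → ℝ) : ℝ :=
  ∑ a, ∑ b, (g x)⁻¹ a b * f a b

section Contraction

variable {m m' : ℕ} {g : MetricField m} {g' : MetricField m'} {x : E m} {x' : E m'}

theorem ctr_add (f f' : Fin m → Fin m → ℝ) :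
    ctr g x (fun a b => f a b + f' a b) = ctr g x f + ctr g x f' := by
  simp only [ctr, mul_add, Finset.sum_add_distrib]

theorem ctr_sub (f f' : Fin m → Fin m → ℝ) :
    ctr g x (fun a b => f a b - f' a b) = ctr g x f - ctr g x f' := by
  simp only [ctr, mul_sub, Finset.sum_sub_distrib]

theorem ctr_neg (f : Fin m → Fin m → ℝ) : ctr g x (fun a b => -f a b) = -ctr g x f := by
  simp only [ctr, mul_neg, Finset.sum_neg_distrib]

theorem ctr_zero : ctr g x (fun _ _ => 0) = 0 := by simp [ctr]

theorem ctr_mul_left (c : ℝ) (f : Fin m → Fin m → ℝ) :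
    ctr g x (fun a b => c * f a b) = c * ctr g x f := by
  simp only [ctr, Finset.mul_sum]
  exact Finset.sum_congr rfl fun a _ => Finset.sum_congr rfl fun b _ => by ring

theorem ctr_mul_right (c : ℝ) (f : Fin m → Fin m → ℝ) :
    ctr g x (fun a b => f a b * c) = ctr g x f * c := by
  simp only [ctr, Finset.sum_mul, mul_assoc]

theorem ctr_sum {ι : Type*} {s : Finset ι} (f : ι → Fin m → Fin m → ℝ) :
    ctr g x (fun a b => ∑ i ∈ s, f i a b) = ∑ i ∈ s, ctr g x (f i) := by
  simp only [ctr, Finset.mul_sum]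
  rw [Finset.sum_comm (s := s)]
  exact Finset.sum_congr rfl fun a _ => Finset.sum_comm

theorem ctr_comm (f : Fin m → Fin m → Fin m' → Fin m' → ℝ) :
    ctr g x (fun a b => ctr g' x' fun c d => f a b c d) =
      ctr g' x' fun c d => ctr g x fun a b => f a b c d := by
  simp only [ctr, Finset.mul_sum]
  rw [sum_comm_two_two]
  exact Finset.sum_congr rfl fun a _ => Finset.sum_congr rfl fun b _ =>
      Finset.sum_congr rfl fun j _ => Finset.sum_congr rfl fun d _ => by ring

theorem ctr_congr {f f' : Fin m → Fin m → ℝ} (h : ∀ a b, f a b = f' a b) :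
    ctr g x f = ctr g x f' := by simp only [ctr, h]

theorem ctr_smooth {V : Opens (E m)} {U : Opens (E m')} (hg : IsMetricOn g V) {φ : E m' → E m}
    (hφ : ∀ a, SmoothOn U fun x => φ x a) (h : ∀ x ∈ U, φ x ∈ V)
    {F : E m' → Fin m → Fin m → ℝ} (hF : ∀ a b, SmoothOn U fun z => F z a b) :
    SmoothOn U fun z => ctr g (φ z) (F z) :=
  SmoothOn.sum fun _ => SmoothOn.sum fun _ => ((hg.inv_smooth _ _).comp hφ h).mul (hF _ _)

variable {V : Opens (E m)} (hg : IsMetricOn g V)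

include hg

theorem ctr_smooth' {F : E m → Fin m → Fin m → ℝ} (hF : ∀ a b, SmoothOn V fun z => F z a b) :
    SmoothOn V fun z => ctr g z (F z) :=
  SmoothOn.sum fun _ => SmoothOn.sum fun _ => (hg.inv_smooth _ _).mul (hF _ _)

theorem ctr_swap (hx : x ∈ V) (f : Fin m → Fin m → ℝ) :
    ctr g x f = ctr g x fun a b => f b a := by
  simp only [ctr]
  rw [Finset.sum_comm]
  exact Finset.sum_congr rfl fun a _ => Finset.sum_congr rfl fun b _ => by rw [hg.inv_symm hx]

theorem ctr_metric (hx : x ∈ V) (f : Fin m → ℝ) (c : Fin m) :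
    ctr g x (fun a b => g x c a * f b) = f c := by
  rw [← hg.lower_raise hx f c]
  simp only [ctr, Finset.mul_sum]
  exact Finset.sum_congr rfl fun a _ => Finset.sum_congr rfl fun b _ => by ring

theorem ctr_metric' (hx : x ∈ V) (f : Fin m → ℝ) (c : Fin m) :
    ctr g x (fun a b => g x c b * f a) = f c := by
  rw [ctr_swap hg hx, ctr_metric hg hx]

theorem ctr_self (hx : x ∈ V) : ctr g x (fun a b => g x a b) = m := hg.trace_metric hx

end Contraction

/-! ### Rules for covariant derivatives -/

section Rules

variable {m r s : ℕ} {g : MetricField m} {V : Opens (E m)} {x : E m}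

theorem nabla_congr {T T' : Tensor m r} (h : ∀ z ∈ V, ∀ A, T z A = T' z A) (hx : x ∈ V)
    (A : Fin (r + 1) → Fin m) : nabla g T x A = nabla g T' x A := by
  simp only [nabla, h x hx, pd_congr (fun z hz => h z hz (Fin.tail A)) hx]

theorem nabla_add {T T' : Tensor m r} (hT : SmoothTensor V T) (hT' : SmoothTensor V T')
    (hx : x ∈ V) (A : Fin (r + 1) → Fin m) :
    nabla g (fun z A => T z A + T' z A) x A = nabla g T x A + nabla g T' x A := by
  simp only [nabla, pd_add (hT _) (hT' _) hx, mul_add, Finset.sum_add_distrib]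
  ring

theorem nabla_sub {T T' : Tensor m r} (hT : SmoothTensor V T) (hT' : SmoothTensor V T')
    (hx : x ∈ V) (A : Fin (r + 1) → Fin m) :
    nabla g (fun z A => T z A - T' z A) x A = nabla g T x A - nabla g T' x A := by
  simp only [nabla, pd_sub (hT _) (hT' _) hx, mul_sub, Finset.sum_sub_distrib]
  ring

theorem nabla_const_mul (c : ℝ) {T : Tensor m r} (hT : SmoothTensor V T)
    (hx : x ∈ V) (A : Fin (r + 1) → Fin m) :
    nabla g (fun z A => c * T z A) x A = c * nabla g T x A := by
  simp only [nabla, pd_const_mul _ (hT _) hx, mul_sub, Finset.mul_sum]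
  congr 1
  exact Finset.sum_congr rfl fun a _ => Finset.sum_congr rfl fun b _ => by ring

theorem nabla_perm (T : Tensor m s) {σ : Fin s → Fin r} (hσ : Function.Bijective σ) (e : Fin m)
    (A : Fin r → Fin m) :
    nabla g (fun z A => T z (A ∘ σ)) x (Fin.cons e A) = nabla g T x (Fin.cons e (A ∘ σ)) := by
  simp only [nabla, Fin.tail_cons, Fin.cons_zero]
  congr 1
  rw [← (Equiv.ofBijective σ hσ).sum_comp]
  refine Finset.sum_congr rfl fun j _ => Finset.sum_congr rfl fun d _ => ?_
  rw [Equiv.ofBijective_apply, Function.update_comp_eq_of_injective _ hσ.injective]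
  rfl

/-- The product rule; the slots of the product are distributed over the factors. -/
theorem nabla_mul {t : ℕ} {S : Tensor m s} {T : Tensor m t} (hS : SmoothTensor V S)
    (hT : SmoothTensor V T) {i : Fin s → Fin r} {j : Fin t → Fin r}
    (hij : Function.Bijective (Sum.elim i j)) (hx : x ∈ V) (e : Fin m) (A : Fin r → Fin m) :
    nabla g (fun z A => S z (A ∘ i) * T z (A ∘ j)) x (Fin.cons e A) =
      nabla g S x (Fin.cons e (A ∘ i)) * T x (A ∘ j) +
        S x (A ∘ i) * nabla g T x (Fin.cons e (A ∘ j)) := by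
  have hi : Function.Injective i := hij.1.comp Sum.inl_injective
  have hj : Function.Injective j := hij.1.comp Sum.inr_injective
  have hne : ∀ a b, i a ≠ j b := fun a b h => Sum.inl_ne_inr (hij.1 (a₁ := .inl a) (a₂ := .inr b) h)
  have h1 : ∀ a d, Function.update A (i a) d ∘ j = A ∘ j := fun a d =>
    Function.update_comp_eq_of_notMem_range _ _ (by rintro ⟨b, hb⟩; exact hne a b hb.symm)
  have h2 : ∀ b d, Function.update A (j b) d ∘ i = A ∘ i := fun b d =>
    Function.update_comp_eq_of_notMem_range _ _ (by rintro ⟨a, ha⟩; exact hne a b ha)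
  simp only [nabla, Fin.tail_cons, Fin.cons_zero, pd_mul (hS _) (hT _) hx]
  rw [← (Equiv.ofBijective _ hij).sum_comp]
  simp only [Fintype.sum_sum_type, Equiv.ofBijective_apply, Sum.elim_inl, Sum.elim_inr,
    Function.update_comp_eq_of_injective _ hi, Function.update_comp_eq_of_injective _ hj, h1, h2,
    Function.comp_apply]
  have e1 : ∀ f : Fin s → Fin m → ℝ, (∑ a, ∑ d, f a d * T x (A ∘ j)) =
      (∑ a, ∑ d, f a d) * T x (A ∘ j) := fun f => by simp only [Finset.sum_mul]
  have e2 : ∀ f : Fin t → Fin m → ℝ, (∑ a, ∑ d, S x (A ∘ i) * f a d) =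
      S x (A ∘ i) * (∑ a, ∑ d, f a d) := fun f => by simp only [Finset.mul_sum]
  simp only [← mul_assoc, e1]
  simp only [mul_comm _ (S x (A ∘ i)), mul_assoc, e2]
  ring

theorem nabla_metric (hg : IsMetricOn g V) (hx : x ∈ V) (e a b : Fin m) :
    nabla g (fun z A => g z (A 0) (A 1)) x ![e, a, b] = 0 := by
  rw [nabla_two]
  simp only [Matrix.cons_val, hg.pd_metric hx]
  ring


/-- Covariant differentiation commutes with metric contractions. -/
theorem nabla_trace (hg : IsMetricOn g V) {T : Tensor m (r + 2)} (hT : SmoothTensor V T)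
    (hx : x ∈ V) (e : Fin m) (A : Fin r → Fin m) :
    nabla g (fun z A => ctr g z fun a b => T z (Fin.cons a (Fin.cons b A))) x (Fin.cons e A) =
      ctr g x fun a b => nabla g T x (Fin.cons e (Fin.cons a (Fin.cons b A))) := by
  simp only [ctr, nabla, Fin.tail_cons, Fin.cons_zero]
  rw [pd_sum (fun a => SmoothOn.sum fun b => (hg.inv_smooth _ _).mul (hT _)) hx]
  simp only [pd_sum (fun b => (hg.inv_smooth _ b).mul (hT _)) hx,
    pd_mul (hg.inv_smooth _ _) (hT _) hx, hg.pd_inv hx, Fin.sum_univ_succ, Fin.cons_zero,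
    Fin.cons_succ, Fin.update_cons_zero, ← Fin.cons_update, mul_sub, mul_add,
    Finset.sum_add_distrib, Finset.sum_sub_distrib, sub_mul, neg_mul, Finset.sum_neg_distrib]
  have h1 : ∑ a, ∑ b, (∑ d, christoffel g x a e d * (g x)⁻¹ d b) *
        T x (Fin.cons a (Fin.cons b A)) =
      ∑ a, ∑ b, (g x)⁻¹ a b * ∑ d, christoffel g x d e a * T x (Fin.cons d (Fin.cons b A)) := by
    simp only [Finset.sum_mul, Finset.mul_sum]
    rw [Finset.sum_comm]
    simp only [fun b => Finset.sum_comm (s := Finset.univ) (t := Finset.univ)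
      (f := fun a d => christoffel g x a e d * (g x)⁻¹ d b * T x (Fin.cons a (Fin.cons b A)))]
    rw [Finset.sum_comm]
    exact Finset.sum_congr rfl fun a _ => Finset.sum_congr rfl fun b _ =>
      Finset.sum_congr rfl fun d _ => by ring
  have h2 : ∑ a, ∑ b, (∑ d, christoffel g x b e d * (g x)⁻¹ a d) *
        T x (Fin.cons a (Fin.cons b A)) =
      ∑ a, ∑ b, (g x)⁻¹ a b * ∑ d, christoffel g x d e b * T x (Fin.cons a (Fin.cons d A)) := by
    simp only [Finset.sum_mul, Finset.mul_sum]
    refine Finset.sum_congr rfl fun a _ => ?_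
    rw [Finset.sum_comm]
    exact Finset.sum_congr rfl fun b _ => Finset.sum_congr rfl fun d _ => by ring
  have h3 : ∑ j, ∑ d, christoffel g x d e (A j) *
        ∑ a, ∑ b, (g x)⁻¹ a b * T x (Fin.cons a (Fin.cons b (Function.update A j d))) =
      ∑ a, ∑ b, (g x)⁻¹ a b * ∑ j, ∑ d, christoffel g x d e (A j) *
        T x (Fin.cons a (Fin.cons b (Function.update A j d))) := by
    simp only [Finset.mul_sum]
    rw [sum_comm_two_two]
    exact Finset.sum_congr rfl fun a _ => Finset.sum_congr rfl fun b _ =>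
      Finset.sum_congr rfl fun j _ => Finset.sum_congr rfl fun d _ => by ring
  rw [h1, h2, h3]
  ring

end Rules

end

end ConformalSubmanifold

namespace ConformalSubmanifold

open TopologicalSpace (Opens)

noncomputable section

/-! ### The Bianchi identities and the commutator of covariant derivatives -/

theorem comp_vec_one {α : Type*} {r : ℕ} (A : Fin r → α) (i : Fin r) :
    A ∘ ![i] = ![A i] := by ext a; fin_cases a; rfl

theorem comp_vec_two {α : Type*} {r : ℕ} (A : Fin r → α) (i j : Fin r) :
    A ∘ ![i, j] = ![A i, A j] := by ext a; fin_cases a <;> rfl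

theorem comp_vec_three {α : Type*} {r : ℕ} (A : Fin r → α) (i j l : Fin r) :
    A ∘ ![i, j, l] = ![A i, A j, A l] := by ext a; fin_cases a <;> rfl

theorem comp_vec_four {α : Type*} {r : ℕ} (A : Fin r → α) (i j l o : Fin r) :
    A ∘ ![i, j, l, o] = ![A i, A j, A l, A o] := by ext a; fin_cases a <;> rfl

theorem vec_two_eta {α : Type*} (A : Fin 2 → α) : ![A 0, A 1] = A := by
  ext a; fin_cases a <;> rfl

theorem vec_four_eta {α : Type*} (A : Fin 4 → α) : ![A 0, A 1, A 2, A 3] = A := by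
  ext a; fin_cases a <;> rfl

namespace IsMetricOn

variable {m : ℕ} {g : MetricField m} {V : Opens (E m)} (hg : IsMetricOn g V) {x : E m}

include hg

theorem nabla_riem_eq (hx : x ∈ V) (e a b c d : Fin m) :
    nabla g (riem g) x ![e, a, b, c, d] = ∑ h, g x d h *
      (pd (fun z => riemUp g z a b c h) x e
        - (∑ f, christoffel g x f e a * riemUp g x f b c h)
        - (∑ f, christoffel g x f e b * riemUp g x a f c h)
        - (∑ f, christoffel g x f e c * riemUp g x a b f h)
        + ∑ f, christoffel g x h e f * riemUp g x a b c f) := by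
  rw [nabla_four]
  simp only [riem, Matrix.cons_val]
  rw [pd_sum (fun h => (hg.smooth d h).mul (hg.riemUp_smooth a b c h)) hx]
  simp only [pd_mul (hg.smooth d _) (hg.riemUp_smooth a b c _) hx, hg.pd_metric hx, mul_add,
    mul_sub, Finset.sum_add_distrib, Finset.sum_sub_distrib, add_mul, Finset.mul_sum,
    Finset.sum_mul]
  have h1 : ∀ (F : Fin m → Fin m → ℝ), ∑ i, ∑ j, F i j = ∑ j, ∑ i, F i j := fun F =>
    Finset.sum_comm
  rw [h1 fun i h => christoffel g x i e a * (g x d h * riemUp g x i b c h),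
    h1 fun i h => christoffel g x i e b * (g x d h * riemUp g x a i c h),
    h1 fun i h => christoffel g x i e c * (g x d h * riemUp g x a b i h),
    h1 fun f i => christoffel g x f e d * (g x f i * riemUp g x a b c i),
    h1 fun h f => g x d h * (christoffel g x h e f * riemUp g x a b c f)]
  simp only [mul_assoc, mul_left_comm (g x d _)]
  ring

/-- The second Bianchi identity. -/
theorem nabla_riem_cyclic (hx : x ∈ V) (e a b c d : Fin m) :
    nabla g (riem g) x ![e, a, b, c, d] + nabla g (riem g) x ![a, b, e, c, d] +
      nabla g (riem g) x ![b, e, a, c, d] = 0 := by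
  rw [hg.nabla_riem_eq hx, hg.nabla_riem_eq hx, hg.nabla_riem_eq hx, ← Finset.sum_add_distrib,
    ← Finset.sum_add_distrib]
  refine Finset.sum_eq_zero fun h _ => ?_
  have hΓ := hg.christoffel_smooth
  let G : Fin m → Matrix (Fin m) (Fin m) ℝ := fun a => Matrix.of fun c d => christoffel g x d a c
  let D : Fin m → Fin m → Matrix (Fin m) (Fin m) ℝ := fun e a =>
    Matrix.of fun c d => pd (fun z => christoffel g z d a c) x e
  let DD : Fin m → Fin m → Fin m → Matrix (Fin m) (Fin m) ℝ := fun f e a =>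
    Matrix.of fun c d => pd (fun w => pd (fun z => christoffel g z d a c) w e) x f
  let R : Fin m → Fin m → Matrix (Fin m) (Fin m) ℝ := fun a b =>
    D b a - D a b + G a * G b - G b * G a
  have hR : ∀ a b c d, riemUp g x a b c d = R a b c d := by
    intro a b c d
    simp only [riemUp, R, G, D, Matrix.sub_apply, Matrix.add_apply, Matrix.mul_apply,
      Matrix.of_apply, Finset.sum_sub_distrib]
    ring
  have hdR : ∀ e a b c d, pd (fun z => riemUp g z a b c d) x e =
      (DD e b a - DD e a b + (D e a * G b + G a * D e b) - (D e b * G a + G b * D e a)) c d := by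
    intro e a b c d
    simp only [riemUp]
    rw [pd_add (((hΓ _ _ _).pd _).sub ((hΓ _ _ _).pd _)) (SmoothOn.sum fun e =>
      ((hΓ _ _ _).mul (hΓ _ _ _)).sub ((hΓ _ _ _).mul (hΓ _ _ _))) hx,
      pd_sub ((hΓ _ _ _).pd _) ((hΓ _ _ _).pd _) hx, pd_sum (fun e =>
      ((hΓ _ _ _).mul (hΓ _ _ _)).sub ((hΓ _ _ _).mul (hΓ _ _ _))) hx]
    simp only [pd_sub ((hΓ _ _ _).mul (hΓ _ _ _)) ((hΓ _ _ _).mul (hΓ _ _ _)) hx,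
      pd_mul (hΓ _ _ _) (hΓ _ _ _) hx, G, D, DD, Matrix.sub_apply, Matrix.add_apply,
      Matrix.mul_apply, Matrix.of_apply, Finset.sum_sub_distrib, Finset.sum_add_distrib]
    ring
  have h1 : ∀ e a b, (∑ f, christoffel g x f e c * riemUp g x a b f h) = (G e * R a b) c h := by
    intro e a b; simp only [hR, G, Matrix.mul_apply, Matrix.of_apply]
  have h2 : ∀ e a b, (∑ f, christoffel g x h e f * riemUp g x a b c f) = (R a b * G e) c h := by
    intro e a b; simp only [hR, G, Matrix.mul_apply, Matrix.of_apply, mul_comm]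
  have h3 : ∀ e a b, (∑ f, christoffel g x f e b * riemUp g x a f c h) =
      -∑ f, christoffel g x f b e * riemUp g x f a c h := by
    intro e a b
    rw [← Finset.sum_neg_distrib]
    refine Finset.sum_congr rfl fun f _ => ?_
    rw [hg.christoffel_symm hx f e b]
    have : riemUp g x a f c h = -riemUp g x f a c h := by
      simp only [riemUp, Finset.sum_sub_distrib]; ring
    rw [this]; ring
  have hDD : ∀ f e a, DD f e a = DD e f a := by
    intro f e a
    ext c d
    exact pd_comm (hΓ d a c) hx e f
  have key : (DD e b a - DD e a b + (D e a * G b + G a * D e b) - (D e b * G a + G b * D e a))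
      - G e * R a b + R a b * G e
      + ((DD a e b - DD a b e + (D a b * G e + G b * D a e) - (D a e * G b + G e * D a b))
      - G a * R b e + R b e * G a)
      + ((DD b a e - DD b e a + (D b e * G a + G e * D b a) - (D b a * G e + G a * D b e))
      - G b * R e a + R e a * G b) = 0 := by
    rw [hDD e b a, hDD a e b, hDD b a e]
    simp only [R]
    noncomm_ring
  have key' := congrFun (congrFun key c) h
  simp only [Matrix.sub_apply, Matrix.add_apply, Matrix.zero_apply] at key'
  rw [h3 e a b, h3 a b e, h3 b e a]
  simp only [hdR, h1, h2, Matrix.sub_apply, Matrix.add_apply]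
  linear_combination (g x d h) * key'

omit hg in
theorem nabla_swap {r : ℕ} {T : Tensor m r} {σ : Fin r → Fin r} (hσ : Function.Bijective σ)
    (hT : SmoothTensor V T) (c : ℝ) (h : ∀ z ∈ V, ∀ A, T z A = c * T z (A ∘ σ)) (hx : x ∈ V)
    (e : Fin m) (A : Fin r → Fin m) :
    nabla g T x (Fin.cons e A) = c * nabla g T x (Fin.cons e (A ∘ σ)) := by
  rw [nabla_congr h hx, nabla_const_mul c (fun A => hT (A ∘ σ)) hx, nabla_perm T hσ]

theorem nabla_riem_swap_right (hx : x ∈ V) (e a b c d : Fin m) :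
    nabla g (riem g) x ![e, a, b, c, d] = -nabla g (riem g) x ![e, a, b, d, c] := by
  have := nabla_swap (g := g) (σ := ![0, 1, 3, 2]) (by decide) hg.riem_smooth (-1)
    (fun z hz A => by
      rw [comp_vec_four, neg_one_mul, ← hg.riem_swap_right hz, vec_four_eta]) hx e ![a, b, c, d]
  rw [comp_vec_four, neg_one_mul] at this
  exact this

theorem nabla_riem_swap_left (hx : x ∈ V) (e a b c d : Fin m) :
    nabla g (riem g) x ![e, a, b, c, d] = -nabla g (riem g) x ![e, b, a, c, d] := by
  have := nabla_swap (g := g) (σ := ![1, 0, 2, 3]) (by decide) hg.riem_smooth (-1)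
    (fun z hz A => by
      rw [comp_vec_four, neg_one_mul, ← riem_swap_left, vec_four_eta]) hx e ![a, b, c, d]
  rw [comp_vec_four, neg_one_mul] at this
  exact this

theorem nabla_schouten_symm (hx : x ∈ V) (e a b : Fin m) :
    nabla g (schouten g) x ![e, a, b] = nabla g (schouten g) x ![e, b, a] := by
  have := nabla_swap (g := g) (σ := ![1, 0]) (by decide) hg.schouten_smooth 1
    (fun z hz A => by
      rw [comp_vec_two, one_mul, ← hg.schouten_symm hz, vec_two_eta]) hx e ![a, b]
  rw [comp_vec_two, one_mul] at this
  exact this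

theorem nabla_ricci (hx : x ∈ V) (e a b : Fin m) :
    nabla g (ricci g) x ![e, a, b] = ctr g x fun c d => nabla g (riem g) x ![e, a, c, b, d] := by
  have h := nabla_trace (r := 2) hg (T := fun z A => riem g z (A ∘ ![2, 0, 3, 1]))
    (fun A => hg.riem_smooth _) hx e ![a, b]
  have h2 : nabla g (ricci g) x ![e, a, b] = nabla g (fun z A => ctr g z fun c d =>
      riem g z ((Fin.cons c (Fin.cons d A) : Fin 4 → Fin m) ∘ ![2, 0, 3, 1])) x ![e, a, b] :=
    nabla_congr (fun z hz A => by simp only [comp_vec_four]; rfl) hx _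
  rw [h2]
  refine h.trans (ctr_congr fun c d => ?_)
  rw [nabla_perm _ (by decide), comp_vec_four]
  rfl

theorem nabla_weyl (hx : x ∈ V) (e a b c d : Fin m) :
    nabla g (weyl g) x ![e, a, b, c, d] = nabla g (riem g) x ![e, a, b, c, d]
      - nabla g (schouten g) x ![e, a, c] * g x b d - nabla g (schouten g) x ![e, b, d] * g x a c
      + nabla g (schouten g) x ![e, a, d] * g x b c
      + nabla g (schouten g) x ![e, b, c] * g x a d := by
  let T : Tensor m 2 := fun z A => g z (A 0) (A 1)
  have hT : SmoothTensor V T := fun A => hg.smooth _ _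
  have hP := hg.schouten_smooth
  have hprod : ∀ (i j : Fin 2 → Fin 4), SmoothTensor V fun z A =>
    schouten g z (A ∘ i) * T z (A ∘ j) := fun i j A => (hP _).mul (hT _)
  have h2 : nabla g (weyl g) x ![e, a, b, c, d] = nabla g (fun z A => riem g z A
      - schouten g z (A ∘ ![0, 2]) * T z (A ∘ ![1, 3])
      - schouten g z (A ∘ ![1, 3]) * T z (A ∘ ![0, 2])
      + schouten g z (A ∘ ![0, 3]) * T z (A ∘ ![1, 2])
      + schouten g z (A ∘ ![1, 2]) * T z (A ∘ ![0, 3])) x ![e, a, b, c, d] :=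
    nabla_congr (fun z hz A => by simp only [comp_vec_two, weyl, T]; simp) hx _
  rw [h2, nabla_add (fun A => (((hg.riem_smooth _).sub (hprod _ _ A)).sub (hprod _ _ A)).add
      (hprod _ _ A)) (hprod _ _) hx,
    nabla_add (fun A => ((hg.riem_smooth _).sub (hprod _ _ A)).sub (hprod _ _ A)) (hprod _ _) hx,
    nabla_sub (fun A => (hg.riem_smooth _).sub (hprod _ _ A)) (hprod _ _) hx,
    nabla_sub hg.riem_smooth (hprod _ _) hx]
  have key : ∀ (i j : Fin 2 → Fin 4), Function.Bijective (Sum.elim i j) →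
      nabla g (fun z A => schouten g z (A ∘ i) * T z (A ∘ j)) x ![e, a, b, c, d] =
      nabla g (schouten g) x ![e, ![a, b, c, d] (i 0), ![a, b, c, d] (i 1)] *
        g x (![a, b, c, d] (j 0)) (![a, b, c, d] (j 1)) := by
    intro i j hij
    refine (nabla_mul hP hT hij hx e ![a, b, c, d]).trans ?_
    have : (Fin.cons e (![a, b, c, d] ∘ j) : Fin 3 → Fin m) =
        ![e, ![a, b, c, d] (j 0), ![a, b, c, d] (j 1)] := by
      ext l; fin_cases l <;> rfl
    rw [this, nabla_metric hg hx, mul_zero, add_zero]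
    have : (Fin.cons e (![a, b, c, d] ∘ i) : Fin 3 → Fin m) =
        ![e, ![a, b, c, d] (i 0), ![a, b, c, d] (i 1)] := by
      ext l; fin_cases l <;> rfl
    rw [this]
    rfl
  rw [key _ _ (by decide), key _ _ (by decide), key _ _ (by decide), key _ _ (by decide)]
  simp

theorem nabla_schouten (hx : x ∈ V) (e a b : Fin m) :
    nabla g (schouten g) x ![e, a, b] = 1 / ((m : ℝ) - 2) *
      (nabla g (ricci g) x ![e, a, b] - pd (trSchouten g) x e * g x a b) := by
  let T : Tensor m 2 := fun z A => g z (A 0) (A 1)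
  have hT : SmoothTensor V T := fun A => hg.smooth _ _
  let S : Tensor m 0 := fun z _ => trSchouten g z
  have hS : SmoothTensor V S := fun A => hg.trSchouten_smooth
  have h2 : nabla g (schouten g) x ![e, a, b] = nabla g (fun z A => 1 / ((m : ℝ) - 2) *
      (ricci g z A - S z (A ∘ ![]) * T z (A ∘ ![0, 1]))) x ![e, a, b] := by
    refine nabla_congr (fun z hz A => ?_) hx _
    simp only [comp_vec_two]
    rfl
  rw [h2, nabla_const_mul _ (fun A => (hg.ricci_smooth A).sub ((hS (A ∘ ![])).mul (hT _))) hx,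
    nabla_sub hg.ricci_smooth (fun A => (hS (A ∘ ![])).mul (hT _)) hx]
  have := nabla_mul (g := g) hS hT (i := ![]) (j := ![0, 1]) (by decide) hx e ![a, b]
  rw [nabla_zero] at this
  have h3 : nabla g T x (Fin.cons e (![a, b] ∘ ![0, 1])) = 0 := by
    rw [comp_vec_two]; exact nabla_metric hg hx e a b
  rw [h3] at this
  refine congrArg _ (congrArg _ (this.trans ?_))
  simp [comp_vec_two, S, T]

theorem pd_trSchouten (hm : 2 < m) (hx : x ∈ V) (e : Fin m) :
    pd (trSchouten g) x e = ctr g x fun a b => nabla g (schouten g) x ![e, a, b] := by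
  have h := nabla_trace (r := 0) hg (T := schouten g) hg.schouten_smooth hx e ![]
  rw [nabla_zero] at h
  refine Eq.trans ?_ h
  exact pd_congr (fun z hz => (hg.trace_schouten hm hz).symm) hx e

theorem pd_scalarCurv_eq (hm : 2 < m) (hx : x ∈ V) (e : Fin m) :
    ctr g x (fun a b => nabla g (ricci g) x ![e, a, b]) = 2 * ((m : ℝ) - 1) * pd (trSchouten g) x e := by
  have hm' : (m : ℝ) - 2 ≠ 0 := by
    have : (2 : ℝ) < m := by exact_mod_cast hm
    linarith
  have h := hg.pd_trSchouten hm hx e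
  have h5 : ctr g x (fun a b => pd (trSchouten g) x e * g x a b) = pd (trSchouten g) x e * m := by
    rw [← ctr_self hg hx]
    exact ctr_mul_left _ _
  simp only [hg.nabla_schouten hx, ctr_mul_left, ctr_sub, h5] at h
  field_simp at h
  linarith

/-- The divergence of the curvature tensor. -/
theorem div_riem (hx : x ∈ V) (a b c : Fin m) :
    ctr g x (fun e d => nabla g (riem g) x ![e, a, b, c, d]) =
      -(nabla g (ricci g) x ![a, b, c] - nabla g (ricci g) x ![b, a, c]) := by
  have h : ∀ e d, nabla g (riem g) x ![e, a, b, c, d] =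
      -nabla g (riem g) x ![a, b, e, c, d] + nabla g (riem g) x ![b, a, e, c, d] := by
    intro e d
    have h1 := hg.nabla_riem_cyclic hx e a b c d
    have h2 := hg.nabla_riem_swap_left hx b e a c d
    linarith
  simp only [h, ctr_add, ctr_neg, hg.nabla_ricci hx]
  ring

theorem div_schouten (hm : 2 < m) (hx : x ∈ V) (a : Fin m) :
    ctr g x (fun e d => nabla g (schouten g) x ![e, a, d]) = pd (trSchouten g) x a := by
  have hm' : (m : ℝ) - 2 ≠ 0 := by
    have : (2 : ℝ) < m := by exact_mod_cast hm
    linarith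
  have h1 : ctr g x (fun b c => ctr g x (fun e d => nabla g (riem g) x ![e, a, b, c, d])) =
      -ctr g x fun e d => nabla g (ricci g) x ![e, a, d] := by
    rw [ctr_comm, ← ctr_neg]
    refine ctr_congr fun e d => ?_
    rw [hg.nabla_ricci hx, ← ctr_neg]
    exact ctr_congr fun b c => hg.nabla_riem_swap_right hx e a b c d
  have h2 : ctr g x (fun b c => ctr g x (fun e d => nabla g (riem g) x ![e, a, b, c, d])) =
      -(2 * ((m : ℝ) - 1) * pd (trSchouten g) x a
        - ctr g x fun e d => nabla g (ricci g) x ![e, a, d]) := by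
    simp only [hg.div_riem hx, ctr_neg, ctr_sub]
    rw [hg.pd_scalarCurv_eq hm hx]
  have h3 : ctr g x (fun e d => nabla g (ricci g) x ![e, a, d]) =
      ((m : ℝ) - 1) * pd (trSchouten g) x a := by linarith
  have h4 : ctr g x (fun e d => pd (trSchouten g) x e * g x a d) = pd (trSchouten g) x a := by
    simpa only [mul_comm] using ctr_metric' hg hx (fun e => pd (trSchouten g) x e) a
  simp only [hg.nabla_schouten hx, ctr_mul_left, ctr_sub, h3, h4]
  field_simp
  ring

/-- The divergence of the Weyl tensor is a multiple of the Cotton tensor. -/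
theorem div_weyl (hm : 2 < m) (hx : x ∈ V) (a b c : Fin m) :
    ctr g x (fun e d => nabla g (weyl g) x ![e, a, b, c, d]) =
      -((m : ℝ) - 3) * cotton g x ![a, b, c] := by
  have hm' : (m : ℝ) - 2 ≠ 0 := by
    have : (2 : ℝ) < m := by exact_mod_cast hm
    linarith
  have h1 : ∀ (f : Fin m → ℝ) (b : Fin m), ctr g x (fun e d => f e * g x b d) = f b := fun f b => by
    simpa only [mul_comm] using ctr_metric' hg hx f b
  simp only [hg.nabla_weyl hx, ctr_add, ctr_sub, ctr_mul_right, hg.div_riem hx,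
    hg.div_schouten hm hx]
  rw [h1 (fun e => nabla g (schouten g) x ![e, a, c]) b,
    h1 (fun e => nabla g (schouten g) x ![e, b, c]) a]
  have h2 : ∀ e a b, nabla g (ricci g) x ![e, a, b] =
      ((m : ℝ) - 2) * nabla g (schouten g) x ![e, a, b] + pd (trSchouten g) x e * g x a b := by
    intro e a b
    rw [hg.nabla_schouten hx]
    field_simp
    ring
  simp only [h2, cotton, Matrix.cons_val]
  ring

/-- The trace of the derivative of the Weyl tensor vanishes. -/
theorem trace_nabla_weyl (hm : 2 < m) (hx : x ∈ V) (e a b : Fin m) :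
    ctr g x (fun c d => nabla g (weyl g) x ![e, a, c, b, d]) = 0 := by
  have h := nabla_trace (r := 2) hg (T := fun z A => weyl g z (A ∘ ![2, 0, 3, 1]))
    (fun A => hg.weyl_smooth _) hx e ![a, b]
  have h2 : nabla g (fun _ _ => 0) x ![e, a, b] = nabla g (fun z A => ctr g z fun c d =>
      weyl g z ((Fin.cons c (Fin.cons d A) : Fin 4 → Fin m) ∘ ![2, 0, 3, 1])) x ![e, a, b] :=
    nabla_congr (fun z hz A => by
      simp only [comp_vec_four]; exact (hg.trace_weyl hm hz (A 0) (A 1)).symm) hx _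
  have h3 : nabla g (fun _ _ => (0 : ℝ)) x ![e, a, b] = 0 := by
    simp [nabla, pd_const]
  rw [h3] at h2
  rw [h2]
  refine Eq.symm (h.trans (ctr_congr fun c d => ?_))
  rw [nabla_perm _ (by decide), comp_vec_four]
  rfl

/-- The commutator of covariant derivatives on one-forms. -/
theorem nabla_nabla_comm {τ : Tensor m 1} (hτ : SmoothTensor V τ) (hx : x ∈ V) (a b c : Fin m) :
    nabla g (nabla g τ) x ![a, b, c] - nabla g (nabla g τ) x ![b, a, c] =
      ∑ d, riemUp g x a b c d * τ x ![d] := by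
  have hΓ := hg.christoffel_smooth
  have h1 : ∀ a b, pd (fun z => nabla g τ z ![b, c]) x a = pd (fun w => pd (fun z => τ z ![c]) w b) x a
      - ((∑ d, pd (fun z => christoffel g z d b c) x a * τ x ![d]) +
        ∑ d, christoffel g x d b c * pd (fun z => τ z ![d]) x a) := by
    intro a b
    simp only [nabla_one]
    rw [pd_sub ((hτ _).pd _) (SmoothOn.sum fun d => (hΓ _ _ _).mul (hτ _)) hx,
      pd_sum (fun d => (hΓ _ _ _).mul (hτ _)) hx]
    simp only [pd_mul (hΓ _ _ _) (hτ _) hx, Finset.sum_add_distrib]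
  rw [nabla_two, nabla_two, h1, h1, pd_comm (hτ _) hx a b]
  simp only [nabla_one, riemUp, mul_sub, add_mul, sub_mul, Finset.sum_add_distrib,
    Finset.sum_sub_distrib, Finset.mul_sum, Finset.sum_mul,
    fun d => hg.christoffel_symm hx d b a]
  rw [Finset.sum_comm (f := fun d e => christoffel g x e a c * christoffel g x d b e * τ x ![d]),
    Finset.sum_comm (f := fun d e => christoffel g x e b c * christoffel g x d a e * τ x ![d])]
  simp only [mul_assoc]
  ring

end IsMetricOn

end

end ConformalSubmanifold

namespace ConformalSubmanifold

open TopologicalSpace (Opens)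

noncomputable section

/-! ### Conformal changes of metrics -/

/-- The Kronecker symbol. -/
def kron {m : ℕ} (a b : Fin m) : ℝ := if a = b then 1 else 0

theorem sum_kron_mul {m : ℕ} (f : Fin m → ℝ) (a : Fin m) : ∑ e, kron e a * f e = f a := by
  simp [kron]

theorem sum_kron_mul' {m : ℕ} (f : Fin m → ℝ) (a : Fin m) : ∑ e, kron a e * f e = f a := by
  simp [kron]

/-- The differential of a function. -/
def dform {m : ℕ} (f : E m → ℝ) : Tensor m 1 := fun x A => pd f x (A 0)

/-- The metric `g'` is the conformal change `e^{2Υ} g` of `g` on an open set. -/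
structure IsConformalChange {m : ℕ} (g g' : MetricField m) (Υ : E m → ℝ) (V : Opens (E m)) :
    Prop where
  metric : IsMetricOn g V
  smooth : SmoothOn V Υ
  eq_smul : ∀ x ∈ V, g' x = Real.exp (2 * Υ x) • g x

/-- The components of the gradient of a function. -/
def gradUp {m : ℕ} (g : MetricField m) (f : E m → ℝ) (x : E m) (c : Fin m) : ℝ :=
  ∑ d, (g x)⁻¹ c d * pd f x d

/-- The tensor `∇_a ∇_b Υ - Υ_a Υ_b + (1/2) |dΥ|² g_{ab}` by which the Schouten tensor changes. -/
def schoutenChange {m : ℕ} (g : MetricField m) (Υ : E m → ℝ) : Tensor m 2 := fun x A =>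
  nabla g (dform Υ) x A - dform Υ x ![A 0] * dform Υ x ![A 1]
    + (1 / 2) * (ctr g x fun a b => dform Υ x ![a] * dform Υ x ![b]) * g x (A 0) (A 1)

theorem dform_smooth {m : ℕ} {V : Opens (E m)} {f : E m → ℝ} (hf : SmoothOn V f) :
    SmoothTensor V (dform f) := fun _ => hf.pd _

theorem hess_symm {m : ℕ} {g : MetricField m} {V : Opens (E m)} (hg : IsMetricOn g V)
    {f : E m → ℝ} (hf : SmoothOn V f) {x : E m} (hx : x ∈ V) (a b : Fin m) :
    nabla g (dform f) x ![a, b] = nabla g (dform f) x ![b, a] := by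
  rw [nabla_one, nabla_one]
  simp only [dform, Matrix.cons_val]
  rw [pd_comm hf hx]
  simp only [hg.christoffel_symm hx _ a b]

namespace IsConformalChange

variable {m : ℕ} {g g' : MetricField m} {Υ : E m → ℝ} {V : Opens (E m)}
  (hc : IsConformalChange g g' Υ V) {x : E m}

include hc

theorem apply (hx : x ∈ V) (a b : Fin m) : g' x a b = Real.exp (2 * Υ x) * g x a b := by
  rw [hc.eq_smul x hx]; rfl

theorem metric' : IsMetricOn g' V where
  smooth a b := ((hc.smooth.const_mul 2).exp.mul (hc.metric.smooth a b)).congr fun _ hx =>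
    hc.apply hx a b
  posDef x hx := by
    rw [hc.eq_smul x hx]
    exact (hc.metric.posDef x hx).smul (Real.exp_pos _)

theorem inv_apply (hx : x ∈ V) (a b : Fin m) :
    (g' x)⁻¹ a b = (Real.exp (2 * Υ x))⁻¹ * (g x)⁻¹ a b := by
  have h : (g' x)⁻¹ = (Real.exp (2 * Υ x))⁻¹ • (g x)⁻¹ := by
    rw [hc.eq_smul x hx]
    apply Matrix.inv_eq_left_inv
    rw [smul_mul_smul_comm, inv_mul_cancel₀ (Real.exp_pos _).ne',
      Matrix.nonsing_inv_mul _ (hc.metric.det_ne_zero hx).isUnit, one_smul]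
  rw [h]; rfl

theorem ctr_eq (hx : x ∈ V) (f : Fin m → Fin m → ℝ) :
    ctr g' x f = (Real.exp (2 * Υ x))⁻¹ * ctr g x f := by
  simp only [ctr, hc.inv_apply hx, Finset.mul_sum, mul_assoc]

theorem pd_metric' (hx : x ∈ V) (e a b : Fin m) :
    pd (fun z => g' z a b) x e =
      Real.exp (2 * Υ x) * (2 * pd Υ x e * g x a b + pd (fun z => g z a b) x e) := by
  rw [pd_congr (fun z hz => hc.apply hz a b) hx,
    pd_mul (hc.smooth.const_mul 2).exp (hc.metric.smooth a b) hx,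
    pd_exp (hc.smooth.const_mul 2) hx, pd_const_mul 2 hc.smooth hx]
  ring

theorem christoffel_eq (hx : x ∈ V) (c a b : Fin m) :
    christoffel g' x c a b = christoffel g x c a b + kron c a * pd Υ x b
      + kron c b * pd Υ x a - g x a b * gradUp g Υ x c := by
  have hs := (Real.exp_pos (2 * Υ x)).ne'
  have h1 : ∀ b, ∑ d, (g x)⁻¹ c d * g x b d = kron c b := by
    intro b
    rw [kron]
    rw [← hc.metric.sum_inv_mul hx c b]
    exact Finset.sum_congr rfl fun d _ => by rw [hc.metric.symm hx b d]
  have h2 : christoffel g' x c a b = ∑ d, ((1 / 2) * ((g x)⁻¹ c d *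
      (pd (fun z => g z b d) x a + pd (fun z => g z a d) x b - pd (fun z => g z a b) x d))
      + ((g x)⁻¹ c d * g x b d) * pd Υ x a + ((g x)⁻¹ c d * g x a d) * pd Υ x b
      - g x a b * ((g x)⁻¹ c d * pd Υ x d)) := by
    simp only [christoffel, hc.inv_apply hx, hc.pd_metric' hx, Finset.mul_sum]
    refine Finset.sum_congr rfl fun d _ => ?_
    field_simp
    ring
  rw [h2]
  simp only [Finset.sum_add_distrib, Finset.sum_sub_distrib, ← Finset.mul_sum, ← Finset.sum_mul,
    h1]
  simp only [christoffel, gradUp]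
  ring

theorem gradUp_smooth (c : Fin m) : SmoothOn V fun x => gradUp g Υ x c :=
  SmoothOn.sum fun _ => (hc.metric.inv_smooth _ _).mul (hc.smooth.pd _)

theorem sum_metric_gradUp (hx : x ∈ V) (a : Fin m) :
    ∑ d, g x a d * gradUp g Υ x d = pd Υ x a :=
  hc.metric.lower_raise hx _ a

theorem pd_gradUp (hx : x ∈ V) (b d : Fin m) :
    pd (fun z => gradUp g Υ z d) x b = (∑ e, (g x)⁻¹ d e * nabla g (dform Υ) x ![b, e])
      - ∑ e, christoffel g x d b e * gradUp g Υ x e := by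
  simp only [gradUp]
  rw [pd_sum (fun e => (hc.metric.inv_smooth d e).mul (hc.smooth.pd e)) hx]
  simp only [pd_mul (hc.metric.inv_smooth d _) (hc.smooth.pd _) hx, hc.metric.pd_inv hx, nabla_one,
    dform, Matrix.cons_val, mul_sub, sub_mul, neg_mul, Finset.sum_sub_distrib,
    Finset.sum_add_distrib, Finset.sum_neg_distrib, Finset.mul_sum, Finset.sum_mul]
  rw [Finset.sum_comm (f := fun e i => christoffel g x d b i * (g x)⁻¹ i e * pd Υ x e),
    Finset.sum_comm (f := fun e i => christoffel g x e b i * (g x)⁻¹ d i * pd Υ x e)]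
  simp only [mul_assoc, mul_left_comm ((g x)⁻¹ d _)]
  ring

omit hc in
theorem ctr_dform_eq (x : E m) :
    (ctr g x fun a b => dform Υ x ![a] * dform Υ x ![b]) = ∑ e, gradUp g Υ x e * pd Υ x e := by
  simp only [ctr, dform, gradUp, Matrix.cons_val, Finset.sum_mul]
  exact Finset.sum_congr rfl fun a _ => Finset.sum_congr rfl fun b _ => by ring

omit hc in
theorem schoutenChange_apply (x : E m) (a b : Fin m) :
    schoutenChange g Υ x ![a, b] = nabla g (dform Υ) x ![a, b] - pd Υ x a * pd Υ x b
      + (1 / 2) * (∑ e, gradUp g Υ x e * pd Υ x e) * g x a b := by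
  simp only [schoutenChange, ctr_dform_eq]
  rfl

/-- The conformal change of the curvature, as a tensor with a raised index. -/
theorem riemUp_eq (hx : x ∈ V) (a b c d : Fin m) :
    riemUp g' x a b c d = riemUp g x a b c d
      - (schoutenChange g Υ x ![a, c] * kron d b
        + (∑ e, (g x)⁻¹ d e * schoutenChange g Υ x ![b, e]) * g x a c
        - (∑ e, (g x)⁻¹ d e * schoutenChange g Υ x ![a, e]) * g x b c
        - schoutenChange g Υ x ![b, c] * kron d a) := by
  have hΓ := hc.metric.christoffel_smooth
  have hU := hc.gradUp_smooth
  have hΥ := hc.smooth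
  have hif : ∀ t (e : Fin m), SmoothOn V fun z => t * pd Υ z e := fun t e => (hΥ.pd _).const_mul _
  let X : Fin m → Fin m → ℝ := fun a c => ∑ e, christoffel g x e a c * pd Υ x e
  let Y : Fin m → Fin m → Fin m → ℝ := fun a c b => ∑ e, christoffel g x e a c * g x b e
  let Z : Fin m → Fin m → ℝ := fun d b => ∑ e, christoffel g x d b e * gradUp g Υ x e
  let N : ℝ := ∑ e, gradUp g Υ x e * pd Υ x e
  let K : Fin m → Fin m → ℝ := fun b c => nabla g (dform Υ) x ![b, c]
  let KU : Fin m → Fin m → ℝ := fun d b => ∑ e, (g x)⁻¹ d e * nabla g (dform Υ) x ![b, e]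
  have hderiv : ∀ a b c, pd (fun z => christoffel g' z d a c) x b =
      pd (fun z => christoffel g z d a c) x b + kron d a * (K b c + X b c)
        + kron d c * (K b a + X b a)
        - ((Y b a c + Y b c a) * gradUp g Υ x d + g x a c * (KU d b - Z d b)) := by
    intro a b c
    have hK : ∀ c, pd (fun z => pd Υ z c) x b = K b c + X b c := by
      intro c; simp only [K, X, nabla_one, dform, Matrix.cons_val]; ring
    rw [pd_congr (fun z hz => hc.christoffel_eq hz d a c) hx,
      pd_sub (((hΓ _ _ _).add (hif _ _)).add (hif _ _)) ((hc.metric.smooth _ _).mul (hU _)) hx,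
      pd_add ((hΓ _ _ _).add (hif _ _)) (hif _ _) hx, pd_add (hΓ _ _ _) (hif _ _) hx,
      pd_mul (hc.metric.smooth _ _) (hU _) hx, pd_const_mul _ (hΥ.pd _) hx,
      pd_const_mul _ (hΥ.pd _) hx, hc.pd_gradUp hx, hc.metric.pd_metric hx, hK, hK]
    have e1 : ∑ e, christoffel g x e b a * g x e c = Y b a c :=
      Finset.sum_congr rfl fun e _ => by rw [hc.metric.symm hx e c]
    rw [e1]
  have hprod : ∀ a b c, ∑ e, christoffel g' x e a c * christoffel g' x d b e =
      (∑ e, christoffel g x e a c * christoffel g x d b e)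
      + (kron d b * X a c + christoffel g x d a c * pd Υ x b - Y a c b * gradUp g Υ x d)
      + pd Υ x c * (christoffel g x d b a + kron d b * pd Υ x a
          + kron d a * pd Υ x b - g x b a * gradUp g Υ x d)
      + pd Υ x a * (christoffel g x d b c + kron d b * pd Υ x c
          + kron d c * pd Υ x b - g x b c * gradUp g Υ x d)
      - g x a c * (Z d b + kron d b * N) := by
    intro a b c
    have h1 : ∀ e, christoffel g' x e a c * christoffel g' x d b e =
        christoffel g x e a c * christoffel g x d b e
        + (kron d b * (christoffel g x e a c * pd Υ x e)
          + kron d e * (christoffel g x e a c * pd Υ x b)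
          - christoffel g x e a c * g x b e * gradUp g Υ x d)
        + kron e a * (pd Υ x c * christoffel g' x d b e)
        + kron e c * (pd Υ x a * christoffel g' x d b e)
        - g x a c * (christoffel g x d b e * gradUp g Υ x e
          + kron d b * (gradUp g Υ x e * pd Υ x e)
          + kron d e * (gradUp g Υ x e * pd Υ x b)
          - (g x b e * gradUp g Υ x e) * gradUp g Υ x d) := by
      intro e
      rw [hc.christoffel_eq hx e a c, hc.christoffel_eq hx d b e]
      ring
    simp only [h1, Finset.sum_add_distrib, Finset.sum_sub_distrib, ← Finset.mul_sum,
      ← Finset.sum_mul, hc.sum_metric_gradUp hx]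
    simp only [fun f : Fin m → ℝ => sum_kron_mul f a, fun f : Fin m → ℝ => sum_kron_mul f c,
      fun f : Fin m → ℝ => sum_kron_mul' f d]
    rw [hc.christoffel_eq hx d b a, hc.christoffel_eq hx d b c]
    simp only [X, Y, Z, N]
    ring
  have hA : ∀ a c, schoutenChange g Υ x ![a, c] = K a c - pd Υ x a * pd Υ x c
      + (1 / 2) * N * g x a c := by
    intro a c
    exact schoutenChange_apply x a c
  have hAU : ∀ b, ∑ e, (g x)⁻¹ d e * schoutenChange g Υ x ![b, e] = KU d b
      - pd Υ x b * gradUp g Υ x d + (1 / 2) * N * kron d b := by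
    intro b
    have h0 : kron d b = _ := (hc.metric.sum_inv_mul hx d b).symm
    rw [h0]
    simp only [hA, KU, K, gradUp, Finset.mul_sum, ← Finset.sum_sub_distrib,
      ← Finset.sum_add_distrib]
    refine Finset.sum_congr rfl fun e _ => ?_
    rw [hc.metric.symm hx b e]; ring
  have hXs : ∀ a b, X a b = X b a := fun a b => by
    simp only [X, hc.metric.christoffel_symm hx _ a b]
  have hYs : ∀ a b c, Y a b c = Y b a c := fun a b c => by
    simp only [Y, hc.metric.christoffel_symm hx _ a b]
  have hKs : ∀ a b, K a b = K b a := fun a b => hess_symm hc.metric hc.smooth hx a b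
  rw [hAU, hAU, hA, hA]
  simp only [riemUp, Finset.sum_sub_distrib]
  rw [hderiv, hderiv, hprod, hprod, hc.metric.christoffel_symm hx d b a, hXs b a, hYs b a c,
    hKs b a, hc.metric.symm hx b a]
  ring

theorem sum_gradUp_weyl_eq (hx : x ∈ V) (a b c : Fin m) :
    ∑ d, gradUp g Υ x d * weyl g x ![a, b, c, d] = (∑ d, riemUp g x a b c d * pd Υ x d)
      - schouten g x ![a, c] * pd Υ x b
      - (∑ d, gradUp g Υ x d * schouten g x ![b, d]) * g x a c
      + (∑ d, gradUp g Υ x d * schouten g x ![a, d]) * g x b c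
      + schouten g x ![b, c] * pd Υ x a := by
  have h1 : ∑ d, gradUp g Υ x d * riem g x ![a, b, c, d] = ∑ d, riemUp g x a b c d * pd Υ x d := by
    simp only [riem, Matrix.cons_val, Finset.mul_sum]
    rw [Finset.sum_comm]
    refine Finset.sum_congr rfl fun e _ => ?_
    rw [← hc.sum_metric_gradUp hx, Finset.mul_sum]
    exact Finset.sum_congr rfl fun d _ => by rw [hc.metric.symm hx d e]; ring
  rw [← h1, ← hc.sum_metric_gradUp hx a, ← hc.sum_metric_gradUp hx b]
  simp only [weyl, Matrix.cons_val, Finset.mul_sum, Finset.sum_mul, ← Finset.sum_sub_distrib,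
    ← Finset.sum_add_distrib]
  exact Finset.sum_congr rfl fun d _ => by ring

theorem riem_eq (hx : x ∈ V) (a b c d : Fin m) :
    riem g' x ![a, b, c, d] = Real.exp (2 * Υ x) * (riem g x ![a, b, c, d]
      - (schoutenChange g Υ x ![a, c] * g x b d + schoutenChange g Υ x ![b, d] * g x a c
        - schoutenChange g Υ x ![a, d] * g x b c - schoutenChange g Υ x ![b, c] * g x a d)) := by
  have h1 : ∀ b, schoutenChange g Υ x ![b, d] =
      ∑ e, g x d e * ∑ f, (g x)⁻¹ e f * schoutenChange g Υ x ![b, f] := fun b =>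
    (hc.metric.lower_raise hx (fun f => schoutenChange g Υ x ![b, f]) d).symm
  have h2 : ∀ b, g x b d = ∑ e, kron e b * g x d e := fun b => by
    rw [sum_kron_mul, hc.metric.symm hx]
  rw [h1 b, h1 a, h2 b, h2 a]
  simp only [riem, Matrix.cons_val, hc.apply hx, hc.riemUp_eq hx, Finset.mul_sum, Finset.sum_mul,
    ← Finset.sum_sub_distrib, ← Finset.sum_add_distrib]
  exact Finset.sum_congr rfl fun e _ => by
    simp only [← Finset.mul_sum, ← Finset.sum_mul]; ring

theorem ricci_eq (hx : x ∈ V) (a b : Fin m) :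
    ricci g' x ![a, b] = ricci g x ![a, b] - (((m : ℝ) - 2) * schoutenChange g Υ x ![a, b]
      + (ctr g x fun c d => schoutenChange g Υ x ![c, d]) * g x a b) := by
  have hs := (Real.exp_pos (2 * Υ x)).ne'
  have e1 : ctr g x (fun c d => schoutenChange g Υ x ![a, b] * g x c d) =
      schoutenChange g Υ x ![a, b] * m := by
    rw [← ctr_self hc.metric hx]; exact ctr_mul_left _ _
  have e2 : ctr g x (fun c d => schoutenChange g Υ x ![a, d] * g x c b) =
      schoutenChange g Υ x ![a, b] := by
    rw [← ctr_metric hc.metric hx (fun d => schoutenChange g Υ x ![a, d]) b]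
    exact ctr_congr fun c d => by rw [hc.metric.symm hx c b]; ring
  have e3 : ctr g x (fun c d => schoutenChange g Υ x ![c, b] * g x a d) =
      schoutenChange g Υ x ![a, b] := by
    rw [← ctr_metric' hc.metric hx (fun d => schoutenChange g Υ x ![d, b]) a]
    exact ctr_congr fun c d => by ring
  change ctr g' x (fun c d => riem g' x ![a, c, b, d]) = ctr g x (fun c d => riem g x ![a, c, b, d]) - _
  rw [hc.ctr_eq hx]
  simp only [hc.riem_eq hx, ctr_mul_left]
  rw [inv_mul_cancel_left₀ hs]
  simp only [ctr_sub, ctr_add, ctr_mul_right, e1, e2, e3]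
  ring

theorem trSchouten_eq (hm : 2 < m) (hx : x ∈ V) :
    trSchouten g' x = (Real.exp (2 * Υ x))⁻¹ * (trSchouten g x
      - ctr g x fun c d => schoutenChange g Υ x ![c, d]) := by
  have hm1 : (m : ℝ) - 1 ≠ 0 := by
    have : (2 : ℝ) < m := by exact_mod_cast hm
    linarith
  have e1 : ctr g x (fun a b => (ctr g x fun c d => schoutenChange g Υ x ![c, d]) * g x a b) =
      (ctr g x fun c d => schoutenChange g Υ x ![c, d]) * m := by
    rw [← ctr_self hc.metric hx]; exact ctr_mul_left _ _
  have h : scalarCurv g' x = (Real.exp (2 * Υ x))⁻¹ * (scalarCurv g x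
      - (2 * (m : ℝ) - 2) * ctr g x fun c d => schoutenChange g Υ x ![c, d]) := by
    change ctr g' x (fun a b => ricci g' x ![a, b]) =
      _ * (ctr g x (fun a b => ricci g x ![a, b]) - _)
    rw [hc.ctr_eq hx]
    simp only [hc.ricci_eq hx, ctr_sub, ctr_add, ctr_mul_left, e1]
    ring
  simp only [trSchouten, h]
  field_simp

theorem schouten_eq (hm : 2 < m) (hx : x ∈ V) (a b : Fin m) :
    schouten g' x ![a, b] = schouten g x ![a, b] - schoutenChange g Υ x ![a, b] := by
  have hs := (Real.exp_pos (2 * Υ x)).ne'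
  have hm' : (m : ℝ) - 2 ≠ 0 := by
    have : (2 : ℝ) < m := by exact_mod_cast hm
    linarith
  simp only [schouten, Matrix.cons_val]
  rw [hc.ricci_eq hx, hc.trSchouten_eq hm hx, hc.apply hx]
  field_simp
  ring

theorem weyl_eq (hm : 2 < m) (hx : x ∈ V) (a b c d : Fin m) :
    weyl g' x ![a, b, c, d] = Real.exp (2 * Υ x) * weyl g x ![a, b, c, d] := by
  simp only [weyl, Matrix.cons_val]
  rw [hc.riem_eq hx, hc.schouten_eq hm hx, hc.schouten_eq hm hx, hc.schouten_eq hm hx,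
    hc.schouten_eq hm hx, hc.apply hx, hc.apply hx, hc.apply hx, hc.apply hx]
  ring

theorem schoutenChange_smooth : SmoothTensor V (schoutenChange g Υ) := fun _ =>
  have hu := dform_smooth hc.smooth
  (((hu.nabla hc.metric _).sub ((hu _).mul (hu _))).add
    (((ctr_smooth' hc.metric fun _ _ => (hu _).mul (hu _)).const_mul _).mul
      (hc.metric.smooth _ _)))

theorem nabla_schoutenChange (hx : x ∈ V) (a b c : Fin m) :
    nabla g (schoutenChange g Υ) x ![a, b, c] = nabla g (nabla g (dform Υ)) x ![a, b, c]
      - (nabla g (dform Υ) x ![a, b] * pd Υ x c + pd Υ x b * nabla g (dform Υ) x ![a, c])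
      + (∑ d, gradUp g Υ x d * nabla g (dform Υ) x ![a, d]) * g x b c := by
  have hg := hc.metric
  have hu := dform_smooth hc.smooth
  let T : Tensor m 2 := fun z A => g z (A 0) (A 1)
  have hT : SmoothTensor V T := fun A => hg.smooth _ _
  let S : Tensor m 0 := fun z _ => ctr g z fun a b => dform Υ z ![a] * dform Υ z ![b]
  have hS : SmoothTensor V S := fun A => ctr_smooth' hg fun _ _ => (hu _).mul (hu _)
  have h2 : nabla g (schoutenChange g Υ) x ![a, b, c] = nabla g (fun z A => nabla g (dform Υ) z A
      - dform Υ z (A ∘ ![0]) * dform Υ z (A ∘ ![1])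
      + (1 / 2) * (S z (A ∘ ![]) * T z (A ∘ ![0, 1]))) x ![a, b, c] :=
    nabla_congr (fun z hz A => by
      simp only [comp_vec_one, comp_vec_two, schoutenChange, S, T, Matrix.cons_val]; ring) hx _
  have huu : SmoothTensor V fun z (A : Fin 2 → Fin m) =>
    dform Υ z (A ∘ ![0]) * dform Υ z (A ∘ ![1]) := fun A => (hu _).mul (hu _)
  have hST : SmoothTensor V fun z (A : Fin 2 → Fin m) => S z (A ∘ ![]) * T z (A ∘ ![0, 1]) :=
    fun A => (hS (A ∘ ![])).mul (hT _)
  rw [h2, nabla_add (fun A => (hu.nabla hg A).sub (huu A)) (fun A => (hST A).const_mul _) hx,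
    nabla_sub (hu.nabla hg) huu hx, nabla_const_mul _ hST hx]
  have e1 := nabla_mul (g := g) hu hu (i := ![0]) (j := ![1]) (by decide) hx a ![b, c]
  have e2 := nabla_mul (g := g) hS hT (i := ![]) (j := ![0, 1]) (by decide) hx a ![b, c]
  have h3 : nabla g T x (Fin.cons a (![b, c] ∘ ![0, 1])) = 0 := by
    rw [comp_vec_two]; exact nabla_metric hg hx a b c
  have e3 := nabla_trace (r := 0) hg (T := fun z A => dform Υ z (A ∘ ![0]) * dform Υ z (A ∘ ![1]))
    huu hx a ![]
  rw [nabla_zero] at e2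
  rw [nabla_zero] at e3
  have e4 : ∀ d e, nabla g (fun z A => dform Υ z (A ∘ ![0]) * dform Υ z (A ∘ ![1])) x
      (Fin.cons a (Fin.cons d (Fin.cons e ![]))) = nabla g (dform Υ) x ![a, d] * pd Υ x e
        + pd Υ x d * nabla g (dform Υ) x ![a, e] := by
    intro d e
    refine (nabla_mul hu hu (by decide) hx a ![d, e]).trans ?_
    simp only [comp_vec_one]
    rfl
  have e5 : pd (fun z => S z (![b, c] ∘ ![])) x a =
      2 * ∑ d, gradUp g Υ x d * nabla g (dform Υ) x ![a, d] := by
    refine e3.trans ?_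
    simp only [e4, ctr_add]
    rw [ctr_swap hg hx fun d e => pd Υ x d * nabla g (dform Υ) x ![a, e]]
    simp only [ctr, gradUp, Finset.sum_mul, ← two_mul, mul_comm (pd Υ x _)]
    congr 1
    exact Finset.sum_congr rfl fun a _ => Finset.sum_congr rfl fun b _ => by ring
  rw [h3, e5, mul_zero, add_zero] at e2
  refine (congrArg₂ _ (congrArg _ e1) (congrArg _ e2)).trans ?_
  simp only [comp_vec_one, comp_vec_two, T, dform, Matrix.cons_val]
  change nabla g (nabla g (dform Υ)) x ![a, b, c] - (nabla g (dform Υ) x ![a, b] * _ +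
    _ * nabla g (dform Υ) x ![a, c]) + _ = _
  ring

/-- The conformal change of the Cotton tensor. -/
theorem cotton_eq (hm : 2 < m) (hx : x ∈ V) (a b c : Fin m) :
    cotton g' x ![a, b, c] = cotton g x ![a, b, c] - ∑ d, gradUp g Υ x d * weyl g x ![a, b, c, d] := by
  have hg := hc.metric
  have hP := hg.schouten_smooth
  have hA := hc.schoutenChange_smooth
  let Q : Tensor m 2 := fun z A => schouten g z A - schoutenChange g Υ z A
  have hS : ∀ a b c, ∑ d, christoffel g' x d a c * Q x ![b, d] =
      (∑ d, christoffel g x d a c * Q x ![b, d]) + Q x ![b, a] * pd Υ x c + Q x ![b, c] * pd Υ x a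
        - g x a c * ∑ d, gradUp g Υ x d * Q x ![b, d] := by
    intro a b c
    rw [← sum_kron_mul (fun d => Q x ![b, d]) a, ← sum_kron_mul (fun d => Q x ![b, d]) c]
    simp only [hc.christoffel_eq hx, Finset.mul_sum, Finset.sum_mul, ← Finset.sum_sub_distrib,
      ← Finset.sum_add_distrib]
    exact Finset.sum_congr rfl fun d _ => by ring
  have h1 : ∀ a b c, nabla g' (schouten g') x ![a, b, c] = nabla g Q x ![a, b, c]
      - (∑ d, (christoffel g' x d a b - christoffel g x d a b) * Q x ![d, c])
      - (Q x ![b, a] * pd Υ x c + Q x ![b, c] * pd Υ x a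
        - g x a c * ∑ d, gradUp g Υ x d * Q x ![b, d]) := by
    intro a b c
    rw [nabla_congr (T' := Q) (fun z hz A => by
      rw [← vec_two_eta A]; exact hc.schouten_eq hm hz _ _) hx, nabla_two, nabla_two, hS]
    simp only [sub_mul, Finset.sum_sub_distrib]
    ring
  have h2 : ∀ a b c, nabla g Q x ![a, b, c] = nabla g (schouten g) x ![a, b, c]
      - nabla g (schoutenChange g Υ) x ![a, b, c] := fun a b c => nabla_sub hP hA hx _
  have hsym : ∑ d, (christoffel g' x d b a - christoffel g x d b a) * Q x ![d, c] =
      ∑ d, (christoffel g' x d a b - christoffel g x d a b) * Q x ![d, c] :=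
    Finset.sum_congr rfl fun d _ => by
      rw [hg.christoffel_symm hx d b a, hc.metric'.christoffel_symm hx d b a]
  have hcomm := hg.nabla_nabla_comm (dform_smooth hc.smooth) hx a b c
  simp only [cotton, Matrix.cons_val]
  rw [h1, h1, hsym, h2, h2, hc.nabla_schoutenChange hx, hc.nabla_schoutenChange hx,
    hc.sum_gradUp_weyl_eq hx, show ∑ d, riemUp g x a b c d * pd Υ x d =
      ∑ d, riemUp g x a b c d * dform Υ x ![d] from rfl, ← hcomm]
  have hQ : ∀ b, ∑ d, gradUp g Υ x d * Q x ![b, d] = (∑ d, gradUp g Υ x d * schouten g x ![b, d])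
      - ((∑ d, gradUp g Υ x d * nabla g (dform Υ) x ![b, d])
        - pd Υ x b * (∑ d, gradUp g Υ x d * pd Υ x d)
        + (1 / 2) * (∑ d, gradUp g Υ x d * pd Υ x d) * pd Υ x b) := by
    intro b
    have e1 : ∑ d, gradUp g Υ x d * (pd Υ x b * pd Υ x d) =
        pd Υ x b * ∑ d, gradUp g Υ x d * pd Υ x d := by
      rw [Finset.mul_sum]
      exact Finset.sum_congr rfl fun d _ => by ring
    have e2 : ∀ t, ∑ d, gradUp g Υ x d * (t * g x b d) = t * pd Υ x b := by
      intro t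
      rw [← hc.sum_metric_gradUp hx b, Finset.mul_sum]
      exact Finset.sum_congr rfl fun d _ => by ring
    simp only [Q, schoutenChange_apply, mul_sub, mul_add, Finset.sum_sub_distrib,
      Finset.sum_add_distrib, e1, e2]
  rw [hQ, hQ]
  simp only [Q, schoutenChange_apply]
  rw [hg.schouten_symm hx b a, hg.symm hx b a, hess_symm hg hc.smooth hx b a]
  ring

end IsConformalChange

end

end ConformalSubmanifold

namespace ConformalSubmanifold

open TopologicalSpace (Opens)

noncomputable section

/-! ### Regular patches -/

namespace Patch

/-- A patch that is a smooth immersion of `U` into `V` with its smooth Riemannian metric. -/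
structure IsRegularOn {k n : ℕ} (p : Patch k n) (U : Opens (E k)) (V : Opens (E n)) : Prop where
  metric : IsMetricOn p.g V
  smooth : ∀ a, SmoothOn U fun y => p.φ y a
  maps : ∀ y ∈ U, p.φ y ∈ V
  indep : ∀ y ∈ U, LinearIndependent ℝ (p.tan y)

variable {k n r s : ℕ} {p : Patch k n} {U : Opens (E k)} {V : Opens (E n)}

theorem trT_eq (y : E k) (f : Fin k → Fin k → ℝ) : p.trT y f = ctr p.h y f := rfl

theorem trN_eq (y : E k) (f : Fin n → Fin n → ℝ) : p.trN y f = ctr p.g (p.φ y) f := rfl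

/-- The matrix of tangent vectors. -/
def tanM (p : Patch k n) (y : E k) : Matrix (Fin k) (Fin n) ℝ := Matrix.of (p.tan y)

/-- The matrix of the projection to the normal space. -/
def norM (p : Patch k n) (y : E k) : Matrix (Fin n) (Fin n) ℝ := Matrix.of (p.nor y)

theorem h_eq (p : Patch k n) (y : E k) :
    p.h y = p.tanM y * p.g (p.φ y) * (p.tanM y).transpose := by
  ext α β
  simp only [h, tanM, Matrix.mul_apply, Matrix.of_apply, Matrix.transpose_apply, Finset.sum_mul]
  rw [Finset.sum_comm]
  exact Finset.sum_congr rfl fun a _ => Finset.sum_congr rfl fun b _ => by ring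

namespace IsRegularOn

variable (hp : p.IsRegularOn U V) {y : E k}

include hp

theorem tan_smooth (α : Fin k) (a : Fin n) : SmoothOn U fun y => p.tan y α a := (hp.smooth a).pd α

theorem comp_smooth {F : E n → ℝ} (hF : SmoothOn V F) : SmoothOn U fun y => F (p.φ y) :=
  hF.comp hp.smooth hp.maps

theorem pd_comp {F : E n → ℝ} (hF : SmoothOn V F) (hy : y ∈ U) (α : Fin k) :
    pd (fun z => F (p.φ z)) y α = ∑ a, p.tan y α a * pd F (p.φ y) a :=
  ConformalSubmanifold.pd_comp hF hp.smooth hp.maps hy α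

theorem induced : IsMetricOn p.h U where
  smooth α β := by
    have : SmoothOn U fun y => ∑ a, ∑ b, p.g (p.φ y) a b * p.tan y α a * p.tan y β b :=
      SmoothOn.sum fun a => SmoothOn.sum fun b =>
        ((hp.comp_smooth (hp.metric.smooth a b)).mul (hp.tan_smooth α a)).mul (hp.tan_smooth β b)
    exact this
  posDef y hy := by
    rw [h_eq]
    have h1 := hp.metric.posDef _ (hp.maps y hy)
    have h2 := h1.mul_mul_conjTranspose_same (B := p.tanM y) (by
      have := hp.indep y hy
      rw [Fintype.linearIndependent_iff] at this
      intro v w hvw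
      ext α
      refine sub_eq_zero.1 (this (fun α => v α - w α) ?_ α)
      ext a
      have := congrFun hvw a
      simp only [Matrix.vecMul, dotProduct, tanM, Matrix.of_apply] at this
      simp [sub_mul, this])
    simpa using h2

theorem norM_eq (hy : y ∈ U) :
    p.norM y = 1 - p.g (p.φ y) * (p.tanM y).transpose * (p.h y)⁻¹ * p.tanM y := by
  ext a b
  simp only [norM, Matrix.of_apply, nor, Matrix.sub_apply, Matrix.one_apply, eq_comm (a := b)]
  congr 1
  simp only [Matrix.mul_apply, Matrix.transpose_apply, tanM, Matrix.of_apply, Finset.sum_mul]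
  refine Finset.sum_congr rfl fun α _ => ?_
  refine Finset.sum_congr rfl fun β _ => Finset.sum_congr rfl fun c _ => ?_
  rw [hp.metric.symm (hp.maps y hy) c a, hp.induced.inv_symm hy]
  ring

theorem h_mul_inv (hy : y ∈ U) : p.h y * (p.h y)⁻¹ = 1 :=
  Matrix.mul_nonsing_inv _ (hp.induced.det_ne_zero hy).isUnit

theorem h_inv_mul (hy : y ∈ U) : (p.h y)⁻¹ * p.h y = 1 :=
  Matrix.nonsing_inv_mul _ (hp.induced.det_ne_zero hy).isUnit

theorem g_inv_mul (hy : y ∈ U) : (p.g (p.φ y))⁻¹ * p.g (p.φ y) = 1 :=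
  Matrix.nonsing_inv_mul _ (hp.metric.det_ne_zero (hp.maps y hy)).isUnit

theorem h_inv_transpose (hy : y ∈ U) : ((p.h y)⁻¹).transpose = (p.h y)⁻¹ := by
  ext a b; exact hp.induced.inv_symm hy b a

theorem tanM_mul_norM (hy : y ∈ U) : p.tanM y * p.norM y = 0 := by
  rw [hp.norM_eq hy, Matrix.mul_sub, ← Matrix.mul_assoc, ← Matrix.mul_assoc, ← Matrix.mul_assoc,
    ← h_eq, hp.h_mul_inv hy, Matrix.mul_one, Matrix.one_mul, sub_self]

theorem norM_mul_g_mul_tanM (hy : y ∈ U) :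
    p.norM y * p.g (p.φ y) * (p.tanM y).transpose = 0 := by
  rw [hp.norM_eq hy, Matrix.sub_mul, Matrix.sub_mul, Matrix.one_mul, Matrix.mul_assoc,
    Matrix.mul_assoc, ← Matrix.mul_assoc (p.tanM y), ← h_eq, Matrix.mul_assoc, hp.h_inv_mul hy,
    Matrix.mul_one, sub_self]

theorem norM_mul_norM (hy : y ∈ U) : p.norM y * p.norM y = p.norM y := by
  conv_lhs => enter [1]; rw [hp.norM_eq hy]
  rw [Matrix.sub_mul, Matrix.mul_assoc _ (p.tanM y), hp.tanM_mul_norM hy]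
  simp

theorem inv_mul_norM (hy : y ∈ U) :
    (p.g (p.φ y))⁻¹ * p.norM y =
      (p.g (p.φ y))⁻¹ - (p.tanM y).transpose * (p.h y)⁻¹ * p.tanM y := by
  rw [hp.norM_eq hy, Matrix.mul_sub, Matrix.mul_one, ← Matrix.mul_assoc, ← Matrix.mul_assoc,
    ← Matrix.mul_assoc, hp.g_inv_mul hy, Matrix.one_mul]

theorem norM_transpose_mul (hy : y ∈ U) :
    (p.norM y).transpose * (p.g (p.φ y))⁻¹ =
      (p.g (p.φ y))⁻¹ - (p.tanM y).transpose * (p.h y)⁻¹ * p.tanM y := by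
  have : ((p.g (p.φ y))⁻¹).transpose = (p.g (p.φ y))⁻¹ := by
    ext a b; exact hp.metric.inv_symm (hp.maps y hy) b a
  have h2 := congrArg Matrix.transpose (hp.inv_mul_norM hy)
  simpa [Matrix.transpose_mul, this, hp.h_inv_transpose hy, Matrix.mul_assoc] using h2

theorem norM_inv_norM (hy : y ∈ U) :
    (p.norM y).transpose * (p.g (p.φ y))⁻¹ * p.norM y =
      (p.g (p.φ y))⁻¹ - (p.tanM y).transpose * (p.h y)⁻¹ * p.tanM y := by
  rw [hp.norM_transpose_mul hy, Matrix.sub_mul, hp.inv_mul_norM hy, Matrix.mul_assoc _ (p.tanM y),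
    hp.tanM_mul_norM hy]
  simp

theorem sum_tan_nor (hy : y ∈ U) (α : Fin k) (b : Fin n) :
    ∑ a, p.tan y α a * p.nor y a b = 0 := by
  have := congrFun (congrFun (hp.tanM_mul_norM hy) α) b
  simpa [Matrix.mul_apply, tanM, norM] using this

theorem sum_nor_tan (hy : y ∈ U) (b : Fin n) (α : Fin k) :
    ∑ c, ∑ d, p.g (p.φ y) c d * p.nor y b c * p.tan y α d = 0 := by
  have := congrFun (congrFun (hp.norM_mul_g_mul_tanM hy) b) α
  simp only [Matrix.mul_apply, tanM, norM, Matrix.of_apply, Matrix.transpose_apply,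
    Matrix.zero_apply, Finset.sum_mul] at this
  rw [Finset.sum_comm, ← this]
  exact Finset.sum_congr rfl fun a _ => Finset.sum_congr rfl fun b _ => by ring

theorem sum_nor_nor (hy : y ∈ U) (b a : Fin n) :
    ∑ c, p.nor y b c * p.nor y c a = p.nor y b a := by
  have := congrFun (congrFun (hp.norM_mul_norM hy) b) a
  simpa [Matrix.mul_apply, norM] using this

/-- A covector that annihilates the tangent space is its own normal projection. -/
theorem sum_nor_of_normal (τ : Fin n → ℝ) (h : ∀ α, ∑ a, p.tan y α a * τ a = 0)
    (hy : y ∈ U) (b : Fin n) : ∑ c, p.nor y b c * τ c = τ b := by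
  have h1 := congrFun (congrArg (fun M => Matrix.mulVec M τ) (hp.norM_eq hy)) b
  have h2 : (p.tanM y).mulVec τ = 0 := by
    ext α; simpa [Matrix.mulVec, dotProduct, tanM] using h α
  simp only [Matrix.sub_mulVec, ← Matrix.mulVec_mulVec, h2, Matrix.mulVec_zero, sub_zero,
    Matrix.one_mulVec] at h1
  simpa [Matrix.mulVec, dotProduct, norM] using h1

theorem nor_smooth (b c : Fin n) : SmoothOn U fun y => p.nor y b c := by
  refine SmoothOn.sub (SmoothOn.const _) (SmoothOn.sum fun α => SmoothOn.sum fun β =>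
    SmoothOn.sum fun c => ?_)
  exact (((hp.induced.inv_smooth _ _).mul (hp.tan_smooth _ _)).mul (hp.tan_smooth _ _)).mul
    (hp.comp_smooth (hp.metric.smooth _ _))

theorem frame_smooth (i : Index k n) (a : Fin n) : SmoothOn U fun y => p.frame y i a := by
  cases i with
  | inl α => exact hp.tan_smooth α a
  | inr b => exact hp.nor_smooth b a

theorem proj_smooth {T : Tensor n r} (hT : SmoothTensor V T) (i : Fin r → Index k n) :
    SmoothOn U fun y => p.proj T y i :=
  SmoothOn.sum fun _ => (SmoothOn.prod fun _ => hp.frame_smooth _ _).mul (hp.comp_smooth (hT _))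

/-- Splitting of an ambient contraction into its tangential and its normal part. -/
theorem ctr_split (hy : y ∈ U) (f : Fin n → Fin n → ℝ) :
    ctr p.g (p.φ y) f =
      ctr p.h y (fun α β => ∑ a, ∑ b, p.tan y α a * p.tan y β b * f a b) +
      ctr p.g (p.φ y) (fun a b => ∑ c, ∑ d, p.nor y a c * p.nor y b d * f c d) := by
  have h1 : ∀ c d, ∑ a, ∑ b, (p.g (p.φ y))⁻¹ a b * (p.nor y a c * p.nor y b d) =
      (p.g (p.φ y))⁻¹ c d - ∑ α, ∑ β, (p.h y)⁻¹ α β * (p.tan y α c * p.tan y β d) := by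
    intro c d
    have h := congrFun (congrFun (hp.norM_inv_norM hy) c) d
    simp only [Matrix.mul_apply, Matrix.sub_apply, norM, tanM, Matrix.of_apply,
      Matrix.transpose_apply, Finset.sum_mul] at h
    rw [Finset.sum_comm, Finset.sum_comm (f := fun α β => (p.h y)⁻¹ α β * _)]
    refine Eq.trans (Finset.sum_congr rfl fun a _ => Finset.sum_congr rfl fun b _ => ?_) (h.trans ?_)
    · ring
    · congr 1
      exact Finset.sum_congr rfl fun a _ => Finset.sum_congr rfl fun b _ => by ring
  have h2 : ∀ {ι : Type} [Fintype ι] (w : ι → ι → ℝ) (v : ι → Fin n → ℝ),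
      ∑ a, ∑ b, w a b * ∑ c, ∑ d, v a c * v b d * f c d =
        ∑ c, ∑ d, (∑ a, ∑ b, w a b * (v a c * v b d)) * f c d := by
    intro ι _ w v
    simp only [Finset.mul_sum, Finset.sum_mul]
    rw [sum_comm_two_two]
    exact Finset.sum_congr rfl fun a _ => Finset.sum_congr rfl fun b _ =>
      Finset.sum_congr rfl fun j _ => Finset.sum_congr rfl fun d _ => by ring
  simp only [ctr]
  rw [h2 (fun α β => (p.h y)⁻¹ α β) (p.tan y), h2 (fun a b => (p.g (p.φ y))⁻¹ a b) (p.nor y)]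
  simp only [h1, ← Finset.sum_add_distrib]
  exact Finset.sum_congr rfl fun c _ => Finset.sum_congr rfl fun d _ => by ring

/-- In a contraction with a normal covector, the other factor may be projected. -/
theorem ctr_nor (hy : y ∈ U) (σ τ : Fin n → ℝ) (h : ∀ α, ∑ a, p.tan y α a * τ a = 0) :
    ctr p.g (p.φ y) (fun a b => (∑ c, p.nor y a c * σ c) * τ b) =
      ctr p.g (p.φ y) (fun a b => σ a * τ b) := by
  rw [hp.ctr_split hy fun a b => σ a * τ b]
  have h1 : ∀ α β, ∑ a, ∑ b, p.tan y α a * p.tan y β b * (σ a * τ b) = 0 := by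
    intro α β
    refine Finset.sum_eq_zero fun a _ => ?_
    rw [← mul_zero (p.tan y α a * σ a), ← h β, Finset.mul_sum]
    exact Finset.sum_congr rfl fun b _ => by ring
  have h2 : ∀ a b, ∑ c, ∑ d, p.nor y a c * p.nor y b d * (σ c * τ d) =
      (∑ c, p.nor y a c * σ c) * τ b := by
    intro a b
    conv_rhs => rw [← hp.sum_nor_of_normal τ h hy b]
    rw [Finset.sum_mul_sum]
    exact Finset.sum_congr rfl fun c _ => Finset.sum_congr rfl fun d _ => by ring
  simp only [h1, h2, ctr_zero, zero_add]

end IsRegularOn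

/-! ### Vector fields along a patch -/

/-- The covariant derivative of a vector field along a patch. -/
def covD (p : Patch k n) (v : E k → Fin n → ℝ) (y : E k) (α : Fin k) (d : Fin n) : ℝ :=
  pd (fun z => v z d) y α +
    ∑ e, ∑ f, christoffel p.g (p.φ y) d e f * p.tan y α e * v y f

/-- The inner product of ambient vectors at a point of a patch. -/
def ip (p : Patch k n) (y : E k) (u v : Fin n → ℝ) : ℝ :=
  ∑ a, ∑ b, p.g (p.φ y) a b * u a * v b

/-- The second fundamental form with values in the ambient tangent space. -/
def Lup (p : Patch k n) (y : E k) (α β : Fin k) (d : Fin n) : ℝ :=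
  ∑ b, (p.g (p.φ y))⁻¹ d b * p.L y ![α, β] b

theorem ip_add_left (y : E k) (u u' v : Fin n → ℝ) :
    p.ip y (fun a => u a + u' a) v = p.ip y u v + p.ip y u' v := by
  simp only [ip, mul_add, add_mul, Finset.sum_add_distrib]

theorem ip_sum_left {ι : Type*} [Fintype ι] (y : E k) (c : ι → ℝ) (u : ι → Fin n → ℝ)
    (v : Fin n → ℝ) : p.ip y (fun a => ∑ i, c i * u i a) v = ∑ i, c i * p.ip y (u i) v := by
  simp only [ip, Finset.mul_sum, Finset.sum_mul]
  calc _ = ∑ a, ∑ i, ∑ b, p.g (p.φ y) a b * (c i * u i a) * v b :=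
        Finset.sum_congr rfl fun a _ => Finset.sum_comm
    _ = _ := by
        rw [Finset.sum_comm]
        exact Finset.sum_congr rfl fun i _ => Finset.sum_congr rfl fun a _ =>
          Finset.sum_congr rfl fun b _ => by ring

theorem L_eq_ip (y : E k) (α β : Fin k) (b : Fin n) :
    p.L y ![α, β] b = p.ip y (p.nor y b) (p.covD (fun z => p.tan z β) y α) := by
  simp only [L, ip, covD, Matrix.cons_val]

namespace IsRegularOn

variable (hp : p.IsRegularOn U V) {y : E k}

include hp

theorem ip_comm (hy : y ∈ U) (u v : Fin n → ℝ) : p.ip y u v = p.ip y v u := by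
  simp only [ip]
  rw [Finset.sum_comm]
  exact Finset.sum_congr rfl fun a _ => Finset.sum_congr rfl fun b _ => by
    rw [hp.metric.symm (hp.maps y hy)]; ring

theorem ip_nor_tan (hy : y ∈ U) (b : Fin n) (α : Fin k) :
    p.ip y (p.nor y b) (p.tan y α) = 0 := hp.sum_nor_tan hy b α

theorem pd_ip {u v : E k → Fin n → ℝ} (hu : ∀ a, SmoothOn U fun z => u z a)
    (hv : ∀ a, SmoothOn U fun z => v z a) (hy : y ∈ U) (α : Fin k) :
    pd (fun z => p.ip z (u z) (v z)) y α =
      p.ip y (p.covD u y α) (v y) + p.ip y (u y) (p.covD v y α) := by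
  have hg : ∀ a b, SmoothOn U fun z => p.g (p.φ z) a b := fun a b =>
    hp.comp_smooth (hp.metric.smooth a b)
  simp only [ip]
  rw [pd_sum (fun a => SmoothOn.sum fun b => ((hg a b).mul (hu a)).mul (hv b)) hy]
  simp only [pd_sum (fun b => ((hg _ b).mul (hu _)).mul (hv b)) hy,
    pd_mul ((hg _ _).mul (hu _)) (hv _) hy, pd_mul (hg _ _) (hu _) hy,
    hp.pd_comp (hp.metric.smooth _ _) hy, hp.metric.pd_metric (hp.maps y hy), covD, mul_add,
    add_mul, Finset.sum_add_distrib]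
  have e1 : ∑ a, ∑ b, (∑ c, p.tan y α c * ∑ d, christoffel p.g (p.φ y) d c a * p.g (p.φ y) d b) *
        u y a * v y b =
      ∑ a, ∑ b, p.g (p.φ y) a b * (∑ e, ∑ f, christoffel p.g (p.φ y) a e f * p.tan y α e * u y f) *
        v y b := by
    simp only [Finset.mul_sum, Finset.sum_mul]
    calc _ = ∑ a, ∑ d, ∑ b, ∑ c, p.tan y α c * (christoffel p.g (p.φ y) d c a * p.g (p.φ y) d b) *
            u y a * v y b := by
          refine Finset.sum_congr rfl fun a _ => ?_
          rw [Finset.sum_comm]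
          refine (Finset.sum_congr rfl fun c _ => Finset.sum_comm).trans ?_
          rw [Finset.sum_comm]
          exact Finset.sum_congr rfl fun d _ => Finset.sum_comm
      _ = _ := by
          rw [Finset.sum_comm]
          refine Finset.sum_congr rfl fun d _ => ?_
          rw [Finset.sum_comm]
          refine Finset.sum_congr rfl fun b _ => ?_
          rw [Finset.sum_comm]
          exact Finset.sum_congr rfl fun a _ => Finset.sum_congr rfl fun c _ => by ring
  have e2 : ∑ a, ∑ b, (∑ c, p.tan y α c * ∑ d, christoffel p.g (p.φ y) d c b * p.g (p.φ y) a d) *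
        u y a * v y b =
      ∑ a, ∑ b, p.g (p.φ y) a b * u y a *
        (∑ e, ∑ f, christoffel p.g (p.φ y) b e f * p.tan y α e * v y f) := by
    refine Finset.sum_congr rfl fun a _ => ?_
    simp only [Finset.mul_sum, Finset.sum_mul]
    calc _ = ∑ d, ∑ b, ∑ c, p.tan y α c * (christoffel p.g (p.φ y) d c b * p.g (p.φ y) a d) *
            u y a * v y b := by
          refine (Finset.sum_congr rfl fun c _ => Finset.sum_comm).trans ?_
          rw [Finset.sum_comm]
      _ = _ := by
          refine Finset.sum_congr rfl fun d _ => ?_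
          rw [Finset.sum_comm]
          exact Finset.sum_congr rfl fun a _ => Finset.sum_congr rfl fun c _ => by ring
  rw [e1, e2]
  ring

theorem covD_tan_symm (hy : y ∈ U) (α β : Fin k) (d : Fin n) :
    p.covD (fun z => p.tan z β) y α d = p.covD (fun z => p.tan z α) y β d := by
  simp only [covD, tan]
  rw [pd_comm (hp.smooth d) hy]
  congr 1
  rw [Finset.sum_comm]
  exact Finset.sum_congr rfl fun e _ => Finset.sum_congr rfl fun f _ => by
    rw [hp.metric.christoffel_symm (hp.maps y hy)]; ring

theorem ip_tan_covD (hy : y ∈ U) (δ α β : Fin k) :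
    p.ip y (p.tan y δ) (p.covD (fun z => p.tan z β) y α) =
      ∑ γ, p.h y δ γ * christoffel p.h y γ α β := by
  rw [hp.induced.christoffel_lower hy]
  have h : ∀ α β δ, pd (fun z => p.h z β δ) y α =
      p.ip y (p.tan y δ) (p.covD (fun z => p.tan z β) y α) +
      p.ip y (p.tan y β) (p.covD (fun z => p.tan z δ) y α) := by
    intro α β δ
    rw [← hp.ip_comm hy (p.covD (fun z => p.tan z β) y α)]
    exact hp.pd_ip (fun a => hp.tan_smooth β a) (fun a => hp.tan_smooth δ a) hy α
  have hs : ∀ α β, p.covD (fun z => p.tan z β) y α = p.covD (fun z => p.tan z α) y β :=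
    fun α β => funext fun d => hp.covD_tan_symm hy α β d
  rw [h, h, h, hs β α, hs δ α, hs δ β]
  ring

/-- Decomposition of an ambient vector into its normal and its tangential part. -/
theorem vec_split (hy : y ∈ U) (v : Fin n → ℝ) (d : Fin n) :
    v d = (∑ γ, ∑ δ, (p.h y)⁻¹ γ δ * p.ip y (p.tan y δ) v * p.tan y γ d) +
      ∑ b, (p.g (p.φ y))⁻¹ d b * p.ip y (p.nor y b) v := by
  have h0 : (p.g (p.φ y))⁻¹ * (p.norM y * p.g (p.φ y)) =
      1 - (p.tanM y).transpose * ((p.h y)⁻¹ * (p.tanM y * p.g (p.φ y))) := by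
    rw [← Matrix.mul_assoc, hp.inv_mul_norM hy, Matrix.sub_mul, hp.g_inv_mul hy]
    simp only [Matrix.mul_assoc]
  have h1 := congrFun (congrArg (fun M => Matrix.mulVec M v) h0) d
  have h2 : ∀ b, (p.norM y * p.g (p.φ y)).mulVec v b = p.ip y (p.nor y b) v := by
    intro b
    simp only [Matrix.mulVec, dotProduct, Matrix.mul_apply, norM, Matrix.of_apply, ip,
      Finset.sum_mul]
    rw [Finset.sum_comm]
    exact Finset.sum_congr rfl fun e _ => Finset.sum_congr rfl fun f _ => by ring
  have h3 : ∀ b, (p.tanM y * p.g (p.φ y)).mulVec v b = p.ip y (p.tan y b) v := by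
    intro b
    simp only [Matrix.mulVec, dotProduct, Matrix.mul_apply, tanM, Matrix.of_apply, ip,
      Finset.sum_mul]
    rw [Finset.sum_comm]
    exact Finset.sum_congr rfl fun e _ => Finset.sum_congr rfl fun f _ => by ring
  simp only [← Matrix.mulVec_mulVec, Matrix.sub_mulVec, Matrix.one_mulVec, Pi.sub_apply] at h1
  have h4 : ((p.g (p.φ y))⁻¹.mulVec ((p.norM y).mulVec ((p.g (p.φ y)).mulVec v))) d =
      ∑ b, (p.g (p.φ y))⁻¹ d b * p.ip y (p.nor y b) v := by
    simp only [← h2, ← Matrix.mulVec_mulVec]; rfl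
  have h5 : ((p.tanM y).transpose.mulVec ((p.h y)⁻¹.mulVec ((p.tanM y).mulVec
      ((p.g (p.φ y)).mulVec v)))) d =
      ∑ γ, ∑ δ, (p.h y)⁻¹ γ δ * p.ip y (p.tan y δ) v * p.tan y γ d := by
    simp only [← h3, ← Matrix.mulVec_mulVec, ← Finset.sum_mul]
    simp only [Matrix.mulVec, dotProduct, Matrix.transpose_apply, tanM, Matrix.of_apply, mul_comm]
  rw [← h4, ← h5, h1]
  exact (add_sub_cancel _ _).symm

/-- The Gauss formula. -/
theorem covD_tan (hy : y ∈ U) (α β : Fin k) (d : Fin n) :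
    p.covD (fun z => p.tan z β) y α d =
      (∑ γ, christoffel p.h y γ α β * p.tan y γ d) + p.Lup y α β d := by
  rw [hp.vec_split hy (p.covD (fun z => p.tan z β) y α) d]
  congr 1
  · refine Finset.sum_congr rfl fun γ _ => ?_
    rw [← Finset.sum_mul]
    congr 1
    simp only [hp.ip_tan_covD hy]
    exact hp.induced.raise_lower hy (fun γ => christoffel p.h y γ α β) γ

theorem L_symm (hy : y ∈ U) (α β : Fin k) (b : Fin n) : p.L y ![α, β] b = p.L y ![β, α] b := by
  rw [L_eq_ip, L_eq_ip]
  congr 1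
  exact funext fun d => hp.covD_tan_symm hy α β d

theorem covD_smooth {v : E k → Fin n → ℝ} (hv : ∀ a, SmoothOn U fun z => v z a) (α : Fin k)
    (d : Fin n) : SmoothOn U fun y => p.covD v y α d :=
  ((hv d).pd α).add (SmoothOn.sum fun _ => SmoothOn.sum fun _ =>
    ((hp.comp_smooth (hp.metric.christoffel_smooth _ _ _)).mul (hp.tan_smooth _ _)).mul (hv _))

theorem ip_smooth {u v : E k → Fin n → ℝ} (hu : ∀ a, SmoothOn U fun z => u z a)
    (hv : ∀ a, SmoothOn U fun z => v z a) : SmoothOn U fun y => p.ip y (u y) (v y) :=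
  SmoothOn.sum fun _ => SmoothOn.sum fun _ =>
    ((hp.comp_smooth (hp.metric.smooth _ _)).mul (hu _)).mul (hv _)

/-- A vector with the components of a covector raised has that covector as its dual. -/
theorem ip_raise (hy : y ∈ U) (u τ : Fin n → ℝ) :
    p.ip y u (fun d => ∑ b, (p.g (p.φ y))⁻¹ d b * τ b) = ∑ a, u a * τ a := by
  simp only [ip]
  refine Finset.sum_congr rfl fun a _ => ?_
  rw [← hp.metric.lower_raise (hp.maps y hy) τ a, Finset.mul_sum]
  exact Finset.sum_congr rfl fun b _ => by ring

end IsRegularOn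

end Patch

end

end ConformalSubmanifold

namespace ConformalSubmanifold

open TopologicalSpace (Opens)

noncomputable section

/-! ### Evaluation of ambient tensors on vector fields along a patch -/

section Rules

variable {m r : ℕ} {g : MetricField m} {V : Opens (E m)} {x : E m}

theorem nabla_fun_mul {f : E m → ℝ} {T : Tensor m r} (hf : SmoothOn V f) (hT : SmoothTensor V T)
    (hx : x ∈ V) (e : Fin m) (A : Fin r → Fin m) :
    nabla g (fun z A => f z * T z A) x (Fin.cons e A) =
      pd f x e * T x A + f x * nabla g T x (Fin.cons e A) := by
  simp only [nabla, Fin.tail_cons, Fin.cons_zero, pd_mul hf (hT _) hx, mul_sub, Finset.mul_sum,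
    mul_left_comm _ (f x)]
  ring

theorem nabla_sum {ι : Type*} [Fintype ι] {T : ι → Tensor m r} (hT : ∀ i, SmoothTensor V (T i))
    (hx : x ∈ V) (A : Fin (r + 1) → Fin m) :
    nabla g (fun z A => ∑ i, T i z A) x A = ∑ i, nabla g (T i) x A := by
  simp only [nabla, pd_sum (fun i => hT i _) hx, Finset.sum_sub_distrib, Finset.mul_sum]
  congr 1
  refine (Finset.sum_congr rfl fun a _ => Finset.sum_comm).trans Finset.sum_comm

end Rules

/-- Evaluation of a covariant tensor on vectors. -/
def ev {n r : ℕ} (T : (Fin r → Fin n) → ℝ) :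
    MultilinearMap ℝ (fun _ : Fin r => Fin n → ℝ) ℝ :=
  ∑ a, T a • (MultilinearMap.mkPiAlgebra ℝ (Fin r) ℝ).compLinearMap fun j => LinearMap.proj (a j)

theorem ev_apply {n r : ℕ} (T : (Fin r → Fin n) → ℝ) (v : Fin r → Fin n → ℝ) :
    ev T v = ∑ a, (∏ j, v j (a j)) * T a := by
  simp [ev, mul_comm]

theorem ev_cons {n r : ℕ} (T : (Fin (r + 1) → Fin n) → ℝ) (u : Fin n → ℝ)
    (v : Fin r → Fin n → ℝ) :
    ev T (Fin.cons u v) = ∑ e, u e * ev (fun a => T (Fin.cons e a)) v := by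
  simp only [ev_apply, Finset.mul_sum]
  rw [← (Fin.consEquiv fun _ => Fin n).sum_comp, Fintype.sum_prod_type]
  refine Finset.sum_congr rfl fun e _ => Finset.sum_congr rfl fun a _ => ?_
  simp [Fin.prod_univ_succ, Fin.consEquiv, mul_assoc]

theorem ev_one {n : ℕ} (T : (Fin 1 → Fin n) → ℝ) (u : Fin n → ℝ) :
    ev T ![u] = ∑ a, u a * T ![a] := by
  simp only [ev_apply, Fin.prod_univ_one]
  rw [← (Equiv.funUnique (Fin 1) (Fin n)).symm.sum_comp]
  refine Finset.sum_congr rfl fun a _ => ?_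
  have : (Equiv.funUnique (Fin 1) (Fin n)).symm a = ![a] := by ext i; fin_cases i; rfl
  rw [this]; rfl

theorem ev_two {n : ℕ} (T : (Fin 2 → Fin n) → ℝ) (u v : Fin n → ℝ) :
    ev T ![u, v] = ∑ a, ∑ b, u a * v b * T ![a, b] := by
  refine (ev_cons T u ![v]).trans (Finset.sum_congr rfl fun a _ => ?_)
  rw [ev_one, Finset.mul_sum]
  exact Finset.sum_congr rfl fun b _ => by rw [← mul_assoc]; rfl

theorem ev_three {n : ℕ} (T : (Fin 3 → Fin n) → ℝ) (u v w : Fin n → ℝ) :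
    ev T ![u, v, w] = ∑ a, ∑ b, ∑ c, u a * v b * w c * T ![a, b, c] := by
  refine (ev_cons T u ![v, w]).trans (Finset.sum_congr rfl fun a _ => ?_)
  rw [ev_two]
  simp only [Finset.mul_sum]
  exact Finset.sum_congr rfl fun b _ => Finset.sum_congr rfl fun c _ => by
    simp only [← mul_assoc]; rfl

theorem ev_four {n : ℕ} (T : (Fin 4 → Fin n) → ℝ) (u v w t : Fin n → ℝ) :
    ev T ![u, v, w, t] = ∑ a, ∑ b, ∑ c, ∑ d, u a * v b * w c * t d * T ![a, b, c, d] := by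
  refine (ev_cons T u ![v, w, t]).trans (Finset.sum_congr rfl fun a _ => ?_)
  rw [ev_three]
  simp only [Finset.mul_sum]
  exact Finset.sum_congr rfl fun b _ => Finset.sum_congr rfl fun c _ =>
    Finset.sum_congr rfl fun d _ => by simp only [← mul_assoc]; rfl

theorem ev_update_sum {n r : ℕ} (T : (Fin r → Fin n) → ℝ) (v : Fin r → Fin n → ℝ) (j : Fin r)
    {ι : Type*} [Fintype ι] (c : ι → ℝ) (w : ι → Fin n → ℝ) :
    ev T (Function.update v j fun d => ∑ i, c i * w i d) =
      ∑ i, c i * ev T (Function.update v j (w i)) := by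
  have : (fun d => ∑ i, c i * w i d) = ∑ i, c i • w i := by ext d; simp
  rw [this, MultilinearMap.map_update_sum]
  simp

namespace Patch

variable {k n r s : ℕ} {p : Patch k n} {U : Opens (E k)} {V : Opens (E n)}

theorem proj_eq_ev (T : Tensor n r) (y : E k) (i : Fin r → Index k n) :
    p.proj T y i = ev (T (p.φ y)) fun j => p.frame y (i j) := (ev_apply _ _).symm

namespace IsRegularOn

variable (hp : p.IsRegularOn U V) {y : E k}

include hp

theorem ev_smooth {T : Tensor n r} (hT : SmoothTensor V T) {v : Fin r → E k → Fin n → ℝ}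
    (hv : ∀ j a, SmoothOn U fun z => v j z a) : SmoothOn U fun z => ev (T (p.φ z)) fun j => v j z := by
  simp only [ev_apply]
  exact SmoothOn.sum fun _ => (SmoothOn.prod fun _ => hv _ _).mul (hp.comp_smooth (hT _))

/-- The product rule for the evaluation of an ambient tensor on vector fields along a patch. -/
theorem pd_ev {T : Tensor n r} (hT : SmoothTensor V T) {v : Fin r → E k → Fin n → ℝ}
    (hv : ∀ j a, SmoothOn U fun z => v j z a) (hy : y ∈ U) (α : Fin k) :
    pd (fun z => ev (T (p.φ z)) fun j => v j z) y α =
      ev (nabla p.g T (p.φ y)) (Fin.cons (p.tan y α) fun j => v j y) +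
        ∑ j, ev (T (p.φ y)) (Function.update (fun j => v j y) j (p.covD (v j) y α)) := by
  have hprod : ∀ a : Fin r → Fin n, pd (fun z => ∏ j, v j z (a j)) y α =
      ∑ j, (∏ l ∈ Finset.univ.erase j, v l y (a l)) * pd (fun z => v j z (a j)) y α := by
    intro a
    simp only [pd]
    rw [fderiv_finsetProd fun j _ => (hv j (a j)).differentiableAt hy]
    simp
  have hupd : ∀ (a : Fin r → Fin n) (j : Fin r) (w : Fin n → ℝ),
      ∏ l, Function.update (fun j => v j y) j w l (a l) =
        (∏ l ∈ Finset.univ.erase j, v l y (a l)) * w (a j) := by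
    intro a j w
    rw [← Finset.prod_erase_mul _ _ (Finset.mem_univ j)]
    rw [Function.update_self]
    congr 1
    refine Finset.prod_congr rfl fun l hl => ?_
    rw [Function.update_of_ne (Finset.ne_of_mem_erase hl)]
  have hswap : ∀ (j : Fin r) (e : Fin n),
      ∑ a : Fin r → Fin n, (∏ l, v l y (a l)) *
        (∑ d, christoffel p.g (p.φ y) d e (a j) * T (p.φ y) (Function.update a j d)) =
      ∑ a : Fin r → Fin n, (∏ l ∈ Finset.univ.erase j, v l y (a l)) *
        (∑ f, christoffel p.g (p.φ y) (a j) e f * v j y f) * T (p.φ y) a := by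
    intro j e
    simp only [Finset.mul_sum, Finset.sum_mul]
    rw [← Fintype.sum_prod_type', ← Fintype.sum_prod_type']
    let σ : (Fin r → Fin n) × Fin n ≃ (Fin r → Fin n) × Fin n :=
      { toFun := fun q => (Function.update q.1 j q.2, q.1 j)
        invFun := fun q => (Function.update q.1 j q.2, q.1 j)
        left_inv := fun q => by simp
        right_inv := fun q => by simp }
    rw [← σ.sum_comp]
    refine Finset.sum_congr rfl fun q _ => ?_
    have h1 : ∏ l ∈ Finset.univ.erase j, v l y (Function.update q.1 j q.2 l) =
        ∏ l ∈ Finset.univ.erase j, v l y (q.1 l) :=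
      Finset.prod_congr rfl fun l hl => by
        rw [Function.update_of_ne (Finset.ne_of_mem_erase hl)]
    have h2 : ∏ l, v l y (Function.update q.1 j q.2 l) =
        (∏ l ∈ Finset.univ.erase j, v l y (q.1 l)) * v j y q.2 := by
      rw [← h1, ← Finset.prod_erase_mul _ _ (Finset.mem_univ j), Function.update_self]
    simp only [σ, Equiv.coe_fn_mk, Function.update_self, Function.update_idem,
      Function.update_eq_self, h2]
    ring
  simp only [ev_apply]
  rw [pd_sum (fun a => (SmoothOn.prod fun j => hv j (a j)).mul (hp.comp_smooth (hT a))) hy]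
  simp only [pd_mul (SmoothOn.prod fun j => hv j _) (hp.comp_smooth (hT _)) hy, hprod,
    hp.pd_comp (hT _) hy, hupd]
  have hcons : ∑ a : Fin (r + 1) → Fin n,
      (∏ j, (Fin.cons (p.tan y α) fun j => v j y : Fin (r + 1) → Fin n → ℝ) j (a j)) *
        nabla p.g T (p.φ y) a =
      ∑ e, p.tan y α e * ∑ a : Fin r → Fin n, (∏ j, v j y (a j)) *
        nabla p.g T (p.φ y) (Fin.cons e a) := by
    rw [← ev_apply, ev_cons]; simp only [ev_apply]
  rw [hcons]
  simp only [nabla, Fin.tail_cons, Fin.cons_zero, covD, mul_sub, mul_add, add_mul,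
    Finset.sum_add_distrib, Finset.sum_sub_distrib]
  have h3 : ∑ e, p.tan y α e * ∑ a : Fin r → Fin n, (∏ j, v j y (a j)) *
        ∑ j, ∑ d, christoffel p.g (p.φ y) d e (a j) * T (p.φ y) (Function.update a j d) =
      ∑ j, ∑ a : Fin r → Fin n, (∏ l ∈ Finset.univ.erase j, v l y (a l)) *
        (∑ e, ∑ f, christoffel p.g (p.φ y) (a j) e f * p.tan y α e * v j y f) * T (p.φ y) a := by
    have : ∀ e, ∑ a : Fin r → Fin n, (∏ j, v j y (a j)) *
        ∑ j, ∑ d, christoffel p.g (p.φ y) d e (a j) * T (p.φ y) (Function.update a j d) =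
        ∑ j, ∑ a : Fin r → Fin n, (∏ l ∈ Finset.univ.erase j, v l y (a l)) *
        (∑ f, christoffel p.g (p.φ y) (a j) e f * v j y f) * T (p.φ y) a := by
      intro e
      rw [← Finset.sum_congr rfl fun j _ => hswap j e, Finset.sum_comm]
      exact Finset.sum_congr rfl fun a _ => Finset.mul_sum _ _ _
    simp only [this]
    simp only [Finset.mul_sum, Finset.sum_mul]
    rw [Finset.sum_comm]
    refine Finset.sum_congr rfl fun j _ => ?_
    rw [Finset.sum_comm]
    refine Finset.sum_congr rfl fun a _ => Finset.sum_congr rfl fun e _ =>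
      Finset.sum_congr rfl fun f _ => by ring
  rw [h3]
  have h4 : ∑ e, p.tan y α e * ∑ a : Fin r → Fin n, (∏ j, v j y (a j)) *
        pd (fun z => T z a) (p.φ y) e =
      ∑ a : Fin r → Fin n, (∏ j, v j y (a j)) * ∑ e, p.tan y α e * pd (fun z => T z a) (p.φ y) e := by
    simp only [Finset.mul_sum]
    rw [Finset.sum_comm]
    exact Finset.sum_congr rfl fun a _ => Finset.sum_congr rfl fun e _ => by ring
  rw [h4]
  have h5 : ∑ a : Fin r → Fin n, (∑ j, (∏ l ∈ Finset.univ.erase j, v l y (a l)) *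
        pd (fun z => v j z (a j)) y α) * T (p.φ y) a =
      ∑ j, ∑ a : Fin r → Fin n, (∏ l ∈ Finset.univ.erase j, v l y (a l)) *
        pd (fun z => v j z (a j)) y α * T (p.φ y) a := by
    rw [Finset.sum_comm]
    exact Finset.sum_congr rfl fun a _ => Finset.sum_mul _ _ _
  rw [h5]
  ring

/-- The covariant derivative commutes with lowering an index. -/
theorem pd_lower {v : E k → Fin n → ℝ} (hv : ∀ a, SmoothOn U fun z => v z a) (hy : y ∈ U)
    (ε : Fin k) (c : Fin n) :
    pd (fun z => ∑ d, v z d * p.g (p.φ z) d c) y ε -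
        ∑ d, ∑ e, christoffel p.g (p.φ y) d e c * p.tan y ε e * (∑ f, v y f * p.g (p.φ y) f d) =
      ∑ d, p.covD v y ε d * p.g (p.φ y) d c := by
  rw [pd_sum (fun d => (hv d).mul (hp.comp_smooth (hp.metric.smooth d c))) hy]
  simp only [pd_mul (hv _) (hp.comp_smooth (hp.metric.smooth _ c)) hy,
    hp.pd_comp (hp.metric.smooth _ _) hy, hp.metric.pd_metric (hp.maps y hy), covD, add_mul,
    mul_add, Finset.sum_add_distrib, Finset.mul_sum, Finset.sum_mul]
  have e1 : ∑ d, ∑ a, ∑ i, v y d * (p.tan y ε a *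
      (christoffel p.g (p.φ y) i a d * p.g (p.φ y) i c)) =
      ∑ d, ∑ e, ∑ f, christoffel p.g (p.φ y) d e f * p.tan y ε e * v y f *
        p.g (p.φ y) d c := by
    rw [Finset.sum_comm]
    simp only [fun e => Finset.sum_comm (s := (Finset.univ : Finset (Fin n)))
      (t := (Finset.univ : Finset (Fin n))) (f := fun d i => v y d * (p.tan y ε e *
      (christoffel p.g (p.φ y) i e d * p.g (p.φ y) i c)))]
    rw [Finset.sum_comm]
    exact Finset.sum_congr rfl fun c _ => Finset.sum_congr rfl fun d _ =>
      Finset.sum_congr rfl fun e _ => by ring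
  have e2 : ∑ d, ∑ a, ∑ i, v y d * (p.tan y ε a *
      (christoffel p.g (p.φ y) i a c * p.g (p.φ y) d i)) =
      ∑ d, ∑ e, ∑ f, christoffel p.g (p.φ y) d e c * p.tan y ε e *
        (v y f * p.g (p.φ y) f d) := by
    rw [Finset.sum_comm]
    simp only [fun e => Finset.sum_comm (s := (Finset.univ : Finset (Fin n)))
      (t := (Finset.univ : Finset (Fin n))) (f := fun d i => v y d * (p.tan y ε e *
      (christoffel p.g (p.φ y) i e c * p.g (p.φ y) d i)))]
    rw [Finset.sum_comm]
    exact Finset.sum_congr rfl fun c _ => Finset.sum_congr rfl fun d _ =>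
      Finset.sum_congr rfl fun e _ => by ring
  rw [e1, e2]
  ring

/-- The covariant derivative of the normal projection. -/
theorem sum_nor_covD_nor (hy : y ∈ U) (ε : Fin k) (b f : Fin n) :
    ∑ c, p.nor y b c * (p.covD (fun z => p.nor z c) y ε f -
        ∑ d, ∑ e, christoffel p.g (p.φ y) d e c * p.tan y ε e * p.nor y d f) =
      -∑ γ, ∑ δ, (p.h y)⁻¹ γ δ * p.L y ![ε, δ] b * p.tan y γ f := by
  let θ : E k → Fin k → Fin n → ℝ := fun z γ c =>
    ∑ δ, (p.h z)⁻¹ γ δ * ∑ d, p.tan z δ d * p.g (p.φ z) d c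
  have hτs : ∀ δ c, SmoothOn U fun z => ∑ d, p.tan z δ d * p.g (p.φ z) d c := fun δ c =>
    SmoothOn.sum fun d => (hp.tan_smooth δ d).mul (hp.comp_smooth (hp.metric.smooth d c))
  have hθs : ∀ γ c, SmoothOn U fun z => θ z γ c := fun γ c =>
    SmoothOn.sum fun δ => (hp.induced.inv_smooth γ δ).mul (hτs δ c)
  have hnor : ∀ z c f, p.nor z c f = (if f = c then 1 else 0) - ∑ γ, p.tan z γ f * θ z γ c := by
    intro z c f
    simp only [nor, θ, Finset.mul_sum]
    congr 1
    exact Finset.sum_congr rfl fun γ _ => Finset.sum_congr rfl fun δ _ =>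
      Finset.sum_congr rfl fun d _ => by ring
  have hτ0 : ∀ δ, ∑ c, p.nor y b c * ∑ d, p.tan y δ d * p.g (p.φ y) d c = 0 := by
    intro δ
    rw [← hp.ip_nor_tan hy b δ]
    simp only [ip, Finset.mul_sum]
    exact Finset.sum_congr rfl fun c _ => Finset.sum_congr rfl fun d _ => by
      rw [hp.metric.symm (hp.maps y hy) d c]; ring
  have hθ0 : ∀ γ, ∑ c, p.nor y b c * θ y γ c = 0 := by
    intro γ
    simp only [θ, Finset.mul_sum]
    rw [Finset.sum_comm]
    refine Finset.sum_eq_zero fun δ _ => ?_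
    rw [← mul_zero ((p.h y)⁻¹ γ δ), ← hτ0 δ]
    simp only [Finset.mul_sum]
    exact Finset.sum_congr rfl fun c _ => Finset.sum_congr rfl fun d _ => by ring
  have hθ1 : ∀ γ, ∑ c, p.nor y b c * (pd (fun z => θ z γ c) y ε -
      ∑ d, ∑ e, christoffel p.g (p.φ y) d e c * p.tan y ε e * θ y γ d) =
      ∑ δ, (p.h y)⁻¹ γ δ * p.L y ![ε, δ] b := by
    intro γ
    have hlow : ∀ δ c, pd (fun z => ∑ d, p.tan z δ d * p.g (p.φ z) d c) y ε -
        ∑ d, ∑ e, christoffel p.g (p.φ y) d e c * p.tan y ε e *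
          (∑ f, p.tan y δ f * p.g (p.φ y) f d) =
        ∑ d, p.covD (fun z => p.tan z δ) y ε d * p.g (p.φ y) d c := fun δ c =>
      hp.pd_lower (fun a => hp.tan_smooth δ a) hy ε c
    have hpd : ∀ c, pd (fun z => θ z γ c) y ε -
        ∑ d, ∑ e, christoffel p.g (p.φ y) d e c * p.tan y ε e * θ y γ d =
        (∑ δ, pd (fun z => (p.h z)⁻¹ γ δ) y ε * ∑ d, p.tan y δ d * p.g (p.φ y) d c) +
        ∑ δ, (p.h y)⁻¹ γ δ * ∑ d, p.covD (fun z => p.tan z δ) y ε d * p.g (p.φ y) d c := by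
      intro c
      simp only [← hlow, θ]
      rw [pd_sum (fun δ => (hp.induced.inv_smooth γ δ).mul (hτs δ c)) hy]
      simp only [pd_mul (hp.induced.inv_smooth γ _) (hτs _ c) hy, Finset.sum_add_distrib, mul_sub,
        Finset.sum_sub_distrib]
      have : ∑ d, ∑ e, christoffel p.g (p.φ y) d e c * p.tan y ε e *
          ∑ δ, (p.h y)⁻¹ γ δ * ∑ f, p.tan y δ f * p.g (p.φ y) f d =
          ∑ δ, (p.h y)⁻¹ γ δ * ∑ d, ∑ e, christoffel p.g (p.φ y) d e c * p.tan y ε e *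
            ∑ f, p.tan y δ f * p.g (p.φ y) f d := by
        simp only [Finset.mul_sum]
        rw [Finset.sum_congr rfl fun d _ => Finset.sum_comm, Finset.sum_comm]
        exact Finset.sum_congr rfl fun δ _ => Finset.sum_congr rfl fun d _ =>
          Finset.sum_congr rfl fun e _ => Finset.sum_congr rfl fun f _ => by ring
      rw [this]
      ring
    simp only [hpd, mul_add, Finset.sum_add_distrib]
    have e1 : ∑ c, p.nor y b c * ∑ δ, pd (fun z => (p.h z)⁻¹ γ δ) y ε *
        ∑ d, p.tan y δ d * p.g (p.φ y) d c = 0 := by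
      rw [Finset.sum_congr rfl fun c _ => Finset.mul_sum _ _ _, Finset.sum_comm]
      refine Finset.sum_eq_zero fun δ _ => ?_
      rw [← mul_zero (pd (fun z => (p.h z)⁻¹ γ δ) y ε), ← hτ0 δ, Finset.mul_sum]
      exact Finset.sum_congr rfl fun c _ => by ring
    rw [e1, zero_add]
    rw [Finset.sum_congr rfl fun c _ => Finset.mul_sum _ _ _, Finset.sum_comm]
    refine Finset.sum_congr rfl fun δ _ => ?_
    rw [L_eq_ip, ip, Finset.mul_sum]
    refine Finset.sum_congr rfl fun c _ => ?_
    rw [Finset.mul_sum, Finset.mul_sum, Finset.mul_sum]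
    exact Finset.sum_congr rfl fun d _ => by rw [hp.metric.symm (hp.maps y hy) d c]; ring
  have hX : ∀ c, p.covD (fun z => p.nor z c) y ε f -
        ∑ d, ∑ e, christoffel p.g (p.φ y) d e c * p.tan y ε e * p.nor y d f =
      -∑ γ, (p.covD (fun z => p.tan z γ) y ε f * θ y γ c + p.tan y γ f *
        (pd (fun z => θ z γ c) y ε -
          ∑ d, ∑ e, christoffel p.g (p.φ y) d e c * p.tan y ε e * θ y γ d)) := by
    intro c
    simp only [covD, hnor]
    rw [pd_sub (SmoothOn.const _) (SmoothOn.sum fun γ => (hp.tan_smooth γ f).mul (hθs γ c)) hy,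
      pd_const, pd_sum (fun γ => (hp.tan_smooth γ f).mul (hθs γ c)) hy]
    simp only [pd_mul (hp.tan_smooth _ f) (hθs _ c) hy, mul_sub, add_mul, Finset.sum_add_distrib,
      Finset.sum_sub_distrib]
    have e1 : ∑ e, ∑ g', christoffel p.g (p.φ y) f e g' * p.tan y ε e * (if g' = c then 1 else 0) =
        ∑ e, christoffel p.g (p.φ y) f e c * p.tan y ε e := by simp
    have e2 : ∑ d, ∑ e, christoffel p.g (p.φ y) d e c * p.tan y ε e * (if f = d then 1 else 0) =
        ∑ e, christoffel p.g (p.φ y) f e c * p.tan y ε e := by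
      rw [Finset.sum_comm]; simp
    have e3 : ∑ e, ∑ g', christoffel p.g (p.φ y) f e g' * p.tan y ε e *
        ∑ γ, p.tan y γ g' * θ y γ c =
        ∑ γ, (∑ e, ∑ g', christoffel p.g (p.φ y) f e g' * p.tan y ε e * p.tan y γ g') *
          θ y γ c := by
      simp only [Finset.mul_sum, Finset.sum_mul]
      rw [Finset.sum_congr rfl fun e _ => Finset.sum_comm, Finset.sum_comm]
      exact Finset.sum_congr rfl fun c _ => Finset.sum_congr rfl fun d _ =>
          Finset.sum_congr rfl fun e _ => by ring
    have e4 : ∑ d, ∑ e, christoffel p.g (p.φ y) d e c * p.tan y ε e *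
        ∑ γ, p.tan y γ f * θ y γ d =
        ∑ γ, p.tan y γ f * ∑ d, ∑ e, christoffel p.g (p.φ y) d e c * p.tan y ε e * θ y γ d := by
      simp only [Finset.mul_sum]
      rw [Finset.sum_congr rfl fun e _ => Finset.sum_comm, Finset.sum_comm]
      exact Finset.sum_congr rfl fun c _ => Finset.sum_congr rfl fun d _ =>
          Finset.sum_congr rfl fun e _ => by ring
    rw [e1, e2, e3, e4]
    ring
  simp only [hX, mul_neg, Finset.sum_neg_distrib, neg_inj, Finset.mul_sum, mul_add,
    Finset.sum_add_distrib]
  rw [Finset.sum_comm (f := fun c γ => p.nor y b c * (p.covD (fun z => p.tan z γ) y ε f * θ y γ c)),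
    Finset.sum_comm (f := fun c γ => p.nor y b c * (p.tan y γ f * _))]
  have e5 : ∑ γ, ∑ c, p.nor y b c * (p.covD (fun z => p.tan z γ) y ε f * θ y γ c) = 0 := by
    refine Finset.sum_eq_zero fun γ _ => ?_
    rw [← mul_zero (p.covD (fun z => p.tan z γ) y ε f), ← hθ0 γ, Finset.mul_sum]
    exact Finset.sum_congr rfl fun c _ => by ring
  rw [e5, zero_add]
  refine Finset.sum_congr rfl fun γ _ => ?_
  rw [← Finset.sum_mul, ← hθ1 γ, Finset.sum_mul]
  exact Finset.sum_congr rfl fun c _ => by ring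

end IsRegularOn

end Patch

end

end ConformalSubmanifold

namespace ConformalSubmanifold

open TopologicalSpace (Opens)

noncomputable section

theorem ev_comp {n r : ℕ} (T : (Fin r → Fin n) → ℝ) (v w : Fin r → Fin n → ℝ) (h : ∀ j, v j = w j) :
    ev T v = ev T w := by rw [funext h]

namespace Patch

variable {k n r s t : ℕ} {p : Patch k n} {U : Opens (E k)} {V : Opens (E n)}

/-- A smooth field of tensors with one normal index. -/
structure IsNField (p : Patch k n) (U : Opens (E k)) (T : NTensor k n r) : Prop where
  smooth : ∀ A b, SmoothOn U fun z => T z A b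
  normal : ∀ y ∈ U, ∀ A α, ∑ a, p.tan y α a * T y A a = 0

/-- The covariant derivative of a field with an ambient covector index. -/
def dN (p : Patch k n) (T : NTensor k n r) : NTensor k n (r + 1) := fun y A c =>
  nabla p.h (fun z A => T z A c) y A -
    ∑ d, ∑ e, christoffel p.g (p.φ y) d e c * p.tan y (A 0) e * T y (Fin.tail A) d

theorem nablaN_eq (T : NTensor k n r) (y : E k) (A : Fin (r + 1) → Fin k) (b : Fin n) :
    p.nablaN T y A b = ∑ c, p.nor y b c * p.dN T y A c := rfl

/-- The components of an ambient tensor with one normal slot `q` and tangential other slots. -/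
def slot (p : Patch k n) (T : Tensor n (r + 1)) (q : Fin (r + 1)) : NTensor k n r := fun y A b =>
  ev (T (p.φ y)) (q.insertNth (p.nor y b) fun j => p.tan y (A j))

namespace IsRegularOn

variable (hp : p.IsRegularOn U V) {y : E k}

include hp

theorem nabla_smooth' {T : Tensor k r} (hT : SmoothTensor U T) :
    SmoothTensor U (nabla p.h T) := hT.nabla hp.induced

theorem dN_smooth {T : NTensor k n r} (hT : ∀ A b, SmoothOn U fun z => T z A b)
    (A : Fin (r + 1) → Fin k) (c : Fin n) : SmoothOn U fun z => p.dN T z A c := by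
  refine SmoothOn.sub ?_ (SmoothOn.sum fun d => SmoothOn.sum fun e => ?_)
  · exact hp.nabla_smooth' (T := fun z A => T z A c) (fun A => hT A c) A
  · exact ((hp.comp_smooth (hp.metric.christoffel_smooth _ _ _)).mul (hp.tan_smooth _ _)).mul (hT _ _)

theorem isNField_nor {T : NTensor k n r} (hT : ∀ A b, SmoothOn U fun z => T z A b) :
    p.IsNField U fun y A b => ∑ c, p.nor y b c * T y A c where
  smooth A b := SmoothOn.sum fun c => (hp.nor_smooth b c).mul (hT A c)
  normal y hy A α := by
    simp only [Finset.mul_sum]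
    rw [Finset.sum_comm]
    refine Finset.sum_eq_zero fun c _ => ?_
    rw [← zero_mul (T y A c), ← hp.sum_tan_nor hy α c, Finset.sum_mul]
    exact Finset.sum_congr rfl fun a _ => by ring

theorem isNField_nablaN {T : NTensor k n r} (hT : p.IsNField U T) : p.IsNField U (p.nablaN T) :=
  hp.isNField_nor fun A c => hp.dN_smooth hT.smooth A c

theorem sum_nor_field {T : NTensor k n r} (hT : p.IsNField U T) (hy : y ∈ U) (A : Fin r → Fin k)
    (b : Fin n) : ∑ c, p.nor y b c * T y A c = T y A b :=
  hp.sum_nor_of_normal _ (hT.normal y hy A) hy b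

theorem isNField_L : p.IsNField U p.L where
  smooth A b := by
    have : (fun z => p.L z A b) =
        fun z => p.ip z (p.nor z b) (p.covD (fun z => p.tan z (A 1)) z (A 0)) := by
      ext z; exact L_eq_ip z (A 0) (A 1) b
    rw [this]
    exact hp.ip_smooth (fun a => hp.nor_smooth b a)
      fun a => hp.covD_smooth (fun a => hp.tan_smooth _ a) _ _
  normal y hy A α := by
    have h1 : ∀ b, p.L y A b = ∑ c, p.nor y b c * ∑ d, p.g (p.φ y) c d *
        p.covD (fun z => p.tan z (A 1)) y (A 0) d := by
      intro b
      refine (L_eq_ip y (A 0) (A 1) b).trans ?_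
      simp only [ip, Finset.mul_sum]
      exact Finset.sum_congr rfl fun a _ => Finset.sum_congr rfl fun a _ => by ring
    simp only [h1, Finset.mul_sum]
    rw [Finset.sum_comm]
    refine Finset.sum_eq_zero fun c _ => ?_
    rw [Finset.sum_comm]
    refine Finset.sum_eq_zero fun d _ => ?_
    rw [← zero_mul (p.g (p.φ y) c d * p.covD (fun z => p.tan z (A 1)) y (A 0) d),
      ← hp.sum_tan_nor hy α c, Finset.sum_mul]
    exact Finset.sum_congr rfl fun a _ => by ring

/-- A vector given by a normal covector. -/
theorem sum_inv_eq (hy : y ∈ U) {τ : Fin n → ℝ} (hτ : ∀ α, ∑ a, p.tan y α a * τ a = 0)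
    (d : Fin n) : ∑ b, (p.g (p.φ y))⁻¹ d b * τ b =
      ∑ a, ∑ a', (p.g (p.φ y))⁻¹ a a' * τ a * p.nor y a' d := by
  have h1 : ∀ c e, ∑ a, (p.g (p.φ y))⁻¹ c a * p.nor y a e =
      ∑ a, p.nor y a c * (p.g (p.φ y))⁻¹ a e := by
    intro c e
    have := (hp.inv_mul_norM hy).trans (hp.norM_transpose_mul hy).symm
    have := congrFun (congrFun this c) e
    simpa [Matrix.mul_apply, norM] using this
  have h2 : ∀ a, ∑ a', (p.g (p.φ y))⁻¹ a a' * τ a * p.nor y a' d =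
      ∑ c, p.nor y c a * (p.g (p.φ y))⁻¹ c d * τ a := by
    intro a
    rw [← Finset.sum_mul, ← h1, Finset.sum_mul]
    exact Finset.sum_congr rfl fun a _ => by ring
  simp only [h2]
  rw [Finset.sum_comm]
  refine Finset.sum_congr rfl fun c _ => ?_
  conv_lhs => rw [← hp.sum_nor_of_normal τ hτ hy c]
  rw [Finset.mul_sum]
  exact Finset.sum_congr rfl fun a _ => by
    rw [hp.metric.inv_symm (hp.maps y hy) d c]; ring

theorem ev_update_raise {r : ℕ} (T : (Fin r → Fin n) → ℝ) (v : Fin r → Fin n → ℝ) (j : Fin r)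
    (hy : y ∈ U) {τ : Fin n → ℝ} (hτ : ∀ α, ∑ a, p.tan y α a * τ a = 0) :
    ev T (Function.update v j fun d => ∑ b, (p.g (p.φ y))⁻¹ d b * τ b) =
      p.trN y fun a a' => τ a * ev T (Function.update v j (p.nor y a')) := by
  have : (fun d => ∑ b, (p.g (p.φ y))⁻¹ d b * τ b) = fun d => ∑ q : Fin n × Fin n,
      ((p.g (p.φ y))⁻¹ q.1 q.2 * τ q.1) * p.nor y q.2 d := by
    ext d
    rw [hp.sum_inv_eq hy hτ d, Fintype.sum_prod_type]
  rw [this, ev_update_sum, Fintype.sum_prod_type]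
  exact Finset.sum_congr rfl fun a _ => Finset.sum_congr rfl fun b _ => by ring

theorem ev_update_covD_tan {r : ℕ} (T : (Fin r → Fin n) → ℝ) (v : Fin r → Fin n → ℝ) (j : Fin r)
    (hy : y ∈ U) (α β : Fin k) :
    ev T (Function.update v j (p.covD (fun z => p.tan z β) y α)) =
      (∑ γ, christoffel p.h y γ α β * ev T (Function.update v j (p.tan y γ))) +
      p.trN y fun a a' => p.L y ![α, β] a * ev T (Function.update v j (p.nor y a')) := by
  have : p.covD (fun z => p.tan z β) y α = (fun d => ∑ γ, christoffel p.h y γ α β * p.tan y γ d) +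
      fun d => ∑ b, (p.g (p.φ y))⁻¹ d b * p.L y ![α, β] b := by
    ext d; exact hp.covD_tan hy α β d
  rw [this, MultilinearMap.map_update_add, ev_update_sum,
    hp.ev_update_raise T v j hy (hp.isNField_L.normal y hy _)]

/-- The covariant derivative of the tangential components of an ambient tensor. -/
theorem nabla_ev {T : Tensor n r} (hT : SmoothTensor V T) (hy : y ∈ U) (ε : Fin k)
    (A : Fin r → Fin k) :
    nabla p.h (fun z A => ev (T (p.φ z)) fun j => p.tan z (A j)) y (Fin.cons ε A) =
      ev (nabla p.g T (p.φ y)) (Fin.cons (p.tan y ε) fun j => p.tan y (A j)) +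
        ∑ j, p.trN y fun a a' => p.L y ![ε, A j] a *
          ev (T (p.φ y)) (Function.update (fun j => p.tan y (A j)) j (p.nor y a')) := by
  have h1 : ∀ j γ, (fun l => p.tan y (Function.update A j γ l)) =
      Function.update (fun j => p.tan y (A j)) j (p.tan y γ) := by
    intro j γ; ext l : 1
    by_cases h : l = j
    · subst h; simp
    · simp [h]
  simp only [nabla, Fin.tail_cons, Fin.cons_zero, h1,
    hp.pd_ev hT (v := fun j z => p.tan z (A j)) (fun j a => hp.tan_smooth _ _) hy,
    hp.ev_update_covD_tan _ _ _ hy, Finset.sum_add_distrib]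
  ring

theorem isNField_slot {T : Tensor n (r + 1)} (hT : SmoothTensor V T) (q : Fin (r + 1)) :
    p.IsNField U (p.slot T q) where
  smooth A b := by
    have := hp.ev_smooth hT (v := fun j z => q.insertNth (α := fun _ => Fin n → ℝ) (p.nor z b)
      (fun j => p.tan z (A j)) j) (fun j a => by
        refine q.succAboveCases ?_ (fun j => ?_) j
        · simpa using hp.nor_smooth b a
        · simpa using hp.tan_smooth _ a)
    exact this
  normal y hy A α := by
    have h : ∀ b, p.slot T q y A b = ev (T (p.φ y)) (Function.update
        (q.insertNth (0 : Fin n → ℝ) fun j => p.tan y (A j)) q (p.nor y b)) := by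
      intro b; rw [slot, Fin.update_insertNth]
    simp only [h]
    rw [← ev_update_sum]
    refine MultilinearMap.map_coord_zero _ q ?_
    ext d
    simpa using hp.sum_tan_nor hy α d

/-- The covariant derivative of components of an ambient tensor with one normal slot. -/
theorem nablaN_slot {T : Tensor n (r + 1)} (hT : SmoothTensor V T) (q : Fin (r + 1)) (hy : y ∈ U)
    (ε : Fin k) (A : Fin r → Fin k) (b : Fin n) :
    p.nablaN (p.slot T q) y (Fin.cons ε A) b =
      ev (nabla p.g T (p.φ y))
        (Fin.cons (p.tan y ε) (q.insertNth (p.nor y b) fun j => p.tan y (A j))) +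
      (∑ j, p.trN y fun a a' => p.L y ![ε, A j] a * ev (T (p.φ y)) (q.insertNth (p.nor y b)
        (Function.update (fun j => p.tan y (A j)) j (p.nor y a')))) -
      p.trT y fun γ δ => p.L y ![ε, δ] b *
        ev (T (p.φ y)) (q.insertNth (p.tan y γ) fun j => p.tan y (A j)) := by
  have h1 : ∀ j γ, (fun l => p.tan y (Function.update A j γ l)) =
      Function.update (fun j => p.tan y (A j)) j (p.tan y γ) := by
    intro j γ; ext l : 1
    by_cases h : l = j
    · subst h; simp
    · simp [h]
  have h2 : ∀ (u : Fin n → ℝ) j w, Function.update (q.insertNth (α := fun _ => Fin n → ℝ) u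
      fun j => p.tan y (A j)) (q.succAbove j) w =
      q.insertNth u (Function.update (fun j => p.tan y (A j)) j w) := by
    intro u j w
    exact (Fin.insertNth_update (α := fun _ => Fin n → ℝ) q u j w (fun j => p.tan y (A j))).symm
  -- linearity in the slot `q`
  have hlin : ∀ {ι : Type} [Fintype ι] (T : (Fin (r + 1) → Fin n) → ℝ) (w : Fin r → Fin n → ℝ)
      (c : ι → ℝ) (u : ι → Fin n → ℝ), ∑ i, c i * ev T (q.insertNth (u i) w) =
        ev T (q.insertNth (fun d => ∑ i, c i * u i d) w) := by
    intro ι _ T w c u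
    have h := ev_update_sum T (q.insertNth (0 : Fin n → ℝ) w) q c u
    simpa only [Fin.update_insertNth] using h.symm
  have hnor : ∀ (T : (Fin (r + 1) → Fin n) → ℝ) (w : Fin r → Fin n → ℝ),
      ∑ c, p.nor y b c * ev T (q.insertNth (p.nor y c) w) = ev T (q.insertNth (p.nor y b) w) := by
    intro T w
    rw [hlin]
    congr 2
    ext d
    exact hp.sum_nor_nor hy b d
  have hnor' : ∑ c, p.nor y b c * ev (nabla p.g T (p.φ y)) (Fin.cons (p.tan y ε)
      (q.insertNth (p.nor y c) fun j => p.tan y (A j))) = ev (nabla p.g T (p.φ y))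
        (Fin.cons (p.tan y ε) (q.insertNth (p.nor y b) fun j => p.tan y (A j))) := by
    simp only [ev_cons, ← hnor _ (fun j => p.tan y (A j)), Finset.mul_sum]
    rw [Finset.sum_comm]
    exact Finset.sum_congr rfl fun a _ => Finset.sum_congr rfl fun b _ => by ring
  have hpd : ∀ c, pd (fun z => p.slot T q z A c) y ε =
      ev (nabla p.g T (p.φ y))
        (Fin.cons (p.tan y ε) (q.insertNth (p.nor y c) fun j => p.tan y (A j))) +
      (ev (T (p.φ y)) (q.insertNth (p.covD (fun z => p.nor z c) y ε) fun j => p.tan y (A j)) +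
      ((∑ j, ∑ γ, christoffel p.h y γ ε (A j) * p.slot T q y (Function.update A j γ) c) +
      ∑ j, p.trN y fun a a' => p.L y ![ε, A j] a * ev (T (p.φ y)) (q.insertNth (p.nor y c)
        (Function.update (fun j => p.tan y (A j)) j (p.nor y a'))))) := by
    intro c
    have := hp.pd_ev hT (v := fun j z => q.insertNth (α := fun _ => Fin n → ℝ) (p.nor z c)
      (fun j => p.tan z (A j)) j) (fun j a => by
        refine q.succAboveCases ?_ (fun j => ?_) j
        · simpa using hp.nor_smooth c a
        · simpa using hp.tan_smooth _ a) hy ε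
    rw [Fin.sum_univ_succAbove _ q] at this
    simp only [Fin.insertNth_apply_same, Fin.insertNth_apply_succAbove, Fin.update_insertNth] at this
    simp only [ hp.ev_update_covD_tan _ _ _ hy] at this
    simp only [h2, Finset.sum_add_distrib] at this
    simp only [slot, h1]
    exact this
  simp only [nablaN, Fin.tail_cons, Fin.cons_zero, hpd]
  have e1 : ∀ c, ∑ d, ∑ e, christoffel p.g (p.φ y) d e c * p.tan y ε e * p.slot T q y A d =
      ev (T (p.φ y)) (q.insertNth (fun f => ∑ d, (∑ e, christoffel p.g (p.φ y) d e c * p.tan y ε e) *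
        p.nor y d f) fun j => p.tan y (A j)) := by
    intro c
    rw [← hlin]
    simp only [slot, Finset.sum_mul]
  have e2 : ∀ c, ev (T (p.φ y)) (q.insertNth (p.covD (fun z => p.nor z c) y ε)
        fun j => p.tan y (A j)) -
      ∑ d, ∑ e, christoffel p.g (p.φ y) d e c * p.tan y ε e * p.slot T q y A d =
      ev (T (p.φ y)) (q.insertNth (fun f => p.covD (fun z => p.nor z c) y ε f -
        ∑ d, ∑ e, christoffel p.g (p.φ y) d e c * p.tan y ε e *
        p.nor y d f) fun j => p.tan y (A j)) := by
    intro c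
    rw [e1]
    have h := MultilinearMap.map_update_sub (ev (T (p.φ y)))
      (q.insertNth (0 : Fin n → ℝ) fun j => p.tan y (A j)) q
      (p.covD (fun z => p.nor z c) y ε) (fun f => ∑ d, (∑ e, christoffel p.g (p.φ y) d e c *
        p.tan y ε e) * p.nor y d f)
    simp only [Fin.update_insertNth] at h
    rw [← h]
    congr 2
    ext f
    simp only [Pi.sub_apply, Finset.sum_mul]
  have e3 : ∑ c, p.nor y b c * (ev (T (p.φ y)) (q.insertNth (p.covD (fun z => p.nor z c) y ε)
        fun j => p.tan y (A j)) -
      ∑ d, ∑ e, christoffel p.g (p.φ y) d e c * p.tan y ε e * p.slot T q y A d) =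
      - p.trT y fun γ δ => p.L y ![ε, δ] b *
        ev (T (p.φ y)) (q.insertNth (p.tan y γ) fun j => p.tan y (A j)) := by
    simp only [e2]
    rw [hlin]
    simp only [hp.sum_nor_covD_nor hy]
    have : (fun d => -∑ γ, ∑ δ, (p.h y)⁻¹ γ δ * p.L y ![ε, δ] b * p.tan y γ d) =
      fun d => ∑ γ, (∑ δ, -((p.h y)⁻¹ γ δ * p.L y ![ε, δ] b)) * p.tan y γ d := by
      ext d
      simp only [Finset.sum_mul, ← Finset.sum_neg_distrib, neg_mul]
    rw [this, ← hlin, trT, ← Finset.sum_neg_distrib]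
    refine Finset.sum_congr rfl fun γ _ => ?_
    rw [Finset.sum_mul, ← Finset.sum_neg_distrib]
    exact Finset.sum_congr rfl fun δ _ => by ring
  have e4 : ∑ c, p.nor y b c * ∑ j, p.trN y (fun a a' => p.L y ![ε, A j] a *
      ev (T (p.φ y)) (q.insertNth (p.nor y c)
        (Function.update (fun j => p.tan y (A j)) j (p.nor y a')))) =
      ∑ j, p.trN y fun a a' => p.L y ![ε, A j] a * ev (T (p.φ y)) (q.insertNth (p.nor y b)
        (Function.update (fun j => p.tan y (A j)) j (p.nor y a'))) := by
    simp only [← hnor _ (Function.update _ _ _), trN, Finset.mul_sum]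
    rw [Finset.sum_comm]
    refine Finset.sum_congr rfl fun j _ => ?_
    rw [Finset.sum_comm]
    refine Finset.sum_congr rfl fun a _ => ?_
    rw [Finset.sum_comm]
    exact Finset.sum_congr rfl fun a _ => Finset.sum_congr rfl fun b _ => by ring
  rw [← hnor', ← e4, sub_eq_add_neg, ← e3, ← Finset.sum_add_distrib, ← Finset.sum_add_distrib]
  exact Finset.sum_congr rfl fun c _ => by ring

end IsRegularOn

end Patch

end

end ConformalSubmanifold

namespace ConformalSubmanifold

open TopologicalSpace (Opens)

noncomputable section

namespace Patch

variable {k n r s t : ℕ} {p : Patch k n} {U : Opens (E k)} {V : Opens (E n)}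

/-! ### Calculus of fields with one normal index -/

namespace IsNField

variable {S T : NTensor k n r}

theorem sub (hS : p.IsNField U S) (hT : p.IsNField U T) :
    p.IsNField U fun z A b => S z A b - T z A b where
  smooth A b := (hS.smooth A b).sub (hT.smooth A b)
  normal y hy A α := by
    simp only [mul_sub, Finset.sum_sub_distrib, hS.normal y hy, hT.normal y hy, sub_zero]

theorem mul {S : Tensor k s} {T : NTensor k n t} (hS : SmoothTensor U S) (hT : p.IsNField U T)
    (i : Fin s → Fin r) (j : Fin t → Fin r) :
    p.IsNField U fun z A b => S z (A ∘ i) * T z (A ∘ j) b where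
  smooth A b := (hS _).mul (hT.smooth _ b)
  normal y hy A α := by
    rw [← mul_zero (S y (A ∘ i)), ← hT.normal y hy (A ∘ j) α, Finset.mul_sum]
    exact Finset.sum_congr rfl fun a _ => by ring

theorem const_mul (hT : p.IsNField U T) (c : ℝ) : p.IsNField U fun z A b => c * T z A b where
  smooth A b := (hT.smooth A b).const_mul c
  normal y hy A α := by
    rw [← mul_zero c, ← hT.normal y hy A α, Finset.mul_sum]
    exact Finset.sum_congr rfl fun a _ => by ring

theorem perm {T : NTensor k n s} (hT : p.IsNField U T) (σ : Fin s → Fin r) :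
    p.IsNField U fun z A b => T z (A ∘ σ) b where
  smooth _ b := hT.smooth _ b
  normal y hy _ α := hT.normal y hy _ α

theorem trace {T : NTensor k n (r + 2)} (hT : p.IsNField U T) (hp : p.IsRegularOn U V) :
    p.IsNField U fun z A b => p.trT z fun β β' => T z (Fin.cons β (Fin.cons β' A)) b where
  smooth A b := ctr_smooth' hp.induced fun _ _ => hT.smooth _ b
  normal y hy A α := by
    simp only [trT_eq, ← ctr_mul_left]
    rw [← ctr_sum]
    simp only [hT.normal y hy, ctr_zero]

end IsNField

namespace IsRegularOn

variable (hp : p.IsRegularOn U V) {y : E k}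

omit hp in
theorem nablaN_congr {S T : NTensor k n r} (h : ∀ z ∈ U, ∀ A b, S z A b = T z A b) (hy : y ∈ U)
    (A : Fin (r + 1) → Fin k) (b : Fin n) : p.nablaN S y A b = p.nablaN T y A b := by
  simp only [nablaN_eq, dN, h y hy]
  refine Finset.sum_congr rfl fun c _ => ?_
  rw [nabla_congr (fun z hz A => h z hz A c) hy]

omit hp in
theorem nablaN_sub {S T : NTensor k n r} (hS : p.IsNField U S) (hT : p.IsNField U T) (hy : y ∈ U)
    (A : Fin (r + 1) → Fin k) (b : Fin n) :
    p.nablaN (fun z A b => S z A b - T z A b) y A b = p.nablaN S y A b - p.nablaN T y A b := by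
  simp only [nablaN_eq, dN, nabla_sub (fun A => hS.smooth A _) (fun A => hT.smooth A _) hy,
    mul_sub, Finset.sum_sub_distrib]
  ring

omit hp in
theorem nablaN_const_mul {T : NTensor k n r} (c : ℝ) (hT : p.IsNField U T) (hy : y ∈ U)
    (A : Fin (r + 1) → Fin k) (b : Fin n) :
    p.nablaN (fun z A b => c * T z A b) y A b = c * p.nablaN T y A b := by
  simp only [nablaN_eq, dN, nabla_const_mul c (fun A => hT.smooth A _) hy,
    mul_sub, Finset.sum_sub_distrib, Finset.mul_sum, mul_left_comm _ c]

omit hp in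
theorem nablaN_perm (T : NTensor k n s) {σ : Fin s → Fin r} (hσ : Function.Bijective σ) (e : Fin k)
    (A : Fin r → Fin k) (b : Fin n) :
    p.nablaN (fun z A b => T z (A ∘ σ) b) y (Fin.cons e A) b =
      p.nablaN T y (Fin.cons e (A ∘ σ)) b := by
  simp only [nablaN_eq, dN, Fin.tail_cons, Fin.cons_zero]
  exact Finset.sum_congr rfl fun c _ => by rw [nabla_perm (fun z A => T z A c) hσ]

include hp

theorem nablaN_mul {S : Tensor k s} {T : NTensor k n t} (hS : SmoothTensor U S)
    (hT : p.IsNField U T) {i : Fin s → Fin r} {j : Fin t → Fin r}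
    (hij : Function.Bijective (Sum.elim i j)) (hy : y ∈ U) (e : Fin k) (A : Fin r → Fin k)
    (b : Fin n) :
    p.nablaN (fun z A b => S z (A ∘ i) * T z (A ∘ j) b) y (Fin.cons e A) b =
      nabla p.h S y (Fin.cons e (A ∘ i)) * T y (A ∘ j) b +
        S y (A ∘ i) * p.nablaN T y (Fin.cons e (A ∘ j)) b := by
  rw [← hp.sum_nor_field hT hy (A ∘ j) b]
  simp only [nablaN_eq, dN, Fin.tail_cons, Fin.cons_zero, Finset.mul_sum, mul_sub,
    ← Finset.sum_add_distrib]
  refine Finset.sum_congr rfl fun c _ => ?_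
  rw [nabla_mul hS (T := fun z A => T z A c) (fun A => hT.smooth A c) hij hy]
  have : ∀ d e, p.nor y b c * (christoffel p.g (p.φ y) d e c * p.tan y ‹_› e *
      (S y (A ∘ i) * T y (A ∘ j) d)) = S y (A ∘ i) * (p.nor y b c * (christoffel p.g (p.φ y) d e c *
        p.tan y ‹_› e * T y (A ∘ j) d)) := fun d e => by ring
  simp only [this]
  ring

theorem nablaN_trace {T : NTensor k n (r + 2)} (hT : p.IsNField U T) (hy : y ∈ U) (e : Fin k)
    (A : Fin r → Fin k) (b : Fin n) :
    p.nablaN (fun z A b => p.trT z fun β β' => T z (Fin.cons β (Fin.cons β' A)) b) y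
        (Fin.cons e A) b =
      p.trT y fun β β' => p.nablaN T y (Fin.cons e (Fin.cons β (Fin.cons β' A))) b := by
  simp only [nablaN_eq, dN, Fin.tail_cons, Fin.cons_zero, trT_eq]
  rw [ctr_sum]
  refine Finset.sum_congr rfl fun c _ => ?_
  rw [nabla_trace hp.induced (T := fun z A => T z A c) (fun A => hT.smooth A c) hy, ctr_mul_left,
    ctr_sub, ctr_sum]
  simp only [ctr_sum, ctr_mul_left]

/-- The product rule for the contraction of two normal indices. -/
theorem nabla_trN {S : NTensor k n s} {T : NTensor k n t} (hS : p.IsNField U S)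
    (hT : p.IsNField U T) {i : Fin s → Fin r} {j : Fin t → Fin r}
    (hij : Function.Bijective (Sum.elim i j)) (hy : y ∈ U) (e : Fin k) (A : Fin r → Fin k) :
    nabla p.h (fun z A => p.trN z fun a a' => S z (A ∘ i) a * T z (A ∘ j) a') y (Fin.cons e A) =
      (p.trN y fun a a' => p.nablaN S y (Fin.cons e (A ∘ i)) a * T y (A ∘ j) a') +
      p.trN y fun a a' => S y (A ∘ i) a * p.nablaN T y (Fin.cons e (A ∘ j)) a' := by
  have hg : ∀ a b, SmoothOn U fun z => (p.g (p.φ z))⁻¹ a b := fun a b =>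
    hp.comp_smooth (hp.metric.inv_smooth a b)
  have hprod : ∀ a b, SmoothTensor U fun z (A : Fin r → Fin k) => S z (A ∘ i) a * T z (A ∘ j) b :=
    fun a b A => (hS.smooth _ a).mul (hT.smooth _ b)
  have h1 : nabla p.h (fun z A => p.trN z fun a a' => S z (A ∘ i) a * T z (A ∘ j) a') y
      (Fin.cons e A) = ∑ a, ∑ b, (pd (fun z => (p.g (p.φ z))⁻¹ a b) y e *
        (S y (A ∘ i) a * T y (A ∘ j) b) + (p.g (p.φ y))⁻¹ a b *
        (nabla p.h (fun z A => S z A a) y (Fin.cons e (A ∘ i)) * T y (A ∘ j) b +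
          S y (A ∘ i) a * nabla p.h (fun z A => T z A b) y (Fin.cons e (A ∘ j)))) := by
    simp only [trN]
    rw [nabla_sum (T := fun a z A => ∑ b, (p.g (p.φ z))⁻¹ a b * (S z (A ∘ i) a * T z (A ∘ j) b))
      (fun a A => SmoothOn.sum fun b => (hg a b).mul (hprod a b A)) hy]
    refine Finset.sum_congr rfl fun a _ => ?_
    rw [nabla_sum (T := fun b z A => (p.g (p.φ z))⁻¹ a b * (S z (A ∘ i) a * T z (A ∘ j) b))
      (fun b A => (hg a b).mul (hprod a b A)) hy]
    refine Finset.sum_congr rfl fun b _ => ?_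
    rw [nabla_fun_mul (hg a b) (hprod a b) hy, nabla_mul (S := fun z A => S z A a)
      (T := fun z A => T z A b) (fun A => hS.smooth A a) (fun A => hT.smooth A b) hij hy]
  have h2 : (p.trN y fun a a' => p.nablaN S y (Fin.cons e (A ∘ i)) a * T y (A ∘ j) a') =
      p.trN y fun a a' => p.dN S y (Fin.cons e (A ∘ i)) a * T y (A ∘ j) a' :=
    hp.ctr_nor hy _ _ (hT.normal y hy _)
  have h3 : (p.trN y fun a a' => S y (A ∘ i) a * p.nablaN T y (Fin.cons e (A ∘ j)) a') =
      p.trN y fun a a' => S y (A ∘ i) a * p.dN T y (Fin.cons e (A ∘ j)) a' := by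
    have := hp.ctr_nor hy (p.dN T y (Fin.cons e (A ∘ j))) (S y (A ∘ i)) (hS.normal y hy _)
    simp only [trN_eq]
    rw [ctr_swap hp.metric (hp.maps y hy), ctr_swap hp.metric (hp.maps y hy)
      (fun a a' => S y (A ∘ i) a * p.dN T y (Fin.cons e (A ∘ j)) a')]
    simp only [mul_comm (S y (A ∘ i) _)]
    exact this
  rw [h1, h2, h3]
  simp only [hp.pd_comp (hp.metric.inv_smooth _ _) hy, hp.metric.pd_inv (hp.maps y hy), trN, dN,
    Fin.tail_cons, Fin.cons_zero]
  have e1 : ∑ a, ∑ b, (∑ c, p.tan y e c * ∑ d, christoffel p.g (p.φ y) a c d *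
      (p.g (p.φ y))⁻¹ d b) * (S y (A ∘ i) a * T y (A ∘ j) b) =
      ∑ a, ∑ b, (p.g (p.φ y))⁻¹ a b * ((∑ d, ∑ f, christoffel p.g (p.φ y) d f a * p.tan y e f *
        S y (A ∘ i) d) * T y (A ∘ j) b) := by
    rw [Finset.sum_comm, Finset.sum_comm (f := fun a b => (p.g (p.φ y))⁻¹ a b * _)]
    refine Finset.sum_congr rfl fun b _ => ?_
    simp only [Finset.mul_sum, Finset.sum_mul]
    calc _ = ∑ d, ∑ a, ∑ c, p.tan y e c * (christoffel p.g (p.φ y) a c d *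
          (p.g (p.φ y))⁻¹ d b) * (S y (A ∘ i) a * T y (A ∘ j) b) := by
          rw [Finset.sum_congr rfl fun a _ => Finset.sum_comm, Finset.sum_comm]
      _ = _ := Finset.sum_congr rfl fun d _ => Finset.sum_congr rfl fun a _ =>
          Finset.sum_congr rfl fun c _ => by ring
  have e2 : ∑ a, ∑ b, (∑ c, p.tan y e c * ∑ d, christoffel p.g (p.φ y) b c d *
      (p.g (p.φ y))⁻¹ a d) * (S y (A ∘ i) a * T y (A ∘ j) b) =
      ∑ a, ∑ b, (p.g (p.φ y))⁻¹ a b * (S y (A ∘ i) a * (∑ d, ∑ f, christoffel p.g (p.φ y) d f b *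
        p.tan y e f * T y (A ∘ j) d)) := by
    refine Finset.sum_congr rfl fun b _ => ?_
    simp only [Finset.mul_sum, Finset.sum_mul]
    calc _ = ∑ d, ∑ a, ∑ c, p.tan y e c * (christoffel p.g (p.φ y) a c d *
          (p.g (p.φ y))⁻¹ b d) * (S y (A ∘ i) b * T y (A ∘ j) a) := by
          rw [Finset.sum_congr rfl fun a _ => Finset.sum_comm, Finset.sum_comm]
      _ = _ := Finset.sum_congr rfl fun d _ => Finset.sum_congr rfl fun a _ =>
          Finset.sum_congr rfl fun c _ => by ring
  simp only [mul_sub, sub_mul, mul_add, mul_neg, neg_mul, Finset.sum_add_distrib,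
    Finset.sum_sub_distrib, Finset.sum_neg_distrib, e1, e2]
  ring

end IsRegularOn

end Patch

end

end ConformalSubmanifold

namespace ConformalSubmanifold

open TopologicalSpace (Opens)

noncomputable section

namespace Patch

open Sum (inl inr)

variable {k n r s t : ℕ} {p : Patch k n} {U : Opens (E k)} {V : Opens (E n)}

namespace IsRegularOn

variable (hp : p.IsRegularOn U V) {y : E k}

include hp

/-! ### The equations of Gauss and Codazzi -/

theorem covD_comm {v : E k → Fin n → ℝ} (hv : ∀ a, SmoothOn U fun z => v z a) (hy : y ∈ U)
    (ε α : Fin k) (d : Fin n) :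
    p.covD (fun z => p.covD v z α) y ε d - p.covD (fun z => p.covD v z ε) y α d =
      -∑ a, ∑ b, ∑ c, p.tan y ε a * p.tan y α b * v y c * riemUp p.g (p.φ y) a b c d := by
  have hΓ : ∀ a b c, SmoothOn U fun z => christoffel p.g (p.φ z) a b c := fun a b c =>
    hp.comp_smooth (hp.metric.christoffel_smooth a b c)
  have key : ∀ ε α, p.covD (fun z => p.covD v z α) y ε d =
      pd (fun z => pd (fun z => v z d) z α) y ε +
      (∑ a, ∑ b, ∑ c, p.tan y ε a * p.tan y α b * v y c *
        pd (fun z => christoffel p.g z d b c) (p.φ y) a) +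
      (∑ e, ∑ f, christoffel p.g (p.φ y) d e f * pd (fun z => p.tan z α e) y ε * v y f) +
      (∑ e, ∑ f, christoffel p.g (p.φ y) d e f * p.tan y α e * pd (fun z => v z f) y ε) +
      (∑ e, ∑ f, christoffel p.g (p.φ y) d e f * p.tan y ε e * pd (fun z => v z f) y α) +
      ∑ a, ∑ b, ∑ c, p.tan y ε a * p.tan y α b * v y c *
        ∑ e, christoffel p.g (p.φ y) e b c * christoffel p.g (p.φ y) d a e := by
    intro ε α
    simp only [covD]
    rw [pd_add ((hv d).pd α) (SmoothOn.sum fun e => SmoothOn.sum fun f =>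
      ((hΓ d e f).mul (hp.tan_smooth α e)).mul (hv f)) hy,
      pd_sum (fun e => SmoothOn.sum fun f => ((hΓ d e f).mul (hp.tan_smooth α e)).mul (hv f)) hy]
    simp only [pd_sum (fun f => ((hΓ d _ f).mul (hp.tan_smooth α _)).mul (hv f)) hy,
      pd_mul ((hΓ d _ _).mul (hp.tan_smooth α _)) (hv _) hy,
      pd_mul (hΓ d _ _) (hp.tan_smooth α _) hy,
      hp.pd_comp (hp.metric.christoffel_smooth _ _ _) hy, add_mul, mul_add,
      Finset.sum_add_distrib]
    have e1 : ∑ e, ∑ f, (∑ c, p.tan y ε c * pd (fun z => christoffel p.g z d e f) (p.φ y) c) *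
        p.tan y α e * v y f = ∑ a, ∑ b, ∑ c, p.tan y ε a * p.tan y α b * v y c *
        pd (fun z => christoffel p.g z d b c) (p.φ y) a := by
      simp only [Finset.sum_mul]
      rw [Finset.sum_congr rfl fun e _ => Finset.sum_comm, Finset.sum_comm]
      exact Finset.sum_congr rfl fun c _ => Finset.sum_congr rfl fun d _ =>
          Finset.sum_congr rfl fun e _ => by ring
    have e2 : ∑ e, ∑ f, christoffel p.g (p.φ y) d e f * p.tan y ε e *
        (∑ a, ∑ b, christoffel p.g (p.φ y) f a b * p.tan y α a * v y b) =
        ∑ a, ∑ b, ∑ c, p.tan y ε a * p.tan y α b * v y c *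
        ∑ e, christoffel p.g (p.φ y) e b c * christoffel p.g (p.φ y) d a e := by
      refine Finset.sum_congr rfl fun e _ => ?_
      simp only [Finset.mul_sum]
      rw [Finset.sum_comm]
      refine Finset.sum_congr rfl fun b _ => ?_
      rw [Finset.sum_comm]
      exact Finset.sum_congr rfl fun c _ => Finset.sum_congr rfl fun d _ => by ring
    rw [e1, e2]
    ring
  have htan : ∀ e, pd (fun z => p.tan z α e) y ε = pd (fun z => p.tan z ε e) y α := fun e =>
    pd_comm (hp.smooth e) hy _ _
  have hswap : ∀ f : Fin n → Fin n → Fin n → ℝ, ∑ a, ∑ b, ∑ c, p.tan y α a * p.tan y ε b * v y c *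
      f a b c = ∑ a, ∑ b, ∑ c, p.tan y ε a * p.tan y α b * v y c * f b a c := by
    intro f
    rw [Finset.sum_comm]
    exact Finset.sum_congr rfl fun c _ => Finset.sum_congr rfl fun d _ =>
          Finset.sum_congr rfl fun e _ => by ring
  rw [key ε α, key α ε, hswap, hswap, pd_comm (hv d) hy]
  simp only [riemUp, htan, mul_add, mul_sub, Finset.sum_add_distrib, Finset.sum_sub_distrib]
  ring

/-- The equation of Codazzi. -/
theorem codazzi (hy : y ∈ U) (ε α β : Fin k) (b : Fin n) :
    p.nablaN p.L y ![ε, α, β] b - p.nablaN p.L y ![α, ε, β] b =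
      -p.proj (riem p.g) y ![inl ε, inl α, inl β, inr b] := by
  let X : Fin k → Fin k → E k → Fin n → ℝ := fun α β z => p.covD (fun z => p.tan z β) z α
  have hX : ∀ α β a, SmoothOn U fun z => X α β z a := fun α β a =>
    hp.covD_smooth (fun a => hp.tan_smooth β a) α a
  have hlow : ∀ {v : E k → Fin n → ℝ}, (∀ a, SmoothOn U fun z => v z a) → ∀ c,
      SmoothOn U fun z => ∑ d, v z d * p.g (p.φ z) d c := fun hv c =>
    SmoothOn.sum fun d => (hv d).mul (hp.comp_smooth (hp.metric.smooth d c))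
  have hip : ∀ v, ∑ c, p.nor y b c * ∑ d, v d * p.g (p.φ y) d c = p.ip y (p.nor y b) v := by
    intro v
    simp only [ip, Finset.mul_sum]
    exact Finset.sum_congr rfl fun c _ => Finset.sum_congr rfl fun d _ => by
      rw [hp.metric.symm (hp.maps y hy) d c]; ring
  have hL : ∀ z ∈ U, ∀ α β c, p.L z ![α, β] c = (∑ d, X α β z d * p.g (p.φ z) d c) -
      ∑ γ, christoffel p.h z γ α β * ∑ d, p.tan z γ d * p.g (p.φ z) d c := by
    intro z hz α β c
    have h1 : ∀ d, X α β z d = (∑ γ, christoffel p.h z γ α β * p.tan z γ d) + p.Lup z α β d :=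
      hp.covD_tan hz α β
    have h2 : ∑ d, p.Lup z α β d * p.g (p.φ z) d c = p.L z ![α, β] c := by
      simp only [Lup, Finset.sum_mul]
      rw [Finset.sum_comm]
      have h3 : ∀ a, ∑ d, (p.g (p.φ z))⁻¹ d a * p.g (p.φ z) d c = if a = c then 1 else 0 := by
        intro a
        rw [← hp.metric.sum_inv_mul (hp.maps z hz)]
        exact Finset.sum_congr rfl fun d _ => by rw [hp.metric.inv_symm (hp.maps z hz) d a]
      simp only [fun a d => mul_right_comm ((p.g (p.φ z))⁻¹ d a) (p.L z ![α, β] a)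
        (p.g (p.φ z) d c), ← Finset.sum_mul, h3]
      simp
    simp only [h1, add_mul, Finset.sum_add_distrib, h2, Finset.sum_mul, Finset.mul_sum]
    rw [Finset.sum_comm]
    simp only [mul_assoc]
    ring
  have key : ∀ ε α, p.nablaN p.L y ![ε, α, β] b =
      p.ip y (p.nor y b) (p.covD (X α β) y ε) -
      (∑ γ, christoffel p.h y γ α β * p.L y ![ε, γ] b) -
      (∑ γ, christoffel p.h y γ ε α * p.L y ![γ, β] b) -
      ∑ γ, christoffel p.h y γ ε β * p.L y ![α, γ] b := by
    intro ε α
    have h1 : ∀ c, pd (fun z => p.L z ![α, β] c) y ε = pd (fun z => ∑ d, X α β z d *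
        p.g (p.φ z) d c) y ε - ∑ γ, (pd (fun z => christoffel p.h z γ α β) y ε *
          (∑ d, p.tan y γ d * p.g (p.φ y) d c) + christoffel p.h y γ α β *
            pd (fun z => ∑ d, p.tan z γ d * p.g (p.φ z) d c) y ε) := by
      intro c
      have hs : ∀ γ, SmoothOn U fun z => christoffel p.h z γ α β *
          ∑ d, p.tan z γ d * p.g (p.φ z) d c := fun γ =>
        (hp.induced.christoffel_smooth _ _ _).mul (hlow (fun a => hp.tan_smooth γ a) c)
      rw [pd_congr (fun z hz => hL z hz α β c) hy, pd_sub (hlow (hX α β) c) (SmoothOn.sum hs) hy,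
        pd_sum hs hy]
      simp only [pd_mul (hp.induced.christoffel_smooth _ _ _)
        (hlow (fun a => hp.tan_smooth _ a) c) hy]
    have h2 : ∀ c, p.dN p.L y ![ε, α, β] c = (∑ d, p.covD (X α β) y ε d * p.g (p.φ y) d c) -
        (∑ γ, pd (fun z => christoffel p.h z γ α β) y ε *
          (∑ d, p.tan y γ d * p.g (p.φ y) d c)) -
        (∑ γ, christoffel p.h y γ α β * ∑ d, X ε γ y d * p.g (p.φ y) d c) -
        (∑ γ, christoffel p.h y γ ε α * p.L y ![γ, β] c) -
        ∑ γ, christoffel p.h y γ ε β * p.L y ![α, γ] c := by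
      intro c
      rw [← hp.pd_lower (hX α β) hy]
      have h3 : ∀ γ, ∑ d, X ε γ y d * p.g (p.φ y) d c = _ := fun γ =>
        (hp.pd_lower (fun a => hp.tan_smooth γ a) hy ε c).symm
      have h4 : Fin.tail ![ε, α, β] = ![α, β] := rfl
      have h5 : ∀ γ, Function.update ![α, β] 0 γ = ![γ, β] := fun γ => by
        ext i; fin_cases i <;> rfl
      have h6 : ∀ γ, Function.update ![α, β] 1 γ = ![α, γ] := fun γ => by
        ext i; fin_cases i <;> rfl
      simp only [dN, nabla, h4, Fin.sum_univ_two, h5, h6, h3, Matrix.cons_val_zero,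
        Matrix.cons_val_one, h1]
      have h7 : ∑ d, ∑ e, christoffel p.g (p.φ y) d e c * p.tan y ε e * p.L y ![α, β] d =
          (∑ d, ∑ e, christoffel p.g (p.φ y) d e c * p.tan y ε e *
            ∑ f, X α β y f * p.g (p.φ y) f d) - ∑ γ, christoffel p.h y γ α β *
            ∑ d, ∑ e, christoffel p.g (p.φ y) d e c * p.tan y ε e *
              ∑ f, p.tan y γ f * p.g (p.φ y) f d := by
        simp only [hL y hy, mul_sub, Finset.sum_sub_distrib]
        congr 1
        simp only [Finset.mul_sum]
        rw [Finset.sum_congr rfl fun d _ => Finset.sum_comm, Finset.sum_comm]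
        exact Finset.sum_congr rfl fun c _ => Finset.sum_congr rfl fun d _ =>
          Finset.sum_congr rfl fun e _ => Finset.sum_congr rfl fun f _ => by ring
      rw [h7]
      simp only [mul_sub, Finset.sum_add_distrib, Finset.sum_sub_distrib]
      ring
    have hpull : ∀ (c' : Fin k → ℝ) (f : Fin k → Fin n → ℝ),
        ∑ c, p.nor y b c * ∑ γ, c' γ * f γ c = ∑ γ, c' γ * ∑ c, p.nor y b c * f γ c := by
      intro c' f
      simp only [Finset.mul_sum]
      rw [Finset.sum_comm]
      exact Finset.sum_congr rfl fun c _ => Finset.sum_congr rfl fun d _ => by ring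
    have hLL : ∀ A, ∑ c, p.nor y b c * p.L y A c = p.L y A b := fun A =>
      hp.sum_nor_field hp.isNField_L hy A b
    rw [nablaN_eq]
    simp only [h2, mul_sub, Finset.sum_sub_distrib, hpull, hip, hp.ip_nor_tan hy, hLL, X,
      ← L_eq_ip, mul_zero, Finset.sum_const_zero, sub_zero]
  have hcom : p.ip y (p.nor y b) (p.covD (X α β) y ε) - p.ip y (p.nor y b) (p.covD (X ε β) y α) =
      -p.proj (riem p.g) y ![inl ε, inl α, inl β, inr b] := by
    have h1 := hp.covD_comm (fun a => hp.tan_smooth β a) hy ε α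
    have h2 : p.ip y (p.nor y b) (p.covD (X α β) y ε) - p.ip y (p.nor y b) (p.covD (X ε β) y α) =
        p.ip y (p.nor y b) (fun d => p.covD (X α β) y ε d - p.covD (X ε β) y α d) := by
      simp only [ip, mul_sub, Finset.sum_sub_distrib]
    have h3 : p.proj (riem p.g) y ![inl ε, inl α, inl β, inr b] =
        ev (riem p.g (p.φ y)) ![p.tan y ε, p.tan y α, p.tan y β, p.nor y b] := by
      rw [proj_eq_ev]
      exact ev_comp _ _ _ fun j => by fin_cases j <;> rfl
    rw [h2, h3, ev_four]
    simp only [X, h1, ip, riem, Matrix.cons_val, mul_neg, Finset.sum_neg_distrib, Finset.mul_sum]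
    rw [neg_inj, sum_comm_two_two]
    refine Finset.sum_congr rfl fun a _ => Finset.sum_congr rfl fun b _ => ?_
    rw [Finset.sum_congr rfl fun d _ => Finset.sum_comm, Finset.sum_comm]
    exact Finset.sum_congr rfl fun c _ => Finset.sum_congr rfl fun d _ =>
      Finset.sum_congr rfl fun e _ => by ring
  have hsy := hp.induced.christoffel_symm hy
  rw [key ε α, key α ε, ← hcom]
  simp only [hsy _ α ε]
  ring

theorem sum_tan_Lup (hy : y ∈ U) (γ α β : Fin k) : p.ip y (p.tan y γ) (p.Lup y α β) = 0 := by
  refine (hp.ip_raise hy _ _).trans ?_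
  exact hp.isNField_L.normal y hy _ γ

theorem ip_Lup_Lup (hy : y ∈ U) (α β γ δ : Fin k) :
    p.ip y (p.Lup y α β) (p.Lup y γ δ) = p.trN y fun a a' => p.L y ![α, β] a * p.L y ![γ, δ] a' := by
  refine (hp.ip_raise hy _ _).trans ?_
  simp only [Lup, trN, Finset.sum_mul]
  rw [Finset.sum_comm]
  exact Finset.sum_congr rfl fun c _ => Finset.sum_congr rfl fun d _ => by
    rw [hp.metric.inv_symm (hp.maps y hy) d c]; ring

/-- The equation of Gauss. -/
theorem gauss (hy : y ∈ U) (ε α β δ : Fin k) :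
    riem p.h y ![ε, α, β, δ] = p.proj (riem p.g) y ![inl ε, inl α, inl β, inl δ] -
      (p.trN y fun a a' => p.L y ![ε, δ] a * p.L y ![α, β] a') +
      p.trN y fun a a' => p.L y ![α, δ] a * p.L y ![ε, β] a' := by
  let X : Fin k → Fin k → E k → Fin n → ℝ := fun α β z => p.covD (fun z => p.tan z β) z α
  have hX : ∀ α β a, SmoothOn U fun z => X α β z a := fun α β a =>
    hp.covD_smooth (fun a => hp.tan_smooth β a) α a
  have hXX : ∀ ε δ α β, p.ip y (X ε δ y) (X α β y) =
      (∑ γ, christoffel p.h y γ ε δ * ∑ σ, p.h y γ σ * christoffel p.h y σ α β) +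
      p.trN y fun a a' => p.L y ![ε, δ] a * p.L y ![α, β] a' := by
    intro ε δ α β
    have h1 : X ε δ y = fun d => (∑ γ, christoffel p.h y γ ε δ * p.tan y γ d) + p.Lup y ε δ d := by
      ext d; exact hp.covD_tan hy ε δ d
    have h2 : X α β y = fun d => p.Lup y α β d + ∑ γ, christoffel p.h y γ α β * p.tan y γ d := by
      ext d; rw [add_comm]; exact hp.covD_tan hy α β d
    rw [h1, ip_add_left, ip_sum_left]
    simp only [X, hp.ip_tan_covD hy]
    congr 1
    change p.ip y (p.Lup y ε δ) (X α β y) = _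
    rw [h2, hp.ip_comm hy, ip_add_left, ip_sum_left]
    simp only [hp.sum_tan_Lup hy, mul_zero, Finset.sum_const_zero, add_zero]
    rw [hp.ip_comm hy]
    exact hp.ip_Lup_Lup hy _ _ _ _
  have key : ∀ ε α, p.ip y (p.tan y δ) (p.covD (X α β) y ε) =
      (∑ γ, p.h y δ γ * (pd (fun z => christoffel p.h z γ α β) y ε +
        ∑ σ, christoffel p.h y σ α β * christoffel p.h y γ ε σ)) -
      p.trN y fun a a' => p.L y ![ε, δ] a * p.L y ![α, β] a' := by
    intro ε α
    have h1 := hp.pd_ip (u := fun z => p.tan z δ) (v := X α β) (fun a => hp.tan_smooth δ a)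
      (hX α β) hy ε
    have h2 : ∀ z ∈ U, p.ip z (p.tan z δ) (X α β z) = _ := fun z hz => hp.ip_tan_covD hz δ α β
    rw [pd_congr h2 hy, pd_sum (fun γ => (hp.induced.smooth δ γ).mul
      (hp.induced.christoffel_smooth γ α β)) hy] at h1
    simp only [pd_mul (hp.induced.smooth δ _) (hp.induced.christoffel_smooth _ α β) hy,
      hp.induced.pd_metric hy] at h1
    have h3 := hXX ε δ α β
    have h4 := eq_sub_of_add_eq' h1.symm
    refine h4.trans ?_
    change _ - p.ip y (X ε δ y) (X α β y) = _
    rw [h3]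
    simp only [add_mul, mul_add, Finset.sum_add_distrib]
    have e1 : ∑ γ, (∑ d, christoffel p.h y d ε δ * p.h y d γ) * christoffel p.h y γ α β =
        ∑ γ, christoffel p.h y γ ε δ * ∑ σ, p.h y γ σ * christoffel p.h y σ α β := by
      simp only [Finset.mul_sum, Finset.sum_mul]
      rw [Finset.sum_comm]
      exact Finset.sum_congr rfl fun c _ => Finset.sum_congr rfl fun d _ => by ring
    have e2 : ∑ γ, (∑ d, christoffel p.h y d ε γ * p.h y δ d) * christoffel p.h y γ α β =
        ∑ γ, p.h y δ γ * ∑ σ, christoffel p.h y σ α β * christoffel p.h y γ ε σ := by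
      simp only [Finset.mul_sum, Finset.sum_mul]
      rw [Finset.sum_comm]
      exact Finset.sum_congr rfl fun c _ => Finset.sum_congr rfl fun d _ => by ring
    rw [e1, e2]
    ring
  have hcom : p.ip y (p.tan y δ) (p.covD (X α β) y ε) - p.ip y (p.tan y δ) (p.covD (X ε β) y α) =
      -p.proj (riem p.g) y ![inl ε, inl α, inl β, inl δ] := by
    have h1 := hp.covD_comm (fun a => hp.tan_smooth β a) hy ε α
    have h2 : p.ip y (p.tan y δ) (p.covD (X α β) y ε) - p.ip y (p.tan y δ) (p.covD (X ε β) y α) =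
        p.ip y (p.tan y δ) (fun d => p.covD (X α β) y ε d - p.covD (X ε β) y α d) := by
      simp only [ip, mul_sub, Finset.sum_sub_distrib]
    have h3 : p.proj (riem p.g) y ![inl ε, inl α, inl β, inl δ] =
        ev (riem p.g (p.φ y)) ![p.tan y ε, p.tan y α, p.tan y β, p.tan y δ] := by
      rw [proj_eq_ev]
      exact ev_comp _ _ _ fun j => by fin_cases j <;> rfl
    rw [h2, h3, ev_four]
    simp only [X, h1, ip, riem, Matrix.cons_val, mul_neg, Finset.sum_neg_distrib, Finset.mul_sum]
    rw [neg_inj, sum_comm_two_two]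
    refine Finset.sum_congr rfl fun a _ => Finset.sum_congr rfl fun b _ => ?_
    rw [Finset.sum_congr rfl fun d _ => Finset.sum_comm, Finset.sum_comm]
    exact Finset.sum_congr rfl fun c _ => Finset.sum_congr rfl fun d _ =>
      Finset.sum_congr rfl fun e _ => by ring
  rw [key ε α, key α ε] at hcom
  have hr : riem p.h y ![ε, α, β, δ] = (∑ γ, p.h y δ γ * (pd (fun z => christoffel p.h z γ ε β) y α +
        ∑ σ, christoffel p.h y σ ε β * christoffel p.h y γ α σ)) -
      ∑ γ, p.h y δ γ * (pd (fun z => christoffel p.h z γ α β) y ε +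
        ∑ σ, christoffel p.h y σ α β * christoffel p.h y γ ε σ) := by
    simp only [riem, riemUp, Matrix.cons_val, ← Finset.sum_sub_distrib]
    refine Finset.sum_congr rfl fun γ _ => ?_
    rw [Finset.sum_sub_distrib]
    ring
  rw [hr]
  linarith

end IsRegularOn

end Patch

end

end ConformalSubmanifold

namespace ConformalSubmanifold

open TopologicalSpace (Opens)

noncomputable section

namespace Patch

open Sum (inl inr)

variable {k n r s t : ℕ} {p : Patch k n} {U : Opens (E k)} {V : Opens (E n)} {y : E k}

/-! ### Algebra of projections -/

theorem proj_perm (T : Tensor n r) (σ : Equiv.Perm (Fin r)) (i : Fin r → Index k n) :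
    p.proj (fun x a => T x (a ∘ σ)) y i = p.proj T y (i ∘ σ) := by
  simp only [proj]
  rw [← (Equiv.arrowCongr σ (Equiv.refl (Fin n))).sum_comp]
  refine Finset.sum_congr rfl fun a _ => ?_
  have h1 : (Equiv.arrowCongr σ (Equiv.refl (Fin n))) a ∘ σ = a := by ext; simp
  rw [h1, ← Equiv.prod_comp σ]
  simp

theorem proj_add (S T : Tensor n r) (i : Fin r → Index k n) :
    p.proj (fun x a => S x a + T x a) y i = p.proj S y i + p.proj T y i := by
  simp only [proj, mul_add, Finset.sum_add_distrib]

theorem proj_sub (S T : Tensor n r) (i : Fin r → Index k n) :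
    p.proj (fun x a => S x a - T x a) y i = p.proj S y i - p.proj T y i := by
  simp only [proj, mul_sub, Finset.sum_sub_distrib]

theorem proj_neg (T : Tensor n r) (i : Fin r → Index k n) :
    p.proj (fun x a => -T x a) y i = -p.proj T y i := by
  simp only [proj, mul_neg, Finset.sum_neg_distrib]

theorem proj_const_mul (c : E n → ℝ) (T : Tensor n r) (i : Fin r → Index k n) :
    p.proj (fun x a => c x * T x a) y i = c (p.φ y) * p.proj T y i := by
  simp only [proj, Finset.mul_sum, mul_left_comm]

theorem proj_congr {S T : Tensor n r} (h : ∀ a, S (p.φ y) a = T (p.φ y) a)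
    (i : Fin r → Index k n) : p.proj S y i = p.proj T y i := by
  simp only [proj, h]

theorem proj_mul (S : Tensor n s) (T : Tensor n t) {σ : Fin s → Fin r} {τ : Fin t → Fin r}
    (h : Function.Bijective (Sum.elim σ τ)) (i : Fin r → Index k n) :
    p.proj (fun x a => S x (a ∘ σ) * T x (a ∘ τ)) y i =
      p.proj S y (i ∘ σ) * p.proj T y (i ∘ τ) := by
  simp only [proj]
  let e := Equiv.ofBijective _ h
  let e' : (Fin s → Fin n) × (Fin t → Fin n) ≃ (Fin r → Fin n) :=
    (Equiv.sumArrowEquivProdArrow _ _ _).symm.trans (Equiv.arrowCongr e (Equiv.refl _))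
  rw [← e'.sum_comp, Fintype.sum_prod_type, Finset.sum_mul_sum]
  refine Finset.sum_congr rfl fun a _ => Finset.sum_congr rfl fun b _ => ?_
  have h0 : ∀ q, e' (a, b) (e q) = Sum.elim a b q := by
    intro q
    cases q <;> simp [e']
  have h1 : e' (a, b) ∘ σ = a := by
    ext q; exact congrArg Fin.val (h0 (inl q))
  have h2 : e' (a, b) ∘ τ = b := by
    ext q; exact congrArg Fin.val (h0 (inr q))
  rw [h1, h2, ← Equiv.prod_comp e, Fintype.prod_sum_type]
  simp only [h0, Sum.elim_inl, Sum.elim_inr]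
  have h3 : ∀ q, e (inl q) = σ q := fun q => rfl
  have h4 : ∀ q, e (inr q) = τ q := fun q => rfl
  simp only [h3, h4, Function.comp]
  ring

theorem IsRegularOn.proj_trace (hp : p.IsRegularOn U V) (hy : y ∈ U) (T : Tensor n (r + 2))
    (i : Fin r → Index k n) :
    p.proj (fun x a => ctr p.g x fun c d => T x (Fin.cons c (Fin.cons d a))) y i =
      (p.trT y fun γ γ' => p.proj T y (Fin.cons (inl γ) (Fin.cons (inl γ') i))) +
      p.trN y fun c c' => p.proj T y (Fin.cons (inr c) (Fin.cons (inr c') i)) := by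
  have h1 : ∀ j l : Index k n, p.proj T y (Fin.cons j (Fin.cons l i)) =
      ∑ c, ∑ d, p.frame y j c * p.frame y l d *
        ∑ a : Fin r → Fin n, (∏ q, p.frame y (i q) (a q)) * T (p.φ y) (Fin.cons c (Fin.cons d a)) := by
    intro j l
    have : (fun q => p.frame y ((Fin.cons j (Fin.cons l i) : Fin (r + 2) → Index k n) q)) =
        Fin.cons (p.frame y j) (Fin.cons (p.frame y l) fun q => p.frame y (i q)) := by
      ext q : 1
      refine Fin.cases rfl (fun q => ?_) q
      exact Fin.cases rfl (fun q => rfl) q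
    rw [proj_eq_ev, this, ev_cons]
    refine Finset.sum_congr rfl fun c _ => ?_
    rw [ev_cons, Finset.mul_sum]
    exact Finset.sum_congr rfl fun d _ => by rw [ev_apply, mul_assoc]
  have h2 := hp.ctr_split hy fun c d => ∑ a : Fin r → Fin n, (∏ q, p.frame y (i q) (a q)) *
    T (p.φ y) (Fin.cons c (Fin.cons d a))
  simp only [h1, trT_eq, trN_eq]
  refine Eq.trans ?_ h2
  rw [ctr_sum]
  exact Finset.sum_congr rfl fun a _ => (ctr_mul_left _ _).symm

/-- The inner product of frame vectors. -/
def gm (p : Patch k n) (y : E k) (i j : Index k n) : ℝ := p.ip y (p.frame y i) (p.frame y j)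

theorem proj_metric (i : Fin 2 → Index k n) :
    p.proj (r := 2) (fun x a => p.g x (a 0) (a 1)) y i = p.gm y (i 0) (i 1) := by
  rw [proj_eq_ev]
  have : (fun j => p.frame y (i j)) = ![p.frame y (i 0), p.frame y (i 1)] := by
    ext j : 1; fin_cases j <;> rfl
  rw [this, ev_two, gm, ip]
  exact Finset.sum_congr rfl fun a _ => Finset.sum_congr rfl fun b _ => by
    simp only [Matrix.cons_val_zero, Matrix.cons_val_one]; ring

theorem gm_inl (α β : Fin k) : p.gm y (inl α) (inl β) = p.h y α β := rfl

namespace IsRegularOn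

variable (hp : p.IsRegularOn U V)

include hp

theorem gm_inl_inr (hy : y ∈ U) (α : Fin k) (b : Fin n) : p.gm y (inl α) (inr b) = 0 := by
  rw [gm, hp.ip_comm hy]; exact hp.ip_nor_tan hy b α

theorem W_swap_right (hy : y ∈ U) (i j l q : Index k n) :
    p.W y ![i, j, l, q] = -p.W y ![i, j, q, l] := by
  have h : p.W y ![i, j, q, l] = p.proj (fun x a => weyl p.g x (a ∘ Equiv.swap 2 3)) y
      ![i, j, l, q] := by
    rw [proj_perm, W]; congr 1; ext x : 1; fin_cases x <;> rfl
  rw [h, ← proj_neg, W]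
  refine proj_congr (fun a => ?_) _
  have h1 : a ∘ ⇑(Equiv.swap (2 : Fin 4) 3) = ![a 0, a 1, a 3, a 2] := by
    ext x : 1; fin_cases x <;> rfl
  rw [h1]
  conv_lhs => rw [← vec_four_eta a]
  exact hp.metric.weyl_swap_right (hp.maps y hy) _ _ _ _

omit hp in
theorem W_swap_left (i j l q : Index k n) :
    p.W y ![i, j, l, q] = -p.W y ![j, i, l, q] := by
  have h : p.W y ![j, i, l, q] = p.proj (fun x a => weyl p.g x (a ∘ Equiv.swap 0 1)) y
      ![i, j, l, q] := by
    rw [proj_perm, W]; congr 1; ext x : 1; fin_cases x <;> rfl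
  rw [h, ← proj_neg, W]
  refine proj_congr (fun a => ?_) _
  have h1 : a ∘ ⇑(Equiv.swap (0 : Fin 4) 1) = ![a 1, a 0, a 2, a 3] := by
    ext x : 1; fin_cases x <;> rfl
  rw [h1]
  conv_lhs => rw [← vec_four_eta a]
  exact IsMetricOn.weyl_swap_left _ _ _ _

theorem W_pair (hy : y ∈ U) (i j l q : Index k n) :
    p.W y ![i, j, l, q] = p.W y ![l, q, i, j] := by
  have h : p.W y ![l, q, i, j] = p.proj (fun x a => weyl p.g x
      (a ∘ (Equiv.swap 0 2 * Equiv.swap 1 3 : Equiv.Perm (Fin 4)))) y ![i, j, l, q] := by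
    rw [proj_perm, W]; congr 1; ext x : 1; fin_cases x <;> rfl
  rw [h, W]
  refine proj_congr (fun a => ?_) _
  have h1 : a ∘ ⇑(Equiv.swap 0 2 * Equiv.swap 1 3 : Equiv.Perm (Fin 4)) = ![a 2, a 3, a 0, a 1] := by
    ext x : 1; fin_cases x <;> rfl
  rw [h1]
  conv_lhs => rw [← vec_four_eta a]
  exact hp.metric.weyl_pair (hp.maps y hy) _ _ _ _

theorem P_symm (hy : y ∈ U) (i j : Index k n) : p.P y ![i, j] = p.P y ![j, i] := by
  have h : p.P y ![j, i] = p.proj (fun x a => schouten p.g x (a ∘ Equiv.swap 0 1)) y ![i, j] := by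
    rw [proj_perm, P]; congr 1; ext x : 1; fin_cases x <;> rfl
  rw [h, P]
  refine proj_congr (fun a => ?_) _
  have h1 : a ∘ ⇑(Equiv.swap (0 : Fin 2) 1) = ![a 1, a 0] := by
    ext x : 1; fin_cases x <;> rfl
  rw [h1]
  conv_lhs => rw [← vec_two_eta a]
  exact hp.metric.schouten_symm (hp.maps y hy) _ _

omit hp in
theorem proj_riem_eq (i j l q : Index k n) :
    p.proj (riem p.g) y ![i, j, l, q] = p.W y ![i, j, l, q] + p.P y ![i, l] * p.gm y j q +
      p.P y ![j, q] * p.gm y i l - p.P y ![i, q] * p.gm y j l - p.P y ![j, l] * p.gm y i q := by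
  have h1 : ∀ {σ τ : Fin 2 → Fin 4} (_ : Function.Bijective (Sum.elim σ τ)) i, _ := fun h i =>
    proj_mul (p := p) (y := y) (schouten p.g) (r := 4) (t := 2) (fun x a => p.g x (a 0) (a 1)) h i
  have e1 := h1 (σ := ![0, 2]) (τ := ![1, 3]) (by decide) ![i, j, l, q]
  have e2 := h1 (σ := ![1, 3]) (τ := ![0, 2]) (by decide) ![i, j, l, q]
  have e3 := h1 (σ := ![0, 3]) (τ := ![1, 2]) (by decide) ![i, j, l, q]
  have e4 := h1 (σ := ![1, 2]) (τ := ![0, 3]) (by decide) ![i, j, l, q]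
  simp only [proj_metric, comp_vec_two, Function.comp, Matrix.cons_val] at e1 e2 e3 e4
  simp only [P, W]
  rw [← e1, ← e2, ← e3, ← e4, ← proj_add, ← proj_add, ← proj_sub, ← proj_sub]
  refine proj_congr (fun a => ?_) _
  simp only [weyl]
  ring

/-- The full trace of the Weyl tensor vanishes. -/
theorem W_trace (hy : y ∈ U) (i j : Index k n) (hn : 2 < n) :
    (p.trT y fun γ γ' => p.W y ![i, inl γ, j, inl γ']) +
      (p.trN y fun c c' => p.W y ![i, inr c, j, inr c']) = 0 := by
  have h1 := hp.proj_trace hy (r := 2) (fun x a => weyl p.g x (a ∘ ![2, 0, 3, 1])) ![i, j]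
  have hb : Function.Bijective (![2, 0, 3, 1] : Fin 4 → Fin 4) := by decide
  have h2 : ∀ B : Fin 4 → Index k n, p.proj (fun x a => weyl p.g x (a ∘ ![2, 0, 3, 1])) y B =
      p.W y ![B 2, B 0, B 3, B 1] := by
    intro B
    refine (proj_perm (weyl p.g) (Equiv.ofBijective _ hb) B).trans ?_
    rw [W]; congr 1; ext x : 1; fin_cases x <;> rfl
  simp only [h2] at h1
  refine Eq.trans h1.symm ?_
  refine (proj_congr (T := fun _ _ => 0) (fun a => ?_) _).trans (by simp [proj])
  have := hp.metric.trace_weyl hn (hp.maps y hy) (a 0) (a 1)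
  refine Eq.trans (ctr_congr fun c d => ?_) this
  rw [comp_vec_four]; rfl

omit hp in
theorem C_swap (i j l : Index k n) : p.C y ![i, j, l] = -p.C y ![j, i, l] := by
  have h : p.C y ![j, i, l] = p.proj (fun x a => cotton p.g x (a ∘ Equiv.swap 0 1)) y ![i, j, l] := by
    rw [proj_perm, C]; congr 1; ext x : 1; fin_cases x <;> rfl
  rw [h, ← proj_neg, C]
  refine proj_congr (fun a => ?_) _
  simp only [cotton]
  have h1 : (a ∘ ⇑(Equiv.swap (0 : Fin 3) 1)) 0 = a 1 := rfl
  have h2 : (a ∘ ⇑(Equiv.swap (0 : Fin 3) 1)) 1 = a 0 := rfl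
  have h3 : (a ∘ ⇑(Equiv.swap (0 : Fin 3) 1)) 2 = a 2 := rfl
  rw [h1, h2, h3]
  ring

end IsRegularOn

end Patch

end

end ConformalSubmanifold

namespace ConformalSubmanifold

open TopologicalSpace (Opens)

noncomputable section

namespace Patch

open Sum (inl inr)

variable {k n r s t : ℕ} {p : Patch k n} {U : Opens (E k)} {V : Opens (E n)} {y : E k}

theorem slot_schouten (A : Fin 1 → Fin k) (b : Fin n) :
    p.slot (schouten p.g) 1 y A b = p.P y ![inl (A 0), inr b] := by
  rw [slot, P, proj_eq_ev]
  exact ev_comp _ _ _ fun j => by fin_cases j <;> rfl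

theorem slot_weyl (A : Fin 3 → Fin k) (b : Fin n) :
    p.slot (weyl p.g) 2 y A b = p.W y ![inl (A 0), inl (A 1), inr b, inl (A 2)] := by
  rw [slot, W, proj_eq_ev]
  exact ev_comp _ _ _ fun j => by fin_cases j <;> rfl

namespace IsRegularOn

variable (hp : p.IsRegularOn U V)

include hp

/-! ### The trace-free second fundamental form -/

theorem isNField_H : p.IsNField U p.H :=
  (hp.isNField_L.trace (r := 0) hp).const_mul _

theorem h_smooth : SmoothTensor U fun z (A : Fin 2 → Fin k) => p.h z (A 0) (A 1) :=
  fun _ => hp.induced.smooth _ _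

theorem isNField_H_mul_h :
    p.IsNField U fun z (A : Fin 2 → Fin k) b => p.H z ![] b * p.h z (A 0) (A 1) := by
  have := IsNField.mul (r := 2) (hp.h_smooth) hp.isNField_H ![0, 1] ![]
  simp only [mul_comm (p.H _ _ _)]
  exact this

theorem isNField_Lo : p.IsNField U p.Lo := hp.isNField_L.sub hp.isNField_H_mul_h

theorem Lo_symm (hy : y ∈ U) (α β : Fin k) (b : Fin n) :
    p.Lo y ![α, β] b = p.Lo y ![β, α] b := by
  simp only [Lo, Matrix.cons_val]
  rw [hp.L_symm hy, hp.induced.symm hy]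

theorem Lo_trace (hk : k ≠ 0) (hy : y ∈ U) (b : Fin n) :
    (p.trT y fun α β => p.Lo y ![α, β] b) = 0 := by
  have hk' : (k : ℝ) ≠ 0 := by exact_mod_cast hk
  simp only [Lo, Matrix.cons_val, trT_eq]
  rw [ctr_sub]
  have : ctr p.h y (fun α β => p.H y ![] b * p.h y α β) = p.H y ![] b * k := by
    rw [← ctr_self hp.induced hy]; exact ctr_mul_left _ _
  rw [this, H, trT_eq]
  field_simp
  ring

theorem nablaN_Lo (hy : y ∈ U) (ε β γ : Fin k) (b : Fin n) :
    p.nablaN p.Lo y ![ε, β, γ] b =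
      p.nablaN p.L y ![ε, β, γ] b - p.nablaN p.H y ![ε] b * p.h y β γ := by
  have h1 := nablaN_sub hp.isNField_L hp.isNField_H_mul_h hy ![ε, β, γ] b
  have h2 := hp.nablaN_mul (r := 2) (hp.h_smooth) hp.isNField_H (i := ![0, 1]) (j := ![])
    (by decide) hy ε ![β, γ] b
  refine h1.trans ?_
  congr 1
  have h3 : p.nablaN (fun z (A : Fin 2 → Fin k) b => p.H z ![] b * p.h z (A 0) (A 1)) y
      ![ε, β, γ] b = p.nablaN (fun z (A : Fin 2 → Fin k) b =>
        p.h z ((A ∘ ![0, 1]) 0) ((A ∘ ![0, 1]) 1) * p.H z (A ∘ ![]) b) y ![ε, β, γ] b :=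
    nablaN_congr (U := U) (fun z _ A b => mul_comm _ _) hy _ b
  refine h3.trans (h2.trans ?_)
  have h4 : (Fin.cons ε (![β, γ] ∘ ![0, 1]) : Fin 3 → Fin k) = ![ε, β, γ] := by
    rw [comp_vec_two]; rfl
  have h5 : (Fin.cons ε (![β, γ] ∘ ![]) : Fin 1 → Fin k) = ![ε] := by
    ext i; fin_cases i; rfl
  rw [h4, h5, nabla_metric hp.induced hy, zero_mul, zero_add, mul_comm]
  rfl

theorem nablaN_Lo_symm (hy : y ∈ U) (ε β γ : Fin k) (b : Fin n) :
    p.nablaN p.Lo y ![ε, β, γ] b = p.nablaN p.Lo y ![ε, γ, β] b := by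
  have h1 := nablaN_perm (p := p) (y := y) p.Lo (σ := ![1, 0]) (by decide) ε ![β, γ] b
  rw [comp_vec_two] at h1
  refine Eq.trans ?_ h1
  exact nablaN_congr (U := U) (fun z hz A b => by
    rw [comp_vec_two, ← hp.Lo_symm hz, vec_two_eta]) hy _ b

theorem nablaN_Lo_trace (hk : k ≠ 0) (hy : y ∈ U) (ε : Fin k) (b : Fin n) :
    (p.trT y fun β γ => p.nablaN p.Lo y ![ε, β, γ] b) = 0 := by
  have h1 := hp.nablaN_trace (r := 0) hp.isNField_Lo hy ε ![] b
  refine h1.symm.trans ?_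
  rw [nablaN_congr (U := U) (T := fun _ _ _ => 0) (fun z hz A b => ?_) hy]
  · simp only [nablaN_eq, dN, nabla, pd_const]; simp
  · have : (fun β β' => p.Lo z (Fin.cons β (Fin.cons β' A)) b) = fun β β' => p.Lo z ![β, β'] b :=
      rfl
    rw [this, hp.Lo_trace hk hz]

theorem isNField_D : p.IsNField U fun z (A : Fin 1 → Fin k) a => p.D z (A 0) a := by
  have h1 := (hp.isNField_slot hp.metric.schouten_smooth 1).sub (hp.isNField_nablaN hp.isNField_H)
  have : (fun z (A : Fin 1 → Fin k) a => p.D z (A 0) a) = fun z A b =>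
      p.slot (schouten p.g) 1 z A b - p.nablaN p.H z A b := by
    ext z A b
    rw [slot_schouten, D]
    congr 2
    ext i; fin_cases i; rfl
  rw [this]; exact h1

theorem isNField_W : p.IsNField U fun z (A : Fin 3 → Fin k) a =>
    p.W z ![inl (A 0), inl (A 1), inr a, inl (A 2)] := by
  have h1 := hp.isNField_slot hp.metric.weyl_smooth 2
  have : (fun z (A : Fin 3 → Fin k) a => p.W z ![inl (A 0), inl (A 1), inr a, inl (A 2)]) =
      p.slot (weyl p.g) 2 := by
    ext z A b; rw [slot_weyl]
  rw [this]; exact h1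

theorem isNField_Wmix : p.IsNField U fun z (A : Fin 1 → Fin k) a => p.Wmix z (A 0) a :=
  ((hp.isNField_W.perm ![2, 0, 1]).trace (r := 1) hp)

theorem codazzi_Lo (hy : y ∈ U) (ε β γ : Fin k) (b : Fin n) :
    p.nablaN p.Lo y ![ε, β, γ] b - p.nablaN p.Lo y ![β, ε, γ] b =
      p.W y ![inl ε, inl β, inr b, inl γ] + p.D y ε b * p.h y β γ - p.D y β b * p.h y ε γ := by
  have h1 := hp.codazzi hy ε β γ b
  rw [proj_riem_eq, hp.gm_inl_inr hy, hp.gm_inl_inr hy, gm_inl, gm_inl,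
    hp.W_swap_right hy (inl ε)] at h1
  rw [hp.nablaN_Lo hy, hp.nablaN_Lo hy]
  simp only [D]
  linarith

theorem divLo_eq (hk : k ≠ 0) (hy : y ∈ U) (α : Fin k) (b : Fin n) :
    p.divLo y α b = -p.Wmix y α b - ((k : ℝ) - 1) * p.D y α b := by
  have h1 : (p.trT y fun ε γ => p.nablaN p.Lo y ![ε, α, γ] b - p.nablaN p.Lo y ![α, ε, γ] b) =
      p.divLo y α b := by
    rw [trT_eq, ctr_sub]
    have := hp.nablaN_Lo_trace hk hy α b
    rw [trT_eq] at this
    rw [this, sub_zero, divLo, trT_eq]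
    exact ctr_congr fun ε γ => hp.nablaN_Lo_symm hy _ _ _ _
  rw [← h1]
  simp only [hp.codazzi_Lo hy, trT_eq]
  rw [ctr_sub, ctr_add]
  have e1 : ctr p.h y (fun ε γ => p.D y ε b * p.h y α γ) = p.D y α b := by
    simp only [mul_comm (p.D _ _ _)]
    exact ctr_metric' hp.induced hy (fun ε => p.D y ε b) α
  have e2 : ctr p.h y (fun ε γ => p.D y α b * p.h y ε γ) = p.D y α b * k := by
    rw [← ctr_self hp.induced hy]; exact ctr_mul_left _ _
  have e3 : ctr p.h y (fun ε γ => p.W y ![inl ε, inl α, inr b, inl γ]) = -p.Wmix y α b := by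
    rw [Wmix, trT_eq, ← ctr_neg]
    exact ctr_congr fun ε γ => W_swap_left _ _ _ _
  rw [e1, e2, e3]
  ring

/-! ### The induced curvature -/

omit hp in
theorem trN_L_L (α β γ δ : Fin k) :
    (p.trN y fun a a' => p.L y ![α, β] a * p.L y ![γ, δ] a') =
      (p.trN y fun a a' => p.Lo y ![α, β] a * p.Lo y ![γ, δ] a') +
      (p.trN y fun a a' => p.Lo y ![α, β] a * p.H y ![] a') * p.h y γ δ +
      p.HL y ![γ, δ] * p.h y α β + p.normHsq y * (p.h y α β * p.h y γ δ) := by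
  have h1 : ∀ α β a, p.L y ![α, β] a = p.Lo y ![α, β] a + p.H y ![] a * p.h y α β := by
    intro α β a; simp only [Lo, Matrix.cons_val]; ring
  simp only [HL, normHsq, trN_eq, ← ctr_mul_right, ← ctr_add]
  exact ctr_congr fun a b => by rw [h1, h1]; ring

theorem trN_Lo_H (hy : y ∈ U) (α β : Fin k) :
    (p.trN y fun a a' => p.Lo y ![α, β] a * p.H y ![] a') = p.HL y ![α, β] := by
  rw [HL, trN_eq, trN_eq, ctr_swap hp.metric (hp.maps y hy)]
  exact ctr_congr fun a b => mul_comm _ _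

omit hp in
theorem calP_apply (A : Fin 2 → Fin k) :
    p.calP y A = p.P y ![inl (A 0), inl (A 1)] + p.HL y A +
      (1 / 2) * p.normHsq y * p.h y (A 0) (A 1) := rfl

theorem riem_h_eq (hy : y ∈ U) (ε α β δ : Fin k) :
    riem p.h y ![ε, α, β, δ] = p.W y ![inl ε, inl α, inl β, inl δ]
      + p.calP y ![ε, β] * p.h y α δ + p.calP y ![α, δ] * p.h y ε β
      - p.calP y ![ε, δ] * p.h y α β - p.calP y ![α, β] * p.h y ε δ
      - (p.trN y fun a a' => p.Lo y ![ε, δ] a * p.Lo y ![α, β] a')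
      + p.trN y fun a a' => p.Lo y ![α, δ] a * p.Lo y ![ε, β] a' := by
  rw [hp.gauss hy, proj_riem_eq, trN_L_L, trN_L_L, hp.trN_Lo_H hy, hp.trN_Lo_H hy]
  simp only [gm_inl, calP_apply, Matrix.cons_val]
  ring

theorem ricci_h_eq (hk : k ≠ 0) (hy : y ∈ U) (α β : Fin k) :
    ricci p.h y ![α, β] = p.Wtr y ![α, β] + ((k : ℝ) - 2) * p.calP y ![α, β] +
      p.trCalP y * p.h y α β - p.Lsq y ![α, β] := by
  have h0 : ricci p.h y ![α, β] = ctr p.h y fun γ δ => riem p.h y ![α, γ, β, δ] := rfl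
  rw [h0]
  simp only [hp.riem_h_eq hy]
  rw [ctr_add, ctr_sub, ctr_sub, ctr_sub, ctr_add, ctr_add]
  have e1 : ctr p.h y (fun γ δ => p.calP y ![α, β] * p.h y γ δ) = p.calP y ![α, β] * k := by
    rw [← ctr_self hp.induced hy]; exact ctr_mul_left _ _
  have e2 : ctr p.h y (fun γ δ => p.calP y ![γ, δ] * p.h y α β) = p.trCalP y * p.h y α β :=
    ctr_mul_right _ _
  have e3 : ctr p.h y (fun γ δ => p.calP y ![α, δ] * p.h y γ β) = p.calP y ![α, β] := by
    have := ctr_metric hp.induced hy (fun δ => p.calP y ![α, δ]) β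
    rw [← this]
    exact ctr_congr fun a b => by rw [hp.induced.symm hy a β, mul_comm]
  have e4 : ctr p.h y (fun γ δ => p.calP y ![γ, β] * p.h y α δ) = p.calP y ![α, β] := by
    have := ctr_metric' hp.induced hy (fun γ => p.calP y ![γ, β]) α
    rw [← this]
    exact ctr_congr fun a b => by rw [mul_comm]
  have e5 : ctr p.h y (fun γ δ => p.trN y fun a a' => p.Lo y ![α, δ] a * p.Lo y ![γ, β] a') =
      p.Lsq y ![α, β] := by
    rw [Lsq, trT_eq, ctr_swap hp.induced hy]
    exact ctr_congr fun γ δ => by simp only [Matrix.cons_val, hp.Lo_symm hy α γ]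
  have e6 : ctr p.h y (fun γ δ => p.trN y fun a a' => p.Lo y ![γ, δ] a * p.Lo y ![α, β] a') = 0 := by
    simp only [trN_eq]
    rw [ctr_comm]
    have : ∀ b, ctr p.h y (fun γ δ => p.Lo y ![γ, δ] b) = 0 := hp.Lo_trace hk hy
    simp only [ctr_mul_right, this, zero_mul, ctr_zero]
  have e7 : ctr p.h y (fun γ δ => p.W y ![inl α, inl γ, inl β, inl δ]) = p.Wtr y ![α, β] := rfl
  rw [e1, e2, e3, e4, e5, e6, e7]
  ring

omit hp in
theorem trace_Lsq : ctr p.h y (fun α β => p.Lsq y ![α, β]) = p.normLsq y := by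
  simp only [Lsq, normLsq, trT_eq, Matrix.cons_val]
  rw [ctr_comm]

theorem Jbar_eq (hk : 1 < k) (hy : y ∈ U) : p.Jbar y = p.trCalP y - p.G y := by
  have hk' : (k : ℝ) - 1 ≠ 0 := by
    have : (1 : ℝ) < k := by exact_mod_cast hk
    linarith
  have h0 : scalarCurv p.h y = ctr p.h y fun α β => ricci p.h y ![α, β] := rfl
  rw [Jbar, trSchouten, h0]
  simp only [hp.ricci_h_eq (by omega) hy]
  rw [ctr_sub, ctr_add, ctr_add, trace_Lsq, ctr_mul_left]
  have e1 : ctr p.h y (fun γ δ => p.trCalP y * p.h y γ δ) = p.trCalP y * k := by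
    rw [← ctr_self hp.induced hy]; exact ctr_mul_left _ _
  have e2 : ctr p.h y (fun α β => p.Wtr y ![α, β]) = p.Wtrtr y := rfl
  have e3 : ctr p.h y (fun α β => p.calP y ![α, β]) = p.trCalP y := rfl
  rw [e1, e2, e3, G]
  field_simp
  ring

theorem Pbar_eq (hk : 2 < k) (hy : y ∈ U) (A : Fin 2 → Fin k) :
    p.Pbar y A = p.calP y A - p.F y A := by
  have hk' : (k : ℝ) - 2 ≠ 0 := by
    have : (2 : ℝ) < k := by exact_mod_cast hk
    linarith
  rw [← vec_two_eta A, Pbar, schouten, hp.ricci_h_eq (by omega) hy,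
    show trSchouten p.h y = p.Jbar y from rfl, hp.Jbar_eq (by omega) hy, F]
  simp only [Matrix.cons_val]
  field_simp
  ring

end IsRegularOn

end Patch

end

end ConformalSubmanifold

namespace ConformalSubmanifold

open TopologicalSpace (Opens)

noncomputable section

namespace Patch

open Sum (inl inr)

variable {k n r s t : ℕ} {p : Patch k n} {U : Opens (E k)} {V : Opens (E n)} {y : E k}

/-- The one-form `L̊^{βγα'} W_{αβα'γ}`. -/
def LW (p : Patch k n) : Tensor k 1 := fun z A =>
  p.trT z fun β β' => p.trT z fun γ γ' => p.trN z fun a a' =>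
    p.Lo z ![β, γ] a * p.W z ![inl (A 0), inl β', inr a', inl γ']

/-- The one-form `L̊_α{}^{βα'} W_{βγα'}{}^γ`. -/
def LWmix (p : Patch k n) : Tensor k 1 := fun z A =>
  p.trT z fun β β' => p.trN z fun a a' => p.Lo z ![A 0, β] a * p.Wmix z β' a'

/-- The one-form `∇̄^β L̊²_{αβ}`. -/
def divLsq (p : Patch k n) : Tensor k 1 := fun z A =>
  p.trT z fun β β' => nabla p.h p.Lsq z ![β, A 0, β']

theorem K1_eq (y : E k) : p.K1 y = p.divT p.LW y + ((k : ℝ) - 4) * p.LC y := rfl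

theorem K2_eq (y : E k) : p.K2 y = p.divT p.LWmix y + ((k : ℝ) - 4) * p.DW y := rfl

theorem lap_eq (f : E k → ℝ) (y : E k) : p.lap f y = p.divT (fun z A => pd f z (A 0)) y := by
  have : (p.nablaT fun z (_ : Fin 0 → Fin k) => f z) = fun z A => pd f z (A 0) := by
    ext z A; simp [nablaT, nabla]
  rw [lap, divT, this]

theorem divT_eq (T : Tensor k 1) (y : E k) :
    p.divT T y = ctr p.h y fun α β => nabla p.h T y ![α, β] := rfl

namespace IsRegularOn

variable (hp : p.IsRegularOn U V)

theorem divT_congr {S T : Tensor k 1} (h : ∀ z ∈ U, ∀ A, S z A = T z A) (hy : y ∈ U) :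
    p.divT S y = p.divT T y :=
  ctr_congr fun _ _ => nabla_congr h hy _

theorem divT_add {S T : Tensor k 1} (hS : SmoothTensor U S) (hT : SmoothTensor U T) (hy : y ∈ U) :
    p.divT (fun z A => S z A + T z A) y = p.divT S y + p.divT T y := by
  simp only [divT_eq, nabla_add hS hT hy, ctr_add]

theorem divT_sub {S T : Tensor k 1} (hS : SmoothTensor U S) (hT : SmoothTensor U T) (hy : y ∈ U) :
    p.divT (fun z A => S z A - T z A) y = p.divT S y - p.divT T y := by
  simp only [divT_eq, nabla_sub hS hT hy, ctr_sub]

theorem divT_const_mul (c : ℝ) {T : Tensor k 1} (hT : SmoothTensor U T) (hy : y ∈ U) :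
    p.divT (fun z A => c * T z A) y = c * p.divT T y := by
  simp only [divT_eq, nabla_const_mul c hT hy, ctr_mul_left]

include hp

theorem trT_smooth {F : E k → Fin k → Fin k → ℝ} (hF : ∀ a b, SmoothOn U fun z => F z a b) :
    SmoothOn U fun z => p.trT z (F z) := ctr_smooth' hp.induced hF

theorem trN_smooth {F : E k → Fin n → Fin n → ℝ} (hF : ∀ a b, SmoothOn U fun z => F z a b) :
    SmoothOn U fun z => p.trN z (F z) := ctr_smooth hp.metric hp.smooth hp.maps hF

theorem W_smooth (i : Fin 4 → Index k n) : SmoothOn U fun z => p.W z i :=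
  hp.proj_smooth hp.metric.weyl_smooth i

theorem Lsq_smooth : SmoothTensor U p.Lsq := fun _ =>
  hp.trT_smooth fun _ _ => hp.trN_smooth fun _ _ =>
    (hp.isNField_Lo.smooth _ _).mul (hp.isNField_Lo.smooth _ _)

theorem normLsq_smooth : SmoothOn U p.normLsq :=
  hp.trT_smooth fun _ _ => hp.trT_smooth fun _ _ => hp.trN_smooth fun _ _ =>
    (hp.isNField_Lo.smooth _ _).mul (hp.isNField_Lo.smooth _ _)

theorem Wtrtr_smooth : SmoothOn U p.Wtrtr :=
  hp.trT_smooth fun _ _ => hp.trT_smooth fun _ _ => hp.W_smooth _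

theorem D_smooth (α : Fin k) (a : Fin n) : SmoothOn U fun z => p.D z α a :=
  hp.isNField_D.smooth ![α] a

theorem DL_smooth : SmoothTensor U p.DL := fun _ =>
  hp.trT_smooth fun _ _ => hp.trN_smooth fun _ _ =>
    (hp.D_smooth _ _).mul (hp.isNField_Lo.smooth _ _)

theorem calCtr_smooth : SmoothTensor U p.calCtr := fun _ =>
  hp.trT_smooth fun _ _ => (hp.proj_smooth hp.metric.cotton_smooth _).sub
    (hp.trN_smooth fun _ _ => (hp.isNField_H.smooth _ _).mul (hp.W_smooth _))

theorem LW_smooth : SmoothTensor U p.LW := fun _ =>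
  hp.trT_smooth fun _ _ => hp.trT_smooth fun _ _ => hp.trN_smooth fun _ _ =>
    (hp.isNField_Lo.smooth _ _).mul (hp.W_smooth _)

theorem LWmix_smooth : SmoothTensor U p.LWmix := fun _ =>
  hp.trT_smooth fun _ _ => hp.trN_smooth fun _ _ =>
    (hp.isNField_Lo.smooth _ _).mul (hp.trT_smooth fun _ _ => hp.W_smooth _)

theorem divLsq_smooth : SmoothTensor U p.divLsq := fun _ =>
  hp.trT_smooth fun _ _ => hp.Lsq_smooth.nabla hp.induced _

omit hp in
theorem lap_sub {f f' : E k → ℝ} (hf : SmoothOn U f) (hf' : SmoothOn U f') (hy : y ∈ U) :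
    p.lap (fun z => f z - f' z) y = p.lap f y - p.lap f' y := by
  simp only [lap_eq]
  rw [← divT_sub (fun A => hf.pd (A 0)) (fun A => hf'.pd (A 0)) hy]
  exact divT_congr (fun z hz A => pd_sub hf hf' hz _) hy

omit hp in
theorem lap_const_mul (c : ℝ) {f : E k → ℝ} (hf : SmoothOn U f) (hy : y ∈ U) :
    p.lap (fun z => c * f z) y = c * p.lap f y := by
  simp only [lap_eq]
  rw [← divT_const_mul c (fun A => hf.pd (A 0)) hy]
  exact divT_congr (fun z hz A => pd_const_mul c hf hz _) hy

theorem inner2_comm (hy : y ∈ U) (S T : Tensor k 2) : p.inner2 S T y = p.inner2 T S y := by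
  simp only [inner2, trT_eq]
  rw [ctr_swap hp.induced hy]
  refine ctr_congr fun α α' => ?_
  rw [ctr_swap hp.induced hy]
  exact ctr_congr fun β β' => mul_comm _ _

omit hp in
theorem inner2_sub_left (S S' T : Tensor k 2) :
    p.inner2 (fun z A => S z A - S' z A) T y = p.inner2 S T y - p.inner2 S' T y := by
  simp only [inner2, trT_eq, sub_mul, ctr_sub]

/-- The combination of the invariants `𝓘` and `𝓙` that enters `𝒥₁` and `𝒥₂`. -/
theorem two_mul_I_add_J (hk : 1 < k) (hy : y ∈ U) :
    2 * p.I y + p.J y = -p.lap p.normLsq y + 2 * p.normLsq y * p.trCalP y +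
      2 * ((k : ℝ) - 6) * (p.inner2 p.Lsq p.calP y - p.divT p.DL y -
        ((k : ℝ) - 3) * p.normDsq y - p.DW y - p.LC y) := by
  have hk' : (k : ℝ) - 1 ≠ 0 := by
    have : (1 : ℝ) < k := by exact_mod_cast hk
    linarith
  have hG : p.lap p.G y = 1 / (2 * ((k : ℝ) - 1)) * (p.lap p.normLsq y - p.lap p.Wtrtr y) := by
    rw [← lap_sub hp.normLsq_smooth hp.Wtrtr_smooth hy,
      ← lap_const_mul _ (hp.normLsq_smooth.sub hp.Wtrtr_smooth) hy]
    rfl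
  rw [I, J, hG, inner2_sub_left, divT_sub hp.calCtr_smooth hp.DL_smooth hy,
    hp.inner2_comm hy p.calP p.Wtr, G]
  field_simp
  ring

/-! ### Derivatives of quadratic expressions -/

theorem nabla_Lsq (hy : y ∈ U) (ε α β : Fin k) :
    nabla p.h p.Lsq y ![ε, α, β] = p.trT y fun γ γ' =>
      (p.trN y fun a a' => p.nablaN p.Lo y ![ε, γ, α] a * p.Lo y ![γ', β] a') +
      p.trN y fun a a' => p.Lo y ![γ, α] a * p.nablaN p.Lo y ![ε, γ', β] a' := by
  let T : Tensor k 4 := fun z B => p.trN z fun a a' => p.Lo z (B ∘ ![0, 2]) a * p.Lo z (B ∘ ![1, 3]) a'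
  have hT : SmoothTensor U T := fun B => hp.trN_smooth fun _ _ =>
    (hp.isNField_Lo.smooth _ _).mul (hp.isNField_Lo.smooth _ _)
  have h1 := nabla_trace (r := 2) hp.induced hT hy ε ![α, β]
  refine Eq.trans ?_ (h1.trans (ctr_congr fun γ γ' => ?_))
  · rfl
  · have h2 := hp.nabla_trN hp.isNField_Lo hp.isNField_Lo (r := 4) (i := ![0, 2]) (j := ![1, 3])
      (by decide) hy ε (Fin.cons γ (Fin.cons γ' ![α, β]))
    refine h2.trans ?_
    simp only [comp_vec_two]
    rfl

theorem pd_normLsq (hy : y ∈ U) (ε : Fin k) :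
    pd p.normLsq y ε = 2 * p.trT y fun α α' => p.trT y fun β β' => p.trN y fun a a' =>
      p.nablaN p.Lo y ![ε, α, β] a * p.Lo y ![α', β'] a' := by
  have h1 := nabla_trace (r := 0) hp.induced hp.Lsq_smooth hy ε ![]
  have h2 : pd p.normLsq y ε = ctr p.h y fun α β => nabla p.h p.Lsq y ![ε, α, β] := by
    refine Eq.trans ?_ h1
    have : (fun (z : E k) (A : Fin 0 → Fin k) =>
        ctr p.h z fun a b => p.Lsq z (Fin.cons a (Fin.cons b A))) = fun z _ => p.normLsq z := by
      ext z A; exact trace_Lsq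
    rw [this]; simp [nabla]
  rw [h2]
  simp only [hp.nabla_Lsq hy, trT_eq, ctr_add]
  rw [two_mul]
  refine congrArg₂ (· + ·) ?_ ?_
  · rw [ctr_comm]
  · rw [ctr_swap hp.induced hy, ctr_comm, ctr_swap hp.induced hy]
    refine ctr_congr fun γ γ' => ctr_congr fun α α' => ?_
    rw [trN_eq, trN_eq, ctr_swap hp.metric (hp.maps y hy)]
    exact ctr_congr fun a a' => mul_comm _ _

theorem DL_apply' (hy : y ∈ U) (γ : Fin k) : p.DL y ![γ] =
    ctr p.h y fun α α' => ctr p.g (p.φ y) fun a a' => p.D y α a * p.Lo y ![α', γ] a' := by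
  simp only [DL, trT_eq, trN_eq, Matrix.cons_val, hp.Lo_symm hy γ]

theorem divLsq_eq (hy : y ∈ U) (γ : Fin k) : p.divLsq y ![γ] =
    (ctr p.h y fun α α' => ctr p.h y fun δ δ' => ctr p.g (p.φ y) fun a a' =>
      p.nablaN p.Lo y ![α, γ, δ] a * p.Lo y ![α', δ'] a') +
    ctr p.h y fun δ δ' => ctr p.g (p.φ y) fun a a' => p.divLo y δ a * p.Lo y ![δ', γ] a' := by
  simp only [divLsq, hp.nabla_Lsq hy, trT_eq, trN_eq, Matrix.cons_val, ctr_add]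
  refine congrArg₂ (· + ·) ?_ ?_
  · refine ctr_congr fun α α' => ctr_congr fun δ δ' => ctr_congr fun a a' => ?_
    rw [hp.nablaN_Lo_symm hy, hp.Lo_symm hy α']
  · rw [ctr_comm, ctr_swap hp.induced hy]
    refine ctr_congr fun δ δ' => ?_
    rw [ctr_comm, ctr_swap hp.metric (hp.maps y hy)]
    refine ctr_congr fun a a' => ?_
    rw [ctr_mul_left, divLo, trT_eq, mul_comm]
    refine congrArg₂ (· * ·) ?_ rfl
    exact ctr_congr fun _ _ => hp.nablaN_Lo_symm hy _ _ _ _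

theorem ctr_W_Lo (hy : y ∈ U) (γ : Fin k) :
    (ctr p.h y fun α α' => ctr p.h y fun δ δ' => ctr p.g (p.φ y) fun a a' =>
      p.W y ![inl γ, inl α, inr a, inl δ] * p.Lo y ![α', δ'] a') = p.LW y ![γ] := by
  simp only [LW, trT_eq, trN_eq]
  rw [ctr_swap hp.induced hy]
  refine ctr_congr fun α α' => ?_
  rw [ctr_swap hp.induced hy]
  refine ctr_congr fun δ δ' => ?_
  rw [ctr_swap hp.metric (hp.maps y hy)]
  exact ctr_congr fun a a' => mul_comm _ _

theorem ctr_metric_Lo (hy : y ∈ U) (σ : Fin n → ℝ) (α α' : Fin k) :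
    (ctr p.h y fun δ δ' => ctr p.g (p.φ y) fun a a' =>
      σ a * p.h y α δ * p.Lo y ![α', δ'] a') =
    ctr p.g (p.φ y) fun a a' => σ a * p.Lo y ![α', α] a' := by
  rw [ctr_comm]
  refine ctr_congr fun a a' => ?_
  simp only [mul_assoc]
  rw [ctr_mul_left]
  refine congrArg₂ (· * ·) rfl ?_
  exact ctr_metric hp.induced hy (fun δ' => p.Lo y ![α', δ'] a') α

theorem half_pd_normLsq_sub (hk : k ≠ 0) (hy : y ∈ U) (γ : Fin k) :
    (1 / 2) * pd p.normLsq y γ - (ctr p.h y fun α α' => ctr p.h y fun δ δ' =>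
      ctr p.g (p.φ y) fun a a' => p.nablaN p.Lo y ![α, γ, δ] a * p.Lo y ![α', δ'] a') =
      p.LW y ![γ] - p.DL y ![γ] := by
  rw [hp.pd_normLsq hy, ← mul_assoc, one_div, inv_mul_cancel₀ two_ne_zero, one_mul]
  simp only [trT_eq, trN_eq, ← ctr_sub, ← sub_mul, hp.codazzi_Lo hy]
  simp only [sub_mul, add_mul, ctr_sub, ctr_add, hp.ctr_metric_Lo hy, hp.ctr_W_Lo hy]
  have e2 : (ctr p.h y fun α α' => ctr p.g (p.φ y) fun a a' => p.D y γ a * p.Lo y ![α', α] a') =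
      0 := by
    rw [ctr_comm]
    have h0 : ∀ a', ctr p.h y (fun α α' => p.Lo y ![α', α] a') = 0 := fun a' => by
      rw [ctr_swap hp.induced hy]; exact hp.Lo_trace hk hy a'
    simp only [ctr_mul_left, h0, mul_zero, ctr_zero]
  rw [e2, ← hp.DL_apply' hy, add_zero]

theorem ctr_divLo_Lo (hk : k ≠ 0) (hy : y ∈ U) (γ : Fin k) :
    (ctr p.h y fun δ δ' => ctr p.g (p.φ y) fun a a' =>
      p.divLo y δ a * p.Lo y ![δ', γ] a') = -p.LWmix y ![γ] - ((k : ℝ) - 1) * p.DL y ![γ] := by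
  have h1 : p.LWmix y ![γ] = ctr p.h y fun δ δ' => ctr p.g (p.φ y) fun a a' =>
      p.Wmix y δ a * p.Lo y ![δ', γ] a' := by
    simp only [LWmix, trT_eq, trN_eq, Matrix.cons_val]
    rw [ctr_swap hp.induced hy]
    refine ctr_congr fun α α' => ?_
    rw [ctr_swap hp.metric (hp.maps y hy)]
    exact ctr_congr fun a a' => by rw [hp.Lo_symm hy, mul_comm]
  rw [h1, hp.DL_apply' hy]
  simp only [hp.divLo_eq hk hy, sub_mul _ (_ * _), neg_mul, ctr_sub, ctr_neg, mul_assoc,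
    ctr_mul_left]

/-- The difference of the gradient of `|L̊|²` and the divergence of `L̊²`. -/
theorem half_pd_normLsq (hk : k ≠ 0) (hy : y ∈ U) (γ : Fin k) :
    (1 / 2) * pd p.normLsq y γ = p.divLsq y ![γ] + p.LW y ![γ] + p.LWmix y ![γ] +
      ((k : ℝ) - 2) * p.DL y ![γ] := by
  have h1 := hp.divLsq_eq hy γ
  have h2 := hp.half_pd_normLsq_sub hk hy γ
  rw [hp.ctr_divLo_Lo hk hy] at h1
  linear_combination h2 - h1

theorem divT_divLsq (hy : y ∈ U) : p.divT p.divLsq y = p.divdivLsq y := by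
  have hs := hp.Lsq_smooth.nabla hp.induced
  rw [divT_eq, divdivLsq]
  refine ctr_congr fun α γ => ?_
  have h1 := nabla_trace (r := 1) hp.induced (T := fun z B => nabla p.h p.Lsq z (B ∘ ![0, 2, 1]))
    (fun B => hs _) hy α ![γ]
  have h2 : (fun (z : E k) (A : Fin 1 → Fin k) => ctr p.h z fun a b => nabla p.h p.Lsq z
      ((Fin.cons a (Fin.cons b A) : Fin 3 → Fin k) ∘ ![0, 2, 1])) = p.divLsq := by
    ext z A
    exact ctr_congr fun _ _ => by rw [comp_vec_three]; rfl
  rw [h2] at h1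
  refine h1.trans (ctr_congr fun β β' => ?_)
  rw [nabla_perm (nabla p.h p.Lsq) (by decide), comp_vec_three]
  rfl

theorem half_lap_normLsq (hk : k ≠ 0) (hy : y ∈ U) :
    (1 / 2) * p.lap p.normLsq y = p.divdivLsq y + p.divT p.LW y + p.divT p.LWmix y +
      ((k : ℝ) - 2) * p.divT p.DL y := by
  rw [lap_eq, ← divT_const_mul _ (fun A => hp.normLsq_smooth.pd (A 0)) hy,
    ← hp.divT_divLsq hy, ← divT_add hp.divLsq_smooth hp.LW_smooth hy,
    ← divT_add (fun A => (hp.divLsq_smooth A).add (hp.LW_smooth A)) hp.LWmix_smooth hy,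
    ← divT_const_mul _ hp.DL_smooth hy,
    ← divT_add (fun A => ((hp.divLsq_smooth A).add (hp.LW_smooth A)).add (hp.LWmix_smooth A))
      (fun A => (hp.DL_smooth A).const_mul _) hy]
  refine divT_congr (fun z hz A => ?_) hy
  have : A = ![A 0] := by ext i; fin_cases i; rfl
  rw [this]
  exact hp.half_pd_normLsq hk hz (A 0)

end IsRegularOn

end Patch

end

end ConformalSubmanifold

namespace ConformalSubmanifold

open TopologicalSpace (Opens)

noncomputable section

namespace Patch

open Sum (inl inr)

variable {k n r s t : ℕ} {p : Patch k n} {U : Opens (E k)} {V : Opens (E n)} {y : E k}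
  {g' : MetricField n} {Υ : E n → ℝ}

/-! ### Conformal changes of the ambient metric -/

/-- The patch with the same map and another ambient metric. -/
def withMetric (p : Patch k n) (g' : MetricField n) : Patch k n := ⟨g', p.φ⟩

/-- The normal derivative of a function. -/
def normalD (p : Patch k n) (Υ : E n → ℝ) : NTensor k n 0 := p.slot (dform Υ) 0

/-- The restriction of a function to the submanifold. -/
def res (p : Patch k n) (Υ : E n → ℝ) (z : E k) : ℝ := Υ (p.φ z)

/-- The conformal factor `e^{2Υ}`. -/
def factor (p : Patch k n) (Υ : E n → ℝ) (z : E k) : ℝ := Real.exp (2 * p.res Υ z)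

theorem factor_ne_zero (z : E k) : p.factor Υ z ≠ 0 := (Real.exp_pos _).ne'

theorem tan_withMetric (α : Fin k) : (p.withMetric g').tan y α = p.tan y α := rfl

theorem proj_dform_inr (a : Fin n) : p.proj (dform Υ) y ![inr a] = p.normalD Υ y ![] a := by
  rw [normalD, slot, proj_eq_ev]
  exact ev_comp _ _ _ fun j => by fin_cases j; rfl

theorem normalD_apply (A : Fin 0 → Fin k) (a : Fin n) :
    p.normalD Υ y A a = ∑ c, p.nor y a c * pd Υ (p.φ y) c := by
  have : p.normalD Υ y A a = ev (dform Υ (p.φ y)) ![p.nor y a] := by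
    rw [normalD, slot]
    exact ev_comp _ _ _ fun j => by fin_cases j; rfl
  rw [this, ev_one]
  rfl

namespace IsRegularOn

variable (hp : p.IsRegularOn U V) (hc : IsConformalChange p.g g' Υ V)

include hp hc

theorem res_smooth : SmoothOn U (p.res Υ) := hp.comp_smooth hc.smooth

theorem pd_res (hy : y ∈ U) (α : Fin k) :
    pd (p.res Υ) y α = ∑ a, p.tan y α a * pd Υ (p.φ y) a := hp.pd_comp hc.smooth hy α

theorem h_withMetric (hy : y ∈ U) (α β : Fin k) :
    (p.withMetric g').h y α β = p.factor Υ y * p.h y α β := by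
  have : ∀ a b, g' (p.φ y) a b = p.factor Υ y * p.g (p.φ y) a b := hc.apply (hp.maps y hy)
  simp only [h, withMetric, Matrix.of_apply, this, Finset.mul_sum]
  exact Finset.sum_congr rfl fun a _ => Finset.sum_congr rfl fun b _ => by
    simp only [tan]; ring

theorem conformal_h : IsConformalChange p.h (p.withMetric g').h (p.res Υ) U where
  metric := hp.induced
  smooth := hp.res_smooth hc
  eq_smul z hz := by ext α β; exact hp.h_withMetric hc hz α β

theorem regular_withMetric : (p.withMetric g').IsRegularOn U V where
  metric := hc.metric'
  smooth := hp.smooth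
  maps := hp.maps
  indep := hp.indep

theorem trT_withMetric (hy : y ∈ U) (f : Fin k → Fin k → ℝ) :
    (p.withMetric g').trT y f = (p.factor Υ y)⁻¹ * p.trT y f := (hp.conformal_h hc).ctr_eq hy f

theorem trN_withMetric (hy : y ∈ U) (f : Fin n → Fin n → ℝ) :
    (p.withMetric g').trN y f = (p.factor Υ y)⁻¹ * p.trN y f := hc.ctr_eq (hp.maps y hy) f

theorem trT_scale (hy : y ∈ U) (c : ℝ) {f f' : Fin k → Fin k → ℝ} (h : ∀ a b, f' a b = c * f a b) :
    (p.withMetric g').trT y f' = ((p.factor Υ y)⁻¹ * c) * p.trT y f := by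
  rw [hp.trT_withMetric hc hy, mul_assoc]
  exact congrArg _ ((ctr_congr h).trans (ctr_mul_left _ _))

theorem trN_scale (hy : y ∈ U) (c : ℝ) {f f' : Fin n → Fin n → ℝ} (h : ∀ a b, f' a b = c * f a b) :
    (p.withMetric g').trN y f' = ((p.factor Υ y)⁻¹ * c) * p.trN y f := by
  rw [hp.trN_withMetric hc hy, mul_assoc]
  exact congrArg _ ((ctr_congr h).trans (ctr_mul_left _ _))

theorem nor_withMetric (hy : y ∈ U) (a : Fin n) : (p.withMetric g').nor y a = p.nor y a := by
  have h1 := factor_ne_zero (p := p) (Υ := Υ) y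
  have h2 : ∀ a b, g' (p.φ y) a b = p.factor Υ y * p.g (p.φ y) a b := hc.apply (hp.maps y hy)
  have h3 : ∀ α β, ((p.withMetric g').h y)⁻¹ α β = (p.factor Υ y)⁻¹ * (p.h y)⁻¹ α β :=
    (hp.conformal_h hc).inv_apply hy
  ext b
  simp only [nor, h3]
  congr 1
  refine Finset.sum_congr rfl fun α _ => Finset.sum_congr rfl fun β _ =>
    Finset.sum_congr rfl fun c _ => ?_
  change _ * _ * _ * g' (p.φ y) c a = _
  rw [h2, tan_withMetric, tan_withMetric]
  field_simp

theorem frame_withMetric (hy : y ∈ U) (i : Index k n) :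
    (p.withMetric g').frame y i = p.frame y i := by
  cases i with
  | inl α => simp only [frame, Sum.elim_inl, tan_withMetric]
  | inr a => simp only [frame, Sum.elim_inr, hp.nor_withMetric hc hy]

theorem proj_withMetric (hy : y ∈ U) (T : Tensor n r) (i : Fin r → Index k n) :
    (p.withMetric g').proj T y i = p.proj T y i := by
  simp only [proj, hp.frame_withMetric hc hy]
  rfl

theorem ip_withMetric (hy : y ∈ U) (v w : Fin n → ℝ) :
    (p.withMetric g').ip y v w = p.factor Υ y * p.ip y v w := by
  have h2 : ∀ a b, g' (p.φ y) a b = p.factor Υ y * p.g (p.φ y) a b := hc.apply (hp.maps y hy)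
  simp only [ip, withMetric, h2, Finset.mul_sum, mul_assoc]

theorem W_withMetric (hn : 2 < n) (hy : y ∈ U) (i : Fin 4 → Index k n) :
    (p.withMetric g').W y i = p.factor Υ y * p.W y i := by
  rw [W, hp.proj_withMetric hc hy, W, proj, proj, Finset.mul_sum]
  refine Finset.sum_congr rfl fun a _ => ?_
  have : weyl g' (p.φ y) a = p.factor Υ y * weyl p.g (p.φ y) a := by
    rw [← vec_four_eta a]; exact hc.weyl_eq hn (hp.maps y hy) _ _ _ _
  change _ * weyl g' (p.φ y) a = _
  rw [this]; ring

theorem isNField_normalD : p.IsNField U (p.normalD Υ) :=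
  hp.isNField_slot (dform_smooth hc.smooth) 0

theorem proj_dform_inl (hy : y ∈ U) (α : Fin k) :
    p.proj (dform Υ) y ![inl α] = pd (p.res Υ) y α := by
  have : p.proj (dform Υ) y ![inl α] = ev (dform Υ (p.φ y)) ![p.tan y α] := by
    rw [proj_eq_ev]
    exact ev_comp _ _ _ fun j => by fin_cases j; rfl
  rw [this, ev_one, hp.pd_res hc hy]
  rfl

/-! #### The second fundamental form -/

theorem L_withMetric (hy : y ∈ U) (α β : Fin k) (b : Fin n) :
    (p.withMetric g').L y ![α, β] b =
      p.factor Υ y * (p.L y ![α, β] b - p.h y α β * p.normalD Υ y ![] b) := by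
  rw [L_eq_ip, hp.ip_withMetric hc hy, hp.nor_withMetric hc hy, L_eq_ip]
  have h1 : (p.withMetric g').covD (fun z => (p.withMetric g').tan z β) y α = fun d =>
      p.covD (fun z => p.tan z β) y α d + (pd (p.res Υ) y β * p.tan y α d +
        pd (p.res Υ) y α * p.tan y β d - p.h y α β * gradUp p.g Υ (p.φ y) d) := by
    ext d
    have h2 : ∀ d e f, christoffel g' (p.φ y) d e f = _ := hc.christoffel_eq (hp.maps y hy)
    simp only [covD, tan_withMetric]
    change _ + ∑ e, ∑ f, christoffel g' (p.φ y) d e f * p.tan y α e * p.tan y β f = _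
    simp only [h2, add_mul, sub_mul, Finset.sum_add_distrib, Finset.sum_sub_distrib]
    have e1 : ∑ e, ∑ f, kron d e * pd Υ (p.φ y) f * p.tan y α e * p.tan y β f =
        pd (p.res Υ) y β * p.tan y α d := by
      rw [hp.pd_res hc hy, Finset.sum_mul, Finset.sum_comm]
      refine Finset.sum_congr rfl fun f _ => ?_
      rw [← sum_kron_mul' (fun e => p.tan y β f * pd Υ (p.φ y) f * p.tan y α e) d]
      exact Finset.sum_congr rfl fun e _ => by ring
    have e2 : ∑ e, ∑ f, kron d f * pd Υ (p.φ y) e * p.tan y α e * p.tan y β f =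
        pd (p.res Υ) y α * p.tan y β d := by
      rw [hp.pd_res hc hy, Finset.sum_mul]
      refine Finset.sum_congr rfl fun e _ => ?_
      rw [← sum_kron_mul' (fun f => p.tan y α e * pd Υ (p.φ y) e * p.tan y β f) d]
      exact Finset.sum_congr rfl fun e _ => by ring
    have e3 : ∑ e, ∑ f, p.g (p.φ y) e f * gradUp p.g Υ (p.φ y) d * p.tan y α e * p.tan y β f =
        p.h y α β * gradUp p.g Υ (p.φ y) d := by
      simp only [h, Matrix.of_apply, Finset.sum_mul]
      exact Finset.sum_congr rfl fun e _ => Finset.sum_congr rfl fun f _ => by ring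
    rw [e1, e2, e3]
    ring
  have h3 : p.ip y (p.nor y b) (gradUp p.g Υ (p.φ y)) = p.normalD Υ y ![] b := by
    rw [normalD_apply]
    exact hp.ip_raise hy _ _
  have h4 : ∀ α, p.ip y (p.nor y b) (p.tan y α) = 0 := hp.ip_nor_tan hy b
  rw [h1]
  have h5 : p.ip y (p.nor y b) (fun d =>
      p.covD (fun z => p.tan z β) y α d + (pd (p.res Υ) y β * p.tan y α d +
        pd (p.res Υ) y α * p.tan y β d - p.h y α β * gradUp p.g Υ (p.φ y) d)) =
      p.ip y (p.nor y b) (p.covD (fun z => p.tan z β) y α) +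
      (pd (p.res Υ) y β * p.ip y (p.nor y b) (p.tan y α) +
        pd (p.res Υ) y α * p.ip y (p.nor y b) (p.tan y β) -
        p.h y α β * p.ip y (p.nor y b) (gradUp p.g Υ (p.φ y))) := by
    simp only [ip, Finset.mul_sum, ← Finset.sum_add_distrib, ← Finset.sum_sub_distrib]
    exact Finset.sum_congr rfl fun e _ => Finset.sum_congr rfl fun f _ => by ring
  rw [h5, h4, h4, h3]
  ring

theorem H_withMetric (hk : k ≠ 0) (hy : y ∈ U) (A : Fin 0 → Fin k) (b : Fin n) :
    (p.withMetric g').H y A b = p.H y A b - p.normalD Υ y A b := by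
  have hk' : (k : ℝ) ≠ 0 := by exact_mod_cast hk
  have h1 := factor_ne_zero (p := p) (Υ := Υ) y
  rw [Subsingleton.elim A ![]]
  simp only [H]
  rw [hp.trT_scale hc hy _ (fun α β => hp.L_withMetric hc hy α β b), trT_eq, ctr_sub]
  have : ctr p.h y (fun α β => p.h y α β * p.normalD Υ y ![] b) = k * p.normalD Υ y ![] b := by
    rw [← ctr_self hp.induced hy]; exact ctr_mul_right _ _
  rw [this, trT_eq]
  field_simp

theorem Lo_withMetric (hk : k ≠ 0) (hy : y ∈ U) (A : Fin 2 → Fin k) (b : Fin n) :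
    (p.withMetric g').Lo y A b = p.factor Υ y * p.Lo y A b := by
  rw [← vec_two_eta A]
  simp only [Lo, Matrix.cons_val]
  rw [hp.L_withMetric hc hy, hp.H_withMetric hc hk hy, hp.h_withMetric hc hy]
  ring

/-! #### Derivatives of the conformal factor -/

theorem hess_tangential (hy : y ∈ U) (ε α : Fin k) :
    p.proj (nabla p.g (dform Υ)) y ![inl ε, inl α] = nabla p.h (dform (p.res Υ)) y ![ε, α] -
      p.trN y fun a a' => p.L y ![ε, α] a * p.normalD Υ y ![] a' := by
  have h1 := hp.nabla_ev (dform_smooth hc.smooth) hy ε ![α]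
  have h2 : nabla p.h (fun z (A : Fin 1 → Fin k) => ev (dform Υ (p.φ z)) fun j => p.tan z (A j)) y
      (Fin.cons ε ![α]) = nabla p.h (dform (p.res Υ)) y ![ε, α] := by
    refine nabla_congr (V := U) (fun z hz A => ?_) hy _
    have : (fun j => p.tan z (A j)) = ![p.tan z (A 0)] := by
      ext j : 1; fin_cases j; rfl
    rw [this, ev_one, dform, hp.pd_res hc hz]
    rfl
  have h3 : ev (nabla p.g (dform Υ) (p.φ y)) (Fin.cons (p.tan y ε) fun j => p.tan y (![α] j)) =
      p.proj (nabla p.g (dform Υ)) y ![inl ε, inl α] := by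
    rw [proj_eq_ev]
    exact ev_comp _ _ _ fun j => by fin_cases j <;> rfl
  have h4 : ∀ a', ev (dform Υ (p.φ y)) (Function.update (fun j => p.tan y (![α] j)) 0 (p.nor y a')) =
      p.normalD Υ y ![] a' := by
    intro a'
    rw [normalD, slot]
    exact ev_comp _ _ _ fun j => by fin_cases j; rfl
  rw [h2, h3] at h1
  simp only [Fin.sum_univ_one, h4] at h1
  rw [h1]
  exact (add_sub_cancel_right _ _).symm

theorem hess_mixed (hy : y ∈ U) (ε : Fin k) (b : Fin n) :
    p.proj (nabla p.g (dform Υ)) y ![inl ε, inr b] = p.nablaN (p.normalD Υ) y ![ε] b +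
      p.trT y fun γ δ => p.L y ![ε, δ] b * pd (p.res Υ) y γ := by
  have h1 := hp.nablaN_slot (dform_smooth hc.smooth) 0 hy ε ![] b
  have h3 : ev (nabla p.g (dform Υ) (p.φ y)) (Fin.cons (p.tan y ε) ((0 : Fin 1).insertNth (p.nor y b)
      fun j => p.tan y (![] j))) =
      p.proj (nabla p.g (dform Υ)) y ![inl ε, inr b] := by
    rw [proj_eq_ev]
    exact ev_comp _ _ _ fun j => by fin_cases j <;> rfl
  have h4 : ∀ γ, ev (dform Υ (p.φ y)) ((0 : Fin 1).insertNth (p.tan y γ) fun j => p.tan y (![] j)) =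
      pd (p.res Υ) y γ := by
    intro γ
    rw [← hp.proj_dform_inl hc hy, proj_eq_ev]
    exact ev_comp _ _ _ fun j => by fin_cases j; rfl
  rw [h3] at h1
  simp only [h4, Fin.sum_univ_zero, add_zero] at h1
  have h5 : p.nablaN (p.slot (dform Υ) 0) y (Fin.cons ε ![]) b = p.nablaN (p.normalD Υ) y ![ε] b :=
    rfl
  rw [h5] at h1
  linarith

theorem nablaN_withMetric {T : NTensor k n 0} (hT : p.IsNField U T) (hy : y ∈ U) (ε : Fin k)
    (b : Fin n) :
    (p.withMetric g').nablaN T y ![ε] b = p.nablaN T y ![ε] b - pd (p.res Υ) y ε * T y ![] b := by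
  have h2 : ∀ d e f, christoffel g' (p.φ y) d e f = _ := hc.christoffel_eq (hp.maps y hy)
  have h0 : Fin.tail ![ε] = ![] := rfl
  simp only [nablaN, Fin.sum_univ_zero, sub_zero, h0, hp.nor_withMetric hc hy, Matrix.cons_val_zero,
    tan_withMetric]
  change ∑ c, p.nor y b c * (_ - ∑ d, ∑ e, christoffel g' (p.φ y) d e c * _ * _) = _
  have h3 : ∀ c, ∑ d, ∑ e, christoffel g' (p.φ y) d e c * p.tan y ε e * T y ![] d =
      (∑ d, ∑ e, christoffel p.g (p.φ y) d e c * p.tan y ε e * T y ![] d) +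
      pd (p.res Υ) y ε * T y ![] c - (∑ e, p.g (p.φ y) e c * p.tan y ε e) *
        ∑ d, gradUp p.g Υ (p.φ y) d * T y ![] d := by
    intro c
    simp only [h2, add_mul, sub_mul, Finset.sum_add_distrib, Finset.sum_sub_distrib]
    have e1 : ∑ d, ∑ e, kron d e * pd Υ (p.φ y) c * p.tan y ε e * T y ![] d = 0 := by
      rw [← mul_zero (pd Υ (p.φ y) c), ← hT.normal y hy ![] ε, Finset.mul_sum]
      refine Finset.sum_congr rfl fun d _ => ?_
      rw [← sum_kron_mul' (fun e => pd Υ (p.φ y) c * (p.tan y ε e * T y ![] d)) d]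
      exact Finset.sum_congr rfl fun e _ => by ring
    have e2 : ∑ d, ∑ e, kron d c * pd Υ (p.φ y) e * p.tan y ε e * T y ![] d =
        pd (p.res Υ) y ε * T y ![] c := by
      rw [hp.pd_res hc hy, ← sum_kron_mul (fun d => (∑ a, p.tan y ε a * pd Υ (p.φ y) a) *
        T y ![] d) c]
      refine Finset.sum_congr rfl fun d _ => ?_
      rw [Finset.sum_mul, Finset.mul_sum]
      exact Finset.sum_congr rfl fun e _ => by ring
    have e3 : ∑ d, ∑ e, p.g (p.φ y) e c * gradUp p.g Υ (p.φ y) d * p.tan y ε e * T y ![] d =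
        (∑ e, p.g (p.φ y) e c * p.tan y ε e) * ∑ d, gradUp p.g Υ (p.φ y) d * T y ![] d := by
      rw [Finset.sum_mul_sum, Finset.sum_comm]
      exact Finset.sum_congr rfl fun e _ => Finset.sum_congr rfl fun d _ => by ring
    rw [e1, e2, e3]
    ring
  have h4 : ∑ c, p.nor y b c * (∑ e, p.g (p.φ y) e c * p.tan y ε e) = 0 := by
    rw [← hp.ip_nor_tan hy b ε]
    simp only [ip, Finset.mul_sum]
    exact Finset.sum_congr rfl fun c _ => Finset.sum_congr rfl fun d _ => by
      rw [hp.metric.symm (hp.maps y hy) d c]; ring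
  rw [← hp.sum_nor_field hT hy ![] b, Finset.mul_sum, ← Finset.sum_sub_distrib, ← sub_eq_zero,
    ← Finset.sum_sub_distrib, ← zero_mul (∑ d, gradUp p.g Υ (p.φ y) d * T y ![] d), ← h4,
    Finset.sum_mul]
  refine Finset.sum_congr rfl fun c _ => ?_
  rw [h3]
  change _ * (pd (fun z => T z ![] c) y ε - _) - _ = _
  ring

theorem trN_normalD (hy : y ∈ U) :
    (ctr p.g (p.φ y) fun a b => dform Υ (p.φ y) ![a] * dform Υ (p.φ y) ![b]) =
      (p.trT y fun α β => pd (p.res Υ) y α * pd (p.res Υ) y β) +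
      p.trN y fun a b => p.normalD Υ y ![] a * p.normalD Υ y ![] b := by
  rw [hp.ctr_split hy]
  simp only [trT_eq, trN_eq]
  congr 1
  · refine ctr_congr fun α β => ?_
    rw [hp.pd_res hc hy, hp.pd_res hc hy, Finset.sum_mul_sum]
    exact Finset.sum_congr rfl fun c _ => Finset.sum_congr rfl fun d _ => by
      simp only [dform, Matrix.cons_val]; ring
  · refine ctr_congr fun α β => ?_
    rw [normalD_apply, normalD_apply, Finset.sum_mul_sum]
    exact Finset.sum_congr rfl fun c _ => Finset.sum_congr rfl fun d _ => by
      simp only [dform, Matrix.cons_val]; ring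

theorem P_withMetric (hn : 2 < n) (hy : y ∈ U) (i j : Index k n) :
    (p.withMetric g').P y ![i, j] = p.P y ![i, j] - p.proj (nabla p.g (dform Υ)) y ![i, j] +
      p.proj (dform Υ) y ![i] * p.proj (dform Υ) y ![j] -
      (1 / 2) * ((p.trT y fun α β => pd (p.res Υ) y α * pd (p.res Υ) y β) +
        p.trN y fun a b => p.normalD Υ y ![] a * p.normalD Υ y ![] b) * p.gm y i j := by
  have h1 : p.proj (dform Υ) y ![i] * p.proj (dform Υ) y ![j] =
      p.proj (r := 2) (fun x a => dform Υ x (a ∘ ![0]) * dform Υ x (a ∘ ![1])) y ![i, j] := by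
    rw [proj_mul _ _ (by decide), comp_vec_one, comp_vec_one]; rfl
  have h2 : (1 / 2) * ((p.trT y fun α β => pd (p.res Υ) y α * pd (p.res Υ) y β) +
        p.trN y fun a b => p.normalD Υ y ![] a * p.normalD Υ y ![] b) * p.gm y i j =
      p.proj (r := 2) (fun x a => (1 / 2) * (ctr p.g x fun a b => dform Υ x ![a] * dform Υ x ![b]) *
        p.g x (a 0) (a 1)) y ![i, j] := by
    rw [proj_const_mul, proj_metric, hp.trN_normalD hc hy]
    rfl
  rw [h1, h2, P, hp.proj_withMetric hc hy, P, ← proj_sub, ← proj_add, ← proj_sub]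
  refine proj_congr (fun a => ?_) _
  rw [← vec_two_eta a]
  change schouten g' (p.φ y) _ = _
  rw [hc.schouten_eq hn (hp.maps y hy), schoutenChange, comp_vec_one, comp_vec_one]
  simp only [Matrix.cons_val]
  ring

theorem D_withMetric (hk : k ≠ 0) (hn : 2 < n) (hy : y ∈ U) (α : Fin k) (b : Fin n) :
    (p.withMetric g').D y α b = p.D y α b -
      p.trT y fun γ δ => pd (p.res Υ) y γ * p.Lo y ![δ, α] b := by
  have h1 : (p.withMetric g').nablaN (p.withMetric g').H y ![α] b =
      (p.withMetric g').nablaN (fun z A b => p.H z A b - p.normalD Υ z A b) y ![α] b :=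
    nablaN_congr (U := U) (fun z hz A b => hp.H_withMetric hc hk hz A b) hy _ b
  have hN := hp.isNField_normalD hc
  rw [D, D, hp.P_withMetric hc hn hy, h1, hp.nablaN_withMetric hc (hp.isNField_H.sub hN) hy,
    nablaN_sub hp.isNField_H hN hy, hp.hess_mixed hc hy, hp.proj_dform_inl hc hy, proj_dform_inr,
    hp.gm_inl_inr hy]
  have h2 : (p.trT y fun γ δ => p.L y ![α, δ] b * pd (p.res Υ) y γ) =
      (p.trT y fun γ δ => pd (p.res Υ) y γ * p.Lo y ![δ, α] b) + p.H y ![] b * pd (p.res Υ) y α := by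
    have h3 : p.H y ![] b * pd (p.res Υ) y α =
        ctr p.h y fun γ δ => p.H y ![] b * (p.h y α δ * pd (p.res Υ) y γ) := by
      rw [ctr_mul_left]
      exact congrArg _ (ctr_metric' hp.induced hy (fun γ => pd (p.res Υ) y γ) α).symm
    rw [h3, trT_eq, trT_eq, ← ctr_add]
    exact ctr_congr fun γ δ => by
      rw [hp.Lo_symm hy]; simp only [Lo, Matrix.cons_val]; ring
  rw [h2]
  ring

theorem calP_withMetric (hk : k ≠ 0) (hn : 2 < n) (hy : y ∈ U) (α β : Fin k) :
    (p.withMetric g').calP y ![α, β] = p.calP y ![α, β] - nabla p.h (dform (p.res Υ)) y ![α, β] +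
      pd (p.res Υ) y α * pd (p.res Υ) y β -
      (1 / 2) * (p.trT y fun α β => pd (p.res Υ) y α * pd (p.res Υ) y β) * p.h y α β := by
  have h1 := factor_ne_zero (p := p) (Υ := Υ) y
  have e1 : (p.withMetric g').HL y ![α, β] =
      p.HL y ![α, β] - p.trN y fun a a' => p.normalD Υ y ![] a * p.Lo y ![α, β] a' := by
    rw [HL, hp.trN_scale hc hy (p.factor Υ y) (f := fun a a' => (p.H y ![] a - p.normalD Υ y ![] a) *
      p.Lo y ![α, β] a') (fun a b => by
        rw [hp.H_withMetric hc hk hy, hp.Lo_withMetric hc hk hy]; ring),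
      inv_mul_cancel₀ h1, one_mul, HL]
    simp only [trN_eq, sub_mul, ctr_sub]
  have e2 : (p.withMetric g').normHsq y = (p.factor Υ y)⁻¹ * (p.normHsq y -
      2 * (p.trN y fun a a' => p.normalD Υ y ![] a * p.H y ![] a') +
      p.trN y fun a b => p.normalD Υ y ![] a * p.normalD Υ y ![] b) := by
    have : (p.trN y fun a a' => p.normalD Υ y ![] a * p.H y ![] a') =
        p.trN y fun a a' => p.H y ![] a * p.normalD Υ y ![] a' := by
      rw [trN_eq, ctr_swap hp.metric (hp.maps y hy)]
      exact ctr_congr fun a b => mul_comm _ _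
    rw [two_mul]
    nth_rewrite 1 [this]
    simp only [normHsq]
    rw [hp.trN_withMetric hc hy]
    simp only [hp.H_withMetric hc hk hy, trN_eq, ← ctr_add, ← ctr_sub]
    congr 1
    exact ctr_congr fun a b => by ring
  have e3 : (p.trN y fun a a' => p.L y ![α, β] a * p.normalD Υ y ![] a') =
      (p.trN y fun a a' => p.normalD Υ y ![] a * p.Lo y ![α, β] a') +
      (p.trN y fun a a' => p.normalD Υ y ![] a * p.H y ![] a') * p.h y α β := by
    rw [trN_eq, ctr_swap hp.metric (hp.maps y hy)]
    simp only [trN_eq]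
    rw [← ctr_mul_right, ← ctr_add]
    exact ctr_congr fun a b => by simp only [Lo, Matrix.cons_val]; ring
  rw [calP_apply, calP_apply]
  simp only [Matrix.cons_val]
  rw [hp.P_withMetric hc hn hy, hp.hess_tangential hc hy, hp.proj_dform_inl hc hy,
    hp.proj_dform_inl hc hy, gm_inl, e1, e2, e3, hp.h_withMetric hc hy]
  field_simp
  ring

theorem C_withMetric (hn : 2 < n) (hy : y ∈ U) (i j l : Index k n) :
    (p.withMetric g').C y ![i, j, l] = p.C y ![i, j, l] -
      ((p.trT y fun γ γ' => pd (p.res Υ) y γ * p.W y ![i, j, l, inl γ']) +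
      p.trN y fun a a' => p.normalD Υ y ![] a * p.W y ![i, j, l, inr a']) := by
  have h1 := hp.proj_trace hy (r := 3) (fun x B => dform Υ x (B ∘ ![0]) *
    weyl p.g x (B ∘ ![2, 3, 4, 1])) ![i, j, l]
  have h2 : ∀ B : Fin 5 → Index k n, p.proj (fun x B => dform Υ x (B ∘ ![0]) *
      weyl p.g x (B ∘ ![2, 3, 4, 1])) y B = p.proj (dform Υ) y ![B 0] *
      p.W y ![B 2, B 3, B 4, B 1] := by
    intro B
    rw [proj_mul _ _ (by decide), comp_vec_one, comp_vec_four, W]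
  simp only [h2] at h1
  have h3 : (p.trT y fun γ γ' => pd (p.res Υ) y γ * p.W y ![i, j, l, inl γ']) =
      p.trT y fun γ γ' => p.proj (dform Υ) y ![inl γ] * p.W y ![i, j, l, inl γ'] := by
    simp only [hp.proj_dform_inl hc hy]
  have h4 : (p.trN y fun a a' => p.normalD Υ y ![] a * p.W y ![i, j, l, inr a']) =
      p.trN y fun a a' => p.proj (dform Υ) y ![inr a] * p.W y ![i, j, l, inr a'] := by
    simp only [proj_dform_inr]
  rw [h3, h4]
  refine Eq.trans ?_ (congrArg (fun t => p.C y ![i, j, l] - t) h1)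
  rw [C, hp.proj_withMetric hc hy, C, ← proj_sub]
  refine proj_congr (fun a => ?_) _
  have h5 : a = ![a 0, a 1, a 2] := by ext x; fin_cases x <;> rfl
  rw [h5]
  change cotton g' (p.φ y) _ = _
  rw [hc.cotton_eq hn (hp.maps y hy)]
  congr 1
  simp only [gradUp, Finset.sum_mul, comp_vec_one, comp_vec_four]
  rw [ctr_swap hp.metric (hp.maps y hy), ctr]
  exact Finset.sum_congr rfl fun c _ => Finset.sum_congr rfl fun d _ => mul_assoc _ _ _

theorem calC_withMetric (hk : k ≠ 0) (hn : 2 < n) (hy : y ∈ U) (i j l : Index k n) :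
    (p.withMetric g').calC y i j l = p.calC y i j l -
      p.trT y fun γ γ' => pd (p.res Υ) y γ * p.W y ![i, j, l, inl γ'] := by
  rw [calC, hp.C_withMetric hc hn hy, hp.trN_scale hc hy (p.factor Υ y) (f := fun a a' =>
    (p.H y ![] a - p.normalD Υ y ![] a) * p.W y ![i, j, l, inr a']) (fun a b => by
      rw [hp.H_withMetric hc hk hy, hp.W_withMetric hc hn hy]; ring),
      inv_mul_cancel₀ (factor_ne_zero _), one_mul, calC]
  simp only [trN_eq, sub_mul, ctr_sub]
  ring

end IsRegularOn

end Patch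

end

end ConformalSubmanifold

namespace ConformalSubmanifold

open TopologicalSpace (Opens)

noncomputable section

/-- The divergence of a rescaled one-form with respect to a conformally changed metric. -/
theorem IsConformalChange.div_eq {m : ℕ} {g g' : MetricField m} {Υ : E m → ℝ} {V : Opens (E m)}
    (hc : IsConformalChange g g' Υ V) {T T' : Tensor m 1} (hT : SmoothTensor V T)
    (h : ∀ z ∈ V, ∀ A, T' z A = (Real.exp (2 * Υ z))⁻¹ * T z A) {x : E m} (hx : x ∈ V) :
    (ctr g' x fun a b => nabla g' T' x ![a, b]) = (Real.exp (2 * Υ x))⁻¹ ^ 2 *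
      ((ctr g x fun a b => nabla g T x ![a, b]) +
        ((m : ℝ) - 4) * ctr g x fun a b => pd Υ x a * T x ![b]) := by
  have hs : SmoothOn V fun z => (Real.exp (2 * Υ z))⁻¹ := by
    simp only [← Real.exp_neg]
    exact (hc.smooth.const_mul 2).neg.exp
  have hpd : ∀ a, pd (fun z => (Real.exp (2 * Υ z))⁻¹) x a =
      -2 * pd Υ x a * (Real.exp (2 * Υ x))⁻¹ := by
    intro a
    have : (fun z => (Real.exp (2 * Υ z))⁻¹) = fun z => Real.exp (-2 * Υ z) := by
      ext z; rw [← Real.exp_neg]; congr 1; ring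
    rw [this, pd_exp (hc.smooth.const_mul (-2)) hx, pd_const_mul (-2) hc.smooth hx, ← Real.exp_neg]
    have : -(2 * Υ x) = -2 * Υ x := by ring
    rw [this]; ring
  have hT' : SmoothTensor V T' := fun A => (hs.mul (hT A)).congr fun z hz => h z hz A
  have h1 : ∀ a b, nabla g T' x ![a, b] = (Real.exp (2 * Υ x))⁻¹ *
      (nabla g T x ![a, b] - 2 * (pd Υ x a * T x ![b])) := by
    intro a b
    rw [nabla_congr h hx]
    refine (nabla_fun_mul hs hT hx a ![b]).trans ?_
    rw [hpd]
    change _ + _ * nabla g T x ![a, b] = _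
    ring
  have h2 : ∀ a b, nabla g' T' x ![a, b] = (Real.exp (2 * Υ x))⁻¹ * (nabla g T x ![a, b] -
      3 * (pd Υ x a * T x ![b]) - pd Υ x b * T x ![a] +
        (ctr g x fun a b => pd Υ x a * T x ![b]) * g x a b) := by
    intro a b
    have h3 : nabla g' T' x ![a, b] = nabla g T' x ![a, b] - pd Υ x a * T' x ![b] -
        pd Υ x b * T' x ![a] + (∑ d, gradUp g Υ x d * T' x ![d]) * g x a b := by
      rw [nabla_one, nabla_one]
      simp only [hc.christoffel_eq hx, add_mul, sub_mul, Finset.sum_add_distrib,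
        Finset.sum_sub_distrib]
      have e1 : ∑ d, kron d a * pd Υ x b * T' x ![d] = pd Υ x b * T' x ![a] := by
        rw [← sum_kron_mul (fun d => pd Υ x b * T' x ![d]) a]
        exact Finset.sum_congr rfl fun d _ => by ring
      have e2 : ∑ d, kron d b * pd Υ x a * T' x ![d] = pd Υ x a * T' x ![b] := by
        rw [← sum_kron_mul (fun d => pd Υ x a * T' x ![d]) b]
        exact Finset.sum_congr rfl fun d _ => by ring
      have e3 : ∑ d, g x a b * gradUp g Υ x d * T' x ![d] =
          (∑ d, gradUp g Υ x d * T' x ![d]) * g x a b := by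
        rw [Finset.sum_mul]
        exact Finset.sum_congr rfl fun d _ => by ring
      rw [e1, e2, e3]
      ring
    have h4 : ∑ d, gradUp g Υ x d * T' x ![d] = (Real.exp (2 * Υ x))⁻¹ *
        ctr g x fun a b => pd Υ x a * T x ![b] := by
      rw [ctr_swap hc.metric hx, ctr, Finset.mul_sum]
      refine Finset.sum_congr rfl fun a _ => ?_
      rw [gradUp, h x hx, Finset.sum_mul, Finset.mul_sum]
      exact Finset.sum_congr rfl fun d _ => by ring
    rw [h3, h1, h4, h x hx, h x hx]
    ring
  rw [hc.ctr_eq hx]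
  simp only [h2]
  rw [ctr_mul_left, ctr_add, ctr_sub, ctr_sub, ctr_mul_left]
  have e1 : (ctr g x fun a b => pd Υ x b * T x ![a]) = ctr g x fun a b => pd Υ x a * T x ![b] :=
    ctr_swap hc.metric hx _
  have e2 : ctr g x (fun a b => (ctr g x fun a b => pd Υ x a * T x ![b]) * g x a b) =
      (ctr g x fun a b => pd Υ x a * T x ![b]) * m := by
    rw [← ctr_self hc.metric hx]; exact ctr_mul_left _ _
  rw [e1, e2]
  ring

namespace Patch

open Sum (inl inr)

variable {k n r s t : ℕ} {p : Patch k n} {U : Opens (E k)} {V : Opens (E n)} {y : E k}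
  {g' : MetricField n} {Υ : E n → ℝ}

/-- The inner product of the differential of a function with a one-form. -/
def dot (p : Patch k n) (u : E k → ℝ) (T : Tensor k 1) (y : E k) : ℝ :=
  ctr p.h y fun α β => pd u y α * T y ![β]

/-- The contraction of `L̊²` with the gradient of a function. -/
def gradLsq (p : Patch k n) (u : E k → ℝ) : Tensor k 1 := fun z A =>
  ctr p.h z fun γ δ => pd u z γ * p.Lsq z ![δ, A 0]

theorem dot_sub (u : E k → ℝ) (S T : Tensor k 1) :
    p.dot u (fun z A => S z A - T z A) y = p.dot u S y - p.dot u T y := by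
  simp only [dot, mul_sub, ctr_sub]

namespace IsRegularOn

variable (hp : p.IsRegularOn U V) (hc : IsConformalChange p.g g' Υ V)

include hp

theorem Lsq_symm (hy : y ∈ U) (α β : Fin k) : p.Lsq y ![α, β] = p.Lsq y ![β, α] := by
  simp only [Lsq, trT_eq, trN_eq, Matrix.cons_val]
  rw [ctr_swap hp.induced hy]
  refine ctr_congr fun γ γ' => ?_
  rw [ctr_swap hp.metric (hp.maps y hy)]
  exact ctr_congr fun a a' => mul_comm _ _

theorem gradLsq_smooth {u : E k → ℝ} (hu : SmoothOn U u) : SmoothTensor U (p.gradLsq u) := fun _ =>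
  hp.trT_smooth fun _ _ => (hu.pd _).mul (hp.Lsq_smooth _)

theorem divT_gradLsq {u : E k → ℝ} (hu : SmoothOn U u) (hy : y ∈ U) :
    p.divT (p.gradLsq u) y = p.dot u p.divLsq y + p.inner2 p.Lsq (nabla p.h (dform u)) y := by
  have hd := dform_smooth hu
  have h1 : ∀ α β, nabla p.h (p.gradLsq u) y ![α, β] =
      (ctr p.h y fun γ δ => nabla p.h (dform u) y ![α, γ] * p.Lsq y ![δ, β]) +
      ctr p.h y fun γ δ => pd u y γ * nabla p.h p.Lsq y ![α, δ, β] := by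
    intro α β
    have h2 := nabla_trace (r := 1) hp.induced (T := fun z B => dform u z (B ∘ ![0]) *
      p.Lsq z (B ∘ ![1, 2])) (fun B => (hd _).mul (hp.Lsq_smooth _)) hy α ![β]
    rw [← ctr_add]
    refine Eq.trans ?_ (h2.trans (ctr_congr fun γ δ => ?_))
    · refine nabla_congr (V := U) (fun z _ A => ctr_congr fun γ δ => ?_) hy _
      rw [comp_vec_two]; rfl
    · rw [nabla_mul hd hp.Lsq_smooth (by decide) hy, comp_vec_one, comp_vec_two]
      rfl
  rw [divT_eq]
  simp only [h1, ctr_add]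
  rw [add_comm]
  refine congrArg₂ (· + ·) ?_ ?_
  · rw [ctr_comm]
    simp only [ctr_mul_left]
    rfl
  · rw [hp.inner2_comm hy]
    refine ctr_congr fun α β => ctr_congr fun γ δ => ?_
    rw [hp.Lsq_symm hy]

include hc

theorem divT_withMetric {T T' : Tensor k 1} (hT : SmoothTensor U T)
    (h : ∀ z ∈ U, ∀ A, T' z A = (p.factor Υ z)⁻¹ * T z A) (hy : y ∈ U) :
    (p.withMetric g').divT T' y = (p.factor Υ y)⁻¹ ^ 2 *
      (p.divT T y + ((k : ℝ) - 4) * p.dot (p.res Υ) T y) :=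
  (hp.conformal_h hc).div_eq hT h hy

variable (hk : k ≠ 0) (hn : 2 < n)

include hk in
theorem Lsq_withMetric (hy : y ∈ U) (A : Fin 2 → Fin k) : (p.withMetric g').Lsq y A = p.Lsq y A := by
  have h1 := factor_ne_zero (p := p) (Υ := Υ) y
  rw [Lsq, hp.trT_scale hc hy _ (fun γ γ' => hp.trN_scale hc hy (p.factor Υ y * p.factor Υ y)
    (f := fun a a' => p.Lo y ![γ, A 0] a * p.Lo y ![γ', A 1] a') fun a a' => by
      rw [hp.Lo_withMetric hc hk hy, hp.Lo_withMetric hc hk hy]; ring)]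
  rw [← Lsq]
  field_simp

include hk in
theorem normLsq_withMetric (hy : y ∈ U) :
    (p.withMetric g').normLsq y = (p.factor Υ y)⁻¹ * p.normLsq y := by
  rw [← trace_Lsq, ← trace_Lsq]
  simp only [hp.Lsq_withMetric hc hk hy]
  exact hp.trT_withMetric hc hy _

include hn

theorem Wtr_withMetric (hy : y ∈ U) (A : Fin 2 → Fin k) : (p.withMetric g').Wtr y A = p.Wtr y A := by
  have h1 := factor_ne_zero (p := p) (Υ := Υ) y
  rw [Wtr, hp.trT_scale hc hy _ (fun γ γ' => hp.W_withMetric hc hn hy _), inv_mul_cancel₀ h1, one_mul,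
    Wtr]

theorem Wtrtr_withMetric (hy : y ∈ U) :
    (p.withMetric g').Wtrtr y = (p.factor Υ y)⁻¹ * p.Wtrtr y := by
  have h1 := hp.trT_scale hc hy 1 (f := fun α β => p.Wtr y ![α, β])
    (f' := fun α β => (p.withMetric g').Wtr y ![α, β])
    (fun α β => by rw [hp.Wtr_withMetric hc hn hy, one_mul])
  rw [mul_one] at h1
  exact h1

theorem Wmix_withMetric (hy : y ∈ U) (α : Fin k) (a : Fin n) :
    (p.withMetric g').Wmix y α a = p.Wmix y α a := by
  have h1 := factor_ne_zero (p := p) (Υ := Υ) y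
  rw [Wmix, hp.trT_scale hc hy _ (fun γ γ' => hp.W_withMetric hc hn hy _), inv_mul_cancel₀ h1, one_mul,
    Wmix]

include hk

theorem G_withMetric (hy : y ∈ U) : (p.withMetric g').G y = (p.factor Υ y)⁻¹ * p.G y := by
  rw [G, G, hp.normLsq_withMetric hc hk hy, hp.Wtrtr_withMetric hc hn hy]; ring

theorem F_withMetric (hy : y ∈ U) (A : Fin 2 → Fin k) : (p.withMetric g').F y A = p.F y A := by
  have h1 := factor_ne_zero (p := p) (Υ := Υ) y
  rw [F, F, hp.Lsq_withMetric hc hk hy, hp.Wtr_withMetric hc hn hy, hp.G_withMetric hc hk hn hy,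
    hp.h_withMetric hc hy]
  field_simp

omit hk hn in
theorem inner2_withMetric (hy : y ∈ U) (S T : Tensor k 2) :
    (p.withMetric g').inner2 S T y = (p.factor Υ y)⁻¹ ^ 2 * p.inner2 S T y := by
  rw [inner2, hp.trT_scale hc hy _ fun α α' => hp.trT_withMetric hc hy _, ← inner2]
  ring

theorem LW_withMetric (hy : y ∈ U) (A : Fin 1 → Fin k) :
    (p.withMetric g').LW y A = (p.factor Υ y)⁻¹ * p.LW y A := by
  have h1 := factor_ne_zero (p := p) (Υ := Υ) y
  rw [LW, hp.trT_scale hc hy _ fun β β' => hp.trT_scale hc hy _ fun γ γ' =>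
    hp.trN_scale hc hy (p.factor Υ y * p.factor Υ y) (f := fun a a' =>
      p.Lo y ![β, γ] a * p.W y ![inl (A 0), inl β', inr a', inl γ']) fun a a' => by
        rw [hp.Lo_withMetric hc hk hy, hp.W_withMetric hc hn hy]; ring, ← LW]
  field_simp

theorem LWmix_withMetric (hy : y ∈ U) (A : Fin 1 → Fin k) :
    (p.withMetric g').LWmix y A = (p.factor Υ y)⁻¹ * p.LWmix y A := by
  have h1 := factor_ne_zero (p := p) (Υ := Υ) y
  rw [LWmix, hp.trT_scale hc hy _ fun β β' =>
    hp.trN_scale hc hy (p.factor Υ y) (f := fun a a' =>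
      p.Lo y ![A 0, β] a * p.Wmix y β' a') fun a a' => by
        rw [hp.Lo_withMetric hc hk hy, hp.Wmix_withMetric hc hn hy]; ring, ← LWmix]
  field_simp

theorem DL_withMetric (hy : y ∈ U) (A : Fin 1 → Fin k) :
    (p.withMetric g').DL y A = (p.factor Υ y)⁻¹ * (p.DL y A - p.gradLsq (p.res Υ) y A) := by
  have h1 := factor_ne_zero (p := p) (Υ := Υ) y
  have h2 : p.gradLsq (p.res Υ) y A = p.trT y fun β β' => p.trN y fun a a' =>
      (p.trT y fun γ δ => pd (p.res Υ) y γ * p.Lo y ![δ, β] a) * p.Lo y ![A 0, β'] a' := by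
    simp only [gradLsq, Lsq, trT_eq, trN_eq, Matrix.cons_val, ← ctr_mul_left, ← ctr_mul_right]
    rw [ctr_comm]
    refine ctr_congr fun β β' => ?_
    rw [ctr_comm]
    refine ctr_congr fun a a' => ctr_congr fun γ δ => ?_
    rw [hp.Lo_symm hy β, hp.Lo_symm hy β', mul_assoc]
  rw [DL, hp.trT_scale hc hy _ fun β β' =>
    hp.trN_scale hc hy (p.factor Υ y) (f := fun a a' =>
      (p.D y β a - p.trT y fun γ δ => pd (p.res Υ) y γ * p.Lo y ![δ, β] a) *
        p.Lo y ![A 0, β'] a') fun a a' => by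
        rw [hp.Lo_withMetric hc hk hy, hp.D_withMetric hc hk hn hy]; ring, h2, DL]
  simp only [sub_mul, trT_eq, trN_eq, ctr_sub]
  field_simp

theorem DW_withMetric (hy : y ∈ U) :
    (p.withMetric g').DW y = (p.factor Υ y)⁻¹ ^ 2 * (p.DW y - p.dot (p.res Υ) p.LWmix y) := by
  have h1 := factor_ne_zero (p := p) (Υ := Υ) y
  have h2 : p.dot (p.res Υ) p.LWmix y = p.trT y fun α α' => p.trN y fun a a' =>
      (p.trT y fun γ δ => pd (p.res Υ) y γ * p.Lo y ![δ, α] a) * p.Wmix y α' a' := by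
    simp only [dot, LWmix, trT_eq, trN_eq, Matrix.cons_val, ← ctr_mul_left, ← ctr_mul_right]
    rw [ctr_comm]
    refine ctr_congr fun β β' => ?_
    rw [ctr_comm]
    refine ctr_congr fun a a' => ctr_congr fun γ δ => ?_
    rw [mul_assoc]
  rw [DW, hp.trT_scale hc hy _ fun β β' =>
    hp.trN_scale hc hy 1 (f := fun a a' =>
      (p.D y β a - p.trT y fun γ δ => pd (p.res Υ) y γ * p.Lo y ![δ, β] a) *
        p.Wmix y β' a') fun a a' => by
        rw [hp.Wmix_withMetric hc hn hy, hp.D_withMetric hc hk hn hy]; ring, h2, DW]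
  simp only [sub_mul, trT_eq, trN_eq, ctr_sub]
  ring

theorem normDsq_withMetric (hy : y ∈ U) :
    (p.withMetric g').normDsq y = (p.factor Υ y)⁻¹ ^ 2 * (p.normDsq y -
      2 * p.dot (p.res Υ) p.DL y + p.dot (p.res Υ) (p.gradLsq (p.res Υ)) y) := by
  let X : Fin k → Fin n → ℝ := fun β a => ctr p.h y fun γ δ => pd (p.res Υ) y γ * p.Lo y ![δ, β] a
  have h2 : p.dot (p.res Υ) p.DL y = ctr p.h y fun α α' => ctr p.g (p.φ y) fun a a' =>
      p.D y α a * X α' a' := by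
    simp only [X, dot, DL, trT_eq, trN_eq, Matrix.cons_val, ← ctr_mul_left]
    rw [ctr_comm]
    refine ctr_congr fun β β' => ?_
    rw [ctr_comm]
    refine ctr_congr fun a a' => ctr_congr fun γ δ => ?_
    ring
  have h3 : p.dot (p.res Υ) p.DL y = ctr p.h y fun α α' => ctr p.g (p.φ y) fun a a' =>
      X α a * p.D y α' a' := by
    rw [h2, ctr_swap hp.induced hy]
    refine ctr_congr fun β β' => ?_
    rw [ctr_swap hp.metric (hp.maps y hy)]
    exact ctr_congr fun a a' => mul_comm _ _
  have h4 : p.dot (p.res Υ) (p.gradLsq (p.res Υ)) y = ctr p.h y fun α α' =>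
      ctr p.g (p.φ y) fun a a' => X α a * X α' a' := by
    simp only [dot, gradLsq, Lsq, trT_eq, trN_eq, Matrix.cons_val]
    have : ∀ α α' a a', X α a * X α' a' = ctr p.h y fun σ τ => ctr p.h y fun γ δ =>
        pd (p.res Υ) y σ * (pd (p.res Υ) y γ * (p.Lo y ![α, δ] a * p.Lo y ![α', τ] a')) := by
      intro α α' a a'
      simp only [X]
      rw [mul_comm, ← ctr_mul_right]
      refine ctr_congr fun σ τ => ?_
      rw [← ctr_mul_left]
      refine ctr_congr fun γ δ => ?_
      rw [hp.Lo_symm hy δ, hp.Lo_symm hy τ]; ring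
    simp only [this, ← ctr_mul_left]
    calc _ = ctr p.h y fun σ τ => ctr p.h y fun α α' => ctr p.g (p.φ y) fun a a' =>
          ctr p.h y fun γ δ => pd (p.res Υ) y σ * (pd (p.res Υ) y γ *
            (p.Lo y ![α, δ] a * p.Lo y ![α', τ] a')) := by
          refine ctr_congr fun σ τ => ?_
          rw [ctr_comm]
          exact ctr_congr fun α α' => ctr_comm _
      _ = _ := by
          rw [ctr_comm]
          exact ctr_congr fun α α' => ctr_comm _
  rw [normDsq, hp.trT_scale hc hy _ fun β β' =>
    hp.trN_scale hc hy 1 (f := fun a a' =>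
      (p.D y β a - X β a) * (p.D y β' a' - X β' a')) fun a a' => by
        rw [hp.D_withMetric hc hk hn hy, hp.D_withMetric hc hk hn hy, one_mul]; rfl]
  rw [two_mul]
  nth_rewrite 1 [h2]
  rw [h3, h4, normDsq]
  simp only [sub_mul, mul_sub, trT_eq, trN_eq, ctr_sub]
  ring

theorem LC_withMetric (hy : y ∈ U) :
    (p.withMetric g').LC y = (p.factor Υ y)⁻¹ ^ 2 * (p.LC y - p.dot (p.res Υ) p.LW y) := by
  have h1 := factor_ne_zero (p := p) (Υ := Υ) y
  have h2 : p.dot (p.res Υ) p.LW y = p.trT y fun α α' => p.trT y fun β β' => p.trN y fun a a' =>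
      p.Lo y ![α, β] a *
        p.trT y fun γ γ' => pd (p.res Υ) y γ * p.W y ![inl α', inr a', inl β', inl γ'] := by
    simp only [dot, LW, trT_eq, trN_eq, Matrix.cons_val, ← ctr_mul_left]
    rw [ctr_comm]
    have : ∀ α α', (ctr p.h y fun σ τ => ctr p.h y fun β β' => ctr p.g (p.φ y) fun a a' =>
        pd (p.res Υ) y σ * (p.Lo y ![α, β] a * p.W y ![inl τ, inl α', inr a', inl β'])) =
        ctr p.h y fun β β' => ctr p.g (p.φ y) fun a a' => ctr p.h y fun σ τ =>
        pd (p.res Υ) y σ * (p.Lo y ![α, β] a * p.W y ![inl τ, inl α', inr a', inl β']) := by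
      intro α α'
      rw [ctr_comm]
      exact ctr_congr fun _ _ => ctr_comm _
    simp only [this]
    rw [ctr_comm]
    refine ctr_congr fun α α' => ctr_congr fun β β' => ctr_congr fun a a' => ctr_congr fun γ δ => ?_
    rw [hp.Lo_symm hy β, hp.W_pair hy, W_swap_left, hp.W_swap_right hy (inl α')]
    ring
  rw [LC, hp.trT_scale hc hy _ fun α α' => hp.trT_scale hc hy _ fun β β' =>
    hp.trN_scale hc hy (p.factor Υ y) (f := fun a a' =>
      p.Lo y ![α, β] a * (p.calC y (inl α') (inr a') (inl β') - p.trT y fun γ γ' =>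
        pd (p.res Υ) y γ * p.W y ![inl α', inr a', inl β', inl γ'])) fun a a' => by
        rw [hp.Lo_withMetric hc hk hy, hp.calC_withMetric hc hk hn hy]; ring, h2, LC]
  simp only [mul_sub, trT_eq, trN_eq, ctr_sub]
  field_simp

theorem K1_withMetric (hy : y ∈ U) :
    (p.withMetric g').K1 y = (p.factor Υ y)⁻¹ ^ 2 * p.K1 y := by
  rw [K1_eq, K1_eq, hp.divT_withMetric hc hp.LW_smooth
    (fun z hz A => hp.LW_withMetric hc hk hn hz A) hy, hp.LC_withMetric hc hk hn hy]
  ring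

theorem K2_withMetric (hy : y ∈ U) :
    (p.withMetric g').K2 y = (p.factor Υ y)⁻¹ ^ 2 * p.K2 y := by
  rw [K2_eq, K2_eq, hp.divT_withMetric hc hp.LWmix_smooth
    (fun z hz A => hp.LWmix_withMetric hc hk hn hz A) hy, hp.DW_withMetric hc hk hn hy]
  ring

theorem trCalP_withMetric (hy : y ∈ U) :
    (p.withMetric g').trCalP y = (p.factor Υ y)⁻¹ * (p.trCalP y - p.lap (p.res Υ) y +
      (1 - (k : ℝ) / 2) * p.dot (p.res Υ) (dform (p.res Υ)) y) := by
  rw [trCalP, hp.trT_withMetric hc hy]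
  simp only [hp.calP_withMetric hc hk hn hy, trT_eq]
  rw [ctr_sub, ctr_add, ctr_sub]
  have e1 : ctr p.h y (fun α β => 1 / 2 * (ctr p.h y fun α β => pd (p.res Υ) y α *
      pd (p.res Υ) y β) * p.h y α β) = 1 / 2 * p.dot (p.res Υ) (dform (p.res Υ)) y * k := by
    rw [← ctr_self hp.induced hy]; exact ctr_mul_left _ _
  have e2 : ctr p.h y (fun α β => pd (p.res Υ) y α * pd (p.res Υ) y β) =
      p.dot (p.res Υ) (dform (p.res Υ)) y := rfl
  have e3 : ctr p.h y (fun α β => nabla p.h (dform (p.res Υ)) y ![α, β]) = p.lap (p.res Υ) y := by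
    rw [lap_eq]; rfl
  have e4 : ctr p.h y (fun α β => p.calP y ![α, β]) = p.trCalP y := rfl
  rw [e1, e2, e3, e4]
  ring

theorem inner2_Lsq_calP_withMetric (hy : y ∈ U) :
    (p.withMetric g').inner2 (p.withMetric g').Lsq (p.withMetric g').calP y =
      (p.factor Υ y)⁻¹ ^ 2 * (p.inner2 p.Lsq p.calP y
        - p.inner2 p.Lsq (nabla p.h (dform (p.res Υ))) y
        + p.dot (p.res Υ) (p.gradLsq (p.res Υ)) y
        - (1 / 2) * p.dot (p.res Υ) (dform (p.res Υ)) y * p.normLsq y) := by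
  rw [hp.inner2_withMetric hc hy]
  simp only [inner2, hp.Lsq_withMetric hc hk hy, hp.calP_withMetric hc hk hn hy, trT_eq]
  congr 1
  simp only [mul_sub, mul_add, ctr_sub, ctr_add]
  have e1 : (ctr p.h y fun α α' => ctr p.h y fun β β' => p.Lsq y ![α, β] *
      (pd (p.res Υ) y α' * pd (p.res Υ) y β')) = p.dot (p.res Υ) (p.gradLsq (p.res Υ)) y := by
    simp only [dot, gradLsq, ← ctr_mul_left]
    rw [ctr_swap hp.induced hy]
    refine ctr_congr fun α α' => ?_
    rw [ctr_swap hp.induced hy]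
    refine ctr_congr fun β β' => ?_
    rw [hp.Lsq_symm hy]
    simp only [Matrix.cons_val]
    ring
  have e2 : (ctr p.h y fun α α' => ctr p.h y fun β β' => p.Lsq y ![α, β] *
      (1 / 2 * (ctr p.h y fun α β => pd (p.res Υ) y α * pd (p.res Υ) y β) * p.h y α' β')) =
      1 / 2 * p.dot (p.res Υ) (dform (p.res Υ)) y * p.normLsq y := by
    rw [← trace_Lsq]
    refine (ctr_congr fun α α' => ?_).trans (ctr_mul_left _ _)
    have := ctr_metric' hp.induced hy (fun β => p.Lsq y ![α, β]) α'
    rw [← this]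
    refine (ctr_congr fun β β' => ?_).trans (ctr_mul_left _ _)
    simp only [dot, dform, Matrix.cons_val]; ring
  rw [e1, e2]

omit hn in
theorem lap_normLsq_withMetric (hy : y ∈ U) :
    (p.withMetric g').lap (p.withMetric g').normLsq y = (p.factor Υ y)⁻¹ ^ 2 *
      (p.lap p.normLsq y - 2 * p.normLsq y * p.lap (p.res Υ) y
        + ((k : ℝ) - 6) * p.dot (p.res Υ) (dform p.normLsq) y
        - 2 * ((k : ℝ) - 4) * p.normLsq y * p.dot (p.res Υ) (dform (p.res Υ)) y) := by
  have hf := hp.normLsq_smooth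
  have hu := hp.res_smooth hc
  let T : Tensor k 1 := fun z A => dform p.normLsq z A - 2 * (p.normLsq z * dform (p.res Υ) z A)
  have hT : SmoothTensor U T := fun A =>
    (dform_smooth hf A).sub ((hf.mul (dform_smooth hu A)).const_mul 2)
  have hs : SmoothOn U fun z => (p.factor Υ z)⁻¹ := by
    simp only [factor, ← Real.exp_neg]
    exact (hu.const_mul 2).neg.exp
  have hpd : ∀ z ∈ U, ∀ A : Fin 1 → Fin k, pd (p.withMetric g').normLsq z (A 0) =
      (p.factor Υ z)⁻¹ * T z A := by
    intro z hz A
    have h1 : pd (fun z => (p.factor Υ z)⁻¹) z (A 0) =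
        -2 * pd (p.res Υ) z (A 0) * (p.factor Υ z)⁻¹ := by
      have : (fun z => (p.factor Υ z)⁻¹) = fun z => Real.exp (-2 * p.res Υ z) := by
        ext z; rw [factor, ← Real.exp_neg]; congr 1; ring
      rw [this, pd_exp (hu.const_mul (-2)) hz, pd_const_mul (-2) hu hz, factor, ← Real.exp_neg]
      have : -(2 * p.res Υ z) = -2 * p.res Υ z := by ring
      rw [this]; ring
    rw [pd_congr (fun x hx => hp.normLsq_withMetric hc hk hx) hz, pd_mul hs hf hz, h1]
    simp only [T, dform]
    ring
  rw [lap_eq, hp.divT_withMetric hc hT hpd hy]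
  have e1 : p.divT T y = p.lap p.normLsq y - 2 * (p.dot (p.res Υ) (dform p.normLsq) y +
      p.normLsq y * p.lap (p.res Υ) y) := by
    have h2 : SmoothTensor U fun z A => p.normLsq z * dform (p.res Υ) z A := fun A =>
      hf.mul (dform_smooth hu A)
    rw [divT_sub (dform_smooth hf) (fun A => (h2 A).const_mul 2) hy, divT_const_mul 2 h2 hy,
      lap_eq, lap_eq]
    congr 2
    rw [divT_eq, divT_eq, ← ctr_mul_left, dot, ctr_swap hp.induced hy fun α β => _ * _, ← ctr_add]
    refine ctr_congr fun α β => ?_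
    refine (nabla_fun_mul hf (dform_smooth hu) hy α ![β]).trans ?_
    simp only [dform, Matrix.cons_val]
    rw [mul_comm]
    rfl
  have e2 : p.dot (p.res Υ) T y = p.dot (p.res Υ) (dform p.normLsq) y -
      2 * (p.normLsq y * p.dot (p.res Υ) (dform (p.res Υ)) y) := by
    simp only [dot, T, mul_sub, ctr_sub, ← ctr_mul_left]
    congr 1
    exact ctr_congr fun α β => by ring
  rw [e1, e2]
  ring

/-- The combination `2𝓘 + 𝓙` is a conformal invariant. -/
theorem two_mul_I_add_J_withMetric (hk1 : 1 < k) (hy : y ∈ U) :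
    2 * (p.withMetric g').I y + (p.withMetric g').J y =
      (p.factor Υ y)⁻¹ ^ 2 * (2 * p.I y + p.J y) := by
  have hu := hp.res_smooth hc
  have hdiv : (p.withMetric g').divT (p.withMetric g').DL y = (p.factor Υ y)⁻¹ ^ 2 *
      (p.divT p.DL y - (p.dot (p.res Υ) p.divLsq y +
        p.inner2 p.Lsq (nabla p.h (dform (p.res Υ))) y) + ((k : ℝ) - 4) *
        (p.dot (p.res Υ) p.DL y - p.dot (p.res Υ) (p.gradLsq (p.res Υ)) y)) := by
    rw [hp.divT_withMetric hc (T := fun z A => p.DL z A - p.gradLsq (p.res Υ) z A)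
      (fun A => (hp.DL_smooth A).sub (hp.gradLsq_smooth hu A))
      (fun z hz A => hp.DL_withMetric hc hk hn hz A) hy,
      divT_sub hp.DL_smooth (hp.gradLsq_smooth hu) hy, hp.divT_gradLsq hu hy, dot_sub]
  have hE : p.dot (p.res Υ) (dform p.normLsq) y = 2 * (p.dot (p.res Υ) p.divLsq y +
      p.dot (p.res Υ) p.LW y + p.dot (p.res Υ) p.LWmix y +
      ((k : ℝ) - 2) * p.dot (p.res Υ) p.DL y) := by
    simp only [dot, ← ctr_mul_left, ← ctr_add]
    refine ctr_congr fun α β => ?_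
    have := hp.half_pd_normLsq hk hy β
    simp only [dform, Matrix.cons_val]
    linear_combination 2 * pd (p.res Υ) y α * this
  rw [(hp.regular_withMetric hc).two_mul_I_add_J hk1 hy, hp.two_mul_I_add_J hk1 hy, hdiv,
    hp.lap_normLsq_withMetric hc hk hy, hp.normLsq_withMetric hc hk hy,
    hp.trCalP_withMetric hc hk hn hy, hp.inner2_Lsq_calP_withMetric hc hk hn hy,
    hp.normDsq_withMetric hc hk hn hy, hp.DW_withMetric hc hk hn hy, hp.LC_withMetric hc hk hn hy, hE]
  ring

end IsRegularOn

end Patch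

end

end ConformalSubmanifold

namespace ConformalSubmanifold

open TopologicalSpace (Opens)

noncomputable section

namespace Patch

open Sum (inl inr)

variable {k n : ℕ} {p : Patch k n} {U : Opens (E k)} {V : Opens (E n)} {y : E k}
  {g' : MetricField n} {Υ : E n → ℝ}

/-! ### Conformal invariance of `𝒥₁` and `𝒥₂` -/

/-- The part of `𝒥₁` that is algebraic in `L̊` and `W`. -/
def J1alg (p : Patch k n) (y : E k) : ℝ :=
    (p.trT y fun α α' => p.trT y fun β β' => p.trT y fun γ γ' => p.trT y fun δ δ' =>
        p.trN y fun a a' => p.Lo y ![α, γ] a * p.Lo y ![β, δ] a' *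
          p.W y ![inl α', inl β', inl γ', inl δ'])
    - (p.trT y fun α α' => p.trT y fun β β' => p.trT y fun γ γ' =>
        p.trN y fun a a' => p.trN y fun b b' => p.Lo y ![α, β] a * p.Lo y ![α', β'] b *
          p.W y ![inr a', inl γ, inr b', inl γ'])
    + (p.trT y fun α α' => p.trT y fun β β' => p.trT y fun γ γ' =>
        p.trN y fun a a' => p.trN y fun b b' => p.Lo y ![γ, α] a * p.Lo y ![γ', β] b *
          (2 * p.W y ![inl α', inr a', inl β', inr b'] -
            p.W y ![inl α', inl β', inr a', inr b']))
    - (1 / 2) * (p.trT y fun α α' => p.trT y fun β β' => p.trT y fun γ γ' =>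
        p.trN y fun a a' => p.W y ![inl α, inl β, inr a, inl γ] *
          p.W y ![inl α', inl β', inr a', inl γ'])
    + (p.trT y fun α α' => p.trN y fun a a' => p.Wmix y α a * p.Wmix y α' a')

theorem J1_eq (y : E k) : p.J1 y =
    -(((k : ℝ) - 2) / (2 * ((k : ℝ) - 3) * ((k : ℝ) - 6))) * (2 * p.I y + p.J y)
    + ((k : ℝ) - 2) / ((k : ℝ) - 3) * (p.K1 y + p.K2 y + p.inner2 p.Lsq p.F y)
    + p.inner2 p.Lsq p.Wtr y
    + ((k : ℝ) - 2) / (((k : ℝ) - 3) * ((k : ℝ) - 6)) * (p.G y * p.normLsq y) + p.J1alg y := by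
  rw [J1, J1alg]; ring

namespace IsRegularOn

variable (hp : p.IsRegularOn U V) (hc : IsConformalChange p.g g' Υ V) (hk : 1 < k) (hn : 2 < n)

include hp hc hk hn

theorem J1alg_withMetric (hy : y ∈ U) :
    (p.withMetric g').J1alg y = (p.factor Υ y)⁻¹ ^ 2 * p.J1alg y := by
  have h1 := factor_ne_zero (p := p) (Υ := Υ) y
  have hk0 : k ≠ 0 := by omega
  have hL := fun A b => hp.Lo_withMetric hc hk0 hy A b
  have hW := fun i => hp.W_withMetric hc hn hy i
  set c := p.factor Υ y with hcdef
  rw [J1alg,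
    hp.trT_scale hc hy _ fun α α' => hp.trT_scale hc hy _ fun β β' => hp.trT_scale hc hy _
      fun γ γ' => hp.trT_scale hc hy _ fun δ δ' => hp.trN_scale hc hy (c * c * c)
        (f := fun a a' => p.Lo y ![α, γ] a * p.Lo y ![β, δ] a' *
          p.W y ![inl α', inl β', inl γ', inl δ']) fun a a' => by
          rw [hL, hL, hW]; ring,
    hp.trT_scale hc hy _ fun α α' => hp.trT_scale hc hy _ fun β β' => hp.trT_scale hc hy _
      fun γ γ' => hp.trN_scale hc hy _ fun a a' => hp.trN_scale hc hy (c * c * c)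
        (f := fun b b' => p.Lo y ![α, β] a * p.Lo y ![α', β'] b *
          p.W y ![inr a', inl γ, inr b', inl γ']) fun b b' => by
          rw [hL, hL, hW]; ring,
    hp.trT_scale hc hy _ fun α α' => hp.trT_scale hc hy _ fun β β' => hp.trT_scale hc hy _
      fun γ γ' => hp.trN_scale hc hy _ fun a a' => hp.trN_scale hc hy (c * c * c)
        (f := fun b b' => p.Lo y ![γ, α] a * p.Lo y ![γ', β] b *
          (2 * p.W y ![inl α', inr a', inl β', inr b'] -
            p.W y ![inl α', inl β', inr a', inr b'])) fun b b' => by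
          rw [hL, hL, hW, hW]; ring,
    hp.trT_scale hc hy _ fun α α' => hp.trT_scale hc hy _ fun β β' => hp.trT_scale hc hy _
      fun γ γ' => hp.trN_scale hc hy (c * c)
        (f := fun a a' => p.W y ![inl α, inl β, inr a, inl γ] *
          p.W y ![inl α', inl β', inr a', inl γ']) fun a a' => by
          rw [hW, hW]; ring,
    hp.trT_scale hc hy _ fun α α' => hp.trN_scale hc hy 1
        (f := fun a a' => p.Wmix y α a * p.Wmix y α' a') fun a a' => by
          rw [hp.Wmix_withMetric hc hn hy, hp.Wmix_withMetric hc hn hy]; ring,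
    J1alg, ← hcdef]
  field_simp

theorem J2_withMetric (hy : y ∈ U) :
    (p.withMetric g').J2 y = (p.factor Υ y)⁻¹ ^ 2 * p.J2 y := by
  have hk0 : k ≠ 0 := by omega
  have hF : (p.withMetric g').inner2 (p.withMetric g').Lsq (p.withMetric g').F y =
      (p.factor Υ y)⁻¹ ^ 2 * p.inner2 p.Lsq p.F y := by
    rw [hp.inner2_withMetric hc hy]
    simp only [inner2, hp.Lsq_withMetric hc hk0 hy, hp.F_withMetric hc hk0 hn hy]
  rw [J2, J2, hp.two_mul_I_add_J_withMetric hc hk0 hn hk hy, hp.K1_withMetric hc hk0 hn hy,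
    hp.K2_withMetric hc hk0 hn hy, hF, hp.G_withMetric hc hk0 hn hy,
    hp.normLsq_withMetric hc hk0 hy]
  ring

theorem J1_withMetric (hy : y ∈ U) :
    (p.withMetric g').J1 y = (p.factor Υ y)⁻¹ ^ 2 * p.J1 y := by
  have hk0 : k ≠ 0 := by omega
  have hF : (p.withMetric g').inner2 (p.withMetric g').Lsq (p.withMetric g').F y =
      (p.factor Υ y)⁻¹ ^ 2 * p.inner2 p.Lsq p.F y := by
    rw [hp.inner2_withMetric hc hy]
    simp only [inner2, hp.Lsq_withMetric hc hk0 hy, hp.F_withMetric hc hk0 hn hy]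
  have hW : (p.withMetric g').inner2 (p.withMetric g').Lsq (p.withMetric g').Wtr y =
      (p.factor Υ y)⁻¹ ^ 2 * p.inner2 p.Lsq p.Wtr y := by
    rw [hp.inner2_withMetric hc hy]
    simp only [inner2, hp.Lsq_withMetric hc hk0 hy, hp.Wtr_withMetric hc hn hy]
  rw [J1_eq, J1_eq, hp.two_mul_I_add_J_withMetric hc hk0 hn hk hy, hp.K1_withMetric hc hk0 hn hy,
    hp.K2_withMetric hc hk0 hn hy, hF, hW, hp.G_withMetric hc hk0 hn hy,
    hp.normLsq_withMetric hc hk0 hy, hp.J1alg_withMetric hc hk hn hy]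
  ring

end IsRegularOn

end Patch

end

end ConformalSubmanifold

namespace ConformalSubmanifold

open TopologicalSpace (Opens)

noncomputable section

namespace Patch

open Sum (inl inr)

variable {k n : ℕ} {p : Patch k n} {U : Opens (E k)} {V : Opens (E n)} {y : E k}

/-! ### Expansion of the divergence terms -/

/-- The tensor `D` as a field with one normal index. -/
def DN (p : Patch k n) : NTensor k n 1 := fun z A a => p.D z (A 0) a

/-- The components `W_{αβα'γ}` as a field with one normal index. -/
def WN (p : Patch k n) : NTensor k n 3 := fun z A a =>
  p.W z ![inl (A 0), inl (A 1), inr a, inl (A 2)]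

/-- The components `W_{αβα'}{}^β` as a field with one normal index. -/
def WmixN (p : Patch k n) : NTensor k n 1 := fun z A a => p.Wmix z (A 0) a

theorem vec_one_eta {α : Type*} (A : Fin 1 → α) : ![A 0] = A := by
  ext a; fin_cases a; rfl

theorem vec_three_eta {α : Type*} (A : Fin 3 → α) : ![A 0, A 1, A 2] = A := by
  ext a; fin_cases a <;> rfl

namespace IsRegularOn

variable (hp : p.IsRegularOn U V)

include hp

theorem isNField_DN : p.IsNField U p.DN := hp.isNField_D

theorem isNField_WN : p.IsNField U p.WN := hp.isNField_W

theorem isNField_WmixN : p.IsNField U p.WmixN := hp.isNField_Wmix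

theorem nabla_DL (hy : y ∈ U) (ε α : Fin k) : nabla p.h p.DL y ![ε, α] = p.trT y fun β β' =>
    (p.trN y fun a a' => p.nablaN p.DN y ![ε, β] a * p.Lo y ![α, β'] a') +
      p.trN y fun a a' => p.D y β a * p.nablaN p.Lo y ![ε, α, β'] a' := by
  have h1 := nabla_trace (r := 1) hp.induced (T := fun z B => p.trN z fun a a' =>
    p.DN z (B ∘ ![0]) a * p.Lo z (B ∘ ![2, 1]) a') (fun B => hp.trN_smooth fun _ _ =>
      (hp.isNField_DN.smooth _ _).mul (hp.isNField_Lo.smooth _ _)) hy ε ![α]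
  refine Eq.trans ?_ (h1.trans (ctr_congr fun β β' => ?_))
  · refine nabla_congr (V := U) (fun z _ A => ctr_congr fun β β' => ?_) hy _
    simp only [comp_vec_one, comp_vec_two]; rfl
  · rw [hp.nabla_trN hp.isNField_DN hp.isNField_Lo (by decide) hy]
    simp only [comp_vec_one, comp_vec_two]; rfl

theorem nabla_LWmix (hy : y ∈ U) (ε α : Fin k) : nabla p.h p.LWmix y ![ε, α] =
    p.trT y fun β β' =>
      (p.trN y fun a a' => p.nablaN p.Lo y ![ε, α, β] a * p.Wmix y β' a') +
      p.trN y fun a a' => p.Lo y ![α, β] a * p.nablaN p.WmixN y ![ε, β'] a' := by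
  have h1 := nabla_trace (r := 1) hp.induced (T := fun z B => p.trN z fun a a' =>
    p.Lo z (B ∘ ![2, 0]) a * p.WmixN z (B ∘ ![1]) a') (fun B => hp.trN_smooth fun _ _ =>
      (hp.isNField_Lo.smooth _ _).mul (hp.isNField_WmixN.smooth _ _)) hy ε ![α]
  refine Eq.trans ?_ (h1.trans (ctr_congr fun β β' => ?_))
  · refine nabla_congr (V := U) (fun z _ A => ctr_congr fun β β' => ?_) hy _
    simp only [comp_vec_one, comp_vec_two]; rfl
  · rw [hp.nabla_trN hp.isNField_Lo hp.isNField_WmixN (by decide) hy]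
    simp only [comp_vec_one, comp_vec_two]; rfl

theorem nablaN_WmixN (hy : y ∈ U) (ε β : Fin k) (b : Fin n) : p.nablaN p.WmixN y ![ε, β] b =
    p.trT y fun γ γ' => p.nablaN p.WN y ![ε, β, γ, γ'] b := by
  have h1 := hp.nablaN_trace (r := 1) (hp.isNField_WN.perm ![2, 0, 1]) hy ε ![β] b
  refine Eq.trans ?_ (h1.trans (ctr_congr fun γ γ' => ?_))
  · refine nablaN_congr (U := U) (fun z _ A b => ctr_congr fun γ γ' => ?_) hy _ b
    rw [comp_vec_three]; rfl
  · rw [nablaN_perm p.WN (by decide), comp_vec_three]; rfl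

theorem nabla_LW (hy : y ∈ U) (ε α : Fin k) : nabla p.h p.LW y ![ε, α] =
    p.trT y fun β β' => p.trT y fun γ γ' =>
      (p.trN y fun a a' => p.nablaN p.Lo y ![ε, β, γ] a * p.WN y ![α, β', γ'] a') +
      p.trN y fun a a' => p.Lo y ![β, γ] a * p.nablaN p.WN y ![ε, α, β', γ'] a' := by
  let T : Tensor k 5 := fun z B => p.trN z fun a a' =>
    p.Lo z (B ∘ ![2, 0]) a * p.WN z (B ∘ ![4, 3, 1]) a'
  have hT : SmoothTensor U T := fun B => hp.trN_smooth fun _ _ =>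
      (hp.isNField_Lo.smooth _ _).mul (hp.isNField_WN.smooth _ _)
  let S : Tensor k 3 := fun z A => ctr p.h z fun γ γ' => T z (Fin.cons γ (Fin.cons γ' A))
  have hS : SmoothTensor U S := fun A => hp.trT_smooth fun _ _ => hT _
  have h1 := nabla_trace (r := 1) hp.induced hS hy ε ![α]
  refine Eq.trans ?_ (h1.trans (ctr_congr fun β β' => ?_))
  · refine nabla_congr (V := U) (fun z _ A => ctr_congr fun β β' => ctr_congr fun γ γ' => ?_) hy _
    simp only [T, comp_vec_three, comp_vec_two]; rfl
  · have h2 := nabla_trace (r := 3) hp.induced hT hy ε ![β, β', α]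
    refine Eq.trans ?_ (h2.trans (ctr_congr fun γ γ' => ?_))
    · rfl
    · refine (hp.nabla_trN hp.isNField_Lo hp.isNField_WN (by decide) hy _ _).trans ?_
      simp only [comp_vec_three, comp_vec_two]; rfl

theorem nablaN_WN (hy : y ∈ U) (ε α β γ : Fin k) (b : Fin n) :
    p.nablaN p.WN y ![ε, α, β, γ] b =
      p.proj (nabla p.g (weyl p.g)) y ![inl ε, inl α, inl β, inr b, inl γ] +
      ((p.trN y fun a a' => p.L y ![ε, α] a * p.W y ![inr a', inl β, inr b, inl γ]) +
      (p.trN y fun a a' => p.L y ![ε, β] a * p.W y ![inl α, inr a', inr b, inl γ]) +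
      p.trN y fun a a' => p.L y ![ε, γ] a * p.W y ![inl α, inl β, inr b, inr a']) -
      p.trT y fun σ δ => p.L y ![ε, δ] b * p.W y ![inl α, inl β, inl σ, inl γ] := by
  have h1 := hp.nablaN_slot hp.metric.weyl_smooth 2 hy ε ![α, β, γ] b
  have h2 : p.slot (weyl p.g) 2 = p.WN := by
    ext z A b; exact slot_weyl A b
  rw [h2] at h1
  refine h1.trans ?_
  rw [Fin.sum_univ_three]
  have e0 : ev (nabla p.g (weyl p.g) (p.φ y)) (Fin.cons (p.tan y ε) ((2 : Fin 4).insertNth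
      (p.nor y b) fun j => p.tan y (![α, β, γ] j))) =
      p.proj (nabla p.g (weyl p.g)) y ![inl ε, inl α, inl β, inr b, inl γ] := by
    rw [proj_eq_ev]; exact ev_comp _ _ _ fun j => by fin_cases j <;> rfl
  have e1 : ∀ a', ev (weyl p.g (p.φ y)) ((2 : Fin 4).insertNth (p.nor y b)
      (Function.update (fun j => p.tan y (![α, β, γ] j)) 0 (p.nor y a'))) =
      p.W y ![inr a', inl β, inr b, inl γ] := fun a' => by
    rw [W, proj_eq_ev]; exact ev_comp _ _ _ fun j => by fin_cases j <;> rfl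
  have e2 : ∀ a', ev (weyl p.g (p.φ y)) ((2 : Fin 4).insertNth (p.nor y b)
      (Function.update (fun j => p.tan y (![α, β, γ] j)) 1 (p.nor y a'))) =
      p.W y ![inl α, inr a', inr b, inl γ] := fun a' => by
    rw [W, proj_eq_ev]; exact ev_comp _ _ _ fun j => by fin_cases j <;> rfl
  have e3 : ∀ a', ev (weyl p.g (p.φ y)) ((2 : Fin 4).insertNth (p.nor y b)
      (Function.update (fun j => p.tan y (![α, β, γ] j)) 2 (p.nor y a'))) =
      p.W y ![inl α, inl β, inr b, inr a'] := fun a' => by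
    rw [W, proj_eq_ev]; exact ev_comp _ _ _ fun j => by fin_cases j <;> rfl
  have e4 : ∀ σ, ev (weyl p.g (p.φ y)) ((2 : Fin 4).insertNth (p.tan y σ)
      (fun j => p.tan y (![α, β, γ] j))) = p.W y ![inl α, inl β, inl σ, inl γ] := fun a' => by
    rw [W, proj_eq_ev]; exact ev_comp _ _ _ fun j => by fin_cases j <;> rfl
  simp only [e0, e1, e2, e3, e4]
  rfl

theorem nablaN_DN (hy : y ∈ U) (ε α : Fin k) (b : Fin n) :
    p.nablaN p.DN y ![ε, α] b =
      p.proj (nabla p.g (schouten p.g)) y ![inl ε, inl α, inr b] +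
      (p.trN y fun a a' => p.L y ![ε, α] a * p.P y ![inr a', inr b]) -
      (p.trT y fun γ δ => p.L y ![ε, δ] b * p.P y ![inl α, inl γ]) -
      p.nablaN (p.nablaN p.H) y ![ε, α] b := by
  have h0 : p.nablaN p.DN y ![ε, α] b = p.nablaN (fun z A b =>
      p.slot (schouten p.g) 1 z A b - p.nablaN p.H z A b) y ![ε, α] b :=
    nablaN_congr (U := U) (fun z _ A b => by rw [slot_schouten, DN, D, vec_one_eta]) hy _ b
  rw [h0, nablaN_sub (hp.isNField_slot hp.metric.schouten_smooth 1)
    (hp.isNField_nablaN hp.isNField_H) hy]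
  have h1 := hp.nablaN_slot hp.metric.schouten_smooth 1 hy ε ![α] b
  refine congrArg (fun t => t - p.nablaN (p.nablaN p.H) y ![ε, α] b) (h1.trans ?_)
  rw [Fin.sum_univ_one]
  have e0 : ev (nabla p.g (schouten p.g) (p.φ y)) (Fin.cons (p.tan y ε) ((1 : Fin 2).insertNth
      (p.nor y b) fun j => p.tan y (![α] j))) =
      p.proj (nabla p.g (schouten p.g)) y ![inl ε, inl α, inr b] := by
    rw [proj_eq_ev]; exact ev_comp _ _ _ fun j => by fin_cases j <;> rfl
  have e1 : ∀ a', ev (schouten p.g (p.φ y)) ((1 : Fin 2).insertNth (p.nor y b)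
      (Function.update (fun j => p.tan y (![α] j)) 0 (p.nor y a'))) =
      p.P y ![inr a', inr b] := fun a' => by
    rw [P, proj_eq_ev]; exact ev_comp _ _ _ fun j => by fin_cases j <;> rfl
  have e4 : ∀ σ, ev (schouten p.g (p.φ y)) ((1 : Fin 2).insertNth (p.tan y σ)
      (fun j => p.tan y (![α] j))) = p.P y ![inl α, inl σ] := fun a' => by
    rw [P, proj_eq_ev]; exact ev_comp _ _ _ fun j => by fin_cases j <;> rfl
  simp only [e0, e1, e4]
  rfl

omit hp in
theorem C_eq (i j l : Index k n) : p.C y ![i, j, l] =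
    p.proj (nabla p.g (schouten p.g)) y ![i, j, l] -
      p.proj (nabla p.g (schouten p.g)) y ![j, i, l] := by
  have h1 : p.proj (nabla p.g (schouten p.g)) y ![j, i, l] =
      p.proj (fun x a => nabla p.g (schouten p.g) x (a ∘ Equiv.swap 0 1)) y ![i, j, l] := by
    rw [proj_perm]; congr 1; ext x : 1; fin_cases x <;> rfl
  rw [h1, ← proj_sub, C]
  refine proj_congr (fun a => ?_) _
  have h2 : a ∘ ⇑(Equiv.swap (0 : Fin 3) 1) = ![a 1, a 0, a 2] := by
    ext x : 1; fin_cases x <;> rfl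
  rw [h2]
  conv_rhs => rw [← vec_three_eta a]
  rfl

theorem divT_DL (hy : y ∈ U) : p.divT p.DL y =
    (p.trT y fun α α' => p.trT y fun β β' => p.trN y fun a a' =>
      p.nablaN p.DN y ![α, β] a * p.Lo y ![α', β'] a') +
    p.trT y fun β β' => p.trN y fun a a' => p.D y β a * p.divLo y β' a' := by
  rw [divT_eq]
  simp only [hp.nabla_DL hy, trT_eq, ctr_add]
  refine congrArg₂ (· + ·) rfl ?_
  rw [ctr_comm]
  refine ctr_congr fun β β' => ?_
  simp only [trN_eq]
  rw [ctr_comm]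
  refine ctr_congr fun a a' => ?_
  rw [ctr_mul_left]
  rfl

end IsRegularOn

end Patch

end

end ConformalSubmanifold

namespace ConformalSubmanifold

open TopologicalSpace (Opens)

noncomputable section

namespace Patch

open Sum (inl inr)

variable {k n r : ℕ} {p : Patch k n} {U : Opens (E k)} {V : Opens (E n)} {y : E k}

/-! ### Hypersurfaces -/

/-- A unit conormal `N` of a hypersurface and the corresponding normal vector `ν`. -/
structure UnitNormal (p : Patch k n) (y : E k) (N ν : Fin n → ℝ) : Prop where
  nor : ∀ a c, p.nor y a c = N a * ν c
  unit : (p.trN y fun a a' => N a * N a') = 1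

/-- The components of an ambient tensor with respect to the tangent vectors (`some α`) and a
vector `ν` (`none`). -/
def projNu (p : Patch k n) (ν : Fin n → ℝ) (T : Tensor n r) (y : E k)
    (i : Fin r → Option (Fin k)) : ℝ :=
  ∑ a : Fin r → Fin n, (∏ j, (i j).elim ν (p.tan y) (a j)) * T (p.φ y) a

theorem IsRegularOn.exists_unitNormal (hp : p.IsRegularOn U V) (hn : n = k + 1) (hy : y ∈ U) :
    ∃ N ν, p.UnitNormal y N ν := by
  have hrank : (p.tanM y).rank = k := by
    have h : LinearIndependent ℝ (p.tanM y).row := hp.indep y hy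
    simpa using h.rank_matrix
  have hker : Module.finrank ℝ (LinearMap.ker (p.tanM y).mulVecLin) = 1 := by
    have := LinearMap.finrank_range_add_finrank_ker (p.tanM y).mulVecLin
    rw [Module.finrank_fin_fun] at this
    have h2 : Module.finrank ℝ (LinearMap.range (p.tanM y).mulVecLin) = k := hrank
    omega
  obtain ⟨⟨N, hN⟩, hN0, hspan⟩ := finrank_eq_one_iff'.1 hker
  have hN0' : N ≠ 0 := fun h => hN0 (Subtype.ext h)
  have hcol : ∀ b, ∃ c : ℝ, ∀ a, c * N a = p.nor y a b := fun b => by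
    obtain ⟨c, hc⟩ := hspan ⟨fun a => p.nor y a b, by
      ext α
      simpa [Matrix.mulVec, dotProduct, tanM] using hp.sum_tan_nor hy α b⟩
    exact ⟨c, fun a => congrFun (congrArg Subtype.val hc) a⟩
  choose ν hν using hcol
  have hpos : 0 < p.trN y fun a a' => N a * N a' := by
    have h1 := (hp.metric.posDef _ (hp.maps y hy)).inv.dotProduct_mulVec_pos hN0'
    simp only [star_trivial, dotProduct, Matrix.mulVec, Finset.mul_sum] at h1
    refine h1.trans_eq (Finset.sum_congr rfl fun a _ => Finset.sum_congr rfl fun b _ => ?_)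
    ring
  set c := p.trN y fun a a' => N a * N a' with hc
  have hs : √c ≠ 0 := (Real.sqrt_pos.2 hpos).ne'
  refine ⟨fun a => N a * (√c)⁻¹, fun a => ν a * √c, fun a b => ?_, ?_⟩
  · rw [← hν b a]; field_simp
  · have h1 : ∀ a a', N a * (√c)⁻¹ * (N a' * (√c)⁻¹) = ((√c)⁻¹ * (√c)⁻¹) * (N a * N a') :=
      fun a a' => by ring
    simp only [h1, trN_eq, ctr_mul_left]
    rw [← trN_eq, ← hc, ← mul_inv, Real.mul_self_sqrt hpos.le, inv_mul_cancel₀ hpos.ne']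

namespace UnitNormal

variable {N ν : Fin n → ℝ} (hN : p.UnitNormal y N ν)

include hN

theorem proj_eq (T : Tensor n r) (i : Fin r → Index k n) :
    p.proj T y i = (∏ j, Sum.elim (fun _ => 1) N (i j)) *
      p.projNu ν T y fun j => Sum.elim some (fun _ => none) (i j) := by
  rw [proj, projNu, Finset.mul_sum]
  refine Finset.sum_congr rfl fun a _ => ?_
  rw [← mul_assoc, ← Finset.prod_mul_distrib]
  refine congrArg (· * _) (Finset.prod_congr rfl fun j _ => ?_)
  rcases i j with α | b
  · simp [frame]
  · simp [frame, hN.nor]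

theorem field {T : NTensor k n r} (hp : p.IsRegularOn U V) (hT : p.IsNField U T) (hy : y ∈ U)
    (A : Fin r → Fin k) (a : Fin n) : T y A a = N a * ∑ c, ν c * T y A c := by
  rw [← hp.sum_nor_field hT hy A a, Finset.mul_sum]
  simp only [hN.nor, mul_assoc]

theorem trN_mul (s t : ℝ) :
    (p.trN y fun a a' => N a * s * (N a' * t)) = s * t := by
  have h1 : ∀ a a', N a * s * (N a' * t) = s * t * (N a * N a') := fun a a' => by ring
  simp only [h1, trN_eq, ctr_mul_left]
  rw [← trN_eq, hN.unit, mul_one]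

theorem trN_self (s : ℝ) : (p.trN y fun a a' => N a * N a' * s) = s := by
  simp only [trN_eq, ctr_mul_right]
  rw [← trN_eq, hN.unit, one_mul]

theorem trN_trN (s t w : ℝ) : (p.trN y fun a a' => p.trN y fun b b' =>
    N a * s * (N b * t) * (N a' * N b' * w)) = s * t * w := by
  have h1 : ∀ a a' b b', N a * s * (N b * t) * (N a' * N b' * w) =
    s * t * w * (N a * N a') * (N b * N b') := fun a a' b b' => by ring
  have hu : ctr p.g (p.φ y) (fun a a' => N a * N a') = 1 := hN.unit
  simp only [h1, trN_eq, ctr_mul_left, hu, mul_one]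

omit hN in
theorem eq_zero_of_skew {F : Fin n → Fin n → ℝ} {w : ℝ} (h : ∀ a b, F a b = N a * N b * w)
    (h' : ∀ a b, F a b = -F b a) (a b : Fin n) : F a b = 0 := by
  have h1 := h' a b
  have h2 : F b a = F a b := by rw [h, h, mul_comm (N a)]
  linarith

theorem W_nn (i j l q : Index k n) : p.W y ![i, j, l, q] =
    Sum.elim (fun _ => 1) N i * Sum.elim (fun _ => 1) N j * Sum.elim (fun _ => 1) N l *
      Sum.elim (fun _ => 1) N q * p.projNu ν (weyl p.g) y (fun s => Sum.elim some (fun _ => none)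
        ((![i, j, l, q] : Fin 4 → Index k n) s)) := by
  rw [W, hN.proj_eq, Fin.prod_univ_four]; rfl

omit hN in
theorem projNu_vec (f : Index k n → Option (Fin k)) (i j l q : Index k n) :
    (fun s => f ((![i, j, l, q] : Fin 4 → Index k n) s)) = ![f i, f j, f l, f q] := by
  ext s : 1; fin_cases s <;> rfl

theorem W_skew (i j : Index k n) (hp : p.IsRegularOn U V) (hy : y ∈ U) (a b : Fin n) :
    p.W y ![i, j, inr a, inr b] = 0 := by
  refine eq_zero_of_skew (N := N) (F := fun a b => p.W y ![i, j, inr a, inr b])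
    (w := Sum.elim (fun _ => 1) N i * Sum.elim (fun _ => 1) N j * p.projNu ν (weyl p.g) y
      ![Sum.elim some (fun _ => none) i, Sum.elim some (fun _ => none) j, none, none])
    (fun a b => ?_) (fun a b => hp.W_swap_right hy _ _ _ _) a b
  rw [hN.W_nn, projNu_vec]
  simp only [Sum.elim_inr]; ring

theorem W_ntnt (β γ : Fin k) (a b : Fin n) : p.W y ![inr a, inl β, inr b, inl γ] =
    N a * N b * p.projNu ν (weyl p.g) y ![none, some β, none, some γ] := by
  rw [hN.W_nn, projNu_vec]
  simp only [Sum.elim_inr, Sum.elim_inl, mul_one]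

section

variable (hp : p.IsRegularOn U V) (hy : y ∈ U)

include hp hy

theorem W_tntn (β γ : Fin k) (a b : Fin n) : p.W y ![inl β, inr a, inl γ, inr b] =
    N a * N b * p.projNu ν (weyl p.g) y ![none, some β, none, some γ] := by
  rw [IsRegularOn.W_swap_left, hp.W_swap_right hy, neg_neg, hN.W_ntnt]

theorem projNu_weyl (hn : 2 < n) (β γ : Fin k) :
    p.projNu ν (weyl p.g) y ![none, some β, none, some γ] = -p.Wtr y ![β, γ] := by
  have h := hp.W_trace hy (inl β) (inl γ) hn
  simp only [hN.W_tntn hp hy, hN.trN_self] at h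
  exact (neg_eq_of_add_eq_zero_right h).symm

theorem Wmix_eq_zero (hn : 2 < n) (α : Fin k) (a : Fin n) : p.Wmix y α a = 0 := by
  have h := hp.W_trace hy (inl α) (inr a) hn
  simp only [hN.W_skew _ _ hp hy, trN_eq, ctr_zero, add_zero] at h
  exact h

theorem trT_W_ntnt (hn : 2 < n) (a b : Fin n) :
    (p.trT y fun γ γ' => p.W y ![inr a, inl γ, inr b, inl γ']) = 0 := by
  have h := hp.W_trace hy (inr a) (inr b) hn
  simp only [hN.W_skew _ _ hp hy, trN_eq, ctr_zero, add_zero] at h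
  exact h

end

end UnitNormal

end Patch

end

end ConformalSubmanifold

namespace ConformalSubmanifold

open TopologicalSpace (Opens)

noncomputable section

namespace Patch

open Sum (inl inr)

variable {k n r : ℕ} {p : Patch k n} {U : Opens (E k)} {V : Opens (E n)} {y : E k}

/-- The scalar second fundamental form of a hypersurface. -/
def lo (p : Patch k n) (ν : Fin n → ℝ) (y : E k) (α β : Fin k) : ℝ := ∑ c, ν c * p.Lo y ![α, β] c

/-- The scalar mean curvature of a hypersurface. -/
def eta (p : Patch k n) (ν : Fin n → ℝ) (y : E k) : ℝ := ∑ c, ν c * p.H y ![] c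

theorem L_eq_Lo (α β : Fin k) (b : Fin n) :
    p.L y ![α, β] b = p.Lo y ![α, β] b + p.H y ![] b * p.h y α β := by
  simp only [Lo, Matrix.cons_val]; ring

namespace UnitNormal

variable {N ν : Fin n → ℝ} (hN : p.UnitNormal y N ν) (hp : p.IsRegularOn U V) (hy : y ∈ U)

include hN hp hy

theorem Lo_eq (α β : Fin k) (a : Fin n) : p.Lo y ![α, β] a = N a * p.lo ν y α β :=
  hN.field hp hp.isNField_Lo hy _ a

theorem H_eq (a : Fin n) : p.H y ![] a = N a * p.eta ν y :=
  hN.field hp hp.isNField_H hy _ a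

theorem L_eq (α β : Fin k) (a : Fin n) :
    p.L y ![α, β] a = N a * (p.lo ν y α β + p.eta ν y * p.h y α β) := by
  rw [L_eq_Lo, hN.Lo_eq hp hy, hN.H_eq hp hy]; ring

omit hN in
theorem lo_symm (α β : Fin k) : p.lo ν y α β = p.lo ν y β α := by
  simp only [lo, hp.Lo_symm hy α β]

omit hN in
theorem lo_trace (hk : k ≠ 0) : ctr p.h y (fun α β => p.lo ν y α β) = 0 := by
  have h : ∀ b, ctr p.h y (fun α β => p.Lo y ![α, β] b) = 0 := hp.Lo_trace hk hy
  simp only [lo, ctr_sum, ctr_mul_left, h, mul_zero, Finset.sum_const_zero]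

theorem HL_eq (α β : Fin k) : p.HL y ![α, β] = p.eta ν y * p.lo ν y α β := by
  simp only [HL, hN.Lo_eq hp hy, hN.H_eq hp hy, hN.trN_mul]

theorem normHsq_eq : p.normHsq y = p.eta ν y * p.eta ν y := by
  simp only [normHsq, hN.H_eq hp hy, hN.trN_mul]

theorem Lsq_eq (α β : Fin k) : p.Lsq y ![α, β] =
    ctr p.h y fun γ γ' => p.lo ν y γ α * p.lo ν y γ' β := by
  simp only [Lsq, Matrix.cons_val, hN.Lo_eq hp hy, hN.trN_mul, trT_eq]

theorem normLsq_eq : p.normLsq y = ctr p.h y fun α α' => ctr p.h y fun β β' =>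
    p.lo ν y α β * p.lo ν y α' β' := by
  simp only [normLsq, hN.Lo_eq hp hy, hN.trN_mul, trT_eq]

theorem inner2_HL (T : Tensor k 2) : p.inner2 p.HL T y = p.eta ν y *
    ctr p.h y fun α α' => ctr p.h y fun β β' => p.lo ν y α β * T y ![α', β'] := by
  simp only [inner2, hN.HL_eq hp hy, trT_eq, ← ctr_mul_left, mul_assoc]

theorem inner2_HL_HL : p.inner2 p.HL p.HL y = p.normHsq y * p.normLsq y := by
  rw [hN.inner2_HL hp hy, hN.normHsq_eq hp hy, hN.normLsq_eq hp hy]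
  simp only [hN.HL_eq hp hy, mul_left_comm _ (p.eta ν y), ctr_mul_left]
  ring

theorem inner2_Lsq_HL : p.inner2 p.Lsq p.HL y = p.trN y fun a a' => p.H y ![] a * p.trLcube y a' := by
  have h1 : ∀ a, p.trLcube y a = N a * ctr p.h y fun α α' => ctr p.h y fun β β' =>
      ctr p.h y fun γ γ' => p.lo ν y α β * p.lo ν y β' γ * p.lo ν y γ' α' := fun a => by
    simp only [trLcube, hN.Lo_eq hp hy, trT_eq, ← ctr_mul_left]
    refine ctr_congr fun α α' => ctr_congr fun β β' => ctr_congr fun γ γ' => ?_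
    have := hN.trN_mul (p.lo ν y α β) (p.lo ν y β' γ)
    rw [← this, trN_eq, trN_eq, ← ctr_mul_right, ← ctr_mul_left]
    exact ctr_congr fun b b' => by ring
  simp only [h1, hN.H_eq hp hy, hN.trN_mul]
  rw [hp.inner2_comm hy, hN.inner2_HL hp hy]
  refine congrArg (p.eta ν y * ·) ?_
  simp only [hN.Lsq_eq hp hy, ← ctr_mul_left]
  calc _ = ctr p.h y (fun γ γ' => ctr p.h y fun α α' => ctr p.h y fun β β' =>
        p.lo ν y α β * (p.lo ν y γ α' * p.lo ν y γ' β')) := by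
        refine Eq.trans (ctr_congr fun α α' => ctr_comm _) ?_
        exact ctr_comm _
    _ = _ := by
        refine ctr_congr fun γ γ' => ?_
        rw [ctr_swap hp.induced hy]
        refine ctr_congr fun α' α => ctr_congr fun β β' => ?_
        rw [lo_symm hp hy γ' β']; ring

theorem LC_eq (hn : 2 < n) : p.LC y =
    (ctr p.h y fun α α' => ctr p.h y fun β β' => p.trN y fun a a' => p.Lo y ![α, β] a *
      p.C y ![inl α', inr a', inl β']) + p.inner2 p.HL p.Wtr y := by
  rw [hN.inner2_HL hp hy]
  simp only [LC, calC, mul_sub, trT_eq, trN_eq, ctr_sub]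
  rw [sub_eq_add_neg]
  refine congrArg₂ (· + ·) rfl ?_
  simp only [← trN_eq, hN.Lo_eq hp hy, hN.H_eq hp hy, hN.W_tntn hp hy, hN.projNu_weyl hp hy hn]
  rw [← ctr_neg, ← ctr_mul_left]
  refine ctr_congr fun α α' => ?_
  rw [← ctr_neg, ← ctr_mul_left]
  refine ctr_congr fun β β' => ?_
  have h1 : ∀ a', (p.trN y fun b b' => N b * p.eta ν y * (N a' * N b' * -p.Wtr y ![α', β'])) =
      N a' * (p.eta ν y * -p.Wtr y ![α', β']) := fun a' => by
    rw [← hN.trN_mul (p.eta ν y) (-p.Wtr y ![α', β']), trN_eq, trN_eq, ← ctr_mul_left]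
    exact ctr_congr fun b b' => by ring
  simp only [h1, hN.trN_mul]
  ring

theorem DW_eq_zero (hn : 2 < n) : p.DW y = 0 := by
  simp only [DW, hN.Wmix_eq_zero hp hy hn, mul_zero, trN_eq, trT_eq, ctr_zero]

theorem divLo_eq (hk : k ≠ 0) (hn : 2 < n) (α : Fin k) (b : Fin n) :
    p.divLo y α b = -((k : ℝ) - 1) * p.D y α b := by
  rw [hp.divLo_eq hk hy, hN.Wmix_eq_zero hp hy hn]; ring

theorem normDivLoSq_eq (hk : k ≠ 0) (hn : 2 < n) :
    p.normDivLoSq y = ((k : ℝ) - 1) ^ 2 * p.normDsq y := by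
  simp only [normDivLoSq, normDsq, hN.divLo_eq hp hy hk hn, trT_eq, trN_eq, ← ctr_mul_left]
  exact ctr_congr fun _ _ => ctr_congr fun _ _ => by ring

theorem divT_DL_eq (hk : k ≠ 0) (hn : 2 < n) : p.divT p.DL y =
    (ctr p.h y fun α α' => ctr p.h y fun β β' => p.trN y fun a a' =>
      p.nablaN p.DN y ![α, β] a * p.Lo y ![α', β'] a') - ((k : ℝ) - 1) * p.normDsq y := by
  rw [hp.divT_DL hy, sub_eq_add_neg, ← neg_mul]
  refine congrArg₂ (· + ·) rfl ?_
  simp only [normDsq, hN.divLo_eq hp hy hk hn, trT_eq, trN_eq, ← ctr_mul_left]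
  exact ctr_congr fun _ _ => ctr_congr fun _ _ => by ring

omit hp hy in
theorem P_nn (a b : Fin n) : p.P y ![inr a, inr b] =
    N a * N b * p.projNu ν (schouten p.g) y ![none, none] := by
  rw [P, hN.proj_eq, Fin.prod_univ_two]
  refine congrArg₂ (· * ·) rfl (congrArg _ ?_)
  ext s : 1; fin_cases s <;> rfl

omit hp hy in
theorem nablaP_ttn (α β : Fin k) (a : Fin n) :
    p.proj (nabla p.g (schouten p.g)) y ![inl α, inl β, inr a] =
      N a * p.projNu ν (nabla p.g (schouten p.g)) y ![some α, some β, none] := by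
  rw [hN.proj_eq, Fin.prod_univ_three]
  refine congrArg₂ (· * ·) ?_ (congrArg _ ?_)
  · change (1 : ℝ) * 1 * N a = N a
    ring
  · ext s : 1; fin_cases s <;> rfl

theorem inner_nabla_D (hk : k ≠ 0) :
    (ctr p.h y fun α α' => ctr p.h y fun β β' => p.trN y fun a a' =>
      p.nablaN p.DN y ![α, β] a * p.Lo y ![α', β'] a') =
    (ctr p.h y fun α α' => ctr p.h y fun β β' => p.trN y fun a a' => p.Lo y ![α, β] a *
      p.proj (nabla p.g (schouten p.g)) y ![inl α', inl β', inr a']) +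
    (p.trT y fun α α' => p.trT y fun β β' => p.trN y fun a a' => p.trN y fun b b' =>
        p.Lo y ![α, β] a * p.Lo y ![α', β'] b * p.P y ![inr a', inr b']) -
    p.inner2 p.Lsq (fun z A => p.P z ![inl (A 0), inl (A 1)]) y -
    p.inner2 p.HL (fun z A => p.P z ![inl (A 0), inl (A 1)]) y -
    (p.trT y fun α α' => p.trT y fun β β' => p.trN y fun a a' =>
        p.Lo y ![α, β] a * p.nablaN (p.nablaN p.H) y ![α', β'] a') := by
  set ℓ := p.lo ν y with hℓ
  set η := p.eta ν y with hη
  set P0 := p.projNu ν (schouten p.g) y ![none, none]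
  set q := fun α β => p.projNu ν (nabla p.g (schouten p.g)) y ![some α, some β, none] with hq
  set x := fun α β => ∑ c, ν c * p.nablaN (p.nablaN p.H) y ![α, β] c with hx
  have eH : ∀ α β a, p.nablaN (p.nablaN p.H) y ![α, β] a = N a * x α β := fun α β a =>
    hN.field hp (hp.isNField_nablaN (hp.isNField_nablaN hp.isNField_H)) hy _ a
  have eD : ∀ α β a, p.nablaN p.DN y ![α, β] a = N a * (q α β + (ℓ α β + η * p.h y α β) * P0 -
      (ctr p.h y fun γ δ => ℓ α δ * p.P y ![inl β, inl γ]) - η * p.P y ![inl β, inl α] - x α β) := by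
    intro α β a
    rw [hp.nablaN_DN hy, hN.nablaP_ttn, eH]
    simp only [hN.L_eq hp hy, hN.P_nn, trN_eq, trT_eq]
    have h1 : (ctr p.g (p.φ y) fun b b' => N b * (ℓ α β + η * p.h y α β) * (N b' * N a * P0)) =
        N a * ((ℓ α β + η * p.h y α β) * P0) := by
      rw [← hN.trN_mul (ℓ α β + η * p.h y α β) P0, trN_eq, ← ctr_mul_left]
      exact ctr_congr fun b b' => by ring
    have h2 : (ctr p.h y fun γ δ => N a * (ℓ α δ + η * p.h y α δ) * p.P y ![inl β, inl γ]) =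
        N a * ((ctr p.h y fun γ δ => ℓ α δ * p.P y ![inl β, inl γ]) +
          η * p.P y ![inl β, inl α]) := by
      rw [← ctr_metric' hp.induced hy (fun γ => p.P y ![inl β, inl γ]) α, ← ctr_mul_left,
        ← ctr_add, ← ctr_mul_left]
      exact ctr_congr fun b b' => by ring
    rw [h1, h2]
    ring
  have eQ : ∀ α β a, p.proj (nabla p.g (schouten p.g)) y ![inl α, inl β, inr a] = N a * q α β :=
    hN.nablaP_ttn
  rw [hN.inner2_HL hp hy]
  simp only [eD, eH, eQ, hN.Lo_eq hp hy, hN.P_nn, hN.trN_mul, hN.trN_trN, trT_eq, inner2,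
    hN.Lsq_eq hp hy, ← hℓ, ← hη]
  have hswap : ∀ f : Fin k → Fin k → ℝ, (ctr p.h y fun α α' => ctr p.h y fun β β' =>
      f α β * ℓ α' β') = ctr p.h y fun α α' => ctr p.h y fun β β' => ℓ α β * f α' β' := by
    intro f
    rw [ctr_swap hp.induced hy]
    refine ctr_congr fun α α' => ?_
    rw [ctr_swap hp.induced hy]
    exact ctr_congr fun β β' => mul_comm _ _
  have hsym : ∀ α β, ℓ α β = ℓ β α := lo_symm hp hy
  have h3 : (ctr p.h y fun α α' => ctr p.h y fun β β' => ℓ α β * p.h y α' β') = 0 := by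
    rw [← lo_trace (ν := ν) hp hy hk]
    exact ctr_congr fun α α' => by
      simpa only [mul_comm] using ctr_metric' hp.induced hy (fun β => ℓ α β) α'
  have h4 : (ctr p.h y fun α α' => ctr p.h y fun β β' => ℓ α β *
        (ctr p.h y fun γ δ => ℓ α' δ * p.P y ![inl β', inl γ])) =
      ctr p.h y fun α α' => ctr p.h y fun β β' =>
        (ctr p.h y fun γ γ' => ℓ γ α * ℓ γ' β) * p.P y ![inl α', inl β'] := by
    calc _ = ctr p.h y (fun γ δ => ctr p.h y fun β β' => ctr p.h y fun α α' =>
          ℓ α β * (ℓ α' δ * p.P y ![inl β', inl γ])) := by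
          simp only [← ctr_mul_left]
          refine (ctr_congr fun α α' => ctr_comm _).trans ((ctr_comm _).trans ?_)
          exact ctr_congr fun γ δ => ctr_comm _
      _ = ctr p.h y (fun δ γ => ctr p.h y fun β β' => ctr p.h y fun α α' =>
          ℓ α β * (ℓ α' δ * p.P y ![inl β', inl γ])) := ctr_swap hp.induced hy _
      _ = _ := by
          rw [ctr_comm]
          refine ctr_congr fun β β' => ctr_congr fun δ γ => ?_
          rw [← ctr_mul_right]
          exact ctr_congr fun α α' => by ring
  rw [hswap fun α β => q α β + (ℓ α β + η * p.h y α β) * P0 -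
      (ctr p.h y fun γ δ => ℓ α δ * p.P y ![inl β, inl γ]) - η * p.P y ![inl β, inl α] - x α β]
  have h5 : ∀ α α' β β', ℓ α β * (q α' β' + (ℓ α' β' + η * p.h y α' β') * P0 -
      (ctr p.h y fun γ δ => ℓ α' δ * p.P y ![inl β', inl γ]) - η * p.P y ![inl β', inl α'] -
        x α' β') = ℓ α β * q α' β' + ℓ α β * ℓ α' β' * P0 + η * P0 * (ℓ α β * p.h y α' β') -
      ℓ α β * (ctr p.h y fun γ δ => ℓ α' δ * p.P y ![inl β', inl γ]) -
      η * (ℓ α β * p.P y ![inl α', inl β']) - ℓ α β * x α' β' := fun α α' β β' => by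
    rw [hp.P_symm hy (inl β') (inl α')]; ring
  simp only [h5, ctr_sub, ctr_add]
  rw [h4]
  simp only [ctr_mul_left, h3, mul_zero, add_zero]
  rfl

theorem LC_eq_nabla (hn : 2 < n) : p.LC y =
    (ctr p.h y fun α α' => ctr p.h y fun β β' => p.trN y fun a a' => p.Lo y ![α, β] a *
      p.proj (nabla p.g (schouten p.g)) y ![inl α', inl β', inr a']) -
    (p.trT y fun α α' => p.trT y fun β β' => p.trN y fun a a' =>
      p.Lo y ![α, β] a * p.proj (nabla p.g (schouten p.g)) y ![inr a', inl α', inl β']) +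
    p.inner2 p.HL p.Wtr y := by
  rw [hN.LC_eq hp hy hn]
  refine congrArg (· + _) ?_
  simp only [IsRegularOn.C_eq, trN_eq, trT_eq, mul_sub, ctr_sub]
  refine congrArg (· - _) ?_
  refine ctr_congr fun α α' => ctr_congr fun β β' => ctr_congr fun a a' => ?_
  refine congrArg (p.Lo y ![α, β] a * ·) ?_
  have h1 : p.proj (nabla p.g (schouten p.g)) y ![inl α', inl β', inr a'] =
      p.proj (fun x a => nabla p.g (schouten p.g) x (a ∘ Equiv.swap 1 2)) y
        ![inl α', inr a', inl β'] := by
    rw [proj_perm]; congr 1; ext x : 1; fin_cases x <;> rfl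
  rw [h1]
  refine proj_congr (fun a => ?_) _
  have h2 : a ∘ ⇑(Equiv.swap (1 : Fin 3) 2) = ![a 0, a 2, a 1] := by
    ext x : 1; fin_cases x <;> rfl
  rw [h2, ← hp.metric.nabla_schouten_symm (hp.maps y hy), vec_three_eta]

end UnitNormal

theorem inner2_congr_right (S : Tensor k 2) {T T' : Tensor k 2} (h : ∀ A, T y A = T' y A) :
    p.inner2 S T y = p.inner2 S T' y := by
  simp only [inner2, h]

namespace IsRegularOn

variable (hp : p.IsRegularOn U V) (hy : y ∈ U)

include hp hy

theorem inner2_metric (S : Tensor k 2) :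
    p.inner2 S (fun z A => p.h z (A 0) (A 1)) y = ctr p.h y fun α β => S y ![α, β] :=
  ctr_congr fun α α' => (ctr_congr fun _ _ => mul_comm _ _).trans
    (ctr_metric' hp.induced hy (fun β => S y ![α, β]) α')

theorem inner2_calP (S : Tensor k 2) : p.inner2 S p.calP y =
    p.inner2 S (fun z A => p.P z ![inl (A 0), inl (A 1)]) y + p.inner2 S p.HL y +
      (1 / 2) * p.normHsq y * ctr p.h y fun α β => S y ![α, β] := by
  rw [← hp.inner2_metric hy]
  simp only [inner2, calP_apply, mul_add, trT_eq, ctr_add, mul_left_comm _ ((1 / 2) * p.normHsq y),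
    ctr_mul_left]

theorem inner2_F (S : Tensor k 2) : p.inner2 S p.F y = 1 / ((k : ℝ) - 2) *
    (p.inner2 S p.Lsq y - p.inner2 S p.Wtr y - p.G y * ctr p.h y fun α β => S y ![α, β]) := by
  rw [← hp.inner2_metric hy]
  have h : ∀ α α' β β', S y ![α, β] * p.F y ![α', β'] = 1 / ((k : ℝ) - 2) *
      (S y ![α, β] * p.Lsq y ![α', β'] - S y ![α, β] * p.Wtr y ![α', β'] -
        p.G y * (S y ![α, β] * p.h y α' β')) := fun α α' β β' => by
    simp only [F, Matrix.cons_val]; ring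
  simp only [inner2, h, trT_eq, ctr_sub, ctr_mul_left, Matrix.cons_val]

theorem inner2_Pbar (hk : 2 < k) (S : Tensor k 2) :
    p.inner2 S p.Pbar y = p.inner2 S p.calP y - p.inner2 S p.F y := by
  rw [inner2_congr_right (T' := fun z A => p.calP z A - p.F z A) S (hp.Pbar_eq hk hy)]
  simp only [inner2, mul_sub, trT_eq, ctr_sub]

end IsRegularOn

theorem IsRegularOn.divT_LWmix_eq_zero (hp : p.IsRegularOn U V) (hn : n = k + 1) (hk : 1 < k)
    (hy : y ∈ U) : p.divT p.LWmix y = 0 := by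
  have h : p.divT p.LWmix y = p.divT (fun _ _ => 0) y :=
    IsRegularOn.divT_congr (U := U) (fun z hz A => by
      obtain ⟨N, ν, hN⟩ := hp.exists_unitNormal hn hz
      simp only [LWmix, hN.Wmix_eq_zero hp hz (by omega : 2 < n), mul_zero, trT_eq, trN_eq, ctr_zero]) hy
  rw [h, divT_eq]
  simp [nabla, pd_const, ctr_zero]

theorem IsRegularOn.J2_eq_juhl2 (hp : p.IsRegularOn U V) (hn : n = k + 1) (hk : 4 ≤ k)
    (hk6 : k ≠ 6) (hy : y ∈ U) : p.J2 y = p.juhl2 y := by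
  obtain ⟨N, ν, hN⟩ := hp.exists_unitNormal hn hy
  have hn2 : 2 < n := by omega
  have hk0 : k ≠ 0 := by omega
  have hkR : (4 : ℝ) ≤ k := by exact_mod_cast hk
  have e1 : (k : ℝ) - 1 ≠ 0 := by linarith
  have e2 : (k : ℝ) - 2 ≠ 0 := by linarith
  have e3 : (k : ℝ) - 3 ≠ 0 := by linarith
  have e6 : (k : ℝ) - 6 ≠ 0 := sub_ne_zero.2 (by exact_mod_cast hk6)
  have hlap := hp.half_lap_normLsq hk0 hy
  rw [hp.divT_LWmix_eq_zero hn (by omega) hy] at hlap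
  have hlap' : p.lap p.normLsq y = 2 * (p.divdivLsq y + p.divT p.LW y +
      ((k : ℝ) - 2) * p.divT p.DL y) := by linarith
  have hHL0 : (ctr p.h y fun α β => p.HL y ![α, β]) = 0 := by
    simp only [hN.HL_eq hp hy, ctr_mul_left, UnitNormal.lo_trace hp hy hk0, mul_zero]
  rw [J2, juhl2, hp.two_mul_I_add_J (by omega) hy, hlap', K1_eq, K2_eq, hN.DW_eq_zero hp hy hn2,
    hp.divT_LWmix_eq_zero hn (by omega) hy, hp.inner2_Pbar hy (by omega),
    hp.inner2_Pbar hy (by omega), hp.inner2_calP hy, hp.inner2_calP hy, hp.inner2_F hy,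
    hp.inner2_F hy, hp.Jbar_eq (by omega) hy, hN.normDivLoSq_eq hp hy hk0 hn2, hHL0, trace_Lsq,
    hN.inner2_HL_HL hp hy, ← hN.inner2_Lsq_HL hp hy, hp.inner2_comm hy p.HL p.Lsq,
    hN.LC_eq_nabla hp hy hn2, hN.divT_DL_eq hp hy hk0 hn2, hN.inner_nabla_D hp hy hk0]
  simp only [trT_eq]
  field_simp
  ring

end Patch

end

end ConformalSubmanifold

namespace ConformalSubmanifold

open TopologicalSpace (Opens)

noncomputable section

theorem vec_five_eta {α : Type*} (A : Fin 5 → α) : ![A 0, A 1, A 2, A 3, A 4] = A := by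
  ext a; fin_cases a <;> rfl

theorem comp_vec_five {α : Type*} {r : ℕ} (A : Fin r → α) (i j l o q : Fin r) :
    A ∘ ![i, j, l, o, q] = ![A i, A j, A l, A o, A q] := by
  ext x; fin_cases x <;> rfl

namespace IsMetricOn

variable {m : ℕ} {g : MetricField m} {V : Opens (E m)} {x : E m} (hg : IsMetricOn g V)

include hg

theorem nabla_weyl_pair (hx : x ∈ V) (e a b c d : Fin m) :
    nabla g (weyl g) x ![e, a, b, c, d] = nabla g (weyl g) x ![e, c, d, a, b] := by
  have := nabla_swap (g := g) (σ := ![2, 3, 0, 1]) (by decide) hg.weyl_smooth 1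
    (fun z hz A => by
      rw [comp_vec_four, one_mul, ← hg.weyl_pair hz, vec_four_eta]) hx e ![a, b, c, d]
  rw [comp_vec_four, one_mul] at this
  exact this

theorem nabla_weyl_swap_right (hx : x ∈ V) (e a b c d : Fin m) :
    nabla g (weyl g) x ![e, a, b, c, d] = -nabla g (weyl g) x ![e, a, b, d, c] := by
  have := nabla_swap (g := g) (σ := ![0, 1, 3, 2]) (by decide) hg.weyl_smooth (-1)
    (fun z hz A => by
      rw [comp_vec_four, neg_one_mul, ← hg.weyl_swap_right hz, vec_four_eta]) hx e ![a, b, c, d]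
  rw [comp_vec_four, neg_one_mul] at this
  exact this

theorem div_weyl_first (hm : 2 < m) (hx : x ∈ V) (a b c : Fin m) :
    ctr g x (fun e d => nabla g (weyl g) x ![e, d, a, b, c]) =
      ((m : ℝ) - 3) * cotton g x ![b, c, a] := by
  have h := hg.div_weyl hm hx b c a
  have h2 : ∀ e d, nabla g (weyl g) x ![e, d, a, b, c] = -nabla g (weyl g) x ![e, b, c, a, d] :=
    fun e d => by rw [hg.nabla_weyl_pair hx, hg.nabla_weyl_swap_right hx]
  simp only [h2, ctr_neg, h]
  ring

end IsMetricOn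

namespace Patch

open Sum (inl inr)

variable {k n r : ℕ} {p : Patch k n} {U : Opens (E k)} {V : Opens (E n)} {y : E k}

theorem proj_comp (T : Tensor n r) {σ : Fin r → Fin r} (hσ : Function.Bijective σ)
    (i : Fin r → Index k n) : p.proj (fun x a => T x (a ∘ σ)) y i = p.proj T y (i ∘ σ) :=
  proj_perm T (Equiv.ofBijective σ hσ) i

/-- Projections of the derivative of the ambient Weyl tensor. -/
abbrev dW (p : Patch k n) (y : E k) (i : Fin 5 → Index k n) : ℝ :=
  p.proj (nabla p.g (weyl p.g)) y i

theorem IsRegularOn.dW_swap (hp : p.IsRegularOn U V) (hy : y ∈ U) (e i j l q : Index k n) :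
    p.dW y ![e, i, j, l, q] = p.dW y ![e, j, i, q, l] := by
  have h := proj_comp (p := p) (y := y) (nabla p.g (weyl p.g)) (σ := ![0, 2, 1, 4, 3]) (by decide)
    ![e, i, j, l, q]
  rw [comp_vec_five] at h
  refine Eq.trans (proj_congr (fun a => ?_) _) h
  have hm := hp.maps y hy
  rw [comp_vec_five, hp.metric.nabla_weyl_swap_right hm, hp.metric.nabla_weyl_pair hm,
    hp.metric.nabla_weyl_swap_right hm, neg_neg, hp.metric.nabla_weyl_pair hm, vec_five_eta]

theorem IsRegularOn.dW_trace (hp : p.IsRegularOn U V) (hy : y ∈ U) (hn : 2 < n)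
    (e i j : Index k n) : (p.trT y fun γ γ' => p.dW y ![e, i, inl γ, j, inl γ']) +
      (p.trN y fun c c' => p.dW y ![e, i, inr c, j, inr c']) = 0 := by
  have h1 := hp.proj_trace hy (r := 3)
    (fun x a => nabla p.g (weyl p.g) x (a ∘ ![2, 3, 0, 4, 1])) ![e, i, j]
  simp only [proj_comp (p := p) (nabla p.g (weyl p.g)) (by decide :
    Function.Bijective (![2, 3, 0, 4, 1] : Fin 5 → Fin 5))] at h1
  refine Eq.trans h1.symm ?_
  refine (proj_congr (T := fun _ _ => 0) (fun a => ?_) _).trans (by simp [proj])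
  exact hp.metric.trace_nabla_weyl hn (hp.maps y hy) (a 0) (a 1) (a 2)

theorem IsRegularOn.dW_div (hp : p.IsRegularOn U V) (hy : y ∈ U) (hn : 2 < n)
    (i j l : Index k n) : (p.trT y fun γ γ' => p.dW y ![inl γ, inl γ', i, j, l]) +
      (p.trN y fun c c' => p.dW y ![inr c, inr c', i, j, l]) =
      ((n : ℝ) - 3) * p.C y ![j, l, i] := by
  have h1 := hp.proj_trace hy (r := 3) (nabla p.g (weyl p.g)) ![i, j, l]
  refine Eq.trans h1.symm ?_
  have h2 := proj_comp (p := p) (y := y) (cotton p.g) (σ := ![1, 2, 0]) (by decide) ![i, j, l]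
  rw [comp_vec_three] at h2
  refine Eq.trans ?_ (congrArg (((n : ℝ) - 3) * ·) h2)
  rw [← proj_const_mul (fun _ => (n : ℝ) - 3)]
  refine proj_congr (fun a => ?_) _
  rw [comp_vec_three, ← hp.metric.div_weyl_first hn (hp.maps y hy)]
  conv_lhs => rw [← vec_three_eta a]
  rfl

namespace UnitNormal

variable {N ν : Fin n → ℝ} (hN : p.UnitNormal y N ν)

include hN

theorem dW_nntnt (β γ : Fin k) (a b c : Fin n) :
    p.dW y ![inr a, inr b, inl β, inr c, inl γ] =
      N a * N b * N c * p.projNu ν (nabla p.g (weyl p.g)) y ![none, none, some β, none, some γ] := by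
  rw [dW, hN.proj_eq, Fin.prod_univ_five]
  refine congrArg₂ (· * ·) ?_ (congrArg _ ?_)
  · change N a * N b * 1 * N c * 1 = N a * N b * N c
    ring
  · ext s : 1; fin_cases s <;> rfl

variable (hp : p.IsRegularOn U V) (hy : y ∈ U)

include hp hy

theorem trT_dW (hn : 2 < n) (β γ : Fin k) (b : Fin n) :
    (p.trT y fun ε α => p.dW y ![inl ε, inl α, inl β, inr b, inl γ]) =
      ((n : ℝ) - 3) * p.C y ![inr b, inl γ, inl β] +
        p.trT y fun δ δ' => p.dW y ![inr b, inl β, inl δ, inl γ, inl δ'] := by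
  have h1 := hp.dW_div hy hn (inl β) (inr b) (inl γ)
  have h2 := hp.dW_trace hy hn (inr b) (inl β) (inl γ)
  simp only [hN.dW_nntnt] at h1
  have h3 : ∀ c c', p.dW y ![inr b, inl β, inr c, inl γ, inr c'] = N b * N c * N c' *
      p.projNu ν (nabla p.g (weyl p.g)) y ![none, none, some β, none, some γ] := fun c c' => by
    rw [hp.dW_swap hy, hN.dW_nntnt]
  simp only [h3] at h2
  have h4 : (p.trN y fun c c' => N c * N c' * N b *
      p.projNu ν (nabla p.g (weyl p.g)) y ![none, none, some β, none, some γ]) =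
      p.trN y fun c c' => N b * N c * N c' *
        p.projNu ν (nabla p.g (weyl p.g)) y ![none, none, some β, none, some γ] :=
    ctr_congr fun c c' => by ring
  linarith

theorem J1alg_eq (hn : 2 < n) : p.J1alg y =
    (p.trT y fun α α' => p.trT y fun β β' => p.trT y fun γ γ' => p.trT y fun δ δ' =>
        p.trN y fun a a' => p.Lo y ![α, γ] a * p.Lo y ![β, δ] a' *
          p.W y ![inl α', inl β', inl γ', inl δ']) - 2 * p.inner2 p.Lsq p.Wtr y -
    (1 / 2) * (p.trT y fun α α' => p.trT y fun β β' => p.trT y fun γ γ' =>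
        p.trN y fun a a' => p.W y ![inl α, inl β, inr a, inl γ] *
          p.W y ![inl α', inl β', inr a', inl γ']) := by
  have h1 : (p.trT y fun α α' => p.trT y fun β β' => p.trT y fun γ γ' =>
        p.trN y fun a a' => p.trN y fun b b' => p.Lo y ![α, β] a * p.Lo y ![α', β'] b *
          p.W y ![inr a', inl γ, inr b', inl γ']) = 0 := by
    refine (ctr_congr fun α α' => (ctr_congr fun β β' => ?_).trans ctr_zero).trans ctr_zero
    simp only [trT_eq, trN_eq]
    rw [ctr_comm]
    refine (ctr_congr fun a a' => ?_).trans ctr_zero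
    rw [ctr_comm]
    refine (ctr_congr fun b b' => ?_).trans ctr_zero
    rw [ctr_mul_left, ← trT_eq, hN.trT_W_ntnt hp hy hn, mul_zero]
  have h2 : (p.trT y fun α α' => p.trT y fun β β' => p.trT y fun γ γ' =>
        p.trN y fun a a' => p.trN y fun b b' => p.Lo y ![γ, α] a * p.Lo y ![γ', β] b *
          (2 * p.W y ![inl α', inr a', inl β', inr b'] -
            p.W y ![inl α', inl β', inr a', inr b'])) = -2 * p.inner2 p.Lsq p.Wtr y := by
    have e : ∀ α β (a b : Fin n), 2 * p.W y ![inl α, inr a, inl β, inr b] -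
        p.W y ![inl α, inl β, inr a, inr b] = N a * N b * (-2 * p.Wtr y ![α, β]) := by
      intro α β a b
      rw [hN.W_tntn hp hy, hN.W_skew _ _ hp hy, hN.projNu_weyl hp hy hn]; ring
    simp only [e, hN.Lo_eq hp hy, hN.trN_trN, inner2, hN.Lsq_eq hp hy, trT_eq]
    simp only [← ctr_mul_left, ← ctr_mul_right]
    exact ctr_congr fun _ _ => ctr_congr fun _ _ => ctr_congr fun _ _ => by ring
  have h3 : (p.trT y fun α α' => p.trN y fun a a' => p.Wmix y α a * p.Wmix y α' a') = 0 := by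
    simp only [hN.Wmix_eq_zero hp hy hn, mul_zero, trN_eq, trT_eq, ctr_zero]
  rw [J1alg, h1, h2, h3]
  ring

theorem inner_nabla_Lo_W (hn : 2 < n) :
    (ctr p.h y fun ε α => ctr p.h y fun β β' => ctr p.h y fun γ γ' => ctr p.g (p.φ y) fun a a' =>
      p.nablaN p.Lo y ![ε, β, γ] a * p.WN y ![α, β', γ'] a') =
    (1 / 2) * (p.trT y fun α α' => p.trT y fun β β' => p.trT y fun γ γ' =>
        p.trN y fun a a' => p.W y ![inl α, inl β, inr a, inl γ] *
          p.W y ![inl α', inl β', inr a', inl γ']) := by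
  have hs : (ctr p.h y fun ε α => ctr p.h y fun β β' => ctr p.h y fun γ γ' =>
      ctr p.g (p.φ y) fun a a' => p.nablaN p.Lo y ![ε, β, γ] a * p.WN y ![α, β', γ'] a') =
      -ctr p.h y fun ε α => ctr p.h y fun β β' => ctr p.h y fun γ γ' =>
      ctr p.g (p.φ y) fun a a' => p.nablaN p.Lo y ![β, ε, γ] a * p.WN y ![α, β', γ'] a' := by
    rw [ctr_comm]
    simp only [← ctr_neg]
    refine ctr_congr fun ε α => ctr_congr fun β β' => ctr_congr fun γ γ' => ctr_congr fun a a' => ?_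
    have : p.WN y ![β', α, γ'] a' = -p.WN y ![α, β', γ'] a' := IsRegularOn.W_swap_left _ _ _ _
    rw [this, mul_neg]
  have hz1 : ∀ α (a' : Fin n), (ctr p.h y fun β β' => ctr p.h y fun γ γ' =>
      p.h y β γ * p.WN y ![α, β', γ'] a') = 0 := fun α a' => by
    rw [← hN.Wmix_eq_zero hp hy hn α a']
    refine Eq.trans (ctr_congr fun β β' =>
      ctr_metric hp.induced hy (fun γ' => p.WN y ![α, β', γ'] a') β) ?_
    exact ctr_swap hp.induced hy _
  have hz2 : ∀ β' (a' : Fin n), (ctr p.h y fun ε α => ctr p.h y fun γ γ' =>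
      p.h y ε γ * p.WN y ![α, β', γ'] a') = 0 := fun β' a' => by
    have h : ∀ α γ, p.WN y ![α, β', γ] a' = -p.WN y ![β', α, γ] a' :=
      fun _ _ => IsRegularOn.W_swap_left _ _ _ _
    simp only [h, mul_neg, ctr_neg, hz1, neg_zero]
  have hd1 : (ctr p.h y fun ε α => ctr p.h y fun β β' => ctr p.h y fun γ γ' =>
      ctr p.g (p.φ y) fun a a' => p.D y ε a * p.h y β γ * p.WN y ![α, β', γ'] a') = 0 := by
    refine (ctr_congr fun ε α => ?_).trans ctr_zero
    refine (ctr_congr fun β β' => ctr_comm _).trans ((ctr_comm _).trans ?_)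
    refine (ctr_congr fun a a' => ?_).trans ctr_zero
    simp only [mul_assoc, ctr_mul_left, hz1, mul_zero]
  have hd2 : (ctr p.h y fun ε α => ctr p.h y fun β β' => ctr p.h y fun γ γ' =>
      ctr p.g (p.φ y) fun a a' => p.D y β a * p.h y ε γ * p.WN y ![α, β', γ'] a') = 0 := by
    rw [ctr_comm]
    refine (ctr_congr fun β β' => ?_).trans ctr_zero
    refine (ctr_congr fun ε α => ctr_comm _).trans ((ctr_comm _).trans ?_)
    refine (ctr_congr fun a a' => ?_).trans ctr_zero
    simp only [mul_assoc, ctr_mul_left, hz2, mul_zero]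
  have hc : ∀ ε α β β' γ γ' (a a' : Fin n),
      p.W y ![inl ε, inl β, inr a, inl γ] * p.W y ![inl α, inl β', inr a', inl γ'] =
      p.nablaN p.Lo y ![ε, β, γ] a * p.WN y ![α, β', γ'] a' -
      p.nablaN p.Lo y ![β, ε, γ] a * p.WN y ![α, β', γ'] a' -
      p.D y ε a * p.h y β γ * p.WN y ![α, β', γ'] a' +
      p.D y β a * p.h y ε γ * p.WN y ![α, β', γ'] a' := fun ε α β β' γ γ' a a' => by
    have h := hp.codazzi_Lo hy ε β γ a
    have h' : p.W y ![inl α, inl β', inr a', inl γ'] = p.WN y ![α, β', γ'] a' := rfl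
    rw [h']
    linear_combination (-p.WN y ![α, β', γ'] a') * h
  simp only [trT_eq, trN_eq, hc, ctr_add, ctr_sub]
  rw [hd1, hd2]
  linarith

theorem trT_nablaN_WN (hk : k ≠ 0) (hn : 2 < n) (β γ : Fin k) (b : Fin n) :
    (ctr p.h y fun ε α => p.nablaN p.WN y ![ε, α, β, γ] b) =
      (p.trT y fun ε α => p.dW y ![inl ε, inl α, inl β, inr b, inl γ]) +
      N b * ((ctr p.h y fun ε α => p.lo ν y ε β * p.Wtr y ![α, γ]) -
        (k : ℝ) * p.eta ν y * p.Wtr y ![β, γ] -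
        ctr p.h y fun ε α => ctr p.h y fun δ σ => p.lo ν y ε δ *
          p.W y ![inl α, inl β, inl σ, inl γ]) := by
  set ℓ := p.lo ν y with hℓ
  set η := p.eta ν y with hη
  have t1 : ∀ ε α, (p.trN y fun a a' => p.L y ![ε, α] a * p.W y ![inr a', inl β, inr b, inl γ]) =
      N b * ((ℓ ε α + η * p.h y ε α) * -p.Wtr y ![β, γ]) := fun ε α => by
    simp only [hN.L_eq hp hy, hN.W_ntnt, hN.projNu_weyl hp hy hn, ← hℓ, ← hη]
    rw [← hN.trN_mul (ℓ ε α + η * p.h y ε α) (-p.Wtr y ![β, γ]), trN_eq, trN_eq, ← ctr_mul_left]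
    exact ctr_congr fun a a' => by ring
  have t2 : ∀ ε α, (p.trN y fun a a' => p.L y ![ε, β] a * p.W y ![inl α, inr a', inr b, inl γ]) =
      N b * ((ℓ ε β + η * p.h y ε β) * p.Wtr y ![α, γ]) := fun ε α => by
    have e : ∀ a', p.W y ![inl α, inr a', inr b, inl γ] = N a' * N b * p.Wtr y ![α, γ] :=
      fun a' => by
        rw [IsRegularOn.W_swap_left, hN.W_ntnt, hN.projNu_weyl hp hy hn]; ring
    simp only [hN.L_eq hp hy, e, ← hℓ, ← hη]
    rw [← hN.trN_mul (ℓ ε β + η * p.h y ε β) (p.Wtr y ![α, γ]), trN_eq, trN_eq, ← ctr_mul_left]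
    exact ctr_congr fun a a' => by ring
  have t4 : ∀ ε α, (p.trT y fun σ δ => p.L y ![ε, δ] b * p.W y ![inl α, inl β, inl σ, inl γ]) =
      N b * ((ctr p.h y fun δ σ => ℓ ε δ * p.W y ![inl α, inl β, inl σ, inl γ]) +
        η * p.W y ![inl α, inl β, inl ε, inl γ]) := fun ε α => by
    rw [← ctr_metric hp.induced hy (fun σ => p.W y ![inl α, inl β, inl σ, inl γ]) ε,
      ← ctr_mul_left, ← ctr_add, ← ctr_mul_left, trT_eq, ctr_swap hp.induced hy]
    refine ctr_congr fun δ σ => ?_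
    rw [hN.L_eq hp hy]; ring
  simp only [hp.nablaN_WN hy, t1, t2, t4, hN.W_skew _ _ hp hy, mul_zero, trN_eq, ctr_zero, add_zero,
    trT_eq]
  have s1 : (ctr p.h y fun ε α => N b * ((ℓ ε α + η * p.h y ε α) * -p.Wtr y ![β, γ])) =
      N b * (-((k : ℝ) * η * p.Wtr y ![β, γ])) := by
    have e : (ctr p.h y fun ε α => η * p.h y ε α) = η * k :=
      (ctr_mul_left _ _).trans (by rw [ctr_self hp.induced hy])
    rw [ctr_mul_left, ctr_mul_right, ctr_add, e, lo_trace hp hy hk]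
    ring
  have s2 : (ctr p.h y fun ε α => N b * ((ℓ ε β + η * p.h y ε β) * p.Wtr y ![α, γ])) =
      N b * ((ctr p.h y fun ε α => ℓ ε β * p.Wtr y ![α, γ]) + η * p.Wtr y ![β, γ]) := by
    rw [← ctr_metric hp.induced hy (fun α => p.Wtr y ![α, γ]) β, ← ctr_mul_left (p.eta ν y),
      ← ctr_add, ← ctr_mul_left]
    refine ctr_congr fun ε α => ?_
    rw [hp.induced.symm hy ε β]; ring
  have s4 : (ctr p.h y fun ε α => p.W y ![inl α, inl β, inl ε, inl γ]) = p.Wtr y ![β, γ] := by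
    rw [ctr_swap hp.induced hy]
    refine ctr_congr fun ε α => ?_
    rw [IsRegularOn.W_swap_left, hp.W_swap_right hy, neg_neg]; rfl
  simp only [ctr_add, ctr_sub, s1, s2]
  rw [ctr_mul_left, ctr_add, ctr_mul_left, s4]
  ring

theorem divT_LW_eq (hk : k ≠ 0) (hn : n = k + 1) (hn2 : 2 < n) : p.divT p.LW y =
    (1 / 2) * (p.trT y fun α α' => p.trT y fun β β' => p.trT y fun γ γ' =>
        p.trN y fun a a' => p.W y ![inl α, inl β, inr a, inl γ] *
          p.W y ![inl α', inl β', inr a', inl γ']) -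
    ((k : ℝ) - 2) * (p.LC y - p.inner2 p.HL p.Wtr y) +
    (p.trT y fun α α' => p.trT y fun β β' => p.trT y fun γ γ' => p.trN y fun a a' =>
        p.Lo y ![α, β] a * p.dW y ![inr a', inl α', inl γ, inl β', inl γ']) -
    k * p.inner2 p.HL p.Wtr y + p.inner2 p.Lsq p.Wtr y -
    (p.trT y fun α α' => p.trT y fun β β' => p.trT y fun γ γ' => p.trT y fun δ δ' =>
        p.trN y fun a a' => p.Lo y ![α, γ] a * p.Lo y ![β, δ] a' *
          p.W y ![inl α', inl β', inl γ', inl δ']) := by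
  rw [divT_eq]
  simp only [hp.nabla_LW hy, trT_eq, trN_eq, ctr_add]
  rw [hN.inner_nabla_Lo_W hp hy hn2]
  have h1 : (ctr p.h y fun ε α => ctr p.h y fun β β' => ctr p.h y fun γ γ' =>
      ctr p.g (p.φ y) fun a a' => p.Lo y ![β, γ] a * p.nablaN p.WN y ![ε, α, β', γ'] a') =
      ctr p.h y fun β β' => ctr p.h y fun γ γ' => ctr p.g (p.φ y) fun a a' => p.Lo y ![β, γ] a *
        ctr p.h y fun ε α => p.nablaN p.WN y ![ε, α, β', γ'] a' := by
    rw [ctr_comm]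
    refine ctr_congr fun β β' => ?_
    rw [ctr_comm]
    refine ctr_congr fun γ γ' => ?_
    rw [ctr_comm]
    exact ctr_congr fun a a' => ctr_mul_left _ _
  rw [h1]
  let X : Fin k → Fin k → ℝ := fun β γ => (ctr p.h y fun ε α => p.lo ν y ε β * p.Wtr y ![α, γ]) -
        (k : ℝ) * p.eta ν y * p.Wtr y ![β, γ] -
        ctr p.h y fun ε α => ctr p.h y fun δ σ => p.lo ν y ε δ *
          p.W y ![inl α, inl β, inl σ, inl γ]
  have hWN : ∀ β γ b, (ctr p.h y fun ε α => p.nablaN p.WN y ![ε, α, β, γ] b) =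
      ((n : ℝ) - 3) * p.C y ![inr b, inl γ, inl β] +
        (p.trT y fun δ δ' => p.dW y ![inr b, inl β, inl δ, inl γ, inl δ']) + N b * X β γ :=
    fun β γ b => by rw [hN.trT_nablaN_WN hp hy hk hn2, hN.trT_dW hp hy hn2]
  have hnR : (n : ℝ) = k + 1 := by rw [hn]; push_cast; rfl
  have h2 : ∀ β β' γ γ' (a a' : Fin n), p.Lo y ![β, γ] a *
      (((n : ℝ) - 3) * p.C y ![inr a', inl γ', inl β'] + (p.trT y fun δ δ' =>
        p.dW y ![inr a', inl β', inl δ, inl γ', inl δ']) + N a' * X β' γ') =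
      -((k : ℝ) - 2) * (p.Lo y ![γ, β] a * p.C y ![inl γ', inr a', inl β']) +
      (ctr p.h y fun δ δ' => p.Lo y ![β, γ] a *
        p.dW y ![inr a', inl β', inl δ, inl γ', inl δ']) +
      N a * p.lo ν y β γ * (N a' * X β' γ') := fun β β' γ γ' a a' => by
    rw [ctr_mul_left, IsRegularOn.C_swap (inr a'), hp.Lo_symm hy γ β, ← hN.Lo_eq hp hy, hnR,
      trT_eq]
    ring
  simp only [hWN, h2, ctr_add, ctr_mul_left]
  have h3 : (ctr p.h y fun β β' => ctr p.h y fun γ γ' => ctr p.g (p.φ y) fun a a' =>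
      p.Lo y ![γ, β] a * p.C y ![inl γ', inr a', inl β']) =
      p.LC y - p.inner2 p.HL p.Wtr y := by
    rw [hN.LC_eq hp hy hn2, add_sub_cancel_right, ctr_comm]; rfl
  have h4 : (ctr p.h y fun β β' => ctr p.h y fun γ γ' => ctr p.g (p.φ y) fun a a' =>
      N a * p.lo ν y β γ * (N a' * X β' γ')) = p.inner2 p.Lsq p.Wtr y -
      k * p.inner2 p.HL p.Wtr y -
      (ctr p.h y fun α α' => ctr p.h y fun β β' => ctr p.h y fun γ γ' => ctr p.h y fun δ δ' =>
        ctr p.g (p.φ y) fun a a' => p.Lo y ![α, γ] a * p.Lo y ![β, δ] a' *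
          p.W y ![inl α', inl β', inl γ', inl δ']) := by
    have e : ∀ s t : ℝ, (ctr p.g (p.φ y) fun a a' => N a * s * (N a' * t)) = s * t := hN.trN_mul
    simp only [hN.Lo_eq hp hy, ctr_mul_right, e, hN.inner2_HL hp hy]
    simp only [X, mul_sub, ctr_sub]
    refine congrArg₂ (· - ·) (congrArg₂ (· - ·) ?_ ?_) ?_
    · simp only [inner2, hN.Lsq_eq hp hy, trT_eq, ← ctr_mul_left, ← ctr_mul_right]
      refine (ctr_congr fun β β' => ctr_comm _).trans ((ctr_comm _).trans ?_)
      refine ctr_congr fun ε α => (ctr_comm _).trans (ctr_congr fun γ γ' => ?_)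
      rw [ctr_swap hp.induced hy]
      refine ctr_congr fun β β' => ?_
      rw [lo_symm hp hy β ε]; ring
    · simp only [← ctr_mul_left]
      exact ctr_congr fun _ _ => ctr_congr fun _ _ => by ring
    · simp only [← ctr_mul_left]
      refine (ctr_congr fun β β' => ctr_comm _).trans ((ctr_comm _).trans ?_)
      refine ctr_congr fun ε α => ctr_congr fun β β' => (ctr_comm _).trans ?_
      exact ctr_congr fun δ σ => ctr_congr fun γ γ' => by ring
  have h5 : (ctr p.h y fun β β' => ctr p.h y fun γ γ' => ctr p.g (p.φ y) fun a a' =>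
      p.Lo y ![β, γ] a * ctr p.h y fun δ δ' =>
        p.dW y ![inr a', inl β', inl δ, inl γ', inl δ']) =
      ctr p.h y fun β β' => ctr p.h y fun γ γ' => ctr p.h y fun δ δ' =>
        ctr p.g (p.φ y) fun a a' => p.Lo y ![β, γ] a *
          p.dW y ![inr a', inl β', inl δ, inl γ', inl δ'] := by
    refine ctr_congr fun β β' => ctr_congr fun γ γ' => ?_
    simp only [← ctr_mul_left]
    exact ctr_comm _
  rw [h3, h4, h5]
  simp only [trT_eq, trN_eq]
  ring

end UnitNormal

theorem IsRegularOn.J1_eq_juhl1 (hp : p.IsRegularOn U V) (hn : n = k + 1) (hk : 4 ≤ k)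
    (hk6 : k ≠ 6) (hy : y ∈ U) : p.J1 y = p.juhl1 y := by
  obtain ⟨N, ν, hN⟩ := hp.exists_unitNormal hn hy
  have hn2 : 2 < n := by omega
  have hk0 : k ≠ 0 := by omega
  have hkR : (4 : ℝ) ≤ k := by exact_mod_cast hk
  have e1 : (k : ℝ) - 1 ≠ 0 := by linarith
  have e2 : (k : ℝ) - 2 ≠ 0 := by linarith
  have e3 : (k : ℝ) - 3 ≠ 0 := by linarith
  have e6 : (k : ℝ) - 6 ≠ 0 := sub_ne_zero.2 (by exact_mod_cast hk6)
  have hlap := hp.half_lap_normLsq hk0 hy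
  rw [hp.divT_LWmix_eq_zero hn (by omega) hy] at hlap
  have hdd : p.divdivLsq y = (1 / 2) * p.lap p.normLsq y - p.divT p.LW y -
      ((k : ℝ) - 2) * p.divT p.DL y := by linarith
  rw [J1_eq, juhl1, hp.two_mul_I_add_J (by omega) hy, hdd, K1_eq, K2_eq, hN.DW_eq_zero hp hy hn2,
    hp.divT_LWmix_eq_zero hn (by omega) hy, hp.inner2_Pbar hy (by omega),
    hp.Jbar_eq (by omega) hy, hN.normDivLoSq_eq hp hy hk0 hn2, hN.J1alg_eq hp hy hn2,
    hN.divT_LW_eq hp hy hk0 hn hn2]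
  simp only [trT_eq]
  field_simp
  ring

end Patch

end

end ConformalSubmanifold

namespace ConformalSubmanifold

open TopologicalSpace (Opens)
open Sum (inl inr)

noncomputable section

/-! ### Partial contractions -/

/-- A partial contraction of a tensor product of elementary tensors, whose free slots are labelled
by `ι`. -/
structure PartialContraction (ι : Type) where
  /-- the labels of the factors -/
  Factor : Type
  /-- there are finitely many factors -/
  [fintypeFactor : Fintype Factor]
  /-- the factors -/
  factor : Factor → Atom
  /-- the labels of the contracted pairs -/
  Pair : Type
  /-- there are finitely many pairs -/
  [fintypePair : Fintype Pair]
  /-- the kind of each pair -/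
  kind : Pair → Kind
  /-- the slots that make up each pair, and the free slots -/
  slots : (Pair × Fin 2) ⊕ ι ≃ Σ j : Factor, Fin (factor j).rank

attribute [instance] PartialContraction.fintypeFactor PartialContraction.fintypePair

namespace PartialContraction

variable {k n : ℕ} {ι ι₁ ι₂ : Type}

open Classical in
/-- The value of a partial contraction at given values of the free indices. -/
def value (M : PartialContraction ι) (p : Patch k n) (y : E k) (ρ : ι → Index k n) : ℝ :=
  ∑ c : M.Pair → Fin 2 → Index k n, (∏ q, (M.kind q).weight p y (c q 0) (c q 1)) *
    ∏ j, (M.factor j).component p y fun s =>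
      Sum.elim (fun q => c q.1 q.2) ρ (M.slots.symm ⟨j, s⟩)

/-- An elementary tensor. -/
def atom (t : Atom) (e : ι ≃ Fin t.rank) : PartialContraction ι where
  Factor := Unit
  factor _ := t
  Pair := Empty
  kind := Empty.elim
  slots := ((Equiv.emptySum _ ι).trans e).trans (Equiv.uniqueSigma fun _ : Unit => Fin t.rank).symm

theorem value_atom (t : Atom) (e : ι ≃ Fin t.rank) (p : Patch k n) (y : E k)
    (ρ : ι → Index k n) : (atom t e).value p y ρ = t.component p y (ρ ∘ e.symm) := by
  classical
  have : Unique ((atom t e).Pair → Fin 2 → Index k n) := Pi.uniqueOfIsEmpty (α := Empty) _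
  have : IsEmpty (atom t e).Pair := inferInstanceAs (IsEmpty Empty)
  have : Unique (atom t e).Factor := inferInstanceAs (Unique Unit)
  rw [value, Fintype.sum_unique, Fintype.prod_empty, one_mul, Fintype.prod_unique]
  rfl

/-- Relabelling of the free slots. -/
def reindex (M : PartialContraction ι₁) (e : ι₁ ≃ ι) : PartialContraction ι :=
  { M with slots := ((Equiv.refl _).sumCongr e.symm).trans M.slots }

theorem value_reindex (M : PartialContraction ι₁) (e : ι₁ ≃ ι) (p : Patch k n) (y : E k)
    (ρ : ι → Index k n) : (M.reindex e).value p y ρ = M.value p y (ρ ∘ e) := by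
  refine Finset.sum_congr rfl fun c _ => congrArg _ (Finset.prod_congr rfl fun j _ =>
    congrArg _ (funext fun s => ?_))
  have h : ∀ (f : M.Pair × Fin 2 → Index k n) w,
      Sum.elim f ρ (Sum.map id e w) = Sum.elim f (ρ ∘ e) w := by rintro f (w | w) <;> rfl
  exact h _ _

/-- The tensor product of partial contractions. -/
def mul (M₁ : PartialContraction ι₁) (M₂ : PartialContraction ι₂) (e : ι₁ ⊕ ι₂ ≃ ι) :
    PartialContraction ι where
  Factor := M₁.Factor ⊕ M₂.Factor
  factor := Sum.elim M₁.factor M₂.factor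
  Pair := M₁.Pair ⊕ M₂.Pair
  kind := Sum.elim M₁.kind M₂.kind
  slots := (((Equiv.sumProdDistrib _ _ _).sumCongr e.symm).trans (Equiv.sumSumSumComm _ _ _ _)).trans
    ((M₁.slots.sumCongr M₂.slots).trans (Equiv.sumSigmaDistrib fun j =>
      Fin (Sum.elim M₁.factor M₂.factor j).rank).symm)

theorem value_mul (M₁ : PartialContraction ι₁) (M₂ : PartialContraction ι₂) (e : ι₁ ⊕ ι₂ ≃ ι)
    (p : Patch k n) (y : E k) (ρ : ι → Index k n) : (M₁.mul M₂ e).value p y ρ =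
      M₁.value p y (ρ ∘ e ∘ inl) * M₂.value p y (ρ ∘ e ∘ inr) := by
  classical
  simp only [value]
  rw [Finset.sum_mul_sum, ← Fintype.sum_prod_type']
  let E₀ : ((M₁.mul M₂ e).Pair → Fin 2 → Index k n) ≃
      (M₁.Pair → Fin 2 → Index k n) × (M₂.Pair → Fin 2 → Index k n) :=
    Equiv.sumArrowEquivProdArrow M₁.Pair M₂.Pair _
  refine Fintype.sum_equiv E₀ _ _ fun c => ?_
  have h1 : ∀ z, Sum.elim (fun q : (M₁.mul M₂ e).Pair × Fin 2 => c q.1 q.2) ρ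
      ((M₁.mul M₂ e).slots.symm z) = Sum.elim
        (fun z => Sum.elim (fun q => c (inl q.1) q.2) (ρ ∘ e ∘ inl) (M₁.slots.symm z))
        (fun z => Sum.elim (fun q => c (inr q.1) q.2) (ρ ∘ e ∘ inr) (M₂.slots.symm z))
        (Equiv.sumSigmaDistrib (fun j => Fin (Sum.elim M₁.factor M₂.factor j).rank) z) := by
    intro z
    obtain ⟨w, rfl⟩ := (M₁.mul M₂ e).slots.surjective z
    rw [Equiv.symm_apply_apply]
    rcases w with ⟨q | q, s⟩ | i
    · exact (congrArg (Sum.elim (fun q : M₁.Pair × Fin 2 => c (inl q.1) q.2) (ρ ∘ e ∘ inl))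
        (M₁.slots.symm_apply_apply (inl (q, s)))).symm
    · exact (congrArg (Sum.elim (fun q : M₂.Pair × Fin 2 => c (inr q.1) q.2) (ρ ∘ e ∘ inr))
        (M₂.slots.symm_apply_apply (inl (q, s)))).symm
    · obtain ⟨i | i, rfl⟩ := e.surjective i
      · have hs : (M₁.mul M₂ e).slots (inr (e (inl i))) = (Equiv.sumSigmaDistrib fun j =>
            Fin (Sum.elim M₁.factor M₂.factor j).rank).symm (inl (M₁.slots (inr i))) :=
          congrArg (fun w => (Equiv.sumSigmaDistrib fun j =>
            Fin (Sum.elim M₁.factor M₂.factor j).rank).symm ((M₁.slots.sumCongr M₂.slots)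
              (Equiv.sumSumSumComm _ _ _ _ (inr w)))) (e.symm_apply_apply (inl i))
        rw [hs]
        exact (congrArg (Sum.elim (fun q : M₁.Pair × Fin 2 => c (inl q.1) q.2) (ρ ∘ e ∘ inl))
          (M₁.slots.symm_apply_apply (inr i))).symm
      · have hs : (M₁.mul M₂ e).slots (inr (e (inr i))) = (Equiv.sumSigmaDistrib fun j =>
            Fin (Sum.elim M₁.factor M₂.factor j).rank).symm (inr (M₂.slots (inr i))) :=
          congrArg (fun w => (Equiv.sumSigmaDistrib fun j =>
            Fin (Sum.elim M₁.factor M₂.factor j).rank).symm ((M₁.slots.sumCongr M₂.slots)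
              (Equiv.sumSumSumComm _ _ _ _ (inr w)))) (e.symm_apply_apply (inr i))
        rw [hs]
        exact (congrArg (Sum.elim (fun q : M₂.Pair × Fin 2 => c (inr q.1) q.2) (ρ ∘ e ∘ inr))
          (M₂.slots.symm_apply_apply (inr i))).symm
  simp only [h1]
  have h2 : ∀ f : (M₁.mul M₂ e).Pair → ℝ, ∏ q, f q = (∏ q, f (inl q)) * ∏ q, f (inr q) :=
    fun f => Fintype.prod_sum_type (α₁ := M₁.Pair) (α₂ := M₂.Pair) f
  have h3 : ∀ f : (M₁.mul M₂ e).Factor → ℝ, ∏ q, f q = (∏ q, f (inl q)) * ∏ q, f (inr q) :=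
    fun f => Fintype.prod_sum_type (α₁ := M₁.Factor) (α₂ := M₂.Factor) f
  rw [h2, h3, mul_mul_mul_comm]
  rfl

/-- The contraction of a pair of free slots. -/
def contract (M : PartialContraction ι₁) (κ : Kind) (e : Fin 2 ⊕ ι ≃ ι₁) : PartialContraction ι where
  Factor := M.Factor
  factor := M.factor
  Pair := M.Pair ⊕ Unit
  kind := Sum.elim M.kind fun _ => κ
  slots := ((Equiv.sumProdDistrib _ _ _).sumCongr (Equiv.refl ι)).trans
    ((Equiv.sumAssoc _ _ _).trans (((Equiv.refl _).sumCongr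
      (((Equiv.punitProd _).sumCongr (Equiv.refl ι)).trans e)).trans M.slots))

theorem value_contract (M : PartialContraction ι₁) (κ : Kind) (e : Fin 2 ⊕ ι ≃ ι₁) (p : Patch k n)
    (y : E k) (ρ : ι → Index k n) : (M.contract κ e).value p y ρ =
      ∑ x, ∑ x', κ.weight p y x x' * M.value p y (Sum.elim ![x, x'] ρ ∘ e.symm) := by
  classical
  simp only [value, Finset.mul_sum]
  rw [← Fintype.sum_prod_type', ← Fintype.sum_prod_type']
  let E₀ : ((M.contract κ e).Pair → Fin 2 → Index k n) ≃
      (Index k n × Index k n) × (M.Pair → Fin 2 → Index k n) :=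
    (Equiv.sumArrowEquivProdArrow M.Pair Unit _).trans ((Equiv.prodComm _ _).trans
      (((Equiv.funUnique Unit _).trans (finTwoArrowEquiv _)).prodCongr (Equiv.refl _)))
  refine Fintype.sum_equiv E₀ _ _ fun c => ?_
  have h1 : ∀ z, Sum.elim (fun q : (M.contract κ e).Pair × Fin 2 => c q.1 q.2) ρ
      ((M.contract κ e).slots.symm z) = Sum.elim (fun q => c (inl q.1) q.2)
        (Sum.elim ![c (inr ()) 0, c (inr ()) 1] ρ ∘ e.symm) (M.slots.symm z) := by
    intro z
    obtain ⟨w, rfl⟩ := (M.contract κ e).slots.surjective z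
    rw [Equiv.symm_apply_apply]
    rcases w with ⟨q | q, s⟩ | i
    · exact (congrArg (Sum.elim (fun q : M.Pair × Fin 2 => c (inl q.1) q.2) _)
        (M.slots.symm_apply_apply (inl (q, s)))).symm
    · have hs : (M.contract κ e).slots (inl (inr q, s)) = M.slots (inr (e (inl s))) := rfl
      rw [hs, Equiv.symm_apply_apply]
      fin_cases s <;> simp
    · have hs : (M.contract κ e).slots (inr i) = M.slots (inr (e (inr i))) := rfl
      rw [hs, Equiv.symm_apply_apply]
      simp
  simp only [h1]
  have h2 : ∀ f : (M.contract κ e).Pair → ℝ, ∏ q, f q = (∏ q, f (inl q)) * f (inr ()) :=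
    fun f => (Fintype.prod_sum_type (α₁ := M.Pair) (α₂ := Unit) f).trans (by simp)
  rw [h2, mul_comm (∏ q, _), mul_assoc]
  rfl

/-- A partial contraction without free slots is a complete contraction. -/
def toComplete [IsEmpty ι] (M : PartialContraction ι) : CompleteContraction where
  numFactors := Fintype.card M.Factor
  factor j := M.factor ((Fintype.equivFin M.Factor).symm j)
  numPairs := Fintype.card M.Pair
  kind q := M.kind ((Fintype.equivFin M.Pair).symm q)
  slots := (((Fintype.equivFin M.Pair).symm.prodCongr (Equiv.refl (Fin 2))).trans
    (Equiv.sumEmpty _ ι).symm).trans (M.slots.trans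
      (Equiv.sigmaCongrLeft' (Fintype.equivFin M.Factor)))

theorem value_toComplete [IsEmpty ι] (M : PartialContraction ι) (p : Patch k n) (y : E k)
    (ρ : ι → Index k n) : M.toComplete.value p y = M.value p y ρ := by
  classical
  simp only [CompleteContraction.value, value]
  let eP := Fintype.equivFin M.Pair
  let eF := Fintype.equivFin M.Factor
  let E₀ : ((Σ j : Fin M.toComplete.numFactors, Fin (M.toComplete.factor j).rank) → Index k n) ≃
      (M.Pair → Fin 2 → Index k n) :=
    { toFun := fun i q s => i (M.toComplete.slots (eP q, s))
      invFun := fun c z => c (eP.symm (M.toComplete.slots.symm z).1) (M.toComplete.slots.symm z).2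
      left_inv := fun i => funext fun z => congrArg i <|
        (congrArg M.toComplete.slots (Prod.ext (eP.apply_symm_apply _) rfl :
          (eP (eP.symm (M.toComplete.slots.symm z).1), (M.toComplete.slots.symm z).2) =
            M.toComplete.slots.symm z)).trans
          (M.toComplete.slots.apply_symm_apply z)
      right_inv := fun c => funext fun q => funext fun s =>
        (congrArg (fun w : Fin M.toComplete.numPairs × Fin 2 => c (eP.symm w.1) w.2)
          (M.toComplete.slots.symm_apply_apply (eP q, s))).trans
          (congrArg (fun w => c w s) (eP.symm_apply_apply q)) }
  refine Fintype.sum_equiv E₀ _ _ fun i => congrArg₂ (· * ·) ?_ ?_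
  · refine Fintype.prod_equiv eP.symm _ _ fun q => ?_
    have h : ∀ s, E₀ i (eP.symm q) s = i (M.toComplete.slots (q, s)) := fun s => by
      change i (M.toComplete.slots (eP (eP.symm q), s)) = _
      rw [Equiv.apply_symm_apply]
    rw [h, h]; rfl
  · refine Fintype.prod_equiv eF.symm _ _ fun j => ?_
    refine congrArg _ (funext fun s => ?_)
    have h : ∀ z, Sum.elim (fun q : M.Pair × Fin 2 => E₀ i q.1 q.2) ρ z =
        i (Equiv.sigmaCongrLeft' eF (M.slots z)) := by
      rintro (⟨q, s⟩ | z)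
      · change i (Equiv.sigmaCongrLeft' eF (M.slots (inl (eP.symm (eP q), s)))) = _
        rw [Equiv.symm_apply_apply]
      · exact isEmptyElim z
    rw [h, Equiv.apply_symm_apply]
    refine congrArg i ?_
    exact ((Equiv.sigmaCongrLeft (β := fun j => Fin (M.factor j).rank) eF.symm).symm_apply_apply
      ⟨j, s⟩).symm

end PartialContraction

end

end ConformalSubmanifold

namespace ConformalSubmanifold

open TopologicalSpace (Opens)
open Sum (inl inr)

noncomputable section

/-! ### Natural tensors -/

variable {k n : ℕ} {ι ι₁ ι₂ : Type}

/-- On regular patches, `F` is a linear combination of partial contractions with fixed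
coefficients. -/
def IsNat (F : Patch k n → E k → (ι → Index k n) → ℝ) : Prop :=
  ∃ (J : Type) (_ : Fintype J) (c : J → ℝ) (M : J → PartialContraction ι),
    ∀ ⦃p : Patch k n⦄ ⦃U V⦄, p.IsRegularOn U V → ∀ y ∈ U, ∀ ρ,
      F p y ρ = ∑ j, c j * (M j).value p y ρ

namespace IsNat

variable {F G : Patch k n → E k → (ι → Index k n) → ℝ}

theorem congr (hF : IsNat F) (h : ∀ ⦃p : Patch k n⦄ ⦃U V⦄, p.IsRegularOn U V → ∀ y ∈ U, ∀ ρ,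
    G p y ρ = F p y ρ) : IsNat G := by
  obtain ⟨J, _, c, M, hM⟩ := hF
  exact ⟨J, inferInstance, c, M, fun p U V hp y hy ρ => (h hp y hy ρ).trans (hM hp y hy ρ)⟩

theorem of_value (M : PartialContraction ι) : IsNat (k := k) (n := n) M.value :=
  ⟨Unit, inferInstance, fun _ => 1, fun _ => M, fun _ _ _ _ _ _ _ => by simp⟩

theorem add (hF : IsNat F) (hG : IsNat G) : IsNat fun p y ρ => F p y ρ + G p y ρ := by
  obtain ⟨J, _, c, M, hM⟩ := hF
  obtain ⟨J', _, c', M', hM'⟩ := hG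
  refine ⟨J ⊕ J', inferInstance, Sum.elim c c', Sum.elim M M', fun p U V hp y hy ρ => ?_⟩
  beta_reduce
  rw [Fintype.sum_sum_type, hM hp y hy, hM' hp y hy]
  rfl

theorem const_mul (a : ℝ) (hF : IsNat F) : IsNat fun p y ρ => a * F p y ρ := by
  obtain ⟨J, _, c, M, hM⟩ := hF
  refine ⟨J, inferInstance, fun j => a * c j, M, fun p U V hp y hy ρ => ?_⟩
  simp only [hM hp y hy, Finset.mul_sum, mul_assoc]

theorem sub (hF : IsNat F) (hG : IsNat G) : IsNat fun p y ρ => F p y ρ - G p y ρ :=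
  (hF.add (hG.const_mul (-1))).congr fun _ _ _ _ _ _ _ => by ring

theorem reindex {F : Patch k n → E k → (ι₁ → Index k n) → ℝ} (hF : IsNat F) (e : ι₁ ≃ ι) :
    IsNat fun p y ρ => F p y (ρ ∘ e) := by
  obtain ⟨J, _, c, M, hM⟩ := hF
  refine ⟨J, inferInstance, c, fun j => (M j).reindex e, fun p U V hp y hy ρ => ?_⟩
  simp only [hM hp y hy, PartialContraction.value_reindex]

theorem mul {F : Patch k n → E k → (ι₁ → Index k n) → ℝ} {G : Patch k n → E k → (ι₂ → Index k n) → ℝ}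
    (hF : IsNat F) (hG : IsNat G) (e : ι₁ ⊕ ι₂ ≃ ι) :
    IsNat fun p y ρ => F p y (ρ ∘ e ∘ inl) * G p y (ρ ∘ e ∘ inr) := by
  obtain ⟨J, _, c, M, hM⟩ := hF
  obtain ⟨J', _, c', M', hM'⟩ := hG
  refine ⟨J × J', inferInstance, fun j => c j.1 * c' j.2, fun j => (M j.1).mul (M' j.2) e,
    fun p U V hp y hy ρ => ?_⟩
  beta_reduce
  rw [hM hp y hy, hM' hp y hy, Finset.sum_mul_sum, Fintype.sum_prod_type]
  refine Finset.sum_congr rfl fun j _ => Finset.sum_congr rfl fun j' _ => ?_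
  rw [PartialContraction.value_mul]; ring

theorem contract {F : Patch k n → E k → (ι₁ → Index k n) → ℝ} (hF : IsNat F) (κ : Kind)
    (e : Fin 2 ⊕ ι ≃ ι₁) : IsNat fun p y ρ =>
      ∑ x, ∑ x', κ.weight p y x x' * F p y (Sum.elim ![x, x'] ρ ∘ e.symm) := by
  obtain ⟨J, _, c, M, hM⟩ := hF
  refine ⟨J, inferInstance, c, fun j => (M j).contract κ e, fun p U V hp y hy ρ => ?_⟩
  simp only [hM hp y hy, PartialContraction.value_contract, Finset.mul_sum]
  rw [Finset.sum_congr rfl fun x _ => Finset.sum_comm, Finset.sum_comm]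
  exact Finset.sum_congr rfl fun x _ => Finset.sum_congr rfl fun x' _ =>
    Finset.sum_congr rfl fun j _ => by ring

end IsNat

theorem sum_weight_tangential (p : Patch k n) (y : E k) (f : Index k n → Index k n → ℝ) :
    ∑ x, ∑ x', Kind.tangential.weight p y x x' * f x x' =
      p.trT y fun α β => f (inl α) (inl β) := by
  simp [Fintype.sum_sum_type, Kind.weight, Patch.trT]

theorem sum_weight_normal (p : Patch k n) (y : E k) (f : Index k n → Index k n → ℝ) :
    ∑ x, ∑ x', Kind.normal.weight p y x x' * f x x' =
      p.trN y fun a b => f (inr a) (inr b) := by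
  simp [Fintype.sum_sum_type, Kind.weight, Patch.trN]

/-- Two new slots in front of `r` slots. -/
def frontEquiv (r : ℕ) : Fin 2 ⊕ Fin r ≃ Fin (r + 2) :=
  Equiv.ofBijective (Sum.elim ![0, 1] fun i => i.succ.succ) <|
    (Fintype.bijective_iff_surjective_and_card _).2 ⟨fun i => by
      refine Fin.cases ⟨inl 0, rfl⟩ (fun i => Fin.cases ⟨inl 1, rfl⟩ (fun i => ⟨inr i, rfl⟩) i) i,
      by simp [add_comm]⟩

theorem elim_comp_frontEquiv {α : Type*} {r : ℕ} (x x' : α) (ρ : Fin r → α) :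
    Sum.elim ![x, x'] ρ ∘ (frontEquiv r).symm = Fin.cons x (Fin.cons x' ρ) := by
  rw [Equiv.comp_symm_eq]
  ext (i | i)
  · fin_cases i <;> rfl
  · rfl

/-- Naturality of a tensor with `r` tangential and `s` normal indices. -/
def IsNatural {k n : ℕ} (r s : ℕ)
    (T : Patch k n → E k → (Fin r → Fin k) → (Fin s → Fin n) → ℝ) : Prop :=
  ∃ F : Patch k n → E k → (Fin r ⊕ Fin s → Index k n) → ℝ, IsNat F ∧
    ∀ ⦃p : Patch k n⦄ ⦃U V⦄, p.IsRegularOn U V → ∀ y ∈ U, ∀ A B, T p y A B = F p y (Sum.map A B)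

namespace IsNatural

variable {r s r₁ s₁ r₂ s₂ : ℕ} {S T : Patch k n → E k → (Fin r → Fin k) → (Fin s → Fin n) → ℝ}

theorem congr (hT : IsNatural r s T) (h : ∀ ⦃p : Patch k n⦄ ⦃U V⦄, p.IsRegularOn U V → ∀ y ∈ U,
    ∀ A B, S p y A B = T p y A B) : IsNatural r s S := by
  obtain ⟨F, hF, hF'⟩ := hT
  exact ⟨F, hF, fun p U V hp y hy A B => (h hp y hy A B).trans (hF' hp y hy A B)⟩

theorem add (hS : IsNatural r s S) (hT : IsNatural r s T) :
    IsNatural r s fun p y A B => S p y A B + T p y A B := by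
  obtain ⟨F, hF, hF'⟩ := hS
  obtain ⟨G, hG, hG'⟩ := hT
  exact ⟨_, hF.add hG, fun p U V hp y hy A B => by beta_reduce; rw [hF' hp y hy, hG' hp y hy]⟩

theorem const_mul (c : ℝ) (hT : IsNatural r s T) : IsNatural r s fun p y A B => c * T p y A B := by
  obtain ⟨F, hF, hF'⟩ := hT
  exact ⟨_, hF.const_mul c, fun p U V hp y hy A B => by beta_reduce; rw [hF' hp y hy]⟩

theorem sub (hS : IsNatural r s S) (hT : IsNatural r s T) :
    IsNatural r s fun p y A B => S p y A B - T p y A B :=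
  (hS.add (hT.const_mul (-1))).congr fun _ _ _ _ _ _ _ _ => by ring

theorem mul {S : Patch k n → E k → (Fin r₁ → Fin k) → (Fin s₁ → Fin n) → ℝ}
    {T : Patch k n → E k → (Fin r₂ → Fin k) → (Fin s₂ → Fin n) → ℝ}
    (hS : IsNatural r₁ s₁ S) (hT : IsNatural r₂ s₂ T) (i : Fin r₁ → Fin r) (i' : Fin r₂ → Fin r)
    (j : Fin s₁ → Fin s) (j' : Fin s₂ → Fin s) (hi : Function.Bijective (Sum.elim i i'))
    (hj : Function.Bijective (Sum.elim j j')) :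
    IsNatural r s fun p y A B => S p y (A ∘ i) (B ∘ j) * T p y (A ∘ i') (B ∘ j') := by
  obtain ⟨F, hF, hF'⟩ := hS
  obtain ⟨G, hG, hG'⟩ := hT
  refine ⟨_, hF.mul hG ((Equiv.sumSumSumComm _ _ _ _).trans
    ((Equiv.ofBijective _ hi).sumCongr (Equiv.ofBijective _ hj))), fun p U V hp y hy A B => ?_⟩
  beta_reduce
  rw [hF' hp y hy, hG' hp y hy]
  refine congrArg₂ (· * ·) (congrArg _ ?_) (congrArg _ ?_) <;> ext (x | x) <;> rfl

theorem trT {T : Patch k n → E k → (Fin (r + 2) → Fin k) → (Fin s → Fin n) → ℝ}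
    (hT : IsNatural (r + 2) s T) : IsNatural r s fun p y A B =>
      p.trT y fun α β => T p y (Fin.cons α (Fin.cons β A)) B := by
  obtain ⟨F, hF, hF'⟩ := hT
  refine ⟨_, hF.contract .tangential ((Equiv.sumAssoc _ _ _).symm.trans
    ((frontEquiv r).sumCongr (Equiv.refl _))), fun p U V hp y hy A B => ?_⟩
  beta_reduce
  rw [sum_weight_tangential p y fun x x' => F p y (Sum.elim ![x, x'] (Sum.map A B) ∘ _)]
  refine congrArg _ (funext fun α => funext fun β => ?_)
  rw [hF' hp y hy]
  refine congrArg _ ?_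
  rw [Equiv.eq_comp_symm]
  ext (i | i | i)
  · fin_cases i <;> rfl
  · rfl
  · rfl

theorem trN {T : Patch k n → E k → (Fin r → Fin k) → (Fin (s + 2) → Fin n) → ℝ}
    (hT : IsNatural r (s + 2) T) : IsNatural r s fun p y A B =>
      p.trN y fun a b => T p y A (Fin.cons a (Fin.cons b B)) := by
  obtain ⟨F, hF, hF'⟩ := hT
  refine ⟨_, hF.contract .normal (((Equiv.sumAssoc _ _ _).symm.trans
    ((Equiv.sumComm _ _).sumCongr (Equiv.refl _))).trans ((Equiv.sumAssoc _ _ _).trans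
    ((Equiv.refl _).sumCongr (frontEquiv s)))), fun p U V hp y hy A B => ?_⟩
  beta_reduce
  rw [sum_weight_normal p y fun x x' => F p y (Sum.elim ![x, x'] (Sum.map A B) ∘ _)]
  refine congrArg _ (funext fun α => funext fun β => ?_)
  rw [hF' hp y hy]
  refine congrArg _ ?_
  rw [Equiv.eq_comp_symm]
  ext (i | i | i)
  · fin_cases i <;> rfl
  · rfl
  · rfl

end IsNatural

theorem IsNat.isNatural {r a b : ℕ} {F : Patch k n → E k → (Fin r → Index k n) → ℝ} (hF : IsNat F)
    {κ : Fin r → Fin a ⊕ Fin b} (hκ : Function.Bijective κ) :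
    IsNatural a b fun p y A B => F p y (Sum.map A B ∘ κ) :=
  ⟨_, hF.reindex (Equiv.ofBijective κ hκ), fun _ _ _ _ _ _ _ _ => rfl⟩

/-! ### Natural ambient tensors -/

/-- Naturality of an ambient tensor: of all its projections. -/
def IsNatAmbient {k n r : ℕ} (T : Patch k n → Tensor n r) : Prop :=
  IsNat fun p y (i : Fin r → Index k n) => p.proj (T p) y i

namespace IsNatAmbient

variable {r s t : ℕ} {S T : Patch k n → Tensor n r}

theorem congr (hT : IsNatAmbient T) (h : ∀ ⦃p : Patch k n⦄ ⦃U V⦄, p.IsRegularOn U V → ∀ x ∈ V,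
    ∀ a, S p x a = T p x a) : IsNatAmbient S :=
  IsNat.congr hT fun _ _ _ hp _ hy _ => Patch.proj_congr (fun a => h hp _ (hp.maps _ hy) a) _

theorem add (hS : IsNatAmbient S) (hT : IsNatAmbient T) :
    IsNatAmbient fun p x a => S p x a + T p x a :=
  (IsNat.add hS hT).congr fun _ _ _ _ _ _ _ => Patch.proj_add _ _ _

theorem sub (hS : IsNatAmbient S) (hT : IsNatAmbient T) :
    IsNatAmbient fun p x a => S p x a - T p x a :=
  (IsNat.sub hS hT).congr fun _ _ _ _ _ _ _ => Patch.proj_sub _ _ _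

theorem const_mul (c : ℝ) (hT : IsNatAmbient T) : IsNatAmbient fun p x a => c * T p x a :=
  (IsNat.const_mul c hT).congr fun _ _ _ _ _ _ _ => Patch.proj_const_mul (fun _ => c) _ _

theorem mul {S : Patch k n → Tensor n s} {T : Patch k n → Tensor n t} (hS : IsNatAmbient S)
    (hT : IsNatAmbient T) {σ : Fin s → Fin r} {τ : Fin t → Fin r}
    (h : Function.Bijective (Sum.elim σ τ)) :
    IsNatAmbient fun p x a => S p x (a ∘ σ) * T p x (a ∘ τ) :=
  (IsNat.mul hS hT (Equiv.ofBijective _ h)).congr fun _ _ _ _ _ _ _ => Patch.proj_mul _ _ h _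

theorem perm (hT : IsNatAmbient T) {σ : Fin r → Fin r} (hσ : Function.Bijective σ) :
    IsNatAmbient fun p x a => T p x (a ∘ σ) :=
  (IsNat.reindex hT (Equiv.ofBijective σ hσ)).congr fun _ _ _ _ _ _ _ => Patch.proj_comp _ hσ _

theorem trace {T : Patch k n → Tensor n (r + 2)} (hT : IsNatAmbient T) :
    IsNatAmbient fun p x a => ctr p.g x fun c d => T p x (Fin.cons c (Fin.cons d a)) :=
  ((IsNat.contract hT .tangential (frontEquiv r)).add
    (IsNat.contract hT .normal (frontEquiv r))).congr fun p U V hp y hy i => by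
      simp only [elim_comp_frontEquiv]
      rw [hp.proj_trace hy, sum_weight_tangential p y fun x x' =>
        p.proj (T p) y (Fin.cons x (Fin.cons x' i)), sum_weight_normal p y fun x x' =>
        p.proj (T p) y (Fin.cons x (Fin.cons x' i))]

theorem riem : IsNatAmbient (k := k) (n := n) fun p => riem p.g :=
  (IsNat.of_value (PartialContraction.atom (.riem 0) (Equiv.refl (Fin 4)))).congr
    fun p _ _ _ y _ ρ => (PartialContraction.value_atom (.riem 0) (Equiv.refl (Fin 4)) p y ρ).symm

theorem nabla_riem : IsNatAmbient (k := k) (n := n) fun p => nabla p.g (ConformalSubmanifold.riem p.g) :=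
  (IsNat.of_value (PartialContraction.atom (.riem 1) (Equiv.refl (Fin 5)))).congr
    fun p _ _ _ y _ ρ => (PartialContraction.value_atom (.riem 1) (Equiv.refl (Fin 5)) p y ρ).symm

theorem metric : IsNatAmbient (k := k) (n := n) fun p x (a : Fin 2 → Fin n) => p.g x (a 0) (a 1) :=
  (IsNat.of_value (PartialContraction.atom .metric (Equiv.refl (Fin 2)))).congr
    fun p _ _ _ y _ ρ => (PartialContraction.value_atom .metric (Equiv.refl (Fin 2)) p y ρ).symm

theorem ricci : IsNatAmbient (k := k) (n := n) fun p => ricci p.g :=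
  (riem.perm (σ := ![2, 0, 3, 1]) (by decide)).trace.congr fun p _ _ _ x _ a =>
    ctr_congr fun c d => by rw [comp_vec_four]; rfl

theorem trSchouten : IsNatAmbient (k := k) (n := n) fun p x (_ : Fin 0 → Fin n) =>
    trSchouten p.g x :=
  (ricci.trace.const_mul (1 / (2 * ((n : ℝ) - 1)))).congr fun p _ _ _ x _ a =>
    congrArg (1 / (2 * ((n : ℝ) - 1)) * ·) (ctr_congr fun c d =>
      congrArg (ConformalSubmanifold.ricci p.g x) (by ext i : 1; fin_cases i <;> rfl))

theorem schouten : IsNatAmbient (k := k) (n := n) fun p => schouten p.g :=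
  ((ricci.sub (trSchouten.mul metric (σ := ![]) (τ := ![0, 1]) (by decide))).const_mul
    (1 / ((n : ℝ) - 2))).congr fun _ _ _ _ _ _ _ => rfl

theorem weyl : IsNatAmbient (k := k) (n := n) fun p => weyl p.g :=
  ((((riem.sub (schouten.mul metric (σ := ![0, 2]) (τ := ![1, 3]) (by decide))).sub
    (schouten.mul metric (σ := ![1, 3]) (τ := ![0, 2]) (by decide))).add
    (schouten.mul metric (σ := ![0, 3]) (τ := ![1, 2]) (by decide))).add
    (schouten.mul metric (σ := ![1, 2]) (τ := ![0, 3]) (by decide))).congr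
    fun p _ _ _ x _ a => by simp only [comp_vec_two]; rfl

theorem nabla_ricci : IsNatAmbient (k := k) (n := n) fun p =>
    nabla p.g (ConformalSubmanifold.ricci p.g) :=
  (nabla_riem.perm (σ := ![2, 3, 0, 4, 1]) (by decide)).trace.congr fun p _ _ hp x hx a => by
    rw [← Patch.vec_three_eta a, hp.metric.nabla_ricci hx]
    exact ctr_congr fun c d => by rw [comp_vec_five]; rfl

theorem pd_trSchouten (hn : 2 < n) : IsNatAmbient (k := k) (n := n) fun p x (a : Fin 1 → Fin n) =>
    pd (ConformalSubmanifold.trSchouten p.g) x (a 0) :=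
  ((nabla_ricci.perm (σ := ![2, 0, 1]) (by decide)).trace.const_mul
    (1 / (2 * ((n : ℝ) - 1)))).congr fun p _ _ hp x hx a => by
      have h1 : (n : ℝ) - 1 ≠ 0 := by
        have : (2 : ℝ) < n := by exact_mod_cast hn
        linarith
      have h := hp.metric.pd_scalarCurv_eq hn hx (a 0)
      refine Eq.trans ?_ (congrArg (1 / (2 * ((n : ℝ) - 1)) * ·) (h.symm.trans
        (ctr_congr fun c d => congrArg _ ?_)))
      · field_simp
      · ext i : 1; fin_cases i <;> rfl

theorem nabla_schouten (hn : 2 < n) : IsNatAmbient (k := k) (n := n) fun p =>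
    nabla p.g (ConformalSubmanifold.schouten p.g) :=
  ((nabla_ricci.sub ((pd_trSchouten hn).mul metric (σ := ![0]) (τ := ![1, 2]) (by decide))).const_mul
    (1 / ((n : ℝ) - 2))).congr fun p _ _ hp x hx a => by
      conv_lhs => rw [← Patch.vec_three_eta a]
      rw [hp.metric.nabla_schouten hx, Patch.vec_three_eta]; rfl

theorem nabla_weyl (hn : 2 < n) : IsNatAmbient (k := k) (n := n) fun p =>
    nabla p.g (ConformalSubmanifold.weyl p.g) :=
  ((((nabla_riem.sub ((nabla_schouten hn).mul metric (σ := ![0, 1, 3]) (τ := ![2, 4]) (by decide))).sub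
    ((nabla_schouten hn).mul metric (σ := ![0, 2, 4]) (τ := ![1, 3]) (by decide))).add
    ((nabla_schouten hn).mul metric (σ := ![0, 1, 4]) (τ := ![2, 3]) (by decide))).add
    ((nabla_schouten hn).mul metric (σ := ![0, 2, 3]) (τ := ![1, 4]) (by decide))).congr
    fun p _ _ hp x hx a => by
      conv_lhs => rw [← vec_five_eta a]
      rw [hp.metric.nabla_weyl hx, vec_five_eta]
      simp only [comp_vec_two]; rfl

end IsNatAmbient

end

end ConformalSubmanifold

namespace ConformalSubmanifold

open TopologicalSpace (Opens)
open Sum (inl inr)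

noncomputable section

namespace Patch

variable {k n : ℕ} {p : Patch k n} {U : Opens (E k)} {V : Opens (E n)} {y : E k}

namespace IsRegularOn

variable (hp : p.IsRegularOn U V)

include hp

theorem nablaN_H (hy : y ∈ U) (ε : Fin k) (b : Fin n) : p.nablaN p.H y ![ε] b =
    1 / (k : ℝ) * p.trT y fun α β => p.nablaN p.L y ![ε, α, β] b := by
  have h1 := nablaN_const_mul (1 / (k : ℝ)) (hp.isNField_L.trace (r := 0) hp) hy ![ε] b
  refine (nablaN_congr (U := U) (fun z _ A b => ?_) hy _ b).trans (h1.trans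
    (congrArg (1 / (k : ℝ) * ·) (hp.nablaN_trace (r := 0) hp.isNField_L hy ε ![] b)))
  rw [Subsingleton.elim A ![]]; rfl

theorem nablaN_nablaN_H (hy : y ∈ U) (ε δ : Fin k) (b : Fin n) :
    p.nablaN (p.nablaN p.H) y ![ε, δ] b =
      1 / (k : ℝ) * p.trT y fun α β => p.nablaN (p.nablaN p.L) y ![ε, δ, α, β] b := by
  have hT := (hp.isNField_nablaN hp.isNField_L).perm (![2, 0, 1] : Fin 3 → Fin 3)
  have h1 := nablaN_const_mul (1 / (k : ℝ)) (hT.trace (r := 1) hp) hy ![ε, δ] b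
  refine (nablaN_congr (U := U) (fun z hz A b => ?_) hy _ b).trans (h1.trans
    (congrArg (1 / (k : ℝ) * ·) ((hp.nablaN_trace (r := 1) hT hy ε ![δ] b).trans
      (ctr_congr fun α β => ?_))))
  · rw [← vec_one_eta A, hp.nablaN_H hz]
    exact congrArg (1 / (k : ℝ) * ·) (ctr_congr fun α β => by rw [comp_vec_three]; rfl)
  · rw [nablaN_perm _ (by decide), comp_vec_three]; rfl

theorem nablaN_nablaN_Lo (hy : y ∈ U) (ε δ β γ : Fin k) (b : Fin n) :
    p.nablaN (p.nablaN p.Lo) y ![ε, δ, β, γ] b = p.nablaN (p.nablaN p.L) y ![ε, δ, β, γ] b -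
      p.nablaN (p.nablaN p.H) y ![ε, δ] b * p.h y β γ := by
  have hH := hp.isNField_nablaN hp.isNField_H
  have hm := IsNField.mul hp.h_smooth hH (r := 3) ![1, 2] ![0]
  have h2 := hp.nablaN_mul hp.h_smooth hH (r := 3) (i := ![1, 2]) (j := ![0]) (by decide) hy ε
    ![δ, β, γ] b
  refine (nablaN_congr (U := U) (fun z hz A b => ?_) hy _ b).trans
    ((nablaN_sub (hp.isNField_nablaN hp.isNField_L) hm hy ![ε, δ, β, γ] b).trans
      (congrArg (_ - ·) (h2.trans ?_)))
  · rw [← vec_three_eta A, hp.nablaN_Lo hz, mul_comm, comp_vec_one]; rfl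
  · rw [comp_vec_two, comp_vec_one]
    have h3 : nabla p.h (fun z A => p.h z (A 0) (A 1)) y ![ε, β, γ] = 0 :=
      nabla_metric hp.induced hy _ _ _
    refine (congrArg₂ (· + ·) (congrArg (· * _) h3) rfl).trans ?_
    rw [zero_mul, zero_add, mul_comm]; rfl

theorem lap_normLsq (hy : y ∈ U) : p.lap p.normLsq y = 2 * p.trT y fun ε δ =>
    p.trT y fun β β' => p.trT y fun γ γ' =>
      (p.trN y fun a a' => p.nablaN (p.nablaN p.Lo) y ![ε, δ, β, γ] a * p.Lo y ![β', γ'] a') +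
      p.trN y fun a a' => p.nablaN p.Lo y ![δ, β, γ] a * p.nablaN p.Lo y ![ε, β', γ'] a' := by
  have hd := hp.isNField_nablaN hp.isNField_Lo
  let T : Tensor k 5 := fun z B => p.trN z fun a a' =>
    p.nablaN p.Lo z (B ∘ ![4, 2, 0]) a * p.Lo z (B ∘ ![3, 1]) a'
  have hT : SmoothTensor U T := fun B => hp.trN_smooth fun _ _ =>
      (hd.smooth _ _).mul (hp.isNField_Lo.smooth _ _)
  let S : Tensor k 3 := fun z A => ctr p.h z fun γ γ' => T z (Fin.cons γ (Fin.cons γ' A))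
  have hS : SmoothTensor U S := fun A => hp.trT_smooth fun _ _ => hT _
  let R : Tensor k 1 := fun z A => ctr p.h z fun β β' => S z (Fin.cons β (Fin.cons β' A))
  have hR : SmoothTensor U R := fun A => hp.trT_smooth fun _ _ => hS _
  have e : ∀ (δ β β' γ γ' : Fin k), (![γ, γ', β, β', δ] : Fin 5 → Fin k) ∘ ![4, 2, 0] = ![δ, β, γ] ∧
      (![γ, γ', β, β', δ] : Fin 5 → Fin k) ∘ ![3, 1] = ![β', γ'] := fun δ β β' γ γ' =>
    ⟨by rw [comp_vec_three]; rfl, by rw [comp_vec_two]; rfl⟩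
  have h1 : p.divT (fun z A => pd p.normLsq z (A 0)) y = p.divT (fun z A => 2 * R z A) y := by
    refine divT_congr (U := U) (fun z hz A => ?_) hy
    rw [hp.pd_normLsq hz]
    refine congrArg (2 * ·) (ctr_congr fun β β' => ctr_congr fun γ γ' => ?_)
    obtain ⟨e1, e2⟩ := e (A 0) β β' γ γ'
    have e0 : (Fin.cons γ (Fin.cons γ' (Fin.cons β (Fin.cons β' A))) : Fin 5 → Fin k) =
        ![γ, γ', β, β', A 0] := by ext j : 1; fin_cases j <;> rfl
    simp only [T, e0, e1, e2]
  rw [lap_eq, h1, divT_const_mul 2 hR hy]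
  refine congrArg (2 * ·) (ctr_congr fun ε δ => ?_)
  refine (nabla_trace (r := 1) hp.induced hS hy ε ![δ]).trans (ctr_congr fun β β' => ?_)
  refine (nabla_trace (r := 3) hp.induced hT hy ε ![β, β', δ]).trans (ctr_congr fun γ γ' => ?_)
  refine (hp.nabla_trN hd hp.isNField_Lo (by decide) hy ε ![γ, γ', β, β', δ]).trans ?_
  obtain ⟨e1, e2⟩ := e δ β β' γ γ'
  simp only [e1, e2]
  rfl

end IsRegularOn

end Patch

namespace IsNatural

variable {k n r s a b : ℕ}

theorem perm {T : Patch k n → E k → (Fin r → Fin k) → (Fin s → Fin n) → ℝ}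
    (hT : IsNatural r s T) {i : Fin r → Fin r} (hi : Function.Bijective i) :
    IsNatural r s fun p y A B => T p y (A ∘ i) B := by
  obtain ⟨F, hF, hF'⟩ := hT
  refine ⟨_, hF.reindex ((Equiv.ofBijective i hi).sumCongr (Equiv.refl _)),
    fun p U V hp y hy A B => ?_⟩
  beta_reduce
  rw [hF' hp y hy]
  refine congrArg _ ?_
  ext (x | x) <;> rfl

theorem extend_apply (T : NTensor k n r) (y : E k) (A : Fin r → Fin k) (B : Fin 1 → Fin n) :
    T.extend y (Sum.map A B ∘ (finSumFinEquiv (m := r) (n := 1)).symm) = T y A (B 0) := by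
  have h1 : ∀ j : Fin r, (Sum.map A B ∘ (finSumFinEquiv (m := r) (n := 1)).symm) j.castSucc =
      inl (A j) := fun j => by
    rw [Function.comp_apply, show j.castSucc = Fin.castAdd 1 j from rfl,
      finSumFinEquiv_symm_apply_castAdd]; rfl
  have h2 : (Sum.map A B ∘ (finSumFinEquiv (m := r) (n := 1)).symm) (Fin.last r) = inr (B 0) := by
    rw [Function.comp_apply, show Fin.last r = Fin.natAdd r (0 : Fin 1) from rfl,
      finSumFinEquiv_symm_apply_natAdd]; rfl
  rw [NTensor.extend]
  simp only [h1, h2, Sum.inl.injEq, Sum.inr.injEq]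
  rw [Finset.sum_eq_single A, Finset.sum_eq_single (B 0)]
  · simp
  · intro b _ hb; simp [hb.symm]
  · simp
  · intro A' _ hA
    refine Finset.sum_eq_zero fun b _ => if_neg fun h => hA (funext fun j => (h.1 j).symm)
  · simp

theorem nablaL (N : ℕ) : IsNatural (k := k) (n := n) (2 + N) 1 fun p y A B => p.nablaL N y A (B 0) :=
  ⟨_, IsNat.of_value (PartialContraction.atom (.sff N) finSumFinEquiv), fun p _ _ _ y _ A B =>
    ((PartialContraction.value_atom (.sff N) finSumFinEquiv p y _).trans
      (extend_apply (p.nablaL N) y A B)).symm⟩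

theorem L : IsNatural (k := k) (n := n) 2 1 fun p y A B => p.L y ![A 0, A 1] (B 0) :=
  (nablaL 0).congr fun _ _ _ _ _ _ A _ => by rw [vec_two_eta]; rfl

theorem dL : IsNatural (k := k) (n := n) 3 1 fun p y A B => p.nablaN p.L y ![A 0, A 1, A 2] (B 0) :=
  (nablaL 1).congr fun _ _ _ _ _ _ A _ => by rw [Patch.vec_three_eta]; rfl

theorem ddL : IsNatural (k := k) (n := n) 4 1 fun p y A B =>
    p.nablaN (p.nablaN p.L) y ![A 0, A 1, A 2, A 3] (B 0) :=
  (nablaL 2).congr fun _ _ _ _ _ _ A _ => by rw [vec_four_eta]; rfl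

theorem h : IsNatural (k := k) (n := n) 2 0 fun p y A _ => p.h y (A 0) (A 1) :=
  (IsNat.isNatural IsNatAmbient.metric (κ := ![inl 0, inl 1]) (by decide)).congr
    fun p _ _ _ y _ A B => (Patch.proj_metric (p := p) (y := y) (Sum.map A B ∘ ![inl 0, inl 1])).symm

theorem H : IsNatural (k := k) (n := n) 0 1 fun p y _ B => p.H y ![] (B 0) :=
  L.trT.const_mul (1 / (k : ℝ))

theorem dH : IsNatural (k := k) (n := n) 1 1 fun p y A B => p.nablaN p.H y ![A 0] (B 0) :=
  ((dL.perm (i := ![2, 0, 1]) (by decide)).trT.const_mul (1 / (k : ℝ))).congr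
    fun _ _ _ hp _ hy _ _ => hp.nablaN_H hy _ _

theorem ddH : IsNatural (k := k) (n := n) 2 1 fun p y A B =>
    p.nablaN (p.nablaN p.H) y ![A 0, A 1] (B 0) :=
  ((ddL.perm (i := ![2, 3, 0, 1]) (by decide)).trT.const_mul (1 / (k : ℝ))).congr
    fun _ _ _ hp _ hy _ _ => hp.nablaN_nablaN_H hy _ _ _

theorem Lo : IsNatural (k := k) (n := n) 2 1 fun p y A B => p.Lo y ![A 0, A 1] (B 0) :=
  L.sub (H.mul h ![] ![0, 1] ![0] ![] (by decide) (by decide))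

theorem dLo : IsNatural (k := k) (n := n) 3 1 fun p y A B =>
    p.nablaN p.Lo y ![A 0, A 1, A 2] (B 0) :=
  (dL.sub (dH.mul h ![0] ![1, 2] ![0] ![] (by decide) (by decide))).congr
    fun _ _ _ hp _ hy _ _ => hp.nablaN_Lo hy _ _ _ _

theorem ddLo : IsNatural (k := k) (n := n) 4 1 fun p y A B =>
    p.nablaN (p.nablaN p.Lo) y ![A 0, A 1, A 2, A 3] (B 0) :=
  (ddL.sub (ddH.mul h ![0, 1] ![2, 3] ![0] ![] (by decide) (by decide))).congr
    fun _ _ _ hp _ hy _ _ => hp.nablaN_nablaN_Lo hy _ _ _ _ _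

theorem W {i j l q : Fin a ⊕ Fin b} (hκ : Function.Bijective ![i, j, l, q]) :
    IsNatural (k := k) (n := n) a b fun p y A B =>
      p.W y ![Sum.map A B i, Sum.map A B j, Sum.map A B l, Sum.map A B q] :=
  (IsNat.isNatural IsNatAmbient.weyl hκ).congr fun _ _ _ _ _ _ _ _ =>
    congrArg _ (by ext x : 1; fin_cases x <;> rfl)

theorem P {i j : Fin a ⊕ Fin b} (hκ : Function.Bijective ![i, j]) :
    IsNatural (k := k) (n := n) a b fun p y A B => p.P y ![Sum.map A B i, Sum.map A B j] :=
  (IsNat.isNatural IsNatAmbient.schouten hκ).congr fun _ _ _ _ _ _ _ _ =>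
    congrArg _ (by ext x : 1; fin_cases x <;> rfl)

theorem dP (hn : 2 < n) {i j l : Fin a ⊕ Fin b} (hκ : Function.Bijective ![i, j, l]) :
    IsNatural (k := k) (n := n) a b fun p y A B => p.proj (nabla p.g (schouten p.g)) y
      ![Sum.map A B i, Sum.map A B j, Sum.map A B l] :=
  (IsNat.isNatural (IsNatAmbient.nabla_schouten hn) hκ).congr fun _ _ _ _ _ _ _ _ =>
    congrArg _ (by ext x : 1; fin_cases x <;> rfl)

theorem D : IsNatural (k := k) (n := n) 1 1 fun p y A B => p.D y (A 0) (B 0) :=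
  (P (i := inl 0) (j := inr 0) (by decide)).sub dH

end IsNatural

end

end ConformalSubmanifold

namespace ConformalSubmanifold

open TopologicalSpace (Opens)
open Sum (inl inr)

noncomputable section

/-! ### Naturality of `𝒥₁` and `𝒥₂` -/

namespace IsNatural

variable {k n a b : ℕ}

theorem trT_trN_mul {S T : Patch k n → E k → Fin k → Fin n → ℝ}
    (hS : IsNatural 1 1 fun p y A B => S p y (A 0) (B 0))
    (hT : IsNatural 1 1 fun p y A B => T p y (A 0) (B 0)) :
    IsNatural 0 0 fun p y _ _ => p.trT y fun α α' => p.trN y fun a a' =>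
      S p y α a * T p y α' a' :=
  (hS.mul hT (r := 2) (s := 2) ![0] ![1] ![0] ![1] (by decide) (by decide)).trN.trT

theorem trT_trT_trN_mul {S T : Patch k n → E k → Fin k → Fin k → Fin n → ℝ}
    (hS : IsNatural 2 1 fun p y A B => S p y (A 0) (A 1) (B 0))
    (hT : IsNatural 2 1 fun p y A B => T p y (A 0) (A 1) (B 0)) :
    IsNatural 0 0 fun p y _ _ => p.trT y fun α α' => p.trT y fun β β' => p.trN y fun a a' =>
      S p y α β a * T p y α' β' a' :=
  (hS.mul hT (r := 4) (s := 2) ![2, 0] ![3, 1] ![0] ![1] (by decide) (by decide)).trN.trT.trT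

theorem inner2 {S T : Patch k n → Tensor k 2}
    (hS : IsNatural 2 0 fun p y A _ => S p y ![A 0, A 1])
    (hT : IsNatural 2 0 fun p y A _ => T p y ![A 0, A 1]) :
    IsNatural 0 0 fun p y _ _ => p.inner2 (S p) (T p) y :=
  (hS.mul hT (r := 4) (s := 0) ![2, 0] ![3, 1] ![] ![] (by decide) (by decide)).trT.trT

theorem normLsq : IsNatural (k := k) (n := n) 0 0 fun p y _ _ => p.normLsq y :=
  trT_trT_trN_mul (S := fun p y α β a => p.Lo y ![α, β] a) (T := fun p y α β a => p.Lo y ![α, β] a)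
    Lo Lo

theorem normHsq : IsNatural (k := k) (n := n) 0 0 fun p y _ _ => p.normHsq y :=
  (H.mul H (r := 0) (s := 2) ![] ![] ![0] ![1] (by decide) (by decide)).trN

theorem calP : IsNatural (k := k) (n := n) 2 0 fun p y A _ => p.calP y ![A 0, A 1] :=
  ((P (i := inl 0) (j := inl 1) (by decide)).add
    (H.mul Lo (r := 2) (s := 2) ![] ![0, 1] ![0] ![1] (by decide) (by decide)).trN).add
    ((normHsq.const_mul (1 / 2)).mul h ![] ![0, 1] ![] ![] (by decide) (by decide))

theorem trCalP : IsNatural (k := k) (n := n) 0 0 fun p y _ _ => p.trCalP y := calP.trT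

theorem Lsq : IsNatural (k := k) (n := n) 2 0 fun p y A _ => p.Lsq y ![A 0, A 1] :=
  (Lo.mul Lo (r := 4) (s := 2) ![0, 2] ![1, 3] ![0] ![1] (by decide) (by decide)).trN.trT

theorem Wtr : IsNatural (k := k) (n := n) 2 0 fun p y A _ => p.Wtr y ![A 0, A 1] :=
  (W (a := 4) (b := 0) (i := inl 2) (j := inl 0) (l := inl 3) (q := inl 1) (by decide)).trT

theorem Wtrtr : IsNatural (k := k) (n := n) 0 0 fun p y _ _ => p.Wtrtr y := Wtr.trT

theorem G : IsNatural (k := k) (n := n) 0 0 fun p y _ _ => p.G y :=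
  (normLsq.sub Wtrtr).const_mul _

theorem F : IsNatural (k := k) (n := n) 2 0 fun p y A _ => p.F y ![A 0, A 1] :=
  ((Lsq.sub Wtr).sub (G.mul h ![] ![0, 1] ![] ![] (by decide) (by decide))).const_mul _

theorem Wmix : IsNatural (k := k) (n := n) 1 1 fun p y A B => p.Wmix y (A 0) (B 0) :=
  (W (a := 3) (b := 1) (i := inl 2) (j := inl 0) (l := inr 0) (q := inl 1) (by decide)).trT

theorem normDsq : IsNatural (k := k) (n := n) 0 0 fun p y _ _ => p.normDsq y :=
  trT_trN_mul D D

theorem DW : IsNatural (k := k) (n := n) 0 0 fun p y _ _ => p.DW y :=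
  trT_trN_mul D Wmix

theorem calC (hn : 2 < n) : IsNatural (k := k) (n := n) 2 1 fun p y A B =>
    p.calC y (inl (A 0)) (inr (B 0)) (inl (A 1)) :=
  (((dP hn (i := inl 0) (j := inr 0) (l := inl 1) (by decide)).sub
    (dP hn (i := inr 0) (j := inl 0) (l := inl 1) (by decide))).sub
    (H.mul (W (a := 2) (b := 2) (i := inl 0) (j := inr 1) (l := inl 1) (q := inr 0) (by decide))
      (r := 2) (s := 3) ![] ![0, 1] ![0] ![1, 2] (by decide) (by decide)).trN).congr
    fun p _ _ _ y _ A B => congrArg (· - _) (Patch.IsRegularOn.C_eq _ _ _)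

theorem LC (hn : 2 < n) : IsNatural (k := k) (n := n) 0 0 fun p y _ _ => p.LC y :=
  trT_trT_trN_mul (S := fun p y α β a => p.Lo y ![α, β] a)
    (T := fun p y α β a => p.calC y (inl α) (inr a) (inl β)) Lo (calC hn)

theorem divLo : IsNatural (k := k) (n := n) 1 1 fun p y A B => p.divLo y (A 0) (B 0) := dLo.trT

theorem dD (hn : 2 < n) : IsNatural (k := k) (n := n) 2 1 fun p y A B =>
    p.nablaN p.DN y ![A 0, A 1] (B 0) :=
  ((((dP hn (i := inl 0) (j := inl 1) (l := inr 0) (by decide)).add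
    (L.mul (P (a := 0) (b := 2) (i := inr 0) (j := inr 1) (by decide)) (r := 2) (s := 3)
      ![0, 1] ![] ![0] ![1, 2] (by decide) (by decide)).trN).sub
    (L.mul (P (a := 2) (b := 0) (i := inl 0) (j := inl 1) (by decide)) (r := 4) (s := 1)
      ![2, 1] ![3, 0] ![0] ![] (by decide) (by decide)).trT).sub ddH).congr
    fun _ _ _ hp _ hy _ _ => hp.nablaN_DN hy _ _ _

theorem divT_DL (hn : 2 < n) : IsNatural (k := k) (n := n) 0 0 fun p y _ _ => p.divT p.DL y :=
  ((trT_trT_trN_mul (S := fun p y α β a => p.nablaN p.DN y ![α, β] a)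
    (T := fun p y α β a => p.Lo y ![α, β] a) (dD hn) Lo).add (trT_trN_mul D divLo)).congr
    fun _ _ _ hp _ hy _ _ => hp.divT_DL hy

theorem WN : IsNatural (k := k) (n := n) 3 1 fun p y A B => p.WN y ![A 0, A 1, A 2] (B 0) :=
  W (i := inl 0) (j := inl 1) (l := inr 0) (q := inl 2) (by decide)

theorem dW (hn : 2 < n) {i j l q t : Fin a ⊕ Fin b} (hκ : Function.Bijective ![i, j, l, q, t]) :
    IsNatural (k := k) (n := n) a b fun p y A B => p.proj (nabla p.g (weyl p.g)) y
      ![Sum.map A B i, Sum.map A B j, Sum.map A B l, Sum.map A B q, Sum.map A B t] :=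
  (IsNat.isNatural (IsNatAmbient.nabla_weyl hn) hκ).congr fun _ _ _ _ _ _ _ _ =>
    congrArg _ (by ext x : 1; fin_cases x <;> rfl)

theorem dWN (hn : 2 < n) : IsNatural (k := k) (n := n) 4 1 fun p y A B =>
    p.nablaN p.WN y ![A 0, A 1, A 2, A 3] (B 0) :=
  (((dW hn (i := inl 0) (j := inl 1) (l := inl 2) (q := inr 0) (t := inl 3) (by decide)).add
    (((L.mul (W (a := 2) (b := 2) (i := inr 0) (j := inl 0) (l := inr 1) (q := inl 1) (by decide))
      (r := 4) (s := 3) ![0, 1] ![2, 3] ![0] ![1, 2] (by decide) (by decide)).trN.add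
    (L.mul (W (a := 2) (b := 2) (i := inl 0) (j := inr 0) (l := inr 1) (q := inl 1) (by decide))
      (r := 4) (s := 3) ![0, 2] ![1, 3] ![0] ![1, 2] (by decide) (by decide)).trN).add
    (L.mul (W (a := 2) (b := 2) (i := inl 0) (j := inl 1) (l := inr 1) (q := inr 0) (by decide))
      (r := 4) (s := 3) ![0, 3] ![1, 2] ![0] ![1, 2] (by decide) (by decide)).trN)).sub
    (L.mul (W (a := 4) (b := 0) (i := inl 0) (j := inl 1) (l := inl 2) (q := inl 3) (by decide))
      (r := 6) (s := 1) ![2, 1] ![3, 4, 0, 5] ![0] ![] (by decide) (by decide)).trT).congr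
    fun _ _ _ hp _ hy _ _ => hp.nablaN_WN hy _ _ _ _ _

theorem divT_LW (hn : 2 < n) : IsNatural (k := k) (n := n) 0 0 fun p y _ _ => p.divT p.LW y :=
  IsNatural.trT (T := fun p y A _ => nabla p.h p.LW y ![A 0, A 1])
    (((dLo.mul WN (r := 6) (s := 2) ![4, 2, 0] ![5, 3, 1] ![0] ![1] (by decide) (by decide)).trN.add
    (Lo.mul (dWN hn) (r := 6) (s := 2) ![2, 0] ![4, 5, 3, 1] ![0] ![1] (by decide)
      (by decide)).trN).trT.trT.congr fun _ _ _ hp _ hy _ _ => hp.nabla_LW hy _ _)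

theorem dWmix (hn : 2 < n) : IsNatural (k := k) (n := n) 2 1 fun p y A B =>
    p.nablaN p.WmixN y ![A 0, A 1] (B 0) :=
  ((dWN hn).perm (i := ![2, 3, 0, 1]) (by decide)).trT.congr
    fun _ _ _ hp _ hy _ _ => hp.nablaN_WmixN hy _ _ _

theorem divT_LWmix (hn : 2 < n) :
    IsNatural (k := k) (n := n) 0 0 fun p y _ _ => p.divT p.LWmix y :=
  IsNatural.trT (T := fun p y A _ => nabla p.h p.LWmix y ![A 0, A 1])
    (((dLo.mul Wmix (r := 4) (s := 2) ![2, 3, 0] ![1] ![0] ![1] (by decide) (by decide)).trN.add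
    (Lo.mul (dWmix hn) (r := 4) (s := 2) ![3, 0] ![2, 1] ![0] ![1] (by decide)
      (by decide)).trN).trT.congr fun _ _ _ hp _ hy _ _ => hp.nabla_LWmix hy _ _)

theorem lap_normLsq : IsNatural (k := k) (n := n) 0 0 fun p y _ _ => p.lap p.normLsq y :=
  (((ddLo.mul Lo (r := 6) (s := 2) ![4, 5, 2, 0] ![3, 1] ![0] ![1] (by decide)
    (by decide)).trN.add (dLo.mul dLo (r := 6) (s := 2) ![5, 2, 0] ![4, 3, 1] ![0] ![1] (by decide)
    (by decide)).trN).trT.trT.trT.const_mul 2).congr fun _ _ _ hp _ hy _ _ => hp.lap_normLsq hy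

theorem mul_scalar {f f' : Patch k n → E k → ℝ} (hf : IsNatural 0 0 fun p y _ _ => f p y)
    (hf' : IsNatural 0 0 fun p y _ _ => f' p y) : IsNatural 0 0 fun p y _ _ => f p y * f' p y :=
  hf.mul hf' ![] ![] ![] ![] (by decide) (by decide)

theorem two_mul_I_add_J (hk : 1 < k) (hn : 2 < n) :
    IsNatural (k := k) (n := n) 0 0 fun p y _ _ => 2 * p.I y + p.J y :=
  (((mul_scalar (normLsq.const_mul 2) trCalP).sub lap_normLsq).add
    (((((inner2 Lsq calP).sub (divT_DL hn)).sub (normDsq.const_mul ((k : ℝ) - 3))).sub DW).sub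
      (LC hn) |>.const_mul (2 * ((k : ℝ) - 6)))).congr fun _ _ _ hp _ hy _ _ => by
    rw [hp.two_mul_I_add_J hk hy]; ring

theorem K1 (hn : 2 < n) : IsNatural (k := k) (n := n) 0 0 fun p y _ _ => p.K1 y :=
  (divT_LW hn).add ((LC hn).const_mul _)

theorem K2 (hn : 2 < n) : IsNatural (k := k) (n := n) 0 0 fun p y _ _ => p.K2 y :=
  (divT_LWmix hn).add (DW.const_mul _)

theorem LoLo : IsNatural (k := k) (n := n) 4 2 fun p y A B =>
    p.Lo y ![A 0, A 1] (B 0) * p.Lo y ![A 2, A 3] (B 1) :=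
  Lo.mul Lo ![0, 1] ![2, 3] ![0] ![1] (by decide) (by decide)

set_option maxRecDepth 2000 in
theorem J1alg : IsNatural (k := k) (n := n) 0 0 fun p y _ _ => p.J1alg y :=
  ((((LoLo.mul (W (a := 4) (b := 0) (i := inl 0) (j := inl 1) (l := inl 2) (q := inl 3) (by decide))
      (r := 8) (s := 2) ![6, 2, 4, 0] ![7, 5, 3, 1] ![0, 1] ![] (by decide)
      (by decide)).trN.trT.trT.trT.trT.sub
    (LoLo.mul (W (a := 2) (b := 2) (i := inr 0) (j := inl 0) (l := inr 1) (q := inl 1) (by decide))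
      (r := 6) (s := 4) ![4, 2, 5, 3] ![0, 1] ![2, 0] ![3, 1] (by decide)
      (by decide)).trN.trN.trT.trT.trT).add
    (LoLo.mul (((W (a := 2) (b := 2) (i := inl 0) (j := inr 0) (l := inl 1) (q := inr 1)
      (by decide)).const_mul 2).sub
      (W (a := 2) (b := 2) (i := inl 0) (j := inl 1) (l := inr 0) (q := inr 1) (by decide)))
      (r := 6) (s := 4) ![0, 4, 1, 2] ![5, 3] ![2, 0] ![3, 1] (by decide)
      (by decide)).trN.trN.trT.trT.trT).sub
    ((WN.mul WN (r := 6) (s := 2) ![4, 2, 0] ![5, 3, 1] ![0] ![1] (by decide)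
      (by decide)).trN.trT.trT.trT.const_mul (1 / 2))).add (trT_trN_mul Wmix Wmix)

theorem J1 (hk : 1 < k) (hn : 2 < n) : IsNatural (k := k) (n := n) 0 0 fun p y _ _ => p.J1 y :=
  (((((two_mul_I_add_J hk hn).const_mul _).add
    ((((K1 hn).add (K2 hn)).add (inner2 Lsq F)).const_mul _)).add (inner2 Lsq Wtr)).add
    ((mul_scalar G normLsq).const_mul _)).add J1alg |>.congr fun _ _ _ _ _ _ _ _ => Patch.J1_eq _

theorem J2 (hk : 1 < k) (hn : 2 < n) : IsNatural (k := k) (n := n) 0 0 fun p y _ _ => p.J2 y :=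
  ((((two_mul_I_add_J hk hn).const_mul _).add (((K1 hn).add (K2 hn)).const_mul _)).sub
    ((inner2 Lsq F).const_mul _)).add ((mul_scalar G normLsq).const_mul _)

/-- A natural scalar is a linear combination of complete contractions. -/
theorem exists_completeContraction {f : Patch k n → E k → ℝ}
    (hf : IsNatural 0 0 fun p y _ _ => f p y) :
    ∃ (N : ℕ) (c : Fin N → ℝ) (T : Fin N → CompleteContraction),
      ∀ ⦃p : Patch k n⦄ ⦃U V⦄, p.IsRegularOn U V → ∀ y ∈ U, f p y = ∑ j, c j * (T j).value p y := by
  obtain ⟨F, ⟨J, _, c, M, hM⟩, hF⟩ := hf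
  let e := Fintype.equivFin J
  refine ⟨Fintype.card J, c ∘ e.symm, fun j => (M (e.symm j)).toComplete, fun p U V hp y hy => ?_⟩
  refine (hF hp y hy ![] ![]).trans ?_
  rw [hM hp y hy, ← e.symm.sum_comp]
  exact Finset.sum_congr rfl fun j _ => congrArg _ (PartialContraction.value_toComplete _ p y _).symm

end IsNatural

end

end ConformalSubmanifold

namespace ConformalSubmanifold

open TopologicalSpace (Opens)

noncomputable section

/-! ### Coordinate representations of immersions -/

section Manifolds

variable {k n : ℕ} {X : Type u} [TopologicalSpace X] [ChartedSpace (E n) X]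
  {Y : Type v} [TopologicalSpace Y] [ChartedSpace (E k) Y]

/-- The domain of the coordinates given by the chart at a point. -/
def chartTarget {m : ℕ} {M : Type*} [TopologicalSpace M] [ChartedSpace (E m) M] (x : M) :
    Opens (E m) := ⟨(extChartAt (𝓡 m) x).target, isOpen_extChartAt_target x⟩

theorem mfderivWithin_chart_symm {m : ℕ} {M : Type*} [TopologicalSpace M] [ChartedSpace (E m) M]
    (x : M) {s : Set (E m)} {u : E m} (hs : s ∈ nhds u) :
    mfderivWithin 𝓘(ℝ, E m) (𝓡 m) (extChartAt (𝓡 m) x).symm s u =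
      mfderiv 𝓘(ℝ, E m) (𝓡 m) (extChartAt (𝓡 m) x).symm u := mfderivWithin_of_mem_nhds hs

theorem injective_mfderiv_chart_symm {m : ℕ} {M : Type*} [TopologicalSpace M]
    [ChartedSpace (E m) M] [IsManifold (𝓡 m) ∞ M] (x : M) {u : E m} (hu : u ∈ chartTarget x) :
    Function.Injective (mfderiv 𝓘(ℝ, E m) (𝓡 m) (extChartAt (𝓡 m) x).symm u) := by
  have : IsManifold (𝓡 m) 1 M := IsManifold.of_le (n := ∞) (by simp)
  rw [← mfderivWithin_chart_symm x (s := Set.range (𝓡 m)) (by simp)]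
  exact (isInvertible_mfderivWithin_extChartAt_symm (I := 𝓡 m) hu).injective

/-- The domain on which an immersion is represented in the charts at `y` and at `i y`. -/
def patchDomain {i : Y → X} (hi : IsSmoothImmersion k n i) (y : Y) : Opens (E k) :=
  ⟨(extChartAt (𝓡 k) y).target ∩
    (extChartAt (𝓡 k) y).symm ⁻¹' (i ⁻¹' (extChartAt (𝓡 n) (i y)).source),
    (continuousOn_extChartAt_symm y).isOpen_inter_preimage (isOpen_extChartAt_target y)
      ((isOpen_extChartAt_source (i y)).preimage hi.smooth.continuous)⟩

theorem mem_patchDomain {i : Y → X} (hi : IsSmoothImmersion k n i) (y : Y) :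
    extChartAt (𝓡 k) y y ∈ patchDomain hi y :=
  ⟨mem_extChartAt_target y, by simp⟩

variable [IsManifold (𝓡 n) ∞ X]

theorem contMDiffOn_chart_frame (x : X) (a : Fin n) :
    ContMDiffOn 𝓘(ℝ, E n) (𝓡 n).tangent ∞ (fun u => (⟨(extChartAt (𝓡 n) x).symm u,
      mfderiv 𝓘(ℝ, E n) (𝓡 n) (extChartAt (𝓡 n) x).symm u (EuclideanSpace.single a (1 : ℝ))⟩ :
        TangentBundle (𝓡 n) X)) (chartTarget x : Opens (E n)) := by
  have : IsManifold (𝓡 n) 1 X := IsManifold.of_le (n := ∞) (by simp)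
  have h1 := (contMDiffOn_extChartAt_symm (I := 𝓡 n) (n := ∞) x).contMDiffOn_tangentMapWithin
    (m := ∞) (by simp) (isOpen_extChartAt_target x).uniqueMDiffOn
  have h2 : ContMDiff 𝓘(ℝ, E n) 𝓘(ℝ, E n).tangent ∞ (fun u : E n =>
      (⟨u, EuclideanSpace.single a (1 : ℝ)⟩ : TangentBundle 𝓘(ℝ, E n) (E n))) := fun u =>
    contMDiffAt_vectorSpace_iff_contDiffAt.2 contDiffAt_const
  refine (h1.comp h2.contMDiffOn (fun u hu => hu)).congr fun u hu => ?_
  simp only [Function.comp_apply, tangentMapWithin]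
  rw [mfderivWithin_chart_symm x ((isOpen_extChartAt_target x).mem_nhds hu)]

theorem metricInChart_isMetricOn (g : SmoothMetric n X) (x : X) :
    IsMetricOn (metricInChart g x) (chartTarget x) where
  smooth a b := by
    rw [SmoothOn, ← contMDiffOn_iff_contDiffOn]
    intro u hu
    have hψ := ContMDiffAt.comp_contMDiffWithinAt u
      (g.contMDiff.contMDiffAt (x := (extChartAt (𝓡 n) x).symm u))
      (contMDiffOn_extChartAt_symm (I := 𝓡 n) (n := ∞) x u hu)
    have h : ContMDiffWithinAt (𝓡 n) ((𝓡 n).prod 𝓘(ℝ)) ∞ (fun u => Bundle.TotalSpace.mk' ℝ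
        (E := Bundle.Trivial X ℝ) ((extChartAt (𝓡 n) x).symm u) (metricInChart g x u a b))
        (chartTarget x : Opens (E n)) u := by
      apply ContMDiffWithinAt.clm_bundle_apply₂ (F₁ := E n) (F₂ := E n)
      · exact hψ
      · exact contMDiffOn_chart_frame x a u hu
      · exact contMDiffOn_chart_frame x b u hu
    simp only [Bundle.contMDiffWithinAt_totalSpace] at h
    exact h.2
  posDef u hu := by
    set D := mfderiv 𝓘(ℝ, E n) (𝓡 n) (extChartAt (𝓡 n) x).symm u with hD
    refine Matrix.PosDef.of_dotProduct_mulVec_pos ?_ fun v hv => ?_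
    · ext a b
      exact g.symm _ _ _
    · have h0 : WithLp.toLp 2 v = ∑ a, v a • EuclideanSpace.single a (1 : ℝ) := by
        ext b; simp [Pi.single_apply]
      have h1 : D (WithLp.toLp 2 v) = ∑ a, v a • D (EuclideanSpace.single a (1 : ℝ)) := by
        rw [h0]
        exact (map_sum D (fun a => v a • (EuclideanSpace.single a (1 : ℝ) : E n)) _).trans
          (Finset.sum_congr rfl fun a _ => map_smul D _ _)
      have h2 : D (WithLp.toLp 2 v) ≠ 0 := fun h => hv <| by
        have := injective_mfderiv_chart_symm x hu (h.trans (map_zero D).symm)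
        exact congrArg (WithLp.ofLp (p := 2)) this
      have h3 := g.pos _ _ h2
      rw [h1] at h3
      refine h3.trans_eq ?_
      simp only [map_sum, sum_apply, map_smul, smul_apply,
        dotProduct, Matrix.mulVec, Finset.mul_sum, smul_eq_mul]
      rw [Finset.sum_comm]
      refine Finset.sum_congr rfl fun a _ => Finset.sum_congr rfl fun b _ => ?_
      simp only [metricInChart, Matrix.of_apply, Pi.star_apply, star_trivial]
      ring

theorem patchAt_isRegularOn [IsManifold (𝓡 k) ∞ Y] (g : SmoothMetric n X) {i : Y → X}
    (hi : IsSmoothImmersion k n i) (y : Y) : (patchAt g i y).IsRegularOn (patchDomain hi y) (chartTarget (i y)) := by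
  have : IsManifold (𝓡 n) 1 X := IsManifold.of_le (n := ∞) (by simp)
  set p : Patch k n := patchAt g i y with hpdef
  have hφ : ContDiffOn ℝ ∞ p.φ (patchDomain hi y : Set (E k)) := by
    rw [← contMDiffOn_iff_contDiffOn]
    exact (contMDiffOn_extChartAt (I := 𝓡 n) (n := ∞) (x := i y)).comp
      (hi.smooth.comp_contMDiffOn ((contMDiffOn_extChartAt_symm (I := 𝓡 k) (n := ∞) y).mono
        Set.inter_subset_left)) fun u hu => by simpa using hu.2
  have hd : ∀ u ∈ patchDomain hi y, DifferentiableAt ℝ p.φ u := fun u hu =>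
    (hφ.contDiffAt ((patchDomain hi y).isOpen.mem_nhds hu)).differentiableAt (by simp)
  refine ⟨metricInChart_isMetricOn g (i y), fun a => ?_, fun u hu => ?_, fun u hu => ?_⟩
  · exact (EuclideanSpace.proj (𝕜 := ℝ) a).contDiff.comp_contDiffOn hφ
  · exact (extChartAt (𝓡 n) (i y)).map_source hu.2
  · have h1 : HasMFDerivAt (𝓡 k) (𝓡 n) p.φ u _ :=
      ((mdifferentiableAt_extChartAt (I := 𝓡 n) (x := i y)
        (by simpa using hu.2)).hasMFDerivAt.comp u
        ((hi.smooth.mdifferentiableAt (by simp)).hasMFDerivAt.comp u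
          ((contMDiffOn_extChartAt_symm (I := 𝓡 k) (n := ∞) y).contMDiffAt
            ((isOpen_extChartAt_target y).mem_nhds hu.1)
            |>.mdifferentiableAt (by simp)).hasMFDerivAt))
    have h2 : Function.Injective (fderiv ℝ p.φ u) := by
      rw [← mfderiv_eq_fderiv, h1.mfderiv]
      exact (isInvertible_mfderiv_extChartAt (I := 𝓡 n) hu.2).injective.comp
        ((hi.injective _).comp (injective_mfderiv_chart_symm y hu.1))
    have h3 : p.tan u = (WithLp.linearEquiv 2 ℝ (Fin n → ℝ)).toLinearMap ∘
        (fderiv ℝ p.φ u).toLinearMap ∘ EuclideanSpace.basisFun (Fin k) ℝ := by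
      ext α a
      have h := ((EuclideanSpace.proj (𝕜 := ℝ) a).hasFDerivAt.comp u (hd u hu).hasFDerivAt).fderiv
      change fderiv ℝ (EuclideanSpace.proj (𝕜 := ℝ) a ∘ p.φ) u (EuclideanSpace.single α 1) = _
      rw [h]
      simp
    rw [h3]
    exact ((EuclideanSpace.basisFun (Fin k) ℝ).toBasis.linearIndependent.map' _
      (LinearMap.ker_eq_bot.2 h2)).map' _ (LinearEquiv.ker _)

theorem patchAt_isConformalChange {g g' : SmoothMetric n X} {Υ : X → ℝ} {i : Y → X}
    (hΥ : ContMDiff (𝓡 n) 𝓘(ℝ, ℝ) ∞ Υ) (h : ∀ (x : X) (v w : TangentSpace (𝓡 n) x),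
      g'.inner x v w = Real.exp (2 * Υ x) * g.inner x v w) (y : Y) :
    IsConformalChange (patchAt (k := k) g i y).g (patchAt (k := k) g' i y).g
      (Υ ∘ (extChartAt (𝓡 n) (i y)).symm) (chartTarget (i y)) where
  metric := metricInChart_isMetricOn g (i y)
  smooth := by
    rw [SmoothOn, ← contMDiffOn_iff_contDiffOn]
    exact hΥ.comp_contMDiffOn (contMDiffOn_extChartAt_symm (I := 𝓡 n) (n := ∞) (i y))
  eq_smul u _ := by
    ext a b
    exact h _ _ _

theorem factor_patchAt (g : SmoothMetric n X) (Υ : X → ℝ) (i : Y → X) (y : Y) :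
    ((patchAt (k := k) g i y).factor (Υ ∘ (extChartAt (𝓡 n) (i y)).symm)
      (extChartAt (𝓡 k) y y))⁻¹ ^ 2 = Real.exp (-4 * Υ (i y)) := by
  have h1 : (patchAt (k := k) g i y).φ (extChartAt (𝓡 k) y y) = extChartAt (𝓡 n) (i y) (i y) := by
    simp [patchAt, writtenInExtChartAt]
  have h2 : (patchAt (k := k) g i y).res (Υ ∘ (extChartAt (𝓡 n) (i y)).symm)
      (extChartAt (𝓡 k) y y) = Υ (i y) := by
    rw [Patch.res, h1, Function.comp_apply, extChartAt_to_inv]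
  rw [Patch.factor, h2, ← Real.exp_neg, ← Real.exp_nat_mul]
  congr 1; push_cast; ring

end Manifolds

/-- A scalar that is natural and conformally covariant on regular patches is a conformal
invariant. -/
theorem isConformalInvariant_of_patch {k n : ℕ} {S : CoordScalar k n}
    (hS : IsNatural 0 0 fun p y _ _ => S p y)
    (hc : ∀ ⦃p : Patch k n⦄ ⦃U V⦄ ⦃g' : MetricField n⦄ ⦃Υ : E n → ℝ⦄ ⦃y : E k⦄, p.IsRegularOn U V →
      IsConformalChange p.g g' Υ V → y ∈ U → S (p.withMetric g') y = (p.factor Υ y)⁻¹ ^ 2 * S p y) :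
    IsConformalInvariant.{u, v} S (-4) := by
  constructor
  · obtain ⟨N, c, T, hT⟩ := hS.exists_completeContraction
    exact ⟨N, c, T, fun X _ _ _ Y _ _ _ g i hi y =>
      hT (patchAt_isRegularOn g hi y) _ (mem_patchDomain hi y)⟩
  · intro X _ _ _ Y _ _ _ g g' Υ i hi hΥ h y
    rw [← factor_patchAt (k := k) g Υ i y]
    exact hc (patchAt_isRegularOn g hi y) (patchAt_isConformalChange hΥ h y) (mem_patchDomain hi y)

end

end ConformalSubmanifold

theorem mainTheorem11 (k n : ℕ) (hk : 4 ≤ k) (hkn : k < n) (hk6 : k ≠ 6) :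
    IsConformalInvariant.{u, v} (calJ1 k n) (-4) ∧
    IsConformalInvariant.{u, v} (calJ2 k n) (-4) ∧
    (n = k + 1 →
      ∀ (X : Type u) [TopologicalSpace X] [ChartedSpace (E n) X] [IsManifold (𝓡 n) ∞ X]
        (Y : Type v) [TopologicalSpace Y] [ChartedSpace (E k) Y] [IsManifold (𝓡 k) ∞ Y]
        (g : SmoothMetric n X) (i : Y → X), IsSmoothImmersion k n i →
        ∀ y : Y,
          (calJ1 k n).onManifold g i y = (juhlFirst k n).onManifold g i y ∧
          (calJ2 k n).onManifold g i y = (juhlSecond k n).onManifold g i y) := by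
  have hk1 : 1 < k := by omega
  have hn : 2 < n := by omega
  refine ⟨isConformalInvariant_of_patch (IsNatural.J1 hk1 hn) fun p U V g' Υ y hp hc hy =>
      hp.J1_withMetric hc hk1 hn hy,
    isConformalInvariant_of_patch (IsNatural.J2 hk1 hn) fun p U V g' Υ y hp hc hy =>
      hp.J2_withMetric hc hk1 hn hy, ?_⟩
  intro hnk X _ _ _ Y _ _ _ g i hi y
  exact ⟨(patchAt_isRegularOn g hi y).J1_eq_juhl1 hnk hk hk6 (mem_patchDomain hi y),
    (patchAt_isRegularOn g hi y).J2_eq_juhl2 hnk hk hk6 (mem_patchDomain hi y)⟩
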